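/- Let $d\ge 3$ and let $V:\mathbb R^d\to\mathbb R$ be measurable, with $V\ge 0$, and differentiable along every ray from the origin (away from the origin); write $\partial_rV$ for its radial derivative. Suppose that there is $\gamma>0$ such that: - if $d>3$, there is $\eta>0$ with $\gamma V(x)+|x|\,\partial_rV(x)\le(1-\eta)\dfrac{(d-1)(d-3)}{2|x|^2}$ for all $x\ne 0$; - if $d=3$, there is a measurable function $W\ge 0$ on $(0,\infty)$ with $\sup_{|x|=t}\{\gamma V(x)+|x|\,\partial_rV(x)\}\le W(t)$ for all $t>0$ and $\int_0^\infty tW(t)\,dt<\tfrac12$. For functions on $\mathbb R^d$ put $$\|g\|_X^2=\sup_{R>0}\frac1R\int_{B(0,R)}|g|^2dx,\qquad \|f\|_{X^*}=\sum_{j\in\mathbb Z}\Big(2^{j+1}\int_{2^j<|x|\le2^{j+1}}|f|^2dx\Big)^{1/2}.$$ Then there is a constant $C<\infty$ such that, for all real $\tau$, all $\epsilon\neq 0$, either choice of the sign $\pm$, all $f$ with $\|f\|_{X^*}<\infty$ and every weak solution $u\in L^2(\mathbb R^d)$ of $$-\Delta u+Vu\pm i\epsilon u-\tau u=f\quad\text{in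 }\mathbb R^d,$$ one has $$\|\nabla u\|_X^2+\max\{0,\tau\}\|u\|_X^2+(d-3)\int_{\mathbb R^d}\frac{|u|^2}{|x|^3}dx+\int_{\mathbb R^d}\frac{V}{|x|}|u|^2dx+\sup_{R>0}\frac1{R^3}\int_{B(0,R)}|u|^2dx+\chi(d)\int_{\mathbb R^3}\frac{W(|x|)}{|x|}|u|^2dx\le C\,\|f\|_{X^*}^2,$$ where $\chi(3)=1$ and $\chi(d)=0$ for $d\ne3$ (for $d>3$ the last term is absent). In particular $C$ does not depend on $\epsilon$ and $\tau$. Here a weak solution is a function $u\in L^2(\mathbb R^d)$ with a weak gradient such that $|\nabla u|^2$ and $V|u|^2$ are locally integrable and $$\int\nabla u\cdot\overline{\nabla v}\,dx+\int Vu\bar v\,dx\pm i\epsilon\int u\bar v\,dx-\tau\int u\bar v\,dx=\int f\bar v\,dx$$ for every compactly supported $v\in H^1(\mathbb R^d)$ with $\int V|v|^2dx<\infty$. -/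

import Mathlib

open MeasureTheory Set Metric
open scoped ENNReal NNReal ContDiff ComplexConjugate

/-- The space `ℝ^d` with its Euclidean norm. -/
abbrev RSpace (d : ℕ) := EuclideanSpace ℝ (Fin d)

/-- The space `ℂ^d` with its Hermitian norm, where gradients of complex functions take values. -/
abbrev CSpace (d : ℕ) := EuclideanSpace ℂ (Fin d)

/-- The radial derivative `∂_r V (x) = (x / |x|) · ∇V (x)`, as a derivative along the ray. -/
noncomputable def radialDeriv {d : ℕ} (V : RSpace d → ℝ) (x : RSpace d) : ℝ :=
  lineDeriv ℝ V x (‖x‖⁻¹ • x)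

/-- The standing assumptions on the potential `V ≥ 0` (and, in dimension three, on the auxiliary
function `W ≥ 0` on `(0, ∞)`). The function `W` plays no role when `d > 3`. -/
structure IsRepulsive {d : ℕ} (V : RSpace d → ℝ) (W : ℝ → ℝ) : Prop where
  aemeasurable : AEMeasurable V volume
  nonneg : ∀ x, x ≠ 0 → 0 ≤ V x
  /-- `V` is differentiable along every ray from the origin. -/
  radial_differentiable : ∀ x, x ≠ 0 → LineDifferentiableAt ℝ V x (‖x‖⁻¹ • x)
  repulsive : ∃ γ : ℝ, 0 < γ ∧
    (3 < d → ∃ η : ℝ, 0 < η ∧ ∀ x, x ≠ 0 →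
      γ * V x + ‖x‖ * radialDeriv V x
        ≤ (1 - η) * ((((d : ℝ) - 1) * ((d : ℝ) - 3)) / (2 * ‖x‖ ^ 2))) ∧
    (d = 3 →
      AEMeasurable W (volume.restrict (Ioi 0)) ∧
      (∀ t, 0 < t → 0 ≤ W t) ∧
      (∀ t, 0 < t → ∀ x, ‖x‖ = t → γ * V x + ‖x‖ * radialDeriv V x ≤ W t) ∧
      ∫⁻ t in Ioi (0 : ℝ), ENNReal.ofReal (t * W t) < 1 / 2)

/-- `G` is the weak (distributional) gradient of the locally integrable function `u`, and is
itself locally integrable. -/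
structure HasWeakGradient {d : ℕ} (u : RSpace d → ℂ) (G : RSpace d → CSpace d) : Prop where
  locallyIntegrable : LocallyIntegrable u volume
  locallyIntegrable_grad : LocallyIntegrable G volume
  integral_eq : ∀ φ : RSpace d → ℝ, ContDiff ℝ ∞ φ → HasCompactSupport φ → ∀ i : Fin d,
    ∫ x, ((fderiv ℝ φ x (EuclideanSpace.single i 1) : ℝ) : ℂ) * u x
      = - ∫ x, ((φ x : ℝ) : ℂ) * G x i

/-- The admissible test functions `v`, with gradient `Gv`: compactly supported elements of
`H¹(ℝ^d)` with finite potential energy `∫ V |v|²`. Every `C_c^∞` function is one if `V` is locally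
integrable, and testing against these `v` is then the same as testing against `C_c^∞`; in general
they form a dense subspace of the form domain of `-Δ + V`. -/
structure IsTestPair {d : ℕ} (V : RSpace d → ℝ) (v : RSpace d → ℂ) (Gv : RSpace d → CSpace d) :
    Prop where
  hasCompactSupport : HasCompactSupport v
  memLp : MemLp v 2 volume
  memLp_grad : MemLp Gv 2 volume
  hasWeakGradient : HasWeakGradient v Gv
  energy : Integrable (fun x => V x * ‖v x‖ ^ 2) volume

/-- `u`, with gradient `G`, is a weak `L²` solution of `-Δ u + V u + i ε u - τ u = f`: the energy
`|∇u|² + V |u|²` is only required to be locally integrable, and the equation is tested against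
compactly supported functions. -/
structure IsHelmholtzSolution {d : ℕ} (V : RSpace d → ℝ) (ε τ : ℝ) (f u : RSpace d → ℂ)
    (G : RSpace d → CSpace d) : Prop where
  memLp : MemLp u 2 volume
  hasWeakGradient : HasWeakGradient u G
  locallyIntegrable_grad_sq : LocallyIntegrable (fun x => ‖G x‖ ^ 2) volume
  locallyIntegrable_energy : LocallyIntegrable (fun x => V x * ‖u x‖ ^ 2) volume
  equation : ∀ (v : RSpace d → ℂ) (Gv : RSpace d → CSpace d), IsTestPair V v Gv →
    (∫ x, ∑ i, G x i * conj (Gv x i)) + (∫ x, (V x : ℂ) * u x * conj (v x))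
      + Complex.I * (ε : ℂ) * (∫ x, u x * conj (v x)) - (τ : ℂ) * (∫ x, u x * conj (v x))
      = ∫ x, f x * conj (v x)

/-- `‖g‖_X² = sup_{R > 0} (1/R) ∫_{B(0,R)} |g|²`, possibly infinite. -/
noncomputable def xNormSq {d : ℕ} {F : Type*} [NormedAddCommGroup F] (g : RSpace d → F) : ℝ≥0∞ :=
  ⨆ (R : ℝ) (_ : 0 < R), ENNReal.ofReal R⁻¹ * ∫⁻ x in ball (0 : RSpace d) R, ‖g x‖ₑ ^ 2

/-- The dyadic shell `C_j = {x : 2^j < |x| ≤ 2^(j+1)}`. -/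
def dyadicShell (d : ℕ) (j : ℤ) : Set (RSpace d) :=
  {x | (2 : ℝ) ^ j < ‖x‖ ∧ ‖x‖ ≤ (2 : ℝ) ^ (j + 1)}

/-- `‖f‖_{X*} = ∑_{j ∈ ℤ} (2^(j+1) ∫_{C_j} |f|²)^(1/2)`, possibly infinite. -/
noncomputable def xStarNorm {d : ℕ} (f : RSpace d → ℂ) : ℝ≥0∞ :=
  ∑' j : ℤ, (ENNReal.ofReal ((2 : ℝ) ^ (j + 1)) * ∫⁻ x in dyadicShell d j, ‖f x‖ₑ ^ 2)
    ^ (1 / 2 : ℝ)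

/-! ### Weak gradients: products, integration by parts against radial fields, dilations. -/

section WeakGradient

variable {d : ℕ}

/-! The estimate comes from a Morawetz multiplier. Let `g(r) = r q(r)` be increasing and concave,
equal to `r / R` up to the scale `R` and constant beyond `11R/10`, and put `p = g'`. Formally the
equation is tested with `q x·∇u` and with half the divergence of `q x` times `u`; in the real part
the `τ` terms cancel. After completing squares (`IsH1.multiplier_identity`) there remain `∫ p D`
with `D = |∂ᵣu + (d-1)u/(2r)|²`, the tangential energy weighted by `q`, the Hardy term `(d-1)(d-3)/4
∫ q|u|²/|x|²`, a term `γ/2 ∫ q V|u|²` from the repulsivity of `V`, and an error containing `p'`.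

The function `q x·∇u` is not admissible, and `∂ᵣV` exists only pointwise along rays. The test
function is therefore `q (u - u(l·))`, divided by `1 - l`, with `l → 1` from below
(`difference_test`, `difference_limit`). Repulsivity enters after integration along rays, as a
one-sided comparison of `σ^γ V(σy)` with `V(y)` (`dilation_le_of_radialDeriv_le`,
`potential_dilation_le`). This comparison also shows that the test function has finite potential
energy. Only inequalities survive the limit, and they have the right direction: the term `|∇(u -
u(l·))|²`, about which nothing is known, has a favourable sign and is dropped. All facts about `u -
u(l·)` come from writing it as an integral of the Euler derivative along the ray
(`IsH1.sub_dilation_ae`).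

The error with `p'` lives on the shell `R ≤ |x| ≤ 11R/10`. Let `M` be the supremum of the averages
`ρ⁻¹ ∫_{B_ρ} D` over `ρ ≥ δ`, and let `R` nearly attain it. Then the shell contains little of `∫ D`,
while a trace inequality (`IsH1.lintegral_radial_le`) bounds the mass of `|u|²` on the sphere of
radius `t` by `M t max(t, δ)`; the error is thus a fraction of `M`. For `d = 3` the Hardy term
vanishes, and the same trace inequality absorbs `W`: this is where `∫ t W < 1/2` is used. For `d >
3` the loss in the repulsivity is a fraction `1 - η` of the Hardy term.

What is left on the right is `|ε| ‖u‖ ‖∇u‖` in `L²` and the pairing of `f` with the test functions.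
The latter is estimated by duality through the growth of `|∇u|² + |u|²/|x|²`, and Young's inequality
absorbs that growth (`exists_source_le`). For the former, testing with `χu`, for a cutoff `χ`,
bounds the local mass `(max(0, τ) + |ε|) ∫_{B_R} |u|²`. Testing with `u` itself then gives `E ≤ F
√(K (E + F²))` for `E = |ε| ‖u‖ ‖∇u‖` and `F = ‖f‖_{X*}`, so `E` is bounded by `F²` (`error_le`,
`le_of_le_mul_sqrt`). No step depends on `ε` or `τ`.

Beforehand, the local energy hypotheses are upgraded to `u ∈ H¹` with finite potential energy by
testing with `χ²u` (`globalEnergy`). That bound is not uniform in `τ`, but it makes every quantity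
above finite, as absorption requires. -/

/-- The gradient of a real function, as a complex vector. -/
noncomputable def cgrad (ψ : RSpace d → ℝ) (x : RSpace d) : CSpace d :=
  WithLp.toLp 2 fun i => ((fderiv ℝ ψ x (EuclideanSpace.single i 1) : ℝ) : ℂ)

/-- The Euler derivative `x · G(x)` of a function with gradient `G`. -/
noncomputable def euler (G : RSpace d → CSpace d) (x : RSpace d) : ℂ :=
  ∑ i, (x i : ℂ) * G x i

/-- `u` belongs to `H¹` and has gradient `G`; both are measurable representatives. -/
structure IsH1 (u : RSpace d → ℂ) (G : RSpace d → CSpace d) : Prop where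
  measurable : Measurable u
  measurable_grad : Measurable G
  memLp : MemLp u 2 volume
  memLp_grad : MemLp G 2 volume
  hasWeakGradient : HasWeakGradient u G

theorem continuous_cgrad {ψ : RSpace d → ℝ} (hψ : ContDiff ℝ ∞ ψ) : Continuous (cgrad ψ) := by
  have h := hψ.continuous_fderiv (by simp)
  unfold cgrad
  refine (PiLp.continuous_toLp 2 _).comp (continuous_pi fun i => ?_)
  fun_prop

theorem integrable_ofReal_mul {φ : RSpace d → ℝ} (hφ : Continuous φ) (hc : HasCompactSupport φ)
    {u : RSpace d → ℂ} (hu : LocallyIntegrable u volume) :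
    Integrable (fun x => (φ x : ℂ) * u x) volume := by
  have := hu.integrable_smul_left_of_hasCompactSupport hφ hc
  simpa [Complex.real_smul] using this

theorem locallyIntegrable_apply {G : RSpace d → CSpace d} (hG : LocallyIntegrable G volume)
    (i : Fin d) : LocallyIntegrable (fun x => G x i) volume := by
  refine hG.mono ?_ (Filter.Eventually.of_forall fun x => PiLp.norm_apply_le (G x) i)
  have : Continuous (fun z : CSpace d => z i) := by fun_prop
  exact this.comp_aestronglyMeasurable hG.aestronglyMeasurable

theorem HasWeakGradient.smooth_mul {u : RSpace d → ℂ} {G : RSpace d → CSpace d}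
    (h : HasWeakGradient u G) {ψ : RSpace d → ℝ} (hψ : ContDiff ℝ ∞ ψ) :
    HasWeakGradient (fun x => (ψ x : ℂ) * u x) (fun x => (ψ x : ℂ) • G x + u x • cgrad ψ x) where
  locallyIntegrable := h.locallyIntegrable.continuous_mul
    (Complex.continuous_ofReal.comp hψ.continuous)
  locallyIntegrable_grad := (h.locallyIntegrable_grad.continuous_smul
    (Complex.continuous_ofReal.comp hψ.continuous)).add
      (h.locallyIntegrable.smul_continuous (continuous_cgrad hψ))
  integral_eq := by
    intro φ hφ hc i
    have hψd : ∀ x, DifferentiableAt ℝ ψ x := fun x => (hψ.differentiable (by simp)) x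
    have hφd : ∀ x, DifferentiableAt ℝ φ x := fun x => (hφ.differentiable (by simp)) x
    have h1 := h.integral_eq (fun x => φ x * ψ x) (hφ.mul hψ) (hc.mul_right) i
    have e1 : ∀ x, fderiv ℝ (fun x => φ x * ψ x) x (EuclideanSpace.single i 1)
        = φ x * fderiv ℝ ψ x (EuclideanSpace.single i 1)
          + ψ x * fderiv ℝ φ x (EuclideanSpace.single i 1) := by
      intro x
      rw [fderiv_fun_mul (hφd x) (hψd x)]; simp
    simp only [e1] at h1
    have hcψ : Continuous fun x => fderiv ℝ ψ x (EuclideanSpace.single i 1) := by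
      have := hψ.continuous_fderiv (by simp); fun_prop
    have hcφ : Continuous fun x => fderiv ℝ φ x (EuclideanSpace.single i 1) := by
      have := hφ.continuous_fderiv (by simp); fun_prop
    have i1 : Integrable (fun x => ((φ x * fderiv ℝ ψ x (EuclideanSpace.single i 1) : ℝ) : ℂ) * u x)
        volume := integrable_ofReal_mul (hφ.continuous.mul hcψ) (hc.mul_right) h.locallyIntegrable
    have i2 : Integrable (fun x => ((ψ x * fderiv ℝ φ x (EuclideanSpace.single i 1) : ℝ) : ℂ) * u x)
        volume := integrable_ofReal_mul (hψ.continuous.mul hcφ)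
      ((hc.fderiv_apply ℝ (EuclideanSpace.single i 1)).mul_left) h.locallyIntegrable
    have i3 : Integrable (fun x => ((φ x * ψ x : ℝ) : ℂ) * G x i) volume :=
      integrable_ofReal_mul (hφ.continuous.mul hψ.continuous) (hc.mul_right)
      (locallyIntegrable_apply h.locallyIntegrable_grad i)
    have e2 : ∫ x, ((φ x * fderiv ℝ ψ x (EuclideanSpace.single i 1)
          + ψ x * fderiv ℝ φ x (EuclideanSpace.single i 1) : ℝ) : ℂ) * u x
        = (∫ x, ((φ x * fderiv ℝ ψ x (EuclideanSpace.single i 1) : ℝ) : ℂ) * u x)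
          + ∫ x, ((ψ x * fderiv ℝ φ x (EuclideanSpace.single i 1) : ℝ) : ℂ) * u x := by
      rw [← integral_add i1 i2]
      congr 1; ext x; push_cast; ring
    rw [e2] at h1
    have e3 : ∫ x, ((φ x : ℝ) : ℂ) * ((ψ x : ℂ) • G x + u x • cgrad ψ x) i
        = (∫ x, ((φ x * ψ x : ℝ) : ℂ) * G x i)
          + ∫ x, ((φ x * fderiv ℝ ψ x (EuclideanSpace.single i 1) : ℝ) : ℂ) * u x := by
      rw [← integral_add i3 i1]
      congr 1; ext x; simp [cgrad]; ring
    rw [e3]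
    have e4 : ∫ x, ((fderiv ℝ φ x (EuclideanSpace.single i 1) : ℝ) : ℂ) * ((ψ x : ℂ) * u x)
        = ∫ x, ((ψ x * fderiv ℝ φ x (EuclideanSpace.single i 1) : ℝ) : ℂ) * u x := by
      congr 1; ext x; push_cast; ring
    rw [e4, neg_add, ← h1]; ring

theorem sum_coord_fderiv (φ : RSpace d → ℝ) (x : RSpace d) :
    ∑ i, x i * fderiv ℝ φ x (EuclideanSpace.single i 1) = fderiv ℝ φ x x := by
  have h : ∑ i, x i • (EuclideanSpace.single i (1 : ℝ) : RSpace d) = x := by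
    simpa using (EuclideanSpace.basisFun (Fin d) ℝ).sum_repr x
  conv_rhs => rw [← congrArg (fderiv ℝ φ x) h, map_sum]
  simp

theorem norm_euler_le (G : RSpace d → CSpace d) (x : RSpace d) : ‖euler G x‖ ≤ ‖x‖ * ‖G x‖ := by
  have h := norm_inner_le_norm (𝕜 := ℂ) (WithLp.toLp 2 fun i => (x i : ℂ) : CSpace d) (G x)
  have e : inner ℂ (WithLp.toLp 2 fun i => (x i : ℂ) : CSpace d) (G x) = euler G x := by
    simp [PiLp.inner_apply, euler, mul_comm]
  have e2 : ‖(WithLp.toLp 2 fun i => (x i : ℂ) : CSpace d)‖ = ‖x‖ := by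
    simp [EuclideanSpace.norm_eq]
  rwa [e, e2] at h

theorem measurable_euler {G : RSpace d → CSpace d} (hG : Measurable G) : Measurable (euler G) := by
  unfold euler
  refine Finset.measurable_sum _ fun i _ => ?_
  have h1 : Measurable fun x : RSpace d => (x i : ℂ) := by fun_prop
  have h2 : Measurable fun x : RSpace d => G x i := by
    have : Continuous (fun z : CSpace d => z i) := by fun_prop
    exact this.measurable.comp hG
  exact h1.mul h2

/-- Integration by parts against the vector field `φ(x) x`. -/
theorem HasWeakGradient.integral_euler {u : RSpace d → ℂ} {G : RSpace d → CSpace d}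
    (h : HasWeakGradient u G) {φ : RSpace d → ℝ} (hφ : ContDiff ℝ ∞ φ)
    (hc : HasCompactSupport φ) :
    ∫ x, ((d * φ x + fderiv ℝ φ x x : ℝ) : ℂ) * u x = - ∫ x, (φ x : ℂ) * euler G x := by
  have hφd : ∀ x, DifferentiableAt ℝ φ x := fun x => (hφ.differentiable (by simp)) x
  have hx : ∀ i, ContDiff ℝ ∞ (fun x : RSpace d => x i) := fun i => by fun_prop
  have hcφ : ∀ i, Continuous fun x => fderiv ℝ φ x (EuclideanSpace.single i 1) := by
    intro i
    have := hφ.continuous_fderiv (by simp); fun_prop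
  have h1 := fun i => h.integral_eq (fun x => φ x * x i) (hφ.mul (hx i)) hc.mul_right i
  have e1 : ∀ i x, fderiv ℝ (fun x => φ x * x i) x (EuclideanSpace.single i 1)
      = φ x + x i * fderiv ℝ φ x (EuclideanSpace.single i 1) := by
    intro i x
    have hp : HasFDerivAt (fun x : RSpace d => x i) (EuclideanSpace.proj i : RSpace d →L[ℝ] ℝ) x :=
      (EuclideanSpace.proj i : RSpace d →L[ℝ] ℝ).hasFDerivAt
    rw [((hφd x).hasFDerivAt.fun_mul hp).fderiv]; simp
  simp only [e1] at h1
  have h2 := Finset.sum_congr rfl fun i (_ : i ∈ Finset.univ) => h1 i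
  rw [← integral_finsetSum, Finset.sum_neg_distrib, ← integral_finsetSum] at h2
  · have a1 : ∀ x, ((d * φ x + fderiv ℝ φ x x : ℝ) : ℂ) * u x
        = ∑ i, ((φ x + x i * fderiv ℝ φ x (EuclideanSpace.single i 1) : ℝ) : ℂ) * u x := by
      intro x
      rw [← sum_coord_fderiv, ← Finset.sum_mul, ← Complex.ofReal_sum, Finset.sum_add_distrib]
      simp
    have a2 : ∀ x, (φ x : ℂ) * euler G x = ∑ i, ((φ x * x i : ℝ) : ℂ) * G x i := by
      intro x
      simp [euler, Finset.mul_sum, mul_assoc]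
    simp only [a1, a2, h2]
  · intro i _
    exact integrable_ofReal_mul (hφ.continuous.mul (hx i).continuous) hc.mul_right
      (locallyIntegrable_apply h.locallyIntegrable_grad i)
  · intro i _
    exact integrable_ofReal_mul (hφ.continuous.add ((hx i).continuous.mul (hcφ i)))
      (hc.add ((hc.fderiv_apply ℝ (EuclideanSpace.single i 1)).mul_left)) h.locallyIntegrable

theorem IsH1.sub {u v : RSpace d → ℂ} {G F : RSpace d → CSpace d} (h : IsH1 u G) (h' : IsH1 v F) :
    IsH1 (fun x => u x - v x) (fun x => G x - F x) where
  measurable := h.measurable.sub h'.measurable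
  measurable_grad := h.measurable_grad.sub h'.measurable_grad
  memLp := h.memLp.sub h'.memLp
  memLp_grad := h.memLp_grad.sub h'.memLp_grad
  hasWeakGradient :=
    { locallyIntegrable := h.hasWeakGradient.locallyIntegrable.sub
        h'.hasWeakGradient.locallyIntegrable
      locallyIntegrable_grad := h.hasWeakGradient.locallyIntegrable_grad.sub
        h'.hasWeakGradient.locallyIntegrable_grad
      integral_eq := by
        intro φ hφ hc i
        have hcφ : Continuous fun x => fderiv ℝ φ x (EuclideanSpace.single i 1) := by
          have := hφ.continuous_fderiv (by simp); fun_prop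
        have hcc := hc.fderiv_apply ℝ (EuclideanSpace.single i 1)
        have := h.hasWeakGradient.integral_eq φ hφ hc i
        have := h'.hasWeakGradient.integral_eq φ hφ hc i
        simp only [mul_sub, PiLp.sub_apply]
        rw [integral_sub, integral_sub]
        · simp [*]; ring
        · exact integrable_ofReal_mul hφ.continuous hc
            (locallyIntegrable_apply h.hasWeakGradient.locallyIntegrable_grad i)
        · exact integrable_ofReal_mul hφ.continuous hc
            (locallyIntegrable_apply h'.hasWeakGradient.locallyIntegrable_grad i)
        · exact integrable_ofReal_mul hcφ hcc h.hasWeakGradient.locallyIntegrable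
        · exact integrable_ofReal_mul hcφ hcc h'.hasWeakGradient.locallyIntegrable }

theorem memLp_comp_smul {F : Type*} [NormedAddCommGroup F] {f : RSpace d → F}
    (hf : MemLp f 2 volume) {s : ℝ} (hs : s ≠ 0) : MemLp (fun x => f (s • x)) 2 volume := by
  have hq := Measure.quasiMeasurePreserving_smul (volume : Measure (RSpace d)) hs
  have hm : AEStronglyMeasurable (fun x => f (s • x)) volume :=
    hf.aestronglyMeasurable.comp_quasiMeasurePreserving hq
  rw [memLp_two_iff_integrable_sq_norm hm]
  have := (memLp_two_iff_integrable_sq_norm hf.aestronglyMeasurable).1 hf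
  exact this.comp_smul hs

theorem IsH1.comp_smul {u : RSpace d → ℂ} {G : RSpace d → CSpace d} (h : IsH1 u G) {s : ℝ}
    (hs : 0 < s) : IsH1 (fun x => u (s • x)) (fun x => (s : ℂ) • G (s • x)) := by
  have hl := memLp_comp_smul h.memLp hs.ne'
  have hl' : MemLp (fun x => (s : ℂ) • G (s • x)) 2 volume :=
    (memLp_comp_smul h.memLp_grad hs.ne').const_smul (s : ℂ)
  refine ⟨h.measurable.comp (measurable_const_smul s),
    
    (h.measurable_grad.comp (measurable_const_smul s)).const_smul (s : ℂ), hl, hl',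
    hl.locallyIntegrable (by norm_num), hl'.locallyIntegrable (by norm_num), ?_⟩
  intro φ hφ hc i
  have hsm : ContDiff ℝ ∞ (fun x : RSpace d => s⁻¹ • x) := by fun_prop
  have hφd : ∀ x, DifferentiableAt ℝ φ x := fun x => (hφ.differentiable (by simp)) x
  have h1 := h.hasWeakGradient.integral_eq (fun x => φ (s⁻¹ • x)) (hφ.comp hsm)
    (hc.comp_homeomorph (Homeomorph.smulOfNeZero s⁻¹ (inv_ne_zero hs.ne'))) i
  have e1 : ∀ x, fderiv ℝ (fun x => φ (s⁻¹ • x)) x (EuclideanSpace.single i 1)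
      = s⁻¹ * fderiv ℝ φ (s⁻¹ • x) (EuclideanSpace.single i 1) := by
    intro x
    rw [fderiv_comp_smul]
    simp
  simp only [e1] at h1
  have h2 := Measure.integral_comp_smul (volume : Measure (RSpace d))
    (fun y => ((s⁻¹ * fderiv ℝ φ (s⁻¹ • y) (EuclideanSpace.single i 1) : ℝ) : ℂ) * u y) s
  have h3 := Measure.integral_comp_smul (volume : Measure (RSpace d))
    (fun y => ((φ (s⁻¹ • y) : ℝ) : ℂ) * G y i) s
  simp only [smul_smul, inv_mul_cancel₀ hs.ne', one_smul] at h2 h3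
  rw [h1] at h2
  rw [smul_neg, ← h3] at h2
  have hsC : (s : ℂ) ≠ 0 := by exact_mod_cast hs.ne'
  have e2 : ∫ x, ((fderiv ℝ φ x (EuclideanSpace.single i 1) : ℝ) : ℂ) * u (s • x)
      = (s : ℂ) * ∫ x, ((s⁻¹ * fderiv ℝ φ x (EuclideanSpace.single i 1) : ℝ) : ℂ) * u (s • x) := by
    rw [← integral_const_mul]
    congr 1; ext x; push_cast; field_simp
  rw [e2, h2, mul_neg, ← integral_const_mul]
  congr 2; ext x; simp; ring

end WeakGradient

/-! ### Increments along rays as integrals of the Euler derivative. -/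

section Dilation

variable {d : ℕ}

/-- The norm of a slice is `s^(-d)` times that of `f`, which is bounded for `s` in `[l, 1]`. This
justifies every later exchange of the `x` and `s` integrals. -/
theorem integrable_comp_smul_prod {F : Type*} [NormedAddCommGroup F] {f : RSpace d → F}
    (hf : Integrable f volume) (hm : StronglyMeasurable f) {l : ℝ} (hl : 0 < l) :
    Integrable (fun p : RSpace d × ℝ => f (p.2 • p.1))
      ((volume : Measure (RSpace d)).prod (volume.restrict (Ioc l 1))) := by
  have hmeas : Measurable fun p : RSpace d × ℝ => p.2 • p.1 := by fun_prop
  have hae : AEStronglyMeasurable (fun p : RSpace d × ℝ => f (p.2 • p.1))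
      ((volume : Measure (RSpace d)).prod (volume.restrict (Ioc l 1))) :=
    (hm.comp_measurable hmeas).aestronglyMeasurable
  rw [integrable_prod_iff' hae]
  constructor
  · filter_upwards [ae_restrict_mem measurableSet_Ioc] with s hs
    exact hf.comp_smul (hl.trans hs.1).ne'
  · have e : ∀ s : ℝ, ∫ x, ‖f (s • x)‖
        = |(s ^ Module.finrank ℝ (RSpace d))⁻¹| * ∫ x, ‖f x‖ := fun s => by
      rw [Measure.integral_comp_smul volume (fun x => ‖f x‖) s, smul_eq_mul]
    simp only [e]
    apply IntegrableOn.mono_set (t := Icc l 1) _ Ioc_subset_Icc_self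
    refine ContinuousOn.integrableOn_Icc (ContinuousOn.mul ?_ continuousOn_const)
    refine ((continuousOn_pow _).inv₀ fun s hs => ?_).abs
    exact pow_ne_zero _ (hl.trans_le hs.1).ne'

theorem IsH1.integrable_grad_sq {u : RSpace d → ℂ} {G : RSpace d → CSpace d} (h : IsH1 u G) :
    Integrable (fun x => ‖G x‖ ^ 2) volume :=
  (memLp_two_iff_integrable_sq_norm h.memLp_grad.aestronglyMeasurable).1 h.memLp_grad

theorem IsH1.integrable_sq {u : RSpace d → ℂ} {G : RSpace d → CSpace d} (h : IsH1 u G) :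
    Integrable (fun x => ‖u x‖ ^ 2) volume :=
  (memLp_two_iff_integrable_sq_norm h.memLp.aestronglyMeasurable).1 h.memLp

theorem IsH1.integrable_euler_prod {u : RSpace d → ℂ} {G : RSpace d → CSpace d} (h : IsH1 u G)
    {l : ℝ} (hl : 0 < l) (r : ℝ) :
    Integrable (fun p : RSpace d × ℝ => (p.2 : ℂ)⁻¹ * euler G (p.2 • p.1))
      (((volume : Measure (RSpace d)).restrict (ball 0 r)).prod (volume.restrict (Ioc l 1))) := by
  have hmeas : Measurable fun p : RSpace d × ℝ => p.2 • p.1 := by fun_prop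
  have h1 := integrable_comp_smul_prod h.integrable_grad_sq
    (h.measurable_grad.norm.pow_const 2).stronglyMeasurable hl
  have h2 : Integrable (fun p : RSpace d × ℝ => ‖G (p.2 • p.1)‖ ^ 2)
      (((volume : Measure (RSpace d)).restrict (ball 0 r)).prod (volume.restrict (Ioc l 1))) :=
    h1.mono_measure (Measure.prod_mono Measure.restrict_le_self le_rfl)
  have : IsFiniteMeasure ((volume : Measure (RSpace d)).restrict (ball 0 r)) :=
    ⟨by simpa using measure_ball_lt_top⟩
  have h3 := ((integrable_const (1 : ℝ)).add h2).const_mul r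
  refine h3.mono' ?_ ?_
  · refine Measurable.aestronglyMeasurable (Measurable.mul ?_ ?_)
    · fun_prop
    · exact (measurable_euler h.measurable_grad).comp hmeas
  · rw [Measure.prod_restrict]
    filter_upwards [ae_restrict_mem (measurableSet_ball.prod measurableSet_Ioc)] with p hp
    obtain ⟨hp1, hp2⟩ := hp
    have hs : 0 < p.2 := hl.trans hp2.1
    have hx : ‖p.1‖ < r := by simpa using hp1
    have h4 := norm_euler_le G (p.2 • p.1)
    rw [norm_smul, Real.norm_of_nonneg hs.le] at h4
    rw [norm_mul, norm_inv, Complex.norm_real, Real.norm_of_nonneg hs.le]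
    simp only [Pi.add_apply]
    calc p.2⁻¹ * ‖euler G (p.2 • p.1)‖ ≤ p.2⁻¹ * (p.2 * ‖p.1‖ * ‖G (p.2 • p.1)‖) := by gcongr
      _ = ‖p.1‖ * ‖G (p.2 • p.1)‖ := by field_simp
      _ ≤ r * ‖G (p.2 • p.1)‖ := by gcongr
      _ ≤ r * (1 + ‖G (p.2 • p.1)‖ ^ 2) := by
        have : 0 ≤ r := (norm_nonneg _).trans hx.le
        gcongr
        nlinarith [sq_nonneg (‖G (p.2 • p.1)‖ - 1)]

/-- Fundamental theorem of calculus for the adjoint dilations `φ ↦ s^(-d) φ(·/s)`. Moving the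
dilation of an `H¹` function to the test function reduces the nonsmooth increment formula to this
smooth one. -/
theorem sub_dilation_eq_integral {φ : RSpace d → ℝ} (hφ : ContDiff ℝ ∞ φ) {l : ℝ} (hl : 0 < l)
    (hl1 : l ≤ 1) (y : RSpace d) :
    φ y - (l ^ d)⁻¹ * φ (l⁻¹ • y)
      = ∫ s in Ioc l 1, -((s ^ (d + 1))⁻¹ * (d * φ (s⁻¹ • y) + fderiv ℝ φ (s⁻¹ • y) (s⁻¹ • y))) := by
  have hφd : ∀ x, DifferentiableAt ℝ φ x := fun x => (hφ.differentiable (by simp)) x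
  have hd : ∀ s ∈ uIcc l 1, HasDerivAt (fun s : ℝ => (s ^ d)⁻¹ * φ (s⁻¹ • y))
      (-((s ^ (d + 1))⁻¹ * (d * φ (s⁻¹ • y) + fderiv ℝ φ (s⁻¹ • y) (s⁻¹ • y)))) s := by
    intro s hs
    rw [uIcc_of_le hl1] at hs
    have hs0 : s ≠ 0 := (hl.trans_le hs.1).ne'
    have h1 : HasDerivAt (fun s : ℝ => (s ^ d)⁻¹) (-(d * s ^ (d - 1)) / (s ^ d) ^ 2) s :=
      (hasDerivAt_pow d s).inv (pow_ne_zero _ hs0)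
    have h2 : HasDerivAt (fun s : ℝ => s⁻¹ • y) (-(s ^ 2)⁻¹ • y) s :=
      (hasDerivAt_inv hs0).smul_const y
    have h3 := (hφd (s⁻¹ • y)).hasFDerivAt.comp_hasDerivAt s h2
    refine (h1.mul h3).congr_deriv ?_
    simp only [Function.comp, map_smul, smul_eq_mul]
    rcases Nat.eq_zero_or_pos d with rfl | hdpos
    · simp; field_simp
    · obtain ⟨n, rfl⟩ : ∃ n, d = n + 1 := ⟨d - 1, by omega⟩
      simp only [Nat.add_sub_cancel]
      push_cast
      field_simp
      ring
  have hcont : ContinuousOn (fun s : ℝ => -((s ^ (d + 1))⁻¹ * (d * φ (s⁻¹ • y)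
      + fderiv ℝ φ (s⁻¹ • y) (s⁻¹ • y)))) (uIcc l 1) := by
    rw [uIcc_of_le hl1]
    have hne : ∀ s ∈ Icc l 1, s ≠ 0 := fun s hs => (hl.trans_le hs.1).ne'
    have hc1 : ContinuousOn (fun s : ℝ => s⁻¹ • y) (Icc l 1) :=
      (continuousOn_inv₀.mono hne).smul continuousOn_const
    have hc2 : Continuous fun z => d * φ z + fderiv ℝ φ z z := by
      have := hφ.continuous_fderiv (by simp); have := hφ.continuous; fun_prop
    exact (((continuousOn_pow _).inv₀ fun s hs => pow_ne_zero _ (hne s hs)).mul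
      (hc2.comp_continuousOn hc1)).neg
  have := intervalIntegral.integral_eq_sub_of_hasDerivAt hd hcont.intervalIntegrable
  rw [intervalIntegral.integral_of_le hl1] at this
  rw [this]; simp

/-- The increment of an `H¹` function along rays is the integral of its Euler derivative. -/
theorem IsH1.sub_dilation_ae {u : RSpace d → ℂ} {G : RSpace d → CSpace d} (h : IsH1 u G)
    {l : ℝ} (hl : 0 < l) (hl1 : l ≤ 1) :
    ∀ᵐ x, u x - u (l • x) = ∫ s in Ioc l 1, (s : ℂ)⁻¹ * euler G (s • x) := by
  have hu := h.hasWeakGradient.locallyIntegrable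
  have hul := (h.comp_smul hl).hasWeakGradient.locallyIntegrable
  -- The identity is checked weakly: after Fubini and a change of variables both sides become
  -- integrals of `u` against dilates of `φ`.
  refine ae_eq_of_integral_contDiff_smul_eq (hu.sub hul) ?_ ?_
  · intro x
    refine ⟨ball 0 (‖x‖ + 1), isOpen_ball.mem_nhds (by simp), ?_⟩
    exact (h.integrable_euler_prod hl (‖x‖ + 1)).integral_prod_left
  intro φ hφ hc
  obtain ⟨r, hr⟩ : ∃ r, tsupport φ ⊆ ball 0 r := hc.isCompact.isBounded.subset_ball 0
  have hφ0 : ∀ x, x ∉ ball (0 : RSpace d) r → φ x = 0 := fun x hx =>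
    image_eq_zero_of_notMem_tsupport (fun hx' => hx (hr hx'))
  -- rewrite the right-hand side
  have hR : ∫ x, φ x • (∫ s in Ioc l 1, (s : ℂ)⁻¹ * euler G (s • x))
      = ∫ s in Ioc l 1, ∫ x, (φ x : ℂ) * ((s : ℂ)⁻¹ * euler G (s • x)) := by
    have e1 : ∫ x, φ x • (∫ s in Ioc l 1, (s : ℂ)⁻¹ * euler G (s • x))
        = ∫ x in ball 0 r, ∫ s in Ioc l 1, (φ x : ℂ) * ((s : ℂ)⁻¹ * euler G (s • x)) := by
      rw [← setIntegral_eq_integral_of_forall_compl_eq_zero (s := ball 0 r)]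
      · congr 1; ext x; rw [Complex.real_smul, integral_const_mul]
      · intro x hx; simp [hφ0 x hx]
    rw [e1, integral_integral_swap]
    · congr 1; ext s
      rw [setIntegral_eq_integral_of_forall_compl_eq_zero]
      intro x hx; simp [hφ0 x hx]
    · obtain ⟨C, hC⟩ := hφ.continuous.bounded_above_of_compact_support hc
      refine (h.integrable_euler_prod hl r).bdd_mul (c := C) ?_ ?_
      · exact ((Complex.continuous_ofReal.comp hφ.continuous).comp
          continuous_fst).aestronglyMeasurable
      · exact Filter.Eventually.of_forall fun p => by
          simpa using hC p.1
  -- For fixed `s`, the substitution `y = s x` puts the dilation on `φ`, and integration by parts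
  -- against the field `φ(y/s) y` removes the gradient from `u`.
  have hcR : ∀ s ∈ Ioc l 1, ∫ x, (φ x : ℂ) * ((s : ℂ)⁻¹ * euler G (s • x))
      = ∫ y, ((-((s ^ (d + 1))⁻¹ * (d * φ (s⁻¹ • y) + fderiv ℝ φ (s⁻¹ • y) (s⁻¹ • y))) : ℝ) : ℂ)
          * u y := by
    intro s hs
    have hs0 : 0 < s := hl.trans hs.1
    have hsm : ContDiff ℝ ∞ (fun x : RSpace d => s⁻¹ • x) := by fun_prop
    have h1 := h.hasWeakGradient.integral_euler (hφ.comp hsm)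
      (hc.comp_homeomorph (Homeomorph.smulOfNeZero s⁻¹ (inv_ne_zero hs0.ne')))
    have e1 : ∀ y, fderiv ℝ (φ ∘ fun x : RSpace d => s⁻¹ • x) y y
        = fderiv ℝ φ (s⁻¹ • y) (s⁻¹ • y) := by
      intro y
      have : (φ ∘ fun x : RSpace d => s⁻¹ • x) = fun x => φ (s⁻¹ • x) := rfl
      rw [this, fderiv_comp_smul]; simp
    simp only [e1, Function.comp] at h1
    have h2 := Measure.integral_comp_smul (volume : Measure (RSpace d))
      (fun y => ((φ (s⁻¹ • y) : ℝ) : ℂ) * euler G y) s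
    simp only [smul_smul, inv_mul_cancel₀ hs0.ne', one_smul, finrank_euclideanSpace,
      Fintype.card_fin] at h2
    have e2 : ∫ x, (φ x : ℂ) * ((s : ℂ)⁻¹ * euler G (s • x))
        = (s : ℂ)⁻¹ * ∫ x, (φ x : ℂ) * euler G (s • x) := by
      rw [← integral_const_mul]; congr 1; ext x; ring
    have e3 : ∫ y, ((-((s ^ (d + 1))⁻¹ * (d * φ (s⁻¹ • y)
          + fderiv ℝ φ (s⁻¹ • y) (s⁻¹ • y))) : ℝ) : ℂ) * u y
        = -((s : ℂ) ^ (d + 1))⁻¹ * ∫ y, ((d * φ (s⁻¹ • y)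
          + fderiv ℝ φ (s⁻¹ • y) (s⁻¹ • y) : ℝ) : ℂ) * u y := by
      rw [← integral_const_mul]; congr 1; ext y; push_cast; ring
    rw [e2, e3, h2, h1, abs_of_pos (by positivity), Complex.real_smul]
    push_cast
    rw [pow_succ, mul_inv]; ring
  rw [hR, setIntegral_congr_fun measurableSet_Ioc hcR]
  -- rewrite the left-hand side
  have hL : ∫ x, φ x • (u x - u (l • x))
      = ∫ y, ((φ y - (l ^ d)⁻¹ * φ (l⁻¹ • y) : ℝ) : ℂ) * u y := by
    have h2 := Measure.integral_comp_smul (volume : Measure (RSpace d))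
      (fun y => ((φ (l⁻¹ • y) : ℝ) : ℂ) * u y) l
    simp only [smul_smul, inv_mul_cancel₀ hl.ne', one_smul, finrank_euclideanSpace,
      Fintype.card_fin] at h2
    have hsm : Continuous (fun x : RSpace d => l⁻¹ • x) := by fun_prop
    have i1 := integrable_ofReal_mul hφ.continuous hc hu
    have i2 := integrable_ofReal_mul hφ.continuous hc hul
    have i3 : Integrable (fun x => ((φ (l⁻¹ • x) : ℝ) : ℂ) * u x) volume :=
      integrable_ofReal_mul (hφ.continuous.comp hsm)
      (hc.comp_homeomorph (Homeomorph.smulOfNeZero l⁻¹ (inv_ne_zero hl.ne'))) hu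
    simp only [Complex.real_smul, mul_sub]
    rw [integral_sub i1 i2, h2, abs_of_pos (by positivity), Complex.real_smul,
      ← integral_const_mul, ← integral_sub i1 (i3.const_mul _)]
    congr 1; ext y; push_cast; ring
  rw [hL]
  simp only [sub_dilation_eq_integral hφ hl hl1]
  have e4 : ∀ y, ((∫ s in Ioc l 1, -((s ^ (d + 1))⁻¹ * (d * φ (s⁻¹ • y)
        + fderiv ℝ φ (s⁻¹ • y) (s⁻¹ • y))) : ℝ) : ℂ) * u y
      = ∫ s in Ioc l 1, ((-((s ^ (d + 1))⁻¹ * (d * φ (s⁻¹ • y)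
        + fderiv ℝ φ (s⁻¹ • y) (s⁻¹ • y))) : ℝ) : ℂ) * u y := by
    intro y
    rw [integral_mul_const, integral_complex_ofReal]
  simp only [e4]
  apply integral_integral_swap
  -- integrability on the product
  set ψ : RSpace d → ℝ := fun z => d * φ z + fderiv ℝ φ z z with hψ
  have hψc : Continuous ψ := by
    have := hφ.continuous_fderiv (by simp); have := hφ.continuous; fun_prop
  have hψs : HasCompactSupport ψ := by
    refine HasCompactSupport.intro hc.isCompact fun x hx => ?_
    have h1 := image_eq_zero_of_notMem_tsupport hx
    have h2 : fderiv ℝ φ x = 0 := image_eq_zero_of_notMem_tsupport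
      (fun hx' => hx (tsupport_fderiv_subset ℝ hx'))
    simp [hψ, h1, h2]
  obtain ⟨C, hC⟩ := hψc.bounded_above_of_compact_support hψs
  have hψ0 : ∀ x, x ∉ ball (0 : RSpace d) r → ψ x = 0 := by
    intro x hx
    have h1 := image_eq_zero_of_notMem_tsupport (fun hx' => hx (hr hx'))
    have h2 : fderiv ℝ φ x = 0 := image_eq_zero_of_notMem_tsupport
      (fun hx' => hx (hr (tsupport_fderiv_subset ℝ hx')))
    simp [hψ, h1, h2]
  have hub : Integrable ((ball (0 : RSpace d) r).indicator fun y => ‖u y‖) volume := by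
    rw [integrable_indicator_iff measurableSet_ball]
    exact ((hu.integrableOn_isCompact (isCompact_closedBall 0 r)).mono_set
      ball_subset_closedBall).norm
  have hdom := (hub.const_mul ((l ^ (d + 1))⁻¹ * C)).comp_fst (volume.restrict (Ioc l 1))
  refine hdom.mono' ?_ ?_
  · refine (Measurable.aestronglyMeasurable (Measurable.mul ?_ ?_))
    · have hm : Measurable fun p : RSpace d × ℝ => p.2⁻¹ • p.1 := by fun_prop
      have := hψc.measurable.comp hm
      refine Complex.measurable_ofReal.comp (Measurable.neg (Measurable.mul ?_ this))
      fun_prop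
    · exact h.measurable.comp measurable_fst
  · have hmem : ∀ᵐ p ∂((volume : Measure (RSpace d)).prod (volume.restrict (Ioc l 1))),
        p.2 ∈ Ioc l 1 := by
      have := Measure.quasiMeasurePreserving_snd (μ := (volume : Measure (RSpace d)))
        (ν := volume.restrict (Ioc l 1))
      exact this.ae (ae_restrict_mem measurableSet_Ioc)
    filter_upwards [hmem] with p hp
    have hs : 0 < p.2 := hl.trans hp.1
    change ‖((-((p.2 ^ (d + 1))⁻¹ * ψ (p.2⁻¹ • p.1)) : ℝ) : ℂ) * u p.1‖ ≤ _
    by_cases hy : p.1 ∈ ball (0 : RSpace d) r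
    · rw [indicator_of_mem hy, norm_mul, Complex.norm_real, norm_neg, norm_mul,
        Real.norm_of_nonneg (by positivity)]
      have := hC (p.2⁻¹ • p.1)
      have hC0 : 0 ≤ C := (norm_nonneg _).trans this
      have : (p.2 ^ (d + 1))⁻¹ ≤ (l ^ (d + 1))⁻¹ := by
        gcongr; exact hp.1.le
      gcongr
    · rw [hψ0 (p.2⁻¹ • p.1), indicator_of_notMem hy]
      · simp
      · simp only [mem_ball, dist_zero_right, not_lt, norm_smul, norm_inv,
          Real.norm_of_nonneg hs.le] at hy ⊢
        -- Since `s ≤ 1`, a point outside the ball is moved further out by `s⁻¹`, where `ψ`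
        -- vanishes.
        have : ‖p.1‖ = p.2 * (p.2⁻¹ * ‖p.1‖) := by field_simp
        nlinarith [hp.2, norm_nonneg p.1, mul_nonneg (inv_nonneg.2 hs.le) (norm_nonneg p.1)]

end Dilation

/-! ### Quantitative estimates for dilation increments, and Hardy's inequality. -/

section DilationEstimates

variable {d : ℕ}

theorem lintegral_comp_smul_of_pos (f : RSpace d → ℝ≥0∞) {s : ℝ} (hs : 0 < s) :
    ∫⁻ x, f (s • x) = ENNReal.ofReal (s ^ d)⁻¹ * ∫⁻ x, f x := by
  have h1 : ∫⁻ x, f (s • x) = ∫⁻ y, f y ∂(Measure.map (fun x : RSpace d => s • x) volume) :=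
    (lintegral_map_equiv f (MeasurableEquiv.smul₀ s hs.ne')).symm
  rw [h1, Measure.map_addHaar_smul volume hs.ne', lintegral_smul_measure, finrank_euclideanSpace,
    Fintype.card_fin, abs_of_pos (by positivity), smul_eq_mul]

theorem sq_lintegral_le {α : Type*} [MeasurableSpace α] (μ : Measure α) {f : α → ℝ≥0∞}
    (hf : AEMeasurable f μ) : (∫⁻ x, f x ∂μ) ^ 2 ≤ μ univ * ∫⁻ x, f x ^ 2 ∂μ := by
  have h := ENNReal.lintegral_mul_le_Lp_mul_Lq μ (Real.HolderConjugate.two_two)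
    (aemeasurable_const (b := (1 : ℝ≥0∞))) hf
  simp only [Pi.mul_apply, one_mul, ENNReal.one_rpow, lintegral_one] at h
  calc (∫⁻ x, f x ∂μ) ^ 2 ≤ (μ univ ^ (1 / 2 : ℝ) * (∫⁻ x, f x ^ (2 : ℝ) ∂μ) ^ (1 / 2 : ℝ)) ^ 2 := by
        gcongr
    _ = μ univ * ∫⁻ x, f x ^ 2 ∂μ := by
        rw [mul_pow, ← ENNReal.rpow_natCast, ← ENNReal.rpow_natCast, ← ENNReal.rpow_mul,
          ← ENNReal.rpow_mul]
        simp

/-- Cauchy–Schwarz in `s` on the ray formula produces one factor `1 - l`; the `s`-integral on the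
right, over an interval of length `1 - l`, supplies the other. -/
theorem IsH1.lintegral_sub_dilation_le {u : RSpace d → ℂ} {G : RSpace d → CSpace d}
    (h : IsH1 u G) {l : ℝ} (hl : 0 < l) (hl1 : l ≤ 1) {w : RSpace d → ℝ≥0∞} (hw : Measurable w) :
    ∫⁻ x, w x * ‖u x - u (l • x)‖ₑ ^ 2
      ≤ ENNReal.ofReal (1 - l) *
        ∫⁻ s in Ioc l 1, ∫⁻ x, w x * ‖(s : ℂ)⁻¹ * euler G (s • x)‖ₑ ^ 2 := by
  have hmeas : Measurable fun p : RSpace d × ℝ => p.2 • p.1 := by fun_prop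
  have hK : Measurable fun p : RSpace d × ℝ => ‖(p.2 : ℂ)⁻¹ * euler G (p.2 • p.1)‖ₑ := by
    refine Measurable.enorm (Measurable.mul ?_ ((measurable_euler h.measurable_grad).comp hmeas))
    fun_prop
  have h1 : ∀ᵐ x, w x * ‖u x - u (l • x)‖ₑ ^ 2
      ≤ ENNReal.ofReal (1 - l) * ∫⁻ s in Ioc l 1, w x * ‖(s : ℂ)⁻¹ * euler G (s • x)‖ₑ ^ 2 := by
    filter_upwards [h.sub_dilation_ae hl hl1] with x hx
    have hp : Measurable fun s : ℝ => s • x := by fun_prop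
    have hKx : Measurable fun s : ℝ => ‖(s : ℂ)⁻¹ * euler G (s • x)‖ₑ := by
      refine Measurable.enorm (Measurable.mul ?_ ((measurable_euler h.measurable_grad).comp hp))
      fun_prop
    rw [lintegral_const_mul _ (hKx.pow_const 2), hx]
    have h2 := enorm_integral_le_lintegral_enorm (μ := volume.restrict (Ioc l 1))
      (fun s : ℝ => (s : ℂ)⁻¹ * euler G (s • x))
    have h3 := sq_lintegral_le (volume.restrict (Ioc l 1)) hKx.aemeasurable
    simp only [Measure.restrict_apply_univ, Real.volume_Ioc] at h3
    calc w x * ‖∫ s in Ioc l 1, (s : ℂ)⁻¹ * euler G (s • x)‖ₑ ^ 2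
        ≤ w x * (ENNReal.ofReal (1 - l)
          * ∫⁻ s in Ioc l 1, ‖(s : ℂ)⁻¹ * euler G (s • x)‖ₑ ^ 2) := by
          gcongr; exact le_trans (by gcongr) h3
      _ = _ := by ring
  have hwK : Measurable fun p : RSpace d × ℝ =>
      w p.1 * ‖(p.2 : ℂ)⁻¹ * euler G (p.2 • p.1)‖ₑ ^ 2 :=
    (hw.comp measurable_fst).mul (hK.pow_const 2)
  refine (lintegral_mono_ae h1).trans ?_
  rw [lintegral_const_mul _ hwK.lintegral_prod_right', lintegral_lintegral_swap]
  exact hwK.aemeasurable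

theorem euler_dilation_enorm_le (G : RSpace d → CSpace d) {s : ℝ} (hs : 0 < s) (x : RSpace d) :
    ‖(s : ℂ)⁻¹ * euler G (s • x)‖ₑ ^ 2 ≤ ENNReal.ofReal (‖x‖ ^ 2) * ‖G (s • x)‖ₑ ^ 2 := by
  have h := norm_euler_le G (s • x)
  rw [norm_smul, Real.norm_of_nonneg hs.le] at h
  have h2 : ‖(s : ℂ)⁻¹ * euler G (s • x)‖ ≤ ‖x‖ * ‖G (s • x)‖ := by
    rw [norm_mul, norm_inv, Complex.norm_real, Real.norm_of_nonneg hs.le]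
    calc s⁻¹ * ‖euler G (s • x)‖ ≤ s⁻¹ * (s * ‖x‖ * ‖G (s • x)‖) := by gcongr
      _ = _ := by field_simp
  rw [← ofReal_norm, ← ofReal_norm, ← ENNReal.ofReal_pow (norm_nonneg _),
    ← ENNReal.ofReal_pow (norm_nonneg _), ← ENNReal.ofReal_mul (by positivity), ← mul_pow]
  gcongr

/-- The weight `|x|⁻²` cancels the factor `|x|` in the Euler derivative. Because `S` is star-shaped,
only the gradient inside `S` enters; with `S` a ball the estimate respects growth on balls, which
the duality with `f` requires. -/
theorem IsH1.lintegral_sub_dilation_div_le {u : RSpace d → ℂ} {G : RSpace d → CSpace d}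
    (h : IsH1 u G) {l : ℝ} (hl : 0 < l) (hl1 : l ≤ 1) {S : Set (RSpace d)} (hS : MeasurableSet S)
    (hstar : ∀ x ∈ S, ∀ s : ℝ, 0 < s → s ≤ 1 → s • x ∈ S) :
    ∫⁻ x in S, ENNReal.ofReal (‖x‖ ^ 2)⁻¹ * ‖u x - u (l • x)‖ₑ ^ 2
      ≤ ENNReal.ofReal ((1 - l) ^ 2 * (l ^ d)⁻¹) * ∫⁻ x in S, ‖G x‖ₑ ^ 2 := by
  have hm : Measurable fun x : RSpace d => ENNReal.ofReal (‖x‖ ^ 2)⁻¹ := by fun_prop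
  have h1 := h.lintegral_sub_dilation_le hl hl1 (hm.indicator hS)
  have e1 : ∫⁻ x in S, ENNReal.ofReal (‖x‖ ^ 2)⁻¹ * ‖u x - u (l • x)‖ₑ ^ 2
      = ∫⁻ x, S.indicator (fun x => ENNReal.ofReal (‖x‖ ^ 2)⁻¹) x * ‖u x - u (l • x)‖ₑ ^ 2 := by
    rw [← lintegral_indicator hS]
    congr 1; ext x; by_cases hx : x ∈ S <;> simp [hx]
  rw [e1]
  refine h1.trans ?_
  have h2 : ∀ s ∈ Ioc l 1, ∫⁻ x, S.indicator (fun x => ENNReal.ofReal (‖x‖ ^ 2)⁻¹) x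
      * ‖(s : ℂ)⁻¹ * euler G (s • x)‖ₑ ^ 2
      ≤ ENNReal.ofReal (l ^ d)⁻¹ * ∫⁻ x in S, ‖G x‖ₑ ^ 2 := by
    intro s hs
    have hs0 : 0 < s := hl.trans hs.1
    calc _ ≤ ∫⁻ x, S.indicator (fun y => ‖G y‖ₑ ^ 2) (s • x) := by
          refine lintegral_mono fun x => ?_
          by_cases hx : x ∈ S
          · rw [indicator_of_mem hx, indicator_of_mem (hstar x hx s hs0 hs.2)]
            calc _ ≤ ENNReal.ofReal (‖x‖ ^ 2)⁻¹ *
                (ENNReal.ofReal (‖x‖ ^ 2) * ‖G (s • x)‖ₑ ^ 2) := by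
                  gcongr; exact euler_dilation_enorm_le G hs0 x
              _ ≤ 1 * ‖G (s • x)‖ₑ ^ 2 := by
                  rw [← mul_assoc, ← ENNReal.ofReal_mul (by positivity)]
                  gcongr
                  rw [← ENNReal.ofReal_one]
                  exact ENNReal.ofReal_le_ofReal (inv_mul_le_one)
              _ = _ := one_mul _
          · simp [hx]
      _ = ENNReal.ofReal (s ^ d)⁻¹ * ∫⁻ x in S, ‖G x‖ₑ ^ 2 := by
          rw [lintegral_comp_smul_of_pos _ hs0, lintegral_indicator hS]
      _ ≤ _ := by
          gcongr; exact hs.1.le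
  calc _ ≤ ENNReal.ofReal (1 - l) * ∫⁻ s in Ioc l 1,
        ENNReal.ofReal (l ^ d)⁻¹ * ∫⁻ x in S, ‖G x‖ₑ ^ 2 := by
        gcongr 1
        exact setLIntegral_mono' measurableSet_Ioc h2
    _ = _ := by
        rw [setLIntegral_const, Real.volume_Ioc, ENNReal.ofReal_mul (by positivity), pow_two,
          ENNReal.ofReal_mul (by linarith)]
        ring

/-- Hardy's inequality, with a non-optimal constant. -/
theorem IsH1.hardy_lintegral {u : RSpace d → ℂ} {G : RSpace d → CSpace d} (h : IsH1 u G)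
    (hd : 3 ≤ d) :
    ∫⁻ x, ENNReal.ofReal (‖u x‖ ^ 2 / ‖x‖ ^ 2) ≤ ENNReal.ofReal (2 * 2 ^ d * ∫ x, ‖G x‖ ^ 2) := by
  set N := ∫ x, ‖G x‖ ^ 2 with hN
  have hN0 : 0 ≤ N := integral_nonneg fun x => by positivity
  have hNl : ∫⁻ x, ‖G x‖ₑ ^ 2 = ENNReal.ofReal N := by
    rw [hN, ofReal_integral_eq_lintegral_ofReal h.integrable_grad_sq
      (Filter.Eventually.of_forall fun x => by positivity)]
    congr 1; ext x; rw [← ofReal_norm, ENNReal.ofReal_pow (norm_nonneg _)]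
  have key : ∀ r : ℝ, 0 < r → ∫⁻ x in {x : RSpace d | r < ‖x‖}, ENNReal.ofReal (‖u x‖ ^ 2 / ‖x‖ ^ 2)
      ≤ ENNReal.ofReal (2 * 2 ^ d * N) := by
    intro r hr
    set S := {x : RSpace d | r < ‖x‖} with hSdef
    have hS : MeasurableSet S := measurableSet_lt measurable_const measurable_norm
    have h2 := h.lintegral_sub_dilation_div_le (l := 1 / 2) (by norm_num) (by norm_num)
      MeasurableSet.univ (fun _ _ _ _ _ => mem_univ _)
    simp only [Measure.restrict_univ, hNl] at h2
    set A := ∫⁻ x in S, ENNReal.ofReal (‖u x‖ ^ 2 / ‖x‖ ^ 2) with hA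
    -- Away from the origin the integral is finite, so it can be absorbed below; the origin is
    -- reached by monotone convergence at the end.
    have hAfin : A ≠ ⊤ := by
      refine ne_top_of_le_ne_top (b := ∫⁻ x, ENNReal.ofReal ((r ^ 2)⁻¹ * ‖u x‖ ^ 2)) ?_ ?_
      · exact (h.integrable_sq.const_mul _).lintegral_lt_top.ne
      · refine (setLIntegral_mono' hS fun x hx => ENNReal.ofReal_le_ofReal ?_).trans
          (setLIntegral_le_lintegral _ _)
        rw [div_eq_inv_mul]
        have : r < ‖x‖ := hx
        gcongr
    -- Halving the argument multiplies the Hardy integral by `2^d / 4`, up to enlarging the domain.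
    -- This is at least `2` exactly because `d ≥ 3`.
    have h3 : ∫⁻ x in S, ENNReal.ofReal (‖u ((1 / 2 : ℝ) • x)‖ ^ 2 / ‖x‖ ^ 2) ≥ 2 * A := by
      have e : ∀ x : RSpace d, S.indicator (fun x => ENNReal.ofReal (‖u ((1 / 2 : ℝ) • x)‖ ^ 2
          / ‖x‖ ^ 2)) x = ({x : RSpace d | r / 2 < ‖x‖}.indicator
            fun y => ENNReal.ofReal (‖u y‖ ^ 2 / (4 * ‖y‖ ^ 2))) ((1 / 2 : ℝ) • x) := by
        intro x
        have hx : (1 / 2 : ℝ) • x ∈ {x : RSpace d | r / 2 < ‖x‖} ↔ x ∈ S := by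
          simp only [mem_ofPred_eq, norm_smul, hSdef]; norm_num
          constructor <;> intro h <;> linarith
        by_cases hxS : x ∈ S
        · rw [indicator_of_mem hxS, indicator_of_mem (hx.2 hxS), norm_smul]
          congr 2; norm_num; ring
        · rw [indicator_of_notMem hxS, indicator_of_notMem (mt hx.1 hxS)]
      rw [← lintegral_indicator hS]
      simp only [e]
      rw [lintegral_comp_smul_of_pos _ (by norm_num : (0 : ℝ) < 1 / 2), lintegral_indicator
        (measurableSet_lt measurable_const measurable_norm)]
      have hsub : S ⊆ {x : RSpace d | r / 2 < ‖x‖} := fun x hx => by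
        have : r < ‖x‖ := hx
        simp only [mem_ofPred_eq]; linarith
      calc 2 * A ≤ ENNReal.ofReal ((1 / 2) ^ d)⁻¹
            * ∫⁻ x in S, ENNReal.ofReal (‖u x‖ ^ 2 / (4 * ‖x‖ ^ 2)) := by
            have e2 : ∀ x : RSpace d, ENNReal.ofReal (‖u x‖ ^ 2 / (4 * ‖x‖ ^ 2))
                = ENNReal.ofReal (1 / 4) * ENNReal.ofReal (‖u x‖ ^ 2 / ‖x‖ ^ 2) := by
              intro x
              rw [← ENNReal.ofReal_mul (by norm_num)]; congr 1; ring
            simp only [e2]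
            rw [lintegral_const_mul' _ _ ENNReal.ofReal_ne_top, ← mul_assoc,
              ← ENNReal.ofReal_mul (by positivity)]
            gcongr
            have : (2 : ℝ≥0∞) = ENNReal.ofReal 2 := by simp
            rw [this]
            apply ENNReal.ofReal_le_ofReal
            have : (2 : ℝ) ^ 3 ≤ 2 ^ d := pow_le_pow_right₀ (by norm_num) hd
            rw [one_div, inv_pow, inv_inv]; linarith
        _ ≤ _ := by
            gcongr
    -- The splitting `(a + b)² ≤ (3/2) a² + 3 b²` is chosen so that `3/2 < 2` and `A` can be
    -- absorbed.
    have h4 : ∫⁻ x in S, ENNReal.ofReal (‖u ((1 / 2 : ℝ) • x)‖ ^ 2 / ‖x‖ ^ 2)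
        ≤ ENNReal.ofReal (3 / 2) * A
          + 3 * (ENNReal.ofReal ((1 - 1 / 2) ^ 2 * ((1 / 2) ^ d)⁻¹) * ENNReal.ofReal N) := by
      refine le_trans ?_ (add_le_add_right (mul_le_mul_right ((setLIntegral_le_lintegral S _).trans
        h2) 3) _)
      rw [hA, ← lintegral_const_mul' _ _ ENNReal.ofReal_ne_top,
        ← lintegral_const_mul' _ _ (by norm_num), ← lintegral_add_right']
      · refine lintegral_mono fun x => ?_
        have e3 : (3 : ℝ≥0∞) * (ENNReal.ofReal (‖x‖ ^ 2)⁻¹ * ‖u x - u ((1 / 2 : ℝ) • x)‖ₑ ^ 2)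
            = ENNReal.ofReal (3 * ((‖x‖ ^ 2)⁻¹ * ‖u x - u ((1 / 2 : ℝ) • x)‖ ^ 2)) := by
          rw [ENNReal.ofReal_mul (by norm_num), ENNReal.ofReal_mul (by positivity),
            ENNReal.ofReal_pow (norm_nonneg _), ofReal_norm]
          simp
        rw [e3, ← ENNReal.ofReal_mul (by norm_num), ← ENNReal.ofReal_add (by positivity)
          (by positivity)]
        apply ENNReal.ofReal_le_ofReal
        set a := ‖u x‖
        set b := ‖u x - u ((1 / 2 : ℝ) • x)‖
        have hc : ‖u ((1 / 2 : ℝ) • x)‖ ≤ a + b := by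
          have := norm_sub_le (u x) (u x - u ((1 / 2 : ℝ) • x))
          rwa [sub_sub_cancel] at this
        have : ‖u ((1 / 2 : ℝ) • x)‖ ^ 2 ≤ 3 / 2 * a ^ 2 + 3 * b ^ 2 := by
          nlinarith [sq_nonneg (a - 2 * b), norm_nonneg (u ((1 / 2 : ℝ) • x)), norm_nonneg (u x),
            norm_nonneg (u x - u ((1 / 2 : ℝ) • x))]
        calc _ ≤ (3 / 2 * a ^ 2 + 3 * b ^ 2) / ‖x‖ ^ 2 := by gcongr
          _ = _ := by ring
      · have hl := (h.comp_smul (s := 1 / 2) (by norm_num)).measurable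
        have := h.measurable
        fun_prop
    have h5 := h3.le.trans h4
    have hAr : A = ENNReal.ofReal A.toReal := (ENNReal.ofReal_toReal hAfin).symm
    have h6 : (2 : ℝ≥0∞) = ENNReal.ofReal 2 := by simp
    have h7 : (3 : ℝ≥0∞) = ENNReal.ofReal 3 := by simp
    have hA0 : 0 ≤ A.toReal := ENNReal.toReal_nonneg
    rw [hAr, h6, h7, ← ENNReal.ofReal_mul (by norm_num), ← ENNReal.ofReal_mul (by norm_num),
      ← ENNReal.ofReal_mul (by positivity), ← ENNReal.ofReal_mul (by norm_num),
      ← ENNReal.ofReal_add (by positivity) (by positivity),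
      ENNReal.ofReal_le_ofReal_iff (by positivity)] at h5
    rw [hAr]
    apply ENNReal.ofReal_le_ofReal
    rw [one_div, inv_pow, inv_inv] at h5
    nlinarith [mul_nonneg (pow_nonneg (by norm_num : (0 : ℝ) ≤ 2) d) hN0]
  have hU : ⋃ n : ℕ, {x : RSpace d | 1 / ((n : ℝ) + 1) < ‖x‖} = {x | x ≠ 0} := by
    ext x
    simp only [mem_iUnion, mem_ofPred_eq]
    constructor
    · rintro ⟨n, hn⟩ rfl
      rw [norm_zero] at hn
      exact absurd hn (not_lt.2 (by positivity))
    · intro hx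
      exact exists_nat_one_div_lt (norm_pos_iff.2 hx)
  have e : ∫⁻ x, ENNReal.ofReal (‖u x‖ ^ 2 / ‖x‖ ^ 2)
      = ∫⁻ x in {x : RSpace d | x ≠ 0}, ENNReal.ofReal (‖u x‖ ^ 2 / ‖x‖ ^ 2) := by
    rw [setLIntegral_eq_of_support_subset]
    intro x hx hx0
    simp only [Function.mem_support] at hx
    apply hx; rw [hx0]; simp
  rw [e, ← hU, setLIntegral_iUnion_of_directed]
  · exact iSup_le fun n => key _ (by positivity)
  · refine Monotone.directed_le fun m n hmn x hx => ?_
    have hx' : 1 / ((m : ℝ) + 1) < ‖x‖ := hx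
    refine lt_of_le_of_lt ?_ hx'
    gcongr

theorem IsH1.integrable_sq_div {u : RSpace d → ℂ} {G : RSpace d → CSpace d} (h : IsH1 u G)
    (hd : 3 ≤ d) : Integrable (fun x => ‖u x‖ ^ 2 / ‖x‖ ^ 2) volume := by
  have hm : Measurable (fun x => ‖u x‖ ^ 2 / ‖x‖ ^ 2) := by
    have := h.measurable; fun_prop
  refine ⟨hm.aestronglyMeasurable, ?_⟩
  rw [hasFiniteIntegral_iff_ofReal (Filter.Eventually.of_forall fun x => by positivity)]
  exact (h.hardy_lintegral hd).trans_lt ENNReal.ofReal_lt_top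

theorem IsH1.hardy {u : RSpace d → ℂ} {G : RSpace d → CSpace d} (h : IsH1 u G) (hd : 3 ≤ d) :
    ∫ x, ‖u x‖ ^ 2 / ‖x‖ ^ 2 ≤ 2 * 2 ^ d * ∫ x, ‖G x‖ ^ 2 := by
  have h1 := h.hardy_lintegral hd
  rw [← ofReal_integral_eq_lintegral_ofReal (h.integrable_sq_div hd)
    (Filter.Eventually.of_forall fun x => by positivity), ENNReal.ofReal_le_ofReal_iff] at h1
  · exact h1
  · have : 0 ≤ ∫ x, ‖G x‖ ^ 2 := integral_nonneg fun x => by positivity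
    positivity

end DilationEstimates

/-! ### Differentiation of dilations at `l = 1`, and integrability of the radial quantities. -/

section RadialParts

open Filter Topology

variable {d : ℕ}

/-- The curve `l ↦ l^(-a) ψ(y/l)` is differentiable at `1` and Lipschitz on `[1/2, 1]` uniformly in
`y`, so dominated convergence applies with only `F ∈ L¹`. The exponent `a` records the homogeneity
of the dilated quantity: `d` for the mass, `d - 2` for the kinetic energy and for `|u|²/|x|²`, `d -
γ` for the potential energy. -/
theorem tendsto_integral_dilation {F ψ : RSpace d → ℝ} (hF : Integrable F volume)
    (hψ : ContDiff ℝ 1 ψ) {C : ℝ} (hC : ∀ x, |ψ x| ≤ C) (hE : ∀ x, |fderiv ℝ ψ x x| ≤ C) (a : ℝ) :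
    Tendsto (fun l : ℝ => (1 - l)⁻¹ * ∫ y, F y * (ψ y - l ^ (-a) * ψ (l⁻¹ • y))) (𝓝[<] 1)
      (𝓝 (-∫ y, F y * (a * ψ y + fderiv ℝ ψ y y))) := by
  have hψd : ∀ x, DifferentiableAt ℝ ψ x := fun x => (hψ.differentiable (by simp)) x
  have hC0 : 0 ≤ C := (abs_nonneg _).trans (hC 0)
  have hd : ∀ y : RSpace d, ∀ l : ℝ, 0 < l → HasDerivAt (fun l : ℝ => l ^ (-a) * ψ (l⁻¹ • y))
      (-(l ^ (-a - 1) * (a * ψ (l⁻¹ • y) + fderiv ℝ ψ (l⁻¹ • y) (l⁻¹ • y)))) l := by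
    intro y l hl
    have h1 : HasDerivAt (fun l : ℝ => l ^ (-a)) (-a * l ^ (-a - 1)) l :=
      Real.hasDerivAt_rpow_const (Or.inl hl.ne')
    have h2 : HasDerivAt (fun s : ℝ => s⁻¹ • y) (-(l ^ 2)⁻¹ • y) l :=
      (hasDerivAt_inv hl.ne').smul_const y
    have h3 := (hψd (l⁻¹ • y)).hasFDerivAt.comp_hasDerivAt l h2
    refine (h1.mul h3).congr_deriv ?_
    simp only [Function.comp, map_smul, smul_eq_mul]
    rw [Real.rpow_sub_one hl.ne']
    field_simp
    ring
  obtain ⟨K, hK⟩ : ∃ K, ∀ l ∈ Icc (1 / 2 : ℝ) 1, ‖l ^ (-a - 1)‖ ≤ K := by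
    refine isCompact_Icc.exists_bound_of_continuousOn fun l hl => ?_
    exact (Real.continuousAt_rpow_const _ _ (Or.inl (by linarith [hl.1]))).continuousWithinAt
  have hK0 : 0 ≤ K := (norm_nonneg _).trans (hK 1 (by norm_num))
  have hlip : ∀ y : RSpace d, ∀ l ∈ Icc (1 / 2 : ℝ) 1,
      ‖ψ y - l ^ (-a) * ψ (l⁻¹ • y)‖ ≤ K * (|a| * C + C) * (1 - l) := by
    intro y l hl
    have h := (convex_Icc (1 / 2 : ℝ) 1).norm_image_sub_le_of_norm_hasDerivWithin_le
      (f := fun l : ℝ => l ^ (-a) * ψ (l⁻¹ • y)) (C := K * (|a| * C + C))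
      (fun s hs => (hd y s (by linarith [hs.1])).hasDerivWithinAt) (fun s hs => by
        rw [norm_neg, norm_mul]
        gcongr
        · exact hK s hs
        · refine (norm_add_le _ _).trans (add_le_add ?_ (hE _))
          rw [norm_mul]
          exact mul_le_mul_of_nonneg_left (hC _) (abs_nonneg a)) hl
      (right_mem_Icc.2 (by norm_num))
    simpa [Real.norm_of_nonneg (sub_nonneg.2 hl.2)] using h
  have hnear : ∀ᶠ l : ℝ in 𝓝[<] 1, l ∈ Ioo (1 / 2 : ℝ) 1 := Ioo_mem_nhdsLT (by norm_num)
  have e1 : (fun l : ℝ => (1 - l)⁻¹ * ∫ y, F y * (ψ y - l ^ (-a) * ψ (l⁻¹ • y)))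
      = fun l : ℝ => ∫ y, (1 - l)⁻¹ * (F y * (ψ y - l ^ (-a) * ψ (l⁻¹ • y))) := by
    ext l; rw [integral_const_mul]
  rw [e1, ← integral_neg]
  refine tendsto_integral_filter_of_dominated_convergence
    (fun y => ‖F y‖ * (K * (|a| * C + C))) ?_ ?_ (hF.norm.mul_const _) ?_
  · refine Eventually.of_forall fun l => ?_
    have h1 : Continuous fun y : RSpace d => ψ (l⁻¹ • y) :=
      hψ.continuous.comp (continuous_const_smul _)
    exact (hF.aestronglyMeasurable.mul (hψ.continuous.sub
      (continuous_const.mul h1)).aestronglyMeasurable).const_mul _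
  · filter_upwards [hnear] with l hl
    refine Eventually.of_forall fun y => ?_
    have h1 := hlip y l ⟨hl.1.le, hl.2.le⟩
    have hl0 : 0 < 1 - l := by linarith [hl.2]
    rw [norm_mul, norm_mul, norm_inv, Real.norm_of_nonneg hl0.le]
    calc (1 - l)⁻¹ * (‖F y‖ * ‖ψ y - l ^ (-a) * ψ (l⁻¹ • y)‖)
        ≤ (1 - l)⁻¹ * (‖F y‖ * (K * (|a| * C + C) * (1 - l))) := by gcongr
      _ = _ := by field_simp
  · refine Eventually.of_forall fun y => ?_
    have h1 := (hd y 1 one_pos).tendsto_slope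
    simp only [Real.one_rpow, inv_one, one_smul, one_mul] at h1
    have h2 := (h1.mono_left (nhdsWithin_mono 1 (fun x (hx : x < 1) => hx.ne))).const_mul (F y)
    rw [← mul_neg]
    refine h2.congr' ?_
    filter_upwards [hnear] with l hl
    have hl0 : 1 - l ≠ 0 := by linarith [hl.2]
    have hl1 : l - 1 ≠ 0 := fun h => hl0 (by linarith)
    rw [slope_def_field]
    simp only [Real.one_rpow, inv_one, one_smul, one_mul]
    field_simp
    ring

/-- Divided by `1 - l`, an increment along rays is an average over `s` in `(l, 1]`, so its limit
follows from the limit of the integrand. -/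
theorem tendsto_average_left {T : ℝ → ℝ} {L : ℝ}
    (hint : ∀ᶠ l in 𝓝[<] (1 : ℝ), IntegrableOn T (Ioc l 1))
    (hT : Tendsto T (𝓝[<] 1) (𝓝 L)) :
    Tendsto (fun l : ℝ => (1 - l)⁻¹ * ∫ s in Ioc l 1, T s) (𝓝[<] 1) (𝓝 L) := by
  rw [Metric.tendsto_nhds]
  intro ε hε
  have h1 := Metric.tendsto_nhds.1 hT (ε / 2) (by positivity)
  obtain ⟨l0, hl0, hl0'⟩ := mem_nhdsLT_iff_exists_Ioo_subset.1 h1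
  have hnear : ∀ᶠ l : ℝ in 𝓝[<] 1, l ∈ Ioo l0 1 := Ioo_mem_nhdsLT hl0
  filter_upwards [hnear, hint] with l hl hli
  have hp : 0 < 1 - l := by linarith [hl.2]
  have h2 : ‖∫ s in Ioo l 1, (T s - L)‖ ≤ ε / 2 * (volume : Measure ℝ).real (Ioo l 1) := by
    refine norm_setIntegral_le_of_norm_le_const (by simp) fun s hs => ?_
    exact (hl0' (show s ∈ Ioo l0 1 from ⟨hl.1.trans hs.1, hs.2⟩) : dist (T s) L < ε / 2).le
  have hli' : IntegrableOn T (Ioo l 1) := hli.mono_set Ioo_subset_Ioc_self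
  rw [integral_sub hli' (by simp), setIntegral_const, Real.volume_real_Ioo_of_le hl.2.le] at h2
  rw [integral_Ioc_eq_integral_Ioo, Real.dist_eq]
  have e : (1 - l)⁻¹ * (∫ s in Ioo l 1, T s) - L
      = (1 - l)⁻¹ * ((∫ s in Ioo l 1, T s) - (1 - l) • L) := by
    rw [smul_eq_mul]; field_simp
  rw [e, abs_mul, abs_of_pos (inv_pos.2 hp)]
  calc (1 - l)⁻¹ * |(∫ s in Ioo l 1, T s) - (1 - l) • L| ≤ (1 - l)⁻¹ * (ε / 2 * (1 - l)) := by
        gcongr; exact h2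
    _ = ε / 2 := by field_simp
    _ < ε := by linarith

theorem abs_re_conj_mul_euler_le (u : RSpace d → ℂ) (G : RSpace d → CSpace d) (x : RSpace d) :
    |(conj (u x) * euler G x).re| / ‖x‖ ^ 2 ≤ ‖u x‖ / ‖x‖ * ‖G x‖ := by
  rcases eq_or_ne x 0 with rfl | hx
  · simp
  have hx : 0 < ‖x‖ := norm_pos_iff.2 hx
  have h1 : |(conj (u x) * euler G x).re| ≤ ‖u x‖ * (‖x‖ * ‖G x‖) := by
    refine (Complex.abs_re_le_norm _).trans ?_
    rw [norm_mul, RCLike.norm_conj]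
    gcongr
    exact norm_euler_le G x
  rw [div_le_iff₀ (by positivity)]
  refine h1.trans (le_of_eq ?_)
  field_simp

theorem IsH1.integrable_div_mul_grad {u : RSpace d → ℂ} {G : RSpace d → CSpace d} (h : IsH1 u G)
    (hd : 3 ≤ d) : Integrable (fun x => ‖u x‖ / ‖x‖ * ‖G x‖) volume := by
  have hu := h.measurable
  have hG := h.measurable_grad
  refine ((h.integrable_sq_div hd).add h.integrable_grad_sq).mono'
    (by fun_prop) (Eventually.of_forall fun x => ?_)
  rw [Real.norm_of_nonneg (by positivity)]
  simp only [Pi.add_apply]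
  rw [← div_pow]
  nlinarith [sq_nonneg (‖u x‖ / ‖x‖ - ‖G x‖), sq_nonneg (‖u x‖ / ‖x‖), sq_nonneg ‖G x‖]

theorem IsH1.integrable_mul_re_euler {u : RSpace d → ℂ} {G : RSpace d → CSpace d} (h : IsH1 u G)
    (hd : 3 ≤ d) {ψ : RSpace d → ℝ} (hψ : Measurable ψ) {C : ℝ} (hC : ∀ x, |ψ x| ≤ C) :
    Integrable (fun x => ψ x / ‖x‖ ^ 2 * (conj (u x) * euler G x).re) volume := by
  have hu := h.measurable
  have hG := measurable_euler h.measurable_grad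
  refine ((h.integrable_div_mul_grad hd).const_mul C).mono' ?_ (Eventually.of_forall fun x => ?_)
  · refine Measurable.aestronglyMeasurable (Measurable.mul (by fun_prop)
      (Complex.measurable_re.comp (Measurable.mul ?_ hG)))
    exact Complex.continuous_conj.measurable.comp hu
  · have h1 := abs_re_conj_mul_euler_le u G x
    have h0 : 0 ≤ C := (abs_nonneg _).trans (hC x)
    calc ‖ψ x / ‖x‖ ^ 2 * (conj (u x) * euler G x).re‖
        = |ψ x| * (|(conj (u x) * euler G x).re| / ‖x‖ ^ 2) := by
          rw [Real.norm_eq_abs, abs_mul, abs_div, abs_of_nonneg (by positivity : 0 ≤ ‖x‖ ^ 2)]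
          ring
      _ ≤ _ := by gcongr; exact hC x

theorem IsH1.integrable_mul_sq_div {u : RSpace d → ℂ} {G : RSpace d → CSpace d} (h : IsH1 u G)
    (hd : 3 ≤ d) {ψ : RSpace d → ℝ} (hψ : Measurable ψ) {C : ℝ} (hC : ∀ x, |ψ x| ≤ C) :
    Integrable (fun x => ψ x / ‖x‖ ^ 2 * ‖u x‖ ^ 2) volume := by
  refine ((h.integrable_sq_div hd).bdd_mul (c := C) hψ.aestronglyMeasurable
    (Eventually.of_forall hC)).congr (Eventually.of_forall fun x => ?_)
  simp only; ring

/-- The squared norm of `(u - u(l ·)) / |x|` is `O((1 - l)²)`. -/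
theorem IsH1.integral_sub_dilation_div_le {u : RSpace d → ℂ} {G : RSpace d → CSpace d}
    (h : IsH1 u G) {l : ℝ} (hl : 0 < l) (hl1 : l ≤ 1) :
    Integrable (fun x => ‖u x - u (l • x)‖ ^ 2 / ‖x‖ ^ 2) volume ∧
    ∫ x, ‖u x - u (l • x)‖ ^ 2 / ‖x‖ ^ 2 ≤ (1 - l) ^ 2 * (l ^ d)⁻¹ * ∫ x, ‖G x‖ ^ 2 := by
  have hul := (h.comp_smul hl).measurable
  have hu := h.measurable
  have h1 := h.lintegral_sub_dilation_div_le hl hl1 MeasurableSet.univ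
    (fun _ _ _ _ _ => mem_univ _)
  have e1 : ∀ x, ENNReal.ofReal (‖x‖ ^ 2)⁻¹ * ‖u x - u (l • x)‖ₑ ^ 2
      = ENNReal.ofReal (‖u x - u (l • x)‖ ^ 2 / ‖x‖ ^ 2) := by
    intro x
    rw [← ofReal_norm, ← ENNReal.ofReal_pow (norm_nonneg _), ← ENNReal.ofReal_mul (by positivity)]
    congr 1; ring
  have e2 : ∫⁻ x, ‖G x‖ₑ ^ 2 = ENNReal.ofReal (∫ x, ‖G x‖ ^ 2) := by
    rw [ofReal_integral_eq_lintegral_ofReal h.integrable_grad_sq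
      (Eventually.of_forall fun x => by positivity)]
    congr 1; ext x; rw [← ofReal_norm, ENNReal.ofReal_pow (norm_nonneg _)]
  have hN : 0 ≤ ∫ x, ‖G x‖ ^ 2 := integral_nonneg fun x => by positivity
  simp only [Measure.restrict_univ, e1, e2] at h1
  rw [← ENNReal.ofReal_mul (by positivity)] at h1
  have hi : Integrable (fun x => ‖u x - u (l • x)‖ ^ 2 / ‖x‖ ^ 2) volume := by
    have hm : Measurable (fun x => ‖u x - u (l • x)‖ ^ 2 / ‖x‖ ^ 2) := by fun_prop
    refine ⟨hm.aestronglyMeasurable, ?_⟩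
    rw [hasFiniteIntegral_iff_ofReal (Eventually.of_forall fun x => by positivity)]
    exact h1.trans_lt ENNReal.ofReal_lt_top
  refine ⟨hi, ?_⟩
  rw [← ofReal_integral_eq_lintegral_ofReal hi (Eventually.of_forall fun x => by positivity),
    ENNReal.ofReal_le_ofReal_iff (by positivity)] at h1
  exact h1

end RadialParts

/-! ### Integration by parts against singular radial fields. -/

section RadialIdentity

open Filter Topology

variable {d : ℕ}

theorem integral_comp_smul_of_pos {F : Type*} [NormedAddCommGroup F] [NormedSpace ℝ F]
    (f : RSpace d → F) {s : ℝ} (hs : 0 < s) : ∫ x, f (s • x) = (s ^ d)⁻¹ • ∫ x, f x := by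
  rw [Measure.integral_comp_smul, finrank_euclideanSpace, Fintype.card_fin,
    abs_of_pos (by positivity)]

/-- Convergence of the pairing with the dilated Euler derivative. -/
theorem IsH1.tendsto_euler_pairing {u : RSpace d → ℂ} {G : RSpace d → CSpace d} (h : IsH1 u G)
    (hd : 3 ≤ d) {ψ : RSpace d → ℝ} (hψ : Continuous ψ) {C : ℝ} (hC : ∀ x, |ψ x| ≤ C) :
    Tendsto (fun s : ℝ => ∫ x, ψ x / ‖x‖ ^ 2 * (conj (u x) * ((s : ℂ)⁻¹ * euler G (s • x))).re)
      (𝓝[<] 1) (𝓝 (∫ x, ψ x / ‖x‖ ^ 2 * (conj (u x) * euler G x).re)) := by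
  have hu := h.measurable
  have hG := h.measurable_grad
  have hEm := measurable_euler hG
  have hC0 : 0 ≤ C := (abs_nonneg _).trans (hC 0)
  set N := ∫ x, ‖G x‖ ^ 2 with hN
  have hN0 : 0 ≤ N := integral_nonneg fun x => by positivity
  have hnear : ∀ᶠ l : ℝ in 𝓝[<] 1, l ∈ Ioo (1 / 2 : ℝ) 1 := Ioo_mem_nhdsLT (by norm_num)
  -- the pairing with both factors dilated
  have hT' : Tendsto (fun s : ℝ => ∫ x, ψ x / ‖x‖ ^ 2 *
      (conj (u (s • x)) * ((s : ℂ)⁻¹ * euler G (s • x))).re) (𝓝[<] 1)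
      (𝓝 (∫ x, ψ x / ‖x‖ ^ 2 * (conj (u x) * euler G x).re)) := by
    -- Undoing the dilation of both factors leaves `s` only in powers and in the continuous function
    -- `ψ(x/s)`, so no continuity of `G` is needed.
    have e : ∀ s ∈ Ioo (1 / 2 : ℝ) 1, ∫ x, (s ^ d)⁻¹ * s * (ψ (s⁻¹ • x) / ‖x‖ ^ 2 *
        (conj (u x) * euler G x).re) = ∫ x, ψ x / ‖x‖ ^ 2 *
      (conj (u (s • x)) * ((s : ℂ)⁻¹ * euler G (s • x))).re := by
      intro s hs
      have hs0 : 0 < s := by linarith [hs.1]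
      have h1 := integral_comp_smul_of_pos (fun y : RSpace d => ψ (s⁻¹ • y) / ‖s⁻¹ • y‖ ^ 2 *
        (conj (u y) * ((s : ℂ)⁻¹ * euler G y)).re) hs0
      simp only [smul_smul, inv_mul_cancel₀ hs0.ne', one_smul] at h1
      rw [h1, smul_eq_mul, ← integral_const_mul]
      congr 1; ext y
      have e2 : (conj (u y) * ((s : ℂ)⁻¹ * euler G y)).re
          = s⁻¹ * (conj (u y) * euler G y).re := by
        rw [← Complex.ofReal_inv, mul_left_comm, Complex.re_ofReal_mul]
      rw [e2, norm_smul, norm_inv, Real.norm_of_nonneg hs0.le]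
      field_simp
    refine Tendsto.congr' (f₁ := fun s : ℝ => ∫ x, (s ^ d)⁻¹ * s * (ψ (s⁻¹ • x) / ‖x‖ ^ 2 *
        (conj (u x) * euler G x).re)) (by filter_upwards [hnear] with s hs using e s hs) ?_
    refine tendsto_integral_filter_of_dominated_convergence
      (fun x => 2 ^ d * (C * (‖u x‖ / ‖x‖ * ‖G x‖))) ?_ ?_
      (((h.integrable_div_mul_grad hd).const_mul C).const_mul _) ?_
    · filter_upwards with s
      have hcs : Continuous fun y : RSpace d => ψ (s⁻¹ • y) := hψ.comp (continuous_const_smul _)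
      have := (h.integrable_mul_re_euler hd hcs.measurable (fun x => hC _)).aestronglyMeasurable
      exact this.const_mul _
    · filter_upwards [hnear] with s hs
      filter_upwards with x
      have hs0 : 0 < s := by linarith [hs.1]
      have h1 := abs_re_conj_mul_euler_le u G x
      rw [Real.norm_eq_abs, abs_mul, abs_mul (ψ _ / _), abs_div,
        abs_of_nonneg (by positivity : 0 ≤ ‖x‖ ^ 2), abs_of_nonneg (by positivity)]
      have h2 : (s ^ d)⁻¹ * s ≤ 2 ^ d := by
        have h3 : (s ^ d)⁻¹ ≤ 2 ^ d := by
          rw [← inv_pow]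
          have : s⁻¹ ≤ 2 := by
            rw [inv_le_comm₀ hs0 (by norm_num)]; linarith [hs.1]
          gcongr
        calc (s ^ d)⁻¹ * s ≤ (s ^ d)⁻¹ * 1 := by gcongr; exact hs.2.le
          _ ≤ _ := by rwa [mul_one]
      have h4 : |ψ (s⁻¹ • x)| / ‖x‖ ^ 2 * |(conj (u x) * euler G x).re|
          = |ψ (s⁻¹ • x)| * (|(conj (u x) * euler G x).re| / ‖x‖ ^ 2) := by ring
      rw [h4]
      gcongr
      exact hC _
    · filter_upwards with x
      have h1 : ContinuousAt (fun s : ℝ => (s ^ d)⁻¹ * s * (ψ (s⁻¹ • x) / ‖x‖ ^ 2 *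
        (conj (u x) * euler G x).re)) 1 := by
        have h2 : ContinuousAt (fun s : ℝ => ψ (s⁻¹ • x)) 1 :=
          hψ.continuousAt.comp ((continuousAt_inv₀ one_ne_zero).smul continuousAt_const)
        have h3 : ContinuousAt (fun s : ℝ => (s ^ d)⁻¹) 1 :=
          (continuousAt_pow 1 d).inv₀ (by simp)
        exact (h3.mul continuousAt_id).mul ((h2.div_const _).mul continuousAt_const)
      have := h1.tendsto
      simp only [one_pow, inv_one, one_smul, one_mul] at this
      exact this.mono_left nhdsWithin_le_nhds
  -- the difference
  have hdiff : Tendsto (fun s : ℝ => (∫ x, ψ x / ‖x‖ ^ 2 *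
      (conj (u x) * ((s : ℂ)⁻¹ * euler G (s • x))).re) - ∫ x, ψ x / ‖x‖ ^ 2 *
      (conj (u (s • x)) * ((s : ℂ)⁻¹ * euler G (s • x))).re) (𝓝[<] 1) (𝓝 0) := by
    have hb : ∀ s ∈ Ioo (1 / 2 : ℝ) 1, ‖(∫ x, ψ x / ‖x‖ ^ 2 *
      (conj (u x) * ((s : ℂ)⁻¹ * euler G (s • x))).re) - ∫ x, ψ x / ‖x‖ ^ 2 *
      (conj (u (s • x)) * ((s : ℂ)⁻¹ * euler G (s • x))).re‖ ≤ (1 - s) * (C * 2 ^ d * N) := by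
      intro s hs
      have hs0 : 0 < s := by linarith [hs.1]
      have hp : 0 < 1 - s := by linarith [hs.2]
      have hsd : (s ^ d)⁻¹ ≤ 2 ^ d := by
        rw [← inv_pow]
        have : s⁻¹ ≤ 2 := by
          rw [inv_le_comm₀ hs0 (by norm_num)]; linarith [hs.1]
        gcongr
      have hsm : Measurable fun x : RSpace d => s • x := by fun_prop
      have hus : Measurable fun x => u (s • x) := hu.comp hsm
      have hGs : Measurable fun x => G (s • x) := hG.comp hsm
      have hEs : Measurable fun x => euler G (s • x) := hEm.comp hsm
      have hEb : ∀ x, ‖(s : ℂ)⁻¹ * euler G (s • x)‖ ≤ ‖x‖ * ‖G (s • x)‖ := by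
        intro x
        have h := norm_euler_le G (s • x)
        rw [norm_smul, Real.norm_of_nonneg hs0.le] at h
        rw [norm_mul, norm_inv, Complex.norm_real, Real.norm_of_nonneg hs0.le]
        calc s⁻¹ * ‖euler G (s • x)‖ ≤ s⁻¹ * (s * ‖x‖ * ‖G (s • x)‖) := by gcongr
          _ = _ := by field_simp
      have hgs : Integrable (fun x => ‖G (s • x)‖ ^ 2) volume :=
        h.integrable_grad_sq.comp_smul hs0.ne'
      have hgsv : ∫ x, ‖G (s • x)‖ ^ 2 = (s ^ d)⁻¹ * N := by
        rw [integral_comp_smul_of_pos (fun x => ‖G x‖ ^ 2) hs0, smul_eq_mul]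
      obtain ⟨hds, hdsv⟩ := h.integral_sub_dilation_div_le hs0 hs.2.le
      have hpt : ∀ (v : RSpace d → ℂ) (x : RSpace d),
          |ψ x / ‖x‖ ^ 2 * (conj (v x) * ((s : ℂ)⁻¹ * euler G (s • x))).re|
          ≤ C * (‖v x‖ / ‖x‖ * ‖G (s • x)‖) := by
        intro v x
        rcases eq_or_ne x 0 with rfl | hx
        · simp
        have hx : 0 < ‖x‖ := norm_pos_iff.2 hx
        rw [abs_mul, abs_div, abs_of_nonneg (by positivity : 0 ≤ ‖x‖ ^ 2)]
        have h1 : |(conj (v x) * ((s : ℂ)⁻¹ * euler G (s • x))).re|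
            ≤ ‖v x‖ * (‖x‖ * ‖G (s • x)‖) := by
          refine (Complex.abs_re_le_norm _).trans ?_
          rw [norm_mul, RCLike.norm_conj]
          gcongr
          exact hEb x
        calc _ ≤ C / ‖x‖ ^ 2 * (‖v x‖ * (‖x‖ * ‖G (s • x)‖)) := by gcongr; exact hC x
          _ = _ := by field_simp
      have hint : ∀ v : RSpace d → ℂ, Measurable v →
          Integrable (fun x => ‖v x‖ ^ 2 / ‖x‖ ^ 2) volume →
          Integrable (fun x => ψ x / ‖x‖ ^ 2 * (conj (v x) * ((s : ℂ)⁻¹ * euler G (s • x))).re)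
            volume := by
        intro v hv hvi
        refine ((hvi.add hgs).const_mul C).mono' ?_ (Eventually.of_forall fun x => ?_)
        · refine Measurable.aestronglyMeasurable (Measurable.mul ?_
            (Complex.measurable_re.comp (Measurable.mul ?_ (hEs.const_mul _))))
          · have := hψ.measurable; fun_prop
          · exact Complex.continuous_conj.measurable.comp hv
        · refine (hpt v x).trans ?_
          simp only [Pi.add_apply]
          rw [← div_pow]
          gcongr
          nlinarith [sq_nonneg (‖v x‖ / ‖x‖ - ‖G (s • x)‖), sq_nonneg (‖v x‖ / ‖x‖),
            sq_nonneg ‖G (s • x)‖]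
      have husi : Integrable (fun x => ‖u (s • x)‖ ^ 2 / ‖x‖ ^ 2) volume :=
        (h.comp_smul hs0).integrable_sq_div hd
      rw [← integral_sub (hint u hu (h.integrable_sq_div hd)) (hint _ hus husi)]
      -- Young's inequality weighted by `1 - s`: the weighted square of the increment is `O((1 -
      -- s)²)`, so both terms are `O(1 - s)`.
      have hdom : Integrable (fun x => C * ((2 * (1 - s))⁻¹ * (‖u x - u (s • x)‖ ^ 2 / ‖x‖ ^ 2)
          + (1 - s) / 2 * ‖G (s • x)‖ ^ 2)) volume :=
        ((hds.const_mul _).add (hgs.const_mul _)).const_mul C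
      refine (norm_integral_le_of_norm_le hdom (Eventually.of_forall fun x => ?_)).trans ?_
      · have e : ψ x / ‖x‖ ^ 2 * (conj (u x) * ((s : ℂ)⁻¹ * euler G (s • x))).re
            - ψ x / ‖x‖ ^ 2 * (conj (u (s • x)) * ((s : ℂ)⁻¹ * euler G (s • x))).re
            = ψ x / ‖x‖ ^ 2 * (conj (u x - u (s • x)) * ((s : ℂ)⁻¹ * euler G (s • x))).re := by
          rw [map_sub, sub_mul, Complex.sub_re]; ring
        rw [e, Real.norm_eq_abs]
        refine (hpt (fun x => u x - u (s • x)) x).trans ?_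
        gcongr
        rw [← div_pow]
        set a := ‖u x - u (s • x)‖ / ‖x‖
        set b := ‖G (s • x)‖
        have : (2 * (1 - s))⁻¹ * a ^ 2 + (1 - s) / 2 * b ^ 2 - a * b
            = (2 * (1 - s))⁻¹ * (a - (1 - s) * b) ^ 2 := by field_simp; ring
        have : 0 ≤ (2 * (1 - s))⁻¹ * (a - (1 - s) * b) ^ 2 := by positivity
        linarith
      · rw [integral_const_mul, integral_add (hds.const_mul _) (hgs.const_mul _),
          integral_const_mul, integral_const_mul, hgsv]
        calc C * ((2 * (1 - s))⁻¹ * (∫ x, ‖u x - u (s • x)‖ ^ 2 / ‖x‖ ^ 2)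
              + (1 - s) / 2 * ((s ^ d)⁻¹ * N))
            ≤ C * ((2 * (1 - s))⁻¹ * ((1 - s) ^ 2 * (s ^ d)⁻¹ * N)
              + (1 - s) / 2 * ((s ^ d)⁻¹ * N)) := by gcongr
          _ = C * ((1 - s) * ((s ^ d)⁻¹ * N)) := by field_simp; ring
          _ ≤ C * ((1 - s) * (2 ^ d * N)) := by gcongr
          _ = _ := by ring
    refine squeeze_zero_norm' (by filter_upwards [hnear] with s hs using hb s hs) ?_
    have : Tendsto (fun s : ℝ => (1 - s) * (C * 2 ^ d * N)) (𝓝 1) (𝓝 ((1 - 1) * (C * 2 ^ d * N))) :=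
      Continuous.tendsto (by fun_prop) 1
    simp only [sub_self, zero_mul] at this
    exact this.mono_left nhdsWithin_le_nhds
  simpa using hdiff.add hT'

/-- By Fubini the difference quotient is the average over `s` of the pairings in
`IsH1.tendsto_euler_pairing`. -/
theorem IsH1.tendsto_sub_dilation_pairing {u : RSpace d → ℂ} {G : RSpace d → CSpace d}
    (h : IsH1 u G) (hd : 3 ≤ d) {ψ : RSpace d → ℝ} (hψ : Continuous ψ) {C : ℝ}
    (hC : ∀ x, |ψ x| ≤ C) :
    Tendsto (fun l : ℝ => (1 - l)⁻¹ * ∫ x, ψ x / ‖x‖ ^ 2 * (conj (u x) * (u x - u (l • x))).re)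
      (𝓝[<] 1) (𝓝 (∫ x, ψ x / ‖x‖ ^ 2 * (conj (u x) * euler G x).re)) := by
  have hu := h.measurable
  have hG := h.measurable_grad
  have hEm := measurable_euler hG
  have hC0 : 0 ≤ C := (abs_nonneg _).trans (hC 0)
  have hnear : ∀ᶠ l : ℝ in 𝓝[<] 1, l ∈ Ioo (1 / 2 : ℝ) 1 := Ioo_mem_nhdsLT (by norm_num)
  have hprod : ∀ l ∈ Ioo (1 / 2 : ℝ) 1, Integrable (fun p : RSpace d × ℝ =>
      ψ p.1 / ‖p.1‖ ^ 2 * (conj (u p.1) * ((p.2 : ℂ)⁻¹ * euler G (p.2 • p.1))).re)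
      ((volume : Measure (RSpace d)).prod (volume.restrict (Ioc l 1))) := by
    intro l hl
    have hl0 : 0 < l := by linarith [hl.1]
    have hsm : Measurable fun p : RSpace d × ℝ => p.2 • p.1 := by fun_prop
    have h1 := integrable_comp_smul_prod h.integrable_grad_sq
      (h.measurable_grad.norm.pow_const 2).stronglyMeasurable hl0
    have h2 := (h.integrable_sq_div hd).comp_fst (volume.restrict (Ioc l 1))
    refine ((h2.add h1).const_mul C).mono' ?_ ?_
    · refine Measurable.aestronglyMeasurable (Measurable.mul ?_
        (Complex.measurable_re.comp (Measurable.mul ?_ (Measurable.mul ?_ (hEm.comp hsm)))))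
      · have := hψ.measurable; fun_prop
      · exact Complex.continuous_conj.measurable.comp (hu.comp measurable_fst)
      · fun_prop
    · have hmem : ∀ᵐ p ∂((volume : Measure (RSpace d)).prod (volume.restrict (Ioc l 1))),
          p.2 ∈ Ioc l 1 := by
        have := Measure.quasiMeasurePreserving_snd (μ := (volume : Measure (RSpace d)))
          (ν := volume.restrict (Ioc l 1))
        exact this.ae (ae_restrict_mem measurableSet_Ioc)
      filter_upwards [hmem] with p hp
      have hs0 : 0 < p.2 := hl0.trans hp.1
      obtain ⟨x, s⟩ := p
      simp only at hs0 ⊢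
      rcases eq_or_ne x 0 with rfl | hx
      · simp; positivity
      have hx : 0 < ‖x‖ := norm_pos_iff.2 hx
      have hEb : ‖(s : ℂ)⁻¹ * euler G (s • x)‖ ≤ ‖x‖ * ‖G (s • x)‖ := by
        have h := norm_euler_le G (s • x)
        rw [norm_smul, Real.norm_of_nonneg hs0.le] at h
        rw [norm_mul, norm_inv, Complex.norm_real, Real.norm_of_nonneg hs0.le]
        calc s⁻¹ * ‖euler G (s • x)‖ ≤ s⁻¹ * (s * ‖x‖ * ‖G (s • x)‖) := by gcongr
          _ = _ := by field_simp
      rw [Real.norm_eq_abs, abs_mul, abs_div, abs_of_nonneg (by positivity : 0 ≤ ‖x‖ ^ 2)]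
      have h1 : |(conj (u x) * ((s : ℂ)⁻¹ * euler G (s • x))).re|
          ≤ ‖u x‖ * (‖x‖ * ‖G (s • x)‖) := by
        refine (Complex.abs_re_le_norm _).trans ?_
        rw [norm_mul, RCLike.norm_conj]
        gcongr
      calc _ ≤ C / ‖x‖ ^ 2 * (‖u x‖ * (‖x‖ * ‖G (s • x)‖)) := by gcongr; exact hC x
        _ = C * (‖u x‖ / ‖x‖ * ‖G (s • x)‖) := by field_simp
        _ ≤ _ := by
          simp only [Pi.add_apply]
          rw [← div_pow]
          gcongr
          nlinarith [sq_nonneg (‖u x‖ / ‖x‖ - ‖G (s • x)‖), sq_nonneg (‖u x‖ / ‖x‖),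
            sq_nonneg ‖G (s • x)‖]
  have hswap : ∀ l ∈ Ioo (1 / 2 : ℝ) 1,
      ∫ x, ψ x / ‖x‖ ^ 2 * (conj (u x) * (u x - u (l • x))).re
      = ∫ s in Ioc l 1, ∫ x, ψ x / ‖x‖ ^ 2 *
        (conj (u x) * ((s : ℂ)⁻¹ * euler G (s • x))).re := by
    intro l hl
    have hl0 : 0 < l := by linarith [hl.1]
    rw [← integral_integral_swap (hprod l hl)]
    refine integral_congr_ae ?_
    have hae : ∀ᵐ x : RSpace d, Integrable (fun s : ℝ => (s : ℂ)⁻¹ * euler G (s • x))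
        (volume.restrict (Ioc l 1)) := by
      have h1 : ∀ n : ℕ, ∀ᵐ x ∂(volume.restrict (ball (0 : RSpace d) n)),
          Integrable (fun s : ℝ => (s : ℂ)⁻¹ * euler G (s • x)) (volume.restrict (Ioc l 1)) :=
        fun n => (h.integrable_euler_prod hl0 n).prod_right_ae
      have h2 : ∀ᵐ x : RSpace d, ∀ n : ℕ, x ∈ ball (0 : RSpace d) n →
          Integrable (fun s : ℝ => (s : ℂ)⁻¹ * euler G (s • x)) (volume.restrict (Ioc l 1)) :=
        ae_all_iff.2 fun n => (ae_restrict_iff' measurableSet_ball).1 (h1 n)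
      filter_upwards [h2] with x hx
      obtain ⟨n, hn⟩ := exists_nat_gt ‖x‖
      exact hx n (by simpa using hn)
    filter_upwards [h.sub_dilation_ae hl0 hl.2.le, hae] with x hx hxi
    rw [hx, integral_const_mul, ← integral_const_mul]
    congr 1
    exact (integral_re (hxi.const_mul (conj (u x)))).symm
  refine (tendsto_average_left ?_ (h.tendsto_euler_pairing hd hψ hC)).congr' ?_
  · filter_upwards [hnear] with l hl using (hprod l hl).integral_prod_right
  · filter_upwards [hnear] with l hl
    rw [hswap l hl]

/-- Integration by parts of `|u|²` against the radial field `ψ(x) x / |x|²`. -/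
theorem IsH1.integral_radial {u : RSpace d → ℂ} {G : RSpace d → CSpace d} (h : IsH1 u G)
    (hd : 3 ≤ d) {ψ : RSpace d → ℝ} (hψ : ContDiff ℝ 1 ψ) {C : ℝ} (hC : ∀ x, |ψ x| ≤ C)
    (hE : ∀ x, |fderiv ℝ ψ x x| ≤ C) :
    ∫ x, ‖u x‖ ^ 2 / ‖x‖ ^ 2 * ((d - 2) * ψ x + fderiv ℝ ψ x x)
      = -2 * ∫ x, ψ x / ‖x‖ ^ 2 * (conj (u x) * euler G x).re := by
  have hC0 : 0 ≤ C := (abs_nonneg _).trans (hC 0)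
  have hψm := hψ.continuous.measurable
  have hnear : ∀ᶠ l : ℝ in 𝓝[<] 1, l ∈ Ioo (1 / 2 : ℝ) 1 := Ioo_mem_nhdsLT (by norm_num)
  have h1 := tendsto_integral_dilation (h.integrable_sq_div hd) hψ hC hE (d - 2)
  have h2 := h.tendsto_sub_dilation_pairing hd hψ.continuous hC
  set N := ∫ x, ‖G x‖ ^ 2 with hN
  have hN0 : 0 ≤ N := integral_nonneg fun x => by positivity
  -- The quadratic remainder in the polarisation below is `O((1 - l)²)`, hence negligible after
  -- division by `1 - l`.
  have h3 : Tendsto (fun l : ℝ => (1 - l)⁻¹ * ∫ x, ψ x / ‖x‖ ^ 2 * ‖u x - u (l • x)‖ ^ 2)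
      (𝓝[<] 1) (𝓝 0) := by
    have hb : ∀ l ∈ Ioo (1 / 2 : ℝ) 1, ‖(1 - l)⁻¹ * ∫ x, ψ x / ‖x‖ ^ 2 * ‖u x - u (l • x)‖ ^ 2‖
        ≤ (1 - l) * (C * 2 ^ d * N) := by
      intro l hl
      have hl0 : 0 < l := by linarith [hl.1]
      have hp : 0 < 1 - l := by linarith [hl.2]
      obtain ⟨hds, hdsv⟩ := h.integral_sub_dilation_div_le hl0 hl.2.le
      have hsd : (l ^ d)⁻¹ ≤ 2 ^ d := by
        rw [← inv_pow]
        have : l⁻¹ ≤ 2 := by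
          rw [inv_le_comm₀ hl0 (by norm_num)]; linarith [hl.1]
        gcongr
      have h4 : ‖∫ x, ψ x / ‖x‖ ^ 2 * ‖u x - u (l • x)‖ ^ 2‖
          ≤ ∫ x, C * (‖u x - u (l • x)‖ ^ 2 / ‖x‖ ^ 2) := by
        refine norm_integral_le_of_norm_le (hds.const_mul C) (Eventually.of_forall fun x => ?_)
        rw [Real.norm_eq_abs, abs_mul, abs_div, abs_of_nonneg (by positivity : 0 ≤ ‖x‖ ^ 2),
          abs_of_nonneg (by positivity : 0 ≤ ‖u x - u (l • x)‖ ^ 2), div_mul_eq_mul_div,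
          ← mul_div_assoc]
        gcongr
        exact hC x
      rw [integral_const_mul] at h4
      rw [norm_mul, norm_inv, Real.norm_of_nonneg hp.le]
      calc _ ≤ (1 - l)⁻¹ * (C * ((1 - l) ^ 2 * 2 ^ d * N)) := by
            gcongr
            refine h4.trans ?_
            gcongr
            refine hdsv.trans ?_
            gcongr
        _ = _ := by field_simp
    refine squeeze_zero_norm' (by filter_upwards [hnear] with s hs using hb s hs) ?_
    have : Tendsto (fun s : ℝ => (1 - s) * (C * 2 ^ d * N)) (𝓝 1) (𝓝 ((1 - 1) * (C * 2 ^ d * N))) :=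
      Continuous.tendsto (by fun_prop) 1
    simp only [sub_self, zero_mul] at this
    exact this.mono_left nhdsWithin_le_nhds
  -- Polarisation: `|u|² - |u_l|² = 2 Re(ū(u - u_l)) - |u - u_l|²`. The exponent `-(d-2)` combines
  -- the Jacobian `l^(-d)` with the factor `l²` from the weight `|x|⁻²`.
  have h4 : ∀ l ∈ Ioo (1 / 2 : ℝ) 1,
      ∫ y, ‖u y‖ ^ 2 / ‖y‖ ^ 2 * (ψ y - l ^ (-((d : ℝ) - 2)) * ψ (l⁻¹ • y))
      = 2 * (∫ x, ψ x / ‖x‖ ^ 2 * (conj (u x) * (u x - u (l • x))).re)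
        - ∫ x, ψ x / ‖x‖ ^ 2 * ‖u x - u (l • x)‖ ^ 2 := by
    intro l hl
    have hl0 : 0 < l := by linarith [hl.1]
    have hu2 := h.integrable_mul_sq_div hd hψm hC
    have hul2 := (h.comp_smul hl0).integrable_mul_sq_div hd hψm hC
    have hd2 := (h.sub (h.comp_smul hl0)).integrable_mul_sq_div hd hψm hC
    have e1 := integral_comp_smul_of_pos
      (fun y : RSpace d => ψ (l⁻¹ • y) / ‖l⁻¹ • y‖ ^ 2 * ‖u y‖ ^ 2) hl0
    simp only [smul_smul, inv_mul_cancel₀ hl0.ne', one_smul] at e1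
    have hpow : l ^ (-((d : ℝ) - 2)) = (l ^ d)⁻¹ * l ^ 2 := by
      rw [neg_sub, Real.rpow_sub hl0, Real.rpow_natCast, div_eq_inv_mul]
      norm_cast
    have hcm : Measurable fun y : RSpace d => ψ (l⁻¹ • y) := hψm.comp (measurable_const_smul _)
    have hu3 := (h.integrable_mul_sq_div hd hcm (fun x => hC _)).const_mul (l ^ (-((d : ℝ) - 2)))
    have e2 : ∫ y, ‖u y‖ ^ 2 / ‖y‖ ^ 2 * (ψ y - l ^ (-((d : ℝ) - 2)) * ψ (l⁻¹ • y))
        = (∫ x, ψ x / ‖x‖ ^ 2 * ‖u x‖ ^ 2) - ∫ x, ψ x / ‖x‖ ^ 2 * ‖u (l • x)‖ ^ 2 := by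
      rw [e1, smul_eq_mul, ← integral_const_mul]
      have e3 : ∀ y : RSpace d, (l ^ d)⁻¹ * (ψ (l⁻¹ • y) / ‖l⁻¹ • y‖ ^ 2 * ‖u y‖ ^ 2)
          = l ^ (-((d : ℝ) - 2)) * (ψ (l⁻¹ • y) / ‖y‖ ^ 2 * ‖u y‖ ^ 2) := by
        intro y
        rw [hpow, norm_smul, norm_inv, Real.norm_of_nonneg hl0.le]
        field_simp
      simp only [e3]
      rw [← integral_sub hu2 hu3]
      congr 1; ext y; ring
    have e5 : ∀ x, (conj (u x) * (u x - u (l • x))).re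
        = 2⁻¹ * (‖u x‖ ^ 2 - ‖u (l • x)‖ ^ 2 + ‖u x - u (l • x)‖ ^ 2) := by
      intro x
      rw [← Complex.normSq_eq_norm_sq, ← Complex.normSq_eq_norm_sq, ← Complex.normSq_eq_norm_sq]
      simp only [Complex.normSq_apply, Complex.mul_re, Complex.sub_re, Complex.sub_im,
        Complex.conj_re, Complex.conj_im]
      ring
    have e4 : ∫ x, ψ x / ‖x‖ ^ 2 * (conj (u x) * (u x - u (l • x))).re
        = 2⁻¹ * ((∫ x, ψ x / ‖x‖ ^ 2 * ‖u x‖ ^ 2) - (∫ x, ψ x / ‖x‖ ^ 2 * ‖u (l • x)‖ ^ 2)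
          + ∫ x, ψ x / ‖x‖ ^ 2 * ‖u x - u (l • x)‖ ^ 2) := by
      have hs : Integrable (fun x => ψ x / ‖x‖ ^ 2 * ‖u x‖ ^ 2 - ψ x / ‖x‖ ^ 2 * ‖u (l • x)‖ ^ 2)
          volume := hu2.sub hul2
      rw [← integral_sub hu2 hul2, ← integral_add hs hd2, ← integral_const_mul]
      congr 1; ext x; rw [e5]; ring
    rw [e2, e4]; ring
  have h5 := (h2.const_mul 2).sub h3
  have h6 := tendsto_nhds_unique h1 (h5.congr' (by
    filter_upwards [hnear] with l hl
    rw [h4 l hl]; ring))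
  linarith

end RadialIdentity

/-! ### Radial functions, and the energy `|∂ᵣu + c u/|x||²`. -/

section Spheres

open Filter Topology

variable {d : ℕ}

/-- Constancy below `a` takes care of the origin, where the norm is not smooth. -/
theorem contDiff_radial {n : WithTop ℕ∞} {q : ℝ → ℝ} (hq : ContDiff ℝ n q) {a : ℝ} (ha : 0 < a)
    (hc : ∀ r < a, q r = q 0) : ContDiff ℝ n (fun x : RSpace d => q ‖x‖) := by
  rw [contDiff_iff_contDiffAt]
  intro x
  rcases eq_or_ne x 0 with rfl | hx
  · have : (fun x : RSpace d => q ‖x‖) =ᶠ[𝓝 0] fun _ => q 0 := by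
      filter_upwards [ball_mem_nhds (0 : RSpace d) ha] with y hy
      exact hc _ (by simpa using hy)
    exact contDiffAt_const.congr_of_eventuallyEq this
  · exact hq.contDiffAt.comp x (contDiffAt_norm ℝ hx)

theorem fderiv_radial {q : ℝ → ℝ} (hq : Differentiable ℝ q) {a : ℝ} (ha : 0 < a)
    (hc : ∀ r < a, q r = q 0) (x v : RSpace d) :
    fderiv ℝ (fun x : RSpace d => q ‖x‖) x v = deriv q ‖x‖ * (inner ℝ x v / ‖x‖) := by
  rcases eq_or_ne x 0 with rfl | hx
  · have : (fun x : RSpace d => q ‖x‖) =ᶠ[𝓝 0] fun _ => q 0 := by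
      filter_upwards [ball_mem_nhds (0 : RSpace d) ha] with y hy
      exact hc _ (by simpa using hy)
    rw [this.fderiv_eq]; simp
  · have h1 : HasFDerivAt (fun x : RSpace d => ‖x‖ ^ 2) (2 • innerSL ℝ x) x :=
      (hasStrictFDerivAt_norm_sq x).hasFDerivAt
    have hx0 : 0 < ‖x‖ := norm_pos_iff.2 hx
    have h2 := h1.sqrt (by positivity)
    simp only [Real.sqrt_sq (norm_nonneg _)] at h2
    have h3 := (hq ‖x‖).hasDerivAt.comp_hasFDerivAt x h2
    have h4 : fderiv ℝ (fun x : RSpace d => q ‖x‖) x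
        = deriv q ‖x‖ • (1 / (2 * ‖x‖)) • 2 • innerSL ℝ x := h3.fderiv
    rw [h4]
    simp only [one_div, smul_apply, coe_innerSL_apply, smul_eq_mul,
      nsmul_eq_mul]
    field_simp
    push_cast
    ring

theorem fderiv_radial_self {q : ℝ → ℝ} (hq : Differentiable ℝ q) {a : ℝ} (ha : 0 < a)
    (hc : ∀ r < a, q r = q 0) (x : RSpace d) :
    fderiv ℝ (fun x : RSpace d => q ‖x‖) x x = deriv q ‖x‖ * ‖x‖ := by
  rw [fderiv_radial hq ha hc, real_inner_self_eq_norm_sq]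
  rcases eq_or_ne x 0 with rfl | hx
  · simp
  have hx0 : 0 < ‖x‖ := norm_pos_iff.2 hx
  field_simp

/-- The squared modulus of `∂ᵣu + c u / |x|`. -/
noncomputable def radialEnergy (c : ℝ) (u : RSpace d → ℂ) (G : RSpace d → CSpace d)
    (x : RSpace d) : ℝ :=
  ‖euler G x + (c : ℂ) * u x‖ ^ 2 / ‖x‖ ^ 2

theorem radialEnergy_nonneg (c : ℝ) (u : RSpace d → ℂ) (G : RSpace d → CSpace d) (x : RSpace d) :
    0 ≤ radialEnergy c u G x := by
  unfold radialEnergy; positivity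

theorem norm_add_ofReal_mul_sq (z w : ℂ) (c : ℝ) :
    ‖z + (c : ℂ) * w‖ ^ 2 = ‖z‖ ^ 2 + 2 * c * (conj w * z).re + c ^ 2 * ‖w‖ ^ 2 := by
  rw [← Complex.normSq_eq_norm_sq, ← Complex.normSq_eq_norm_sq, ← Complex.normSq_eq_norm_sq]
  simp only [Complex.normSq_apply, Complex.add_re, Complex.add_im, Complex.mul_re, Complex.mul_im,
    Complex.conj_re, Complex.conj_im, Complex.ofReal_re, Complex.ofReal_im]
  ring

theorem radialEnergy_eq (c : ℝ) (u : RSpace d → ℂ) (G : RSpace d → CSpace d) (x : RSpace d) :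
    radialEnergy c u G x = ‖euler G x‖ ^ 2 / ‖x‖ ^ 2
      + 2 * c * ((conj (u x) * euler G x).re / ‖x‖ ^ 2) + c ^ 2 * (‖u x‖ ^ 2 / ‖x‖ ^ 2) := by
  unfold radialEnergy
  rw [norm_add_ofReal_mul_sq]; ring

theorem norm_euler_sq_div_le (G : RSpace d → CSpace d) (x : RSpace d) :
    ‖euler G x‖ ^ 2 / ‖x‖ ^ 2 ≤ ‖G x‖ ^ 2 := by
  rcases eq_or_ne x 0 with rfl | hx
  · simp
  have hx0 : 0 < ‖x‖ := norm_pos_iff.2 hx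
  rw [div_le_iff₀ (by positivity), ← mul_pow, mul_comm]
  gcongr
  exact norm_euler_le G x

theorem measurable_radialEnergy (c : ℝ) {u : RSpace d → ℂ} {G : RSpace d → CSpace d}
    (hu : Measurable u) (hG : Measurable G) : Measurable (radialEnergy c u G) := by
  have := measurable_euler hG
  unfold radialEnergy
  fun_prop

theorem radialEnergy_le (c : ℝ) (u : RSpace d → ℂ) (G : RSpace d → CSpace d) (x : RSpace d) :
    radialEnergy c u G x ≤ 2 * ‖G x‖ ^ 2 + 2 * c ^ 2 * (‖u x‖ ^ 2 / ‖x‖ ^ 2) := by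
  have h1 := norm_euler_sq_div_le G x
  have h2 : ‖euler G x + (c : ℂ) * u x‖ ^ 2 ≤ 2 * ‖euler G x‖ ^ 2 + 2 * c ^ 2 * ‖u x‖ ^ 2 := by
    have h3 := norm_add_le (euler G x) ((c : ℂ) * u x)
    rw [norm_mul, Complex.norm_real, Real.norm_eq_abs] at h3
    calc _ ≤ (‖euler G x‖ + |c| * ‖u x‖) ^ 2 := by gcongr
      _ ≤ 2 * ‖euler G x‖ ^ 2 + 2 * (|c| * ‖u x‖) ^ 2 := by
        nlinarith [sq_nonneg (‖euler G x‖ - |c| * ‖u x‖)]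
      _ = _ := by rw [mul_pow, sq_abs]; ring
  unfold radialEnergy
  calc _ ≤ (2 * ‖euler G x‖ ^ 2 + 2 * c ^ 2 * ‖u x‖ ^ 2) / ‖x‖ ^ 2 := by gcongr
    _ = 2 * (‖euler G x‖ ^ 2 / ‖x‖ ^ 2) + 2 * c ^ 2 * (‖u x‖ ^ 2 / ‖x‖ ^ 2) := by ring
    _ ≤ _ := by gcongr

theorem IsH1.integrable_radialEnergy {u : RSpace d → ℂ} {G : RSpace d → CSpace d} (h : IsH1 u G)
    (hd : 3 ≤ d) (c : ℝ) : Integrable (radialEnergy c u G) volume := by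
  refine ((h.integrable_grad_sq.const_mul 2).add
    ((h.integrable_sq_div hd).const_mul (2 * c ^ 2))).mono'
    (measurable_radialEnergy c h.measurable h.measurable_grad).aestronglyMeasurable
    (Eventually.of_forall fun x => ?_)
  rw [Real.norm_of_nonneg (radialEnergy_nonneg _ _ _ _)]
  exact radialEnergy_le c u G x

/-- The one-dimensional identity `∫ q |v'|² = ∫ q |v' - v/r|² + ∫ (-q'/r) |v|²` for
`v = r^((d-1)/2) u`, integrated over the sphere. -/
theorem IsH1.integral_radialEnergy {u : RSpace d → ℂ} {G : RSpace d → CSpace d} (h : IsH1 u G)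
    (hd : 3 ≤ d) {q : ℝ → ℝ} (hq : ContDiff ℝ 1 q) {a : ℝ} (ha : 0 < a)
    (hc : ∀ r < a, q r = q 0) {C : ℝ} (hC : ∀ r, |q r| ≤ C) (hE : ∀ r, |deriv q r * r| ≤ C) :
    ∫ x, q ‖x‖ * radialEnergy ((d - 1) / 2) u G x
      = (∫ x, q ‖x‖ * radialEnergy ((d - 1) / 2 - 1) u G x)
        + ∫ x, -(deriv q ‖x‖ * ‖x‖) * (‖u x‖ ^ 2 / ‖x‖ ^ 2) := by
  have hqd := hq.differentiable (by simp)
  have hψ := contDiff_radial (d := d) hq ha hc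
  have hB := h.integral_radial hd hψ (fun x => hC ‖x‖)
    (fun x => by rw [fderiv_radial_self hqd ha hc]; exact hE _)
  simp only [fderiv_radial_self hqd ha hc] at hB
  have hm : AEStronglyMeasurable (fun x : RSpace d => q ‖x‖) volume :=
    hψ.continuous.aestronglyMeasurable
  have hm' : AEStronglyMeasurable (fun x : RSpace d => deriv q ‖x‖ * ‖x‖) volume := by
    have := hq.continuous_deriv (by simp)
    exact (Continuous.mul (this.comp continuous_norm) continuous_norm).aestronglyMeasurable
  have i1 := (h.integrable_radialEnergy hd ((d - 1) / 2)).bdd_mul hm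
    (Eventually.of_forall fun x => hC ‖x‖)
  have i2 := (h.integrable_radialEnergy hd ((d - 1) / 2 - 1)).bdd_mul hm
    (Eventually.of_forall fun x => hC ‖x‖)
  have i3 := (h.integrable_sq_div hd).bdd_mul hm' (Eventually.of_forall fun x => hE ‖x‖)
  have i4 := h.integrable_mul_re_euler hd hψ.continuous.measurable (fun x => hC ‖x‖)
  have i5 := (h.integrable_sq_div hd).bdd_mul hm (Eventually.of_forall fun x => hC ‖x‖)
  have e1 : ∫ x, ‖u x‖ ^ 2 / ‖x‖ ^ 2 * (((d : ℝ) - 2) * q ‖x‖ + deriv q ‖x‖ * ‖x‖)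
      = (d - 2) * (∫ x, q ‖x‖ * (‖u x‖ ^ 2 / ‖x‖ ^ 2))
        + ∫ x, deriv q ‖x‖ * ‖x‖ * (‖u x‖ ^ 2 / ‖x‖ ^ 2) := by
    rw [← integral_const_mul, ← integral_add (i5.const_mul _) i3]
    congr 1; ext x; ring
  -- Lowering `c` by `1` changes the energy by twice the cross term plus `c² - (c-1)² = 2c - 1 = d -
  -- 2` times `|u|²/|x|²`. This is the combination evaluated by `IsH1.integral_radial`.
  have e2 : (∫ x, q ‖x‖ * radialEnergy ((d - 1) / 2) u G x)
      - (∫ x, q ‖x‖ * radialEnergy ((d - 1) / 2 - 1) u G x)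
      = 2 * (∫ x, q ‖x‖ / ‖x‖ ^ 2 * (conj (u x) * euler G x).re)
        + (d - 2) * ∫ x, q ‖x‖ * (‖u x‖ ^ 2 / ‖x‖ ^ 2) := by
    rw [← integral_sub i1 i2, ← integral_const_mul, ← integral_const_mul,
      ← integral_add (i4.const_mul _) (i5.const_mul _)]
    congr 1; ext x
    rw [radialEnergy_eq, radialEnergy_eq]; ring
  have e3 : ∫ x, -(deriv q ‖x‖ * ‖x‖) * (‖u x‖ ^ 2 / ‖x‖ ^ 2)
      = - ∫ x, deriv q ‖x‖ * ‖x‖ * (‖u x‖ ^ 2 / ‖x‖ ^ 2) := by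
    rw [← integral_neg]; congr 1; ext x; ring
  rw [e1] at hB
  rw [e3]
  linarith

/-- `∫_{B_R} |u|²/|x|² ≤ 4 ∫_{B_{2R}} |∂ᵣu + (d-1)u/(2|x|)|²`. -/
theorem IsH1.setIntegral_sq_div_le {u : RSpace d → ℂ} {G : RSpace d → CSpace d} (h : IsH1 u G)
    (hd : 3 ≤ d) {R : ℝ} (hR : 0 < R) :
    ∫ x in ball (0 : RSpace d) R, ‖u x‖ ^ 2 / ‖x‖ ^ 2
      ≤ 4 * ∫ x in ball (0 : RSpace d) (2 * R), radialEnergy ((d - 1) / 2) u G x := by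
  set q : ℝ → ℝ := fun r => 1 - Real.smoothTransition (R⁻¹ * r - 1) with hqdef
  have hst : ContDiff ℝ 1 Real.smoothTransition := Real.smoothTransition.contDiff (n := 1)
  have hq : ContDiff ℝ 1 q := by
    refine contDiff_const.sub (hst.comp ?_)
    fun_prop
  have hq0 : ∀ r, 0 ≤ q r := fun r => sub_nonneg.2 (Real.smoothTransition.le_one _)
  have hq1 : ∀ r, q r ≤ 1 := fun r => sub_le_self _ (Real.smoothTransition.nonneg _)
  have hqone : ∀ r ≤ R, q r = 1 := by
    intro r hr
    have : R⁻¹ * r - 1 ≤ 0 := by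
      rw [sub_nonpos, inv_mul_le_iff₀ hR]; linarith
    simp [hqdef, Real.smoothTransition.zero_of_nonpos this]
  have hqzero : ∀ r, 2 * R ≤ r → q r = 0 := by
    intro r hr
    have : 1 ≤ R⁻¹ * r - 1 := by
      rw [le_sub_iff_add_le, le_inv_mul_iff₀ hR]; linarith
    simp [hqdef, Real.smoothTransition.one_of_one_le this]
  have hanti : Antitone q := by
    intro r s hrs
    have h1 : R⁻¹ * r - 1 ≤ R⁻¹ * s - 1 := by gcongr
    exact sub_le_sub_left (Real.smoothTransition.monotone h1) _
  have hder0 : ∀ r, deriv q r ≤ 0 := fun r => hanti.deriv_nonpos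
  have hdz : ∀ r, r ∉ Icc R (2 * R) → deriv q r = 0 := by
    intro r hr
    simp only [mem_Icc, not_and_or, not_le] at hr
    rcases hr with hr | hr
    · have : q =ᶠ[𝓝 r] fun _ => 1 := by
        filter_upwards [Iio_mem_nhds hr] with s hs using hqone s (le_of_lt hs)
      rw [this.deriv_eq]; simp
    · have : q =ᶠ[𝓝 r] fun _ => 0 := by
        filter_upwards [Ioi_mem_nhds hr] with s hs using hqzero s (le_of_lt hs)
      rw [this.deriv_eq]; simp
  have hcs : HasCompactSupport fun r => deriv q r * r :=
    HasCompactSupport.intro (isCompact_Icc (a := R) (b := 2 * R)) fun r hr => by simp [hdz r hr]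
  obtain ⟨C, hC⟩ := ((hq.continuous_deriv (by simp)).mul continuous_id).bounded_above_of_compact_support hcs
  have hmain := h.integral_radialEnergy hd hq hR
    (fun r hr => by rw [hqone r hr.le, hqone 0 hR.le]) (C := max C 1)
    (fun r => by rw [abs_of_nonneg (hq0 r)]; exact (hq1 r).trans (le_max_right _ _))
    (fun r => (hC r).trans (le_max_left _ _))
  have hψm : AEStronglyMeasurable (fun x : RSpace d => q ‖x‖) volume :=
    (hq.continuous.comp continuous_norm).aestronglyMeasurable
  have hb : ∀ x : RSpace d, ‖q ‖x‖‖ ≤ 1 := fun x => by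
    rw [Real.norm_of_nonneg (hq0 _)]; exact hq1 _
  have i1 := (h.integrable_radialEnergy hd ((d - 1) / 2)).bdd_mul hψm (Eventually.of_forall hb)
  have i2 := (h.integrable_radialEnergy hd ((d - 1) / 2 - 1)).bdd_mul hψm (Eventually.of_forall hb)
  -- As `q` decreases, the energy with constant `(d-1)/2 - 1` is dominated by the one with
  -- `(d-1)/2`.
  have hlast : 0 ≤ ∫ x, -(deriv q ‖x‖ * ‖x‖) * (‖u x‖ ^ 2 / ‖x‖ ^ 2) := by
    refine integral_nonneg fun x => mul_nonneg ?_ (by positivity)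
    have := mul_nonneg (neg_nonneg.2 (hder0 ‖x‖)) (norm_nonneg x)
    linarith
  have h1 : ∫ x in ball (0 : RSpace d) R, ‖u x‖ ^ 2 / ‖x‖ ^ 2
      ≤ ∫ x, (2 * (q ‖x‖ * radialEnergy ((d - 1) / 2) u G x)
        + 2 * (q ‖x‖ * radialEnergy ((d - 1) / 2 - 1) u G x)) := by
    rw [← integral_indicator measurableSet_ball]
    refine integral_mono ((h.integrable_sq_div hd).indicator measurableSet_ball)
      ((i1.const_mul 2).add (i2.const_mul 2)) fun x => ?_
    have hn : ∀ c, 0 ≤ q ‖x‖ * radialEnergy c u G x :=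
      fun c => mul_nonneg (hq0 _) (radialEnergy_nonneg _ _ _ _)
    by_cases hx : x ∈ ball (0 : RSpace d) R
    · simp only [indicator_of_mem hx]
      rw [hqone ‖x‖ (by simpa using (mem_ball_zero_iff.1 hx).le), radialEnergy_eq, radialEnergy_eq]
      set A := ‖euler G x‖ ^ 2 / ‖x‖ ^ 2
      -- Parallelogram law about the midpoint: the energies for `c` and `c - 1` sum to twice the
      -- energy for `c - 1/2` plus `|u|²/(2|x|²)`. Hence the factor `2` in `h1`, and `4` in the
      -- conclusion.
      have e := radialEnergy_eq ((d - 1) / 2 - 1 / 2) u G x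
      have hnn := radialEnergy_nonneg (((d : ℝ) - 1) / 2 - 1 / 2) u G x
      nlinarith
    · simp only [indicator_of_notMem hx]
      have := hn ((d - 1) / 2)
      have := hn ((d - 1) / 2 - 1)
      positivity
  rw [integral_add (i1.const_mul 2) (i2.const_mul 2), integral_const_mul, integral_const_mul] at h1
  have h2 : ∫ x, q ‖x‖ * radialEnergy ((d - 1) / 2) u G x
      ≤ ∫ x in ball (0 : RSpace d) (2 * R), radialEnergy ((d - 1) / 2) u G x := by
    rw [← integral_indicator measurableSet_ball]
    refine integral_mono i1 ((h.integrable_radialEnergy hd _).indicator measurableSet_ball)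
      fun x => ?_
    by_cases hx : x ∈ ball (0 : RSpace d) (2 * R)
    · simp only [indicator_of_mem hx]
      exact mul_le_of_le_one_left (radialEnergy_nonneg _ _ _ _) (hq1 _)
    · simp only [indicator_of_notMem hx]
      rw [hqzero ‖x‖ (by simpa using hx), zero_mul]
  linarith

end Spheres

/-! ### A trace inequality: the mass of `|u|²` on spheres. -/

section SphereMeasure

open Filter Topology

variable {d : ℕ}

/-- The energy identity with `-q' = t z(t)`, after dropping the nonnegative energy on its right,
bounds `∫ z|u|²` by `∫ q D`. Since `q` is an integral of indicators of balls, the growth of `∫_{B_t}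
D` finishes the argument. The bound is available only for `t ≥ δ`, whence `max t δ`. -/
theorem IsH1.lintegral_radial_continuous_le {u : RSpace d → ℂ} {G : RSpace d → CSpace d}
    (h : IsH1 u G) (hd : 3 ≤ d) {M δ : ℝ}
    (hM : ∀ R, δ ≤ R → 0 < R → ∫ x in ball (0 : RSpace d) R, radialEnergy ((d - 1) / 2) u G x ≤ M * R)
    {z : ℝ → ℝ} (hz : Continuous z) (hzc : HasCompactSupport z) (hz0 : ∀ t, 0 ≤ z t) {a : ℝ}
    (ha : 0 < a) (hza : ∀ t ≤ a, z t = 0) :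
    ∫⁻ x, ENNReal.ofReal (z ‖x‖ * ‖u x‖ ^ 2)
      ≤ ∫⁻ t in Ioi (0 : ℝ), ENNReal.ofReal (z t) * ENNReal.ofReal (M * t * max t δ) := by
  set D := radialEnergy ((d - 1) / 2) u G with hD
  have hDm : Measurable D := measurable_radialEnergy _ h.measurable h.measurable_grad
  have hD0 : ∀ x, 0 ≤ D x := radialEnergy_nonneg _ _ _
  have hDi : Integrable D volume := h.integrable_radialEnergy hd _
  have hzt : Continuous fun t => z t * t := hz.mul continuous_id
  have hztc : HasCompactSupport fun t => z t * t := hzc.mul_right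
  have hzi : Integrable (fun t => z t * t) volume := hzt.integrable_of_hasCompactSupport hztc
  have hztn : ∀ t, 0 ≤ z t * t := by
    intro t
    rcases le_or_gt t a with ht | ht
    · simp [hza t ht]
    · exact mul_nonneg (hz0 t) (ha.trans ht).le
  set I := ∫ t in Ioi (0 : ℝ), z t * t with hI
  -- On `r ≥ 0` this is the tail integral `∫_r^∞ t z(t) dt`. The present form is defined and `C¹` on
  -- the whole line and constant below `a`.
  set q : ℝ → ℝ := fun r => I - ∫ t in (0 : ℝ)..r, z t * t with hq
  have hqd : ∀ r, HasDerivAt q (-(z r * r)) r := by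
    intro r
    have := (hzt.integral_hasStrictDerivAt 0 r).hasDerivAt
    simpa using this.const_sub I
  have hqderiv : deriv q = fun r => -(z r * r) := funext fun r => (hqd r).deriv
  have hq1 : ContDiff ℝ 1 q := by
    rw [contDiff_one_iff_deriv]
    refine ⟨fun r => (hqd r).differentiableAt, ?_⟩
    rw [hqderiv]; exact hzt.neg
  have hq0 : q 0 = I := by simp [hq]
  have hqa : ∀ r < a, q r = q 0 := by
    intro r hr
    rw [hq0]
    have : ∫ t in (0 : ℝ)..r, z t * t = 0 := by
      rw [intervalIntegral.integral_congr (g := fun _ => (0 : ℝ))]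
      · simp
      · intro t ht
        have : t ≤ a := by
          rcases le_total 0 r with h0 | h0
          · rw [uIcc_of_le h0] at ht; exact ht.2.trans hr.le
          · rw [uIcc_of_ge h0] at ht; exact ht.2.trans ha.le
        simp [hza t this]
    simp [hq, this]
  have hqtail : ∀ r, 0 ≤ r → q r = ∫ t in Ioi r, z t * t := by
    intro r hr
    have h1 := intervalIntegral.integral_interval_add_Ioi (μ := volume) (a := 0) (b := r)
      hzi.integrableOn hzi.integrableOn
    simp only [hq, hI]
    linarith
  have hI0 : 0 ≤ I := setIntegral_nonneg measurableSet_Ioi fun t _ => hztn t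
  have hqb : ∀ r, |q r| ≤ I := by
    intro r
    rcases le_or_gt 0 r with hr | hr
    · rw [hqtail r hr, abs_of_nonneg (setIntegral_nonneg measurableSet_Ioi fun t _ => hztn t)]
      exact setIntegral_mono_set hzi.integrableOn
        (Eventually.of_forall fun t => hztn t) (Ioi_subset_Ioi hr).eventuallyLE
    · rw [hqa r (hr.trans ha), hq0, abs_of_nonneg hI0]
  have hcs : HasCompactSupport fun r => deriv q r * r := by
    rw [hqderiv]; exact hztc.neg.mul_right
  obtain ⟨C, hC⟩ := ((hq1.continuous_deriv (by simp)).mul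
    continuous_id).bounded_above_of_compact_support hcs
  have hmain := h.integral_radialEnergy hd hq1 ha hqa (C := max C I)
    (fun r => (hqb r).trans (le_max_right _ _)) (fun r => (hC r).trans (le_max_left _ _))
  have hqn : ∀ r, 0 ≤ r → 0 ≤ q r := fun r hr => by
    rw [hqtail r hr]; exact setIntegral_nonneg measurableSet_Ioi fun t _ => hztn t
  have hnn : 0 ≤ ∫ x, q ‖x‖ * radialEnergy ((d - 1) / 2 - 1) u G x :=
    integral_nonneg fun x => mul_nonneg (hqn _ (norm_nonneg x)) (radialEnergy_nonneg _ _ _ _)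
  have e1 : ∀ x : RSpace d, -(deriv q ‖x‖ * ‖x‖) * (‖u x‖ ^ 2 / ‖x‖ ^ 2) = z ‖x‖ * ‖u x‖ ^ 2 := by
    intro x
    rw [hqderiv]
    rcases eq_or_ne x 0 with rfl | hx
    · simp [hza 0 ha.le]
    have : 0 < ‖x‖ := norm_pos_iff.2 hx
    field_simp
  simp only [e1] at hmain
  obtain ⟨B, hB⟩ := hz.bounded_above_of_compact_support hzc
  have i1 : Integrable (fun x : RSpace d => z ‖x‖ * ‖u x‖ ^ 2) volume :=
    h.integrable_sq.bdd_mul (hz.comp continuous_norm).aestronglyMeasurable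
      (Eventually.of_forall fun x => hB ‖x‖)
  have i2 : Integrable (fun x : RSpace d => q ‖x‖ * D x) volume :=
    hDi.bdd_mul (hq1.continuous.comp continuous_norm).aestronglyMeasurable
      (Eventually.of_forall fun x => hqb ‖x‖)
  have h1 : ∫⁻ x, ENNReal.ofReal (z ‖x‖ * ‖u x‖ ^ 2) ≤ ∫⁻ x, ENNReal.ofReal (q ‖x‖ * D x) := by
    rw [← ofReal_integral_eq_lintegral_ofReal i1
      (Eventually.of_forall fun x => mul_nonneg (hz0 _) (by positivity)),
      ← ofReal_integral_eq_lintegral_ofReal i2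
      (Eventually.of_forall fun x => mul_nonneg (hqn _ (norm_nonneg x)) (hD0 x))]
    apply ENNReal.ofReal_le_ofReal
    linarith
  refine h1.trans ?_
  -- Layer-cake formula: `q(|x|)` is the integral of `t z(t)` over those `t` for which `x` lies in
  -- `B_t`.
  have e2 : ∀ x : RSpace d, ENNReal.ofReal (q ‖x‖ * D x)
      = ∫⁻ t in Ioi (0 : ℝ), ENNReal.ofReal (z t * t) *
        (ball (0 : RSpace d) t).indicator (fun y => ENNReal.ofReal (D y)) x := by
    intro x
    rw [ENNReal.ofReal_mul (hqn _ (norm_nonneg x)), hqtail _ (norm_nonneg x),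
      ofReal_integral_eq_lintegral_ofReal hzi.integrableOn (Eventually.of_forall hztn),
      ← lintegral_mul_const _ (by fun_prop)]
    rw [← lintegral_indicator measurableSet_Ioi, ← lintegral_indicator measurableSet_Ioi]
    congr 1; ext t
    by_cases ht : t ∈ Ioi ‖x‖
    · have ht0 : t ∈ Ioi (0 : ℝ) := (norm_nonneg x).trans_lt ht
      rw [indicator_of_mem ht, indicator_of_mem ht0, indicator_of_mem (by simpa using ht)]
    · rw [indicator_of_notMem ht]
      by_cases ht0 : t ∈ Ioi (0 : ℝ)
      · rw [indicator_of_mem ht0, indicator_of_notMem (by simpa using ht), mul_zero]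
      · rw [indicator_of_notMem ht0]
  simp only [e2]
  have hmeas : Measurable fun p : RSpace d × ℝ => ENNReal.ofReal (z p.2 * p.2) *
      (ball (0 : RSpace d) p.2).indicator (fun y => ENNReal.ofReal (D y)) p.1 := by
    refine Measurable.mul (by fun_prop) ?_
    have hS : MeasurableSet {p : RSpace d × ℝ | ‖p.1‖ < p.2} :=
      measurableSet_lt (by fun_prop) (by fun_prop)
    have : (fun p : RSpace d × ℝ => (ball (0 : RSpace d) p.2).indicator
        (fun y => ENNReal.ofReal (D y)) p.1)
        = {p : RSpace d × ℝ | ‖p.1‖ < p.2}.indicator (fun p => ENNReal.ofReal (D p.1)) := by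
      ext p
      simp [indicator]
    rw [this]
    exact (by fun_prop : Measurable fun p : RSpace d × ℝ => ENNReal.ofReal (D p.1)).indicator hS
  rw [lintegral_lintegral_swap hmeas.aemeasurable]
  refine setLIntegral_mono' measurableSet_Ioi fun t ht => ?_
  have ht0 : 0 < t := ht
  rw [lintegral_const_mul' _ _ ENNReal.ofReal_ne_top, lintegral_indicator measurableSet_ball,
    ← ofReal_integral_eq_lintegral_ofReal hDi.integrableOn (Eventually.of_forall hD0),
    ENNReal.ofReal_mul (hz0 t), mul_assoc, ← ENNReal.ofReal_mul ht0.le]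
  gcongr ENNReal.ofReal _ * ENNReal.ofReal ?_
  have h2 : ∫ x in ball (0 : RSpace d) t, D x ≤ ∫ x in ball (0 : RSpace d) (max t δ), D x :=
    setIntegral_mono_set hDi.integrableOn (Eventually.of_forall hD0)
      (ball_subset_ball (le_max_left _ _)).eventuallyLE
  have h3 := hM (max t δ) (le_max_right _ _) (lt_max_of_lt_left ht0)
  calc t * ∫ x in ball (0 : RSpace d) t, D x ≤ t * (M * max t δ) := by gcongr; exact h2.trans h3
    _ = M * t * max t δ := by ring

/-- Spheres carry at most the mass `M t max(t, δ)` of `|u|²`. -/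
theorem IsH1.lintegral_radial_le {u : RSpace d → ℂ} {G : RSpace d → CSpace d}
    (h : IsH1 u G) (hd : 3 ≤ d) {M δ : ℝ}
    (hM : ∀ R, δ ≤ R → 0 < R → ∫ x in ball (0 : RSpace d) R, radialEnergy ((d - 1) / 2) u G x ≤ M * R)
    {w : ℝ → ℝ≥0∞} (hw : AEMeasurable w (volume.restrict (Ioi 0))) :
    ∫⁻ x, w ‖x‖ * ENNReal.ofReal (‖u x‖ ^ 2)
      ≤ ∫⁻ t in Ioi (0 : ℝ), w t * ENNReal.ofReal (M * t * max t δ) := by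
  have hd0 : 0 < d := by omega
  have : Nonempty (Fin d) := ⟨⟨0, hd0⟩⟩
  have hum := h.measurable
  set ρ : Measure (RSpace d) := volume.withDensity fun x => ENNReal.ofReal (‖u x‖ ^ 2) with hρ
  have hρm : Measurable fun x => ENNReal.ofReal (‖u x‖ ^ 2) := by fun_prop
  set μ : Measure ℝ := ρ.map norm with hμ
  set κ : ℝ → ℝ≥0∞ := fun t => ENNReal.ofReal (M * t * max t δ) with hκ
  have hκc : Continuous fun t : ℝ => M * t * max t δ := by fun_prop
  have hκm : Measurable κ := by fun_prop
  set ν : Measure ℝ := (volume.restrict (Ioi 0)).withDensity κ with hν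
  have hρfin : IsFiniteMeasure ρ := isFiniteMeasure_withDensity_ofReal h.integrable_sq.2
  have hμfin : IsFiniteMeasure μ := Measure.isFiniteMeasure_map ρ norm
  have hνfin : IsLocallyFiniteMeasure ν := IsLocallyFiniteMeasure.withDensity_ofReal hκc
  have hnm : Measurable (norm : RSpace d → ℝ) := measurable_norm
  have hμ0 : μ (Iic 0) = 0 := by
    rw [hμ, Measure.map_apply hnm measurableSet_Iic]
    have : norm ⁻¹' Iic (0 : ℝ) = ({0} : Set (RSpace d)) := by
      ext x; simp
    rw [this]
    exact (withDensity_absolutelyContinuous _ _) (by simp)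
  -- Comparison of measures on the half-line. Inner regularity of the finite measure `μ` reduces it
  -- to compact sets, outer regularity of `ν` gives a slightly larger open set, and a continuous
  -- bump between the two is covered by the preceding lemma.
  have hle : μ ≤ ν := by
    refine Measure.le_iff.2 fun A hA => ?_
    have hA' : μ A ≤ μ (A ∩ Ioi 0) := by
      calc μ A ≤ μ (A ∩ Ioi 0 ∪ Iic 0) := measure_mono fun t ht => by
            rcases le_or_gt t 0 with h0 | h0
            · exact Or.inr h0
            · exact Or.inl ⟨ht, h0⟩
        _ ≤ μ (A ∩ Ioi 0) + μ (Iic 0) := measure_union_le _ _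
        _ = _ := by rw [hμ0, add_zero]
    refine hA'.trans (le_trans ?_ (measure_mono inter_subset_left : ν (A ∩ Ioi 0) ≤ ν A))
    rw [(hA.inter measurableSet_Ioi).measure_eq_iSup_isCompact_of_ne_top (measure_ne_top _ _)]
    refine iSup₂_le fun K hKA => iSup_le fun hK => ?_
    refine le_trans ?_ (measure_mono hKA : ν K ≤ _)
    refine le_of_forall_gt fun b hb => ?_
    obtain ⟨U, hKU, hU, hUb⟩ := K.exists_isOpen_lt_of_lt b hb
    refine lt_of_le_of_lt ?_ hUb
    rcases K.eq_empty_or_nonempty with rfl | hKne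
    · simp
    obtain ⟨a, ha, hKa⟩ : ∃ a : ℝ, 0 < a ∧ K ⊆ Ioi a := by
      obtain ⟨m, hmK, hm⟩ := hK.exists_isLeast hKne
      have hm0 : 0 < m := (hKA hmK).2
      -- Half the least element of `K`: the bump must vanish near `0` for the continuous case to
      -- apply.
      exact ⟨m / 2, by positivity, fun t ht => by
        have := hm ht
        simp only [mem_Ioi]; linarith⟩
    obtain ⟨f, hf1, hf0, hfc, hf01⟩ := exists_continuous_one_zero_of_isCompact hK
      (hU.inter isOpen_Ioi).isClosed_compl (t := (U ∩ Ioi a)ᶜ)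
      (disjoint_compl_right_iff_subset.2 (subset_inter hKU hKa))
    have h1 := h.lintegral_radial_continuous_le hd hM f.continuous hfc (fun t => (hf01 t).1) ha
      (fun t ht => hf0 (fun h' => absurd h'.2 (not_lt.2 ht)))
    calc μ K = ∫⁻ t, K.indicator 1 t ∂μ := by rw [lintegral_indicator_one hK.measurableSet]
      _ = ∫⁻ x, K.indicator 1 ‖x‖ ∂ρ := by
          rw [hμ, lintegral_map (measurable_one.indicator hK.measurableSet) hnm]
      _ = ∫⁻ x, ENNReal.ofReal (‖u x‖ ^ 2) * K.indicator 1 ‖x‖ := by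
          have hKm : Measurable fun x : RSpace d => K.indicator (1 : ℝ → ℝ≥0∞) ‖x‖ :=
            (measurable_one.indicator hK.measurableSet).comp hnm
          rw [hρ, lintegral_withDensity_eq_lintegral_mul _ hρm hKm]
          rfl
      _ ≤ ∫⁻ x, ENNReal.ofReal (f ‖x‖ * ‖u x‖ ^ 2) := by
          refine lintegral_mono fun x => ?_
          by_cases hx : ‖x‖ ∈ K
          · rw [indicator_of_mem hx, hf1 hx]; simp
          · rw [indicator_of_notMem hx]; simp
      _ ≤ _ := h1
      _ = ∫⁻ t, ENNReal.ofReal (f t) ∂ν := by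
          rw [hν, lintegral_withDensity_eq_lintegral_mul _ hκm (by fun_prop)]
          congr 1; ext t; simp [hκ, mul_comm]
      _ ≤ ∫⁻ t, U.indicator 1 t ∂ν := by
          refine lintegral_mono fun t => ?_
          by_cases ht : t ∈ U
          · rw [indicator_of_mem ht]
            simpa using (hf01 t).2
          · rw [hf0 (fun h' => ht h'.1)]; simp
      _ = ν U := lintegral_indicator_one hU.measurableSet
  have hνac : ν ≪ volume.restrict (Ioi 0) := withDensity_absolutelyContinuous _ _
  have hwν : AEMeasurable w ν := hw.mono_ac hνac
  have hwμ : AEMeasurable w μ := hwν.mono_measure hle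
  calc ∫⁻ x, w ‖x‖ * ENNReal.ofReal (‖u x‖ ^ 2) = ∫⁻ x, w ‖x‖ ∂ρ := by
        have hwρ : AEMeasurable (fun x => w ‖x‖) ρ := hwμ.comp_measurable hnm
        rw [hρ, lintegral_withDensity_eq_lintegral_mul₀' hρm.aemeasurable hwρ]
        congr 1; ext x; simp [mul_comm]
    _ = ∫⁻ t, w t ∂μ := by rw [hμ, lintegral_map' hwμ hnm.aemeasurable]
    _ ≤ ∫⁻ t, w t ∂ν := lintegral_mono' hle le_rfl
    _ = _ := by
        rw [hν, lintegral_withDensity_eq_lintegral_mul₀' hκm.aemeasurable hwν]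
        congr 1; ext t; simp [hκ, mul_comm]

end SphereMeasure

/-! ### The duality between `X` and `X*` on dyadic shells. -/

section Duality

open Filter Topology

variable {d : ℕ}

theorem measurableSet_dyadicShell (j : ℤ) : MeasurableSet (dyadicShell d j) :=
  (measurableSet_lt measurable_const measurable_norm).inter
    (measurableSet_le measurable_norm measurable_const)

theorem iUnion_dyadicShell : ⋃ j : ℤ, dyadicShell d j = {x | x ≠ 0} := by
  ext x
  simp only [mem_iUnion, dyadicShell, mem_ofPred_eq]
  constructor
  · rintro ⟨j, h1, -⟩ rfl
    rw [norm_zero] at h1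
    exact absurd h1 (not_lt.2 (by positivity))
  · intro hx
    obtain ⟨j, hj⟩ := exists_mem_Ioc_zpow (norm_pos_iff.2 hx) (one_lt_two : (1 : ℝ) < 2)
    exact ⟨j, hj.1, hj.2⟩

theorem pairwise_disjoint_dyadicShell : Pairwise (Function.onFun Disjoint (dyadicShell d)) := by
  intro i j hij
  wlog h : i < j generalizing i j
  · exact (this hij.symm (lt_of_le_of_ne (not_lt.1 h) hij.symm)).symm
  rw [Function.onFun, Set.disjoint_left]
  rintro x ⟨-, h1⟩ ⟨h2, -⟩
  have : (2 : ℝ) ^ (i + 1) ≤ 2 ^ j := zpow_le_zpow_right₀ (by norm_num) (by omega)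
  linarith

/-- The duality between `X` and `X*`, with the `X`-norm taken on dyadic shells. -/
theorem lintegral_mul_le_xStarNorm (hd : 0 < d) {f : RSpace d → ℂ}
    (hf : AEStronglyMeasurable f volume) {v : RSpace d → ℝ≥0∞} (hv : AEMeasurable v volume)
    {S : ℝ≥0∞} (hS : ∀ j : ℤ, ∫⁻ x in dyadicShell d j, v x ^ 2 ≤ ENNReal.ofReal (2 ^ (j + 1)) * S) :
    ∫⁻ x, ‖f x‖ₑ * v x ≤ xStarNorm f * S ^ (1 / 2 : ℝ) := by
  have : Nonempty (Fin d) := ⟨⟨0, hd⟩⟩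
  have e1 : ∫⁻ x, ‖f x‖ₑ * v x = ∑' j : ℤ, ∫⁻ x in dyadicShell d j, ‖f x‖ₑ * v x := by
    rw [← lintegral_iUnion measurableSet_dyadicShell pairwise_disjoint_dyadicShell,
      iUnion_dyadicShell]
    have : (volume : Measure (RSpace d)).restrict {x | x ≠ 0} = volume := by
      rw [Measure.restrict_eq_self_of_ae_mem]
      rw [ae_iff]
      simp
    rw [this]
  rw [e1, xStarNorm, ← ENNReal.tsum_mul_right]
  refine ENNReal.tsum_le_tsum fun j => ?_
  have h1 := ENNReal.lintegral_mul_le_Lp_mul_Lq (volume.restrict (dyadicShell d j))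
    Real.HolderConjugate.two_two hf.enorm.restrict hv.restrict
  simp only [Pi.mul_apply, ENNReal.rpow_two] at h1
  refine h1.trans ?_
  have hp : (0 : ℝ) ≤ 1 / 2 := by norm_num
  rw [← ENNReal.mul_rpow_of_nonneg _ _ hp, ← ENNReal.mul_rpow_of_nonneg _ _ hp,
    mul_comm (ENNReal.ofReal _), mul_assoc]
  exact ENNReal.rpow_le_rpow (mul_le_mul' le_rfl (hS j)) hp

theorem enorm_integral_mul_conj_le (f v : RSpace d → ℂ) :
    ‖∫ x, f x * conj (v x)‖ₑ ≤ ∫⁻ x, ‖f x‖ₑ * ‖v x‖ₑ := by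
  refine (enorm_integral_le_lintegral_enorm _).trans (lintegral_mono fun x => ?_)
  rw [enorm_mul]
  simp [← ofReal_norm]

/-- Real version of the duality, when the `X`-norm of `v` is controlled on dyadic shells. -/
theorem norm_integral_le_xStarNorm (hd : 0 < d) {f : RSpace d → ℂ}
    (hf : AEStronglyMeasurable f volume) (hfin : xStarNorm f < ⊤) {v : RSpace d → ℂ}
    (hv : AEStronglyMeasurable v volume) {S : ℝ} (hS0 : 0 ≤ S)
    (hS : ∀ j : ℤ, ∫⁻ x in dyadicShell d j, ‖v x‖ₑ ^ 2 ≤ ENNReal.ofReal (2 ^ (j + 1) * S)) :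
    ‖∫ x, f x * conj (v x)‖ ≤ (xStarNorm f).toReal * √S := by
  have h1 := lintegral_mul_le_xStarNorm hd hf hv.enorm (S := ENNReal.ofReal S) (fun j => by
    rw [← ENNReal.ofReal_mul (by positivity)]; exact hS j)
  have h2 := (enorm_integral_mul_conj_le f v).trans h1
  rw [ENNReal.ofReal_rpow_of_nonneg hS0 (by norm_num), ← Real.sqrt_eq_rpow,
    ← ENNReal.ofReal_toReal hfin.ne, ← ENNReal.ofReal_mul (by positivity), ← ofReal_norm] at h2
  exact (ENNReal.ofReal_le_ofReal_iff (by positivity)).1 h2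

theorem lintegral_mul_lt_top_of_xStarNorm (hd : 0 < d) {f : RSpace d → ℂ}
    (hf : AEStronglyMeasurable f volume) (hfin : xStarNorm f < ⊤) {v : RSpace d → ℂ}
    (hv : AEStronglyMeasurable v volume) {S : ℝ}
    (hS : ∀ j : ℤ, ∫⁻ x in dyadicShell d j, ‖v x‖ₑ ^ 2 ≤ ENNReal.ofReal (2 ^ (j + 1) * S)) :
    ∫⁻ x, ‖f x‖ₑ * ‖v x‖ₑ < ⊤ := by
  refine (lintegral_mul_le_xStarNorm hd hf hv.enorm (S := ENNReal.ofReal S) (fun j => by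
    rw [← ENNReal.ofReal_mul (by positivity)]; exact hS j)).trans_lt ?_
  exact ENNReal.mul_lt_top hfin (ENNReal.rpow_lt_top_of_nonneg (by norm_num) ENNReal.ofReal_ne_top)

/-- On a dyadic shell `|v|² ≤ 2^(j+1) |v|²/|x|`. -/
theorem lintegral_dyadicShell_le {v : RSpace d → ℂ} (j : ℤ)
    (hi : Integrable (fun x => ‖v x‖ ^ 2 / ‖x‖) volume) :
    ∫⁻ x in dyadicShell d j, ‖v x‖ₑ ^ 2
      ≤ ENNReal.ofReal (2 ^ (j + 1) * ∫ x, ‖v x‖ ^ 2 / ‖x‖) := by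
  rw [← integral_const_mul, ofReal_integral_eq_lintegral_ofReal (hi.const_mul _)
    (Eventually.of_forall fun x => by positivity)]
  refine (setLIntegral_mono' (measurableSet_dyadicShell j) fun x hx => ?_).trans
    (setLIntegral_le_lintegral _ _)
  rw [← ofReal_norm, ← ENNReal.ofReal_pow (norm_nonneg _)]
  apply ENNReal.ofReal_le_ofReal
  have h0 : 0 < ‖x‖ := lt_trans (by positivity) hx.1
  rw [mul_div_assoc', le_div_iff₀ h0, mul_comm]
  gcongr
  exact hx.2

theorem IsH1.integrable_sq_div_norm {u : RSpace d → ℂ} {G : RSpace d → CSpace d} (h : IsH1 u G)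
    (hd : 3 ≤ d) : Integrable (fun x => ‖u x‖ ^ 2 / ‖x‖) volume := by
  have hm := h.measurable
  have hm' : Measurable (fun x => ‖u x‖ ^ 2 / ‖x‖) := by fun_prop
  refine (h.integrable_sq.add (h.integrable_sq_div hd)).mono' hm'.aestronglyMeasurable
    (Eventually.of_forall fun x => ?_)
  rw [Real.norm_of_nonneg (by positivity)]
  simp only [Pi.add_apply]
  rcases eq_or_ne x 0 with rfl | hx
  · simp
  have hx0 : 0 < ‖x‖ := norm_pos_iff.2 hx
  have e : ‖u x‖ ^ 2 + ‖u x‖ ^ 2 / ‖x‖ ^ 2 - ‖u x‖ ^ 2 / ‖x‖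
      = ‖u x‖ ^ 2 * ((1 - (‖x‖)⁻¹ / 2) ^ 2 + 3 / 4 * (‖x‖⁻¹) ^ 2) := by field_simp; ring
  have : 0 ≤ ‖u x‖ ^ 2 * ((1 - (‖x‖)⁻¹ / 2) ^ 2 + 3 / 4 * (‖x‖⁻¹) ^ 2) := by positivity
  linarith

theorem dyadicShell_ae_subset_ball (hd : 0 < d) (j : ℤ) :
    (dyadicShell d j : Set (RSpace d)) ≤ᵐ[volume] ball (0 : RSpace d) (2 ^ (j + 1)) := by
  have : Nonempty (Fin d) := ⟨⟨0, hd⟩⟩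
  have h1 : ∀ᵐ x : RSpace d, x ∉ sphere (0 : RSpace d) (2 ^ (j + 1)) := by
    rw [ae_iff]
    simp only [not_not]
    exact Measure.addHaar_sphere volume (0 : RSpace d) (2 ^ (j + 1))
  filter_upwards [h1] with x hx hxs
  have h2 : ‖x‖ ≤ 2 ^ (j + 1) := hxs.2
  simp only [mem_sphere_iff_norm, sub_zero] at hx
  exact mem_ball_zero_iff.2 (lt_of_le_of_ne h2 hx)

/-- The duality for functions that are small near the origin: the density `H` need only satisfy
the growth bound `∫_{B_ρ} H ≤ T ρ` for `ρ ≥ δ`. -/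
theorem norm_integral_le_of_growth (hd : 0 < d) {f : RSpace d → ℂ}
    (hf : AEStronglyMeasurable f volume) (hfin : xStarNorm f < ⊤) {v : RSpace d → ℂ}
    (hv : AEStronglyMeasurable v volume) {H : RSpace d → ℝ} (hH0 : ∀ x, 0 ≤ H x)
    (hHi : Integrable H volume) {δ R T K : ℝ} (hδ : 0 < δ) (hR : δ ≤ R) (hK : 0 ≤ K)
    (hT : ∀ ρ, δ ≤ ρ → ∫ x in ball (0 : RSpace d) ρ, H x ≤ T * ρ)
    (hvH : ∀ ρ, 0 < ρ → ∫⁻ x in ball (0 : RSpace d) ρ, ‖v x‖ₑ ^ 2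
      ≤ ENNReal.ofReal (K * (min 1 (ρ / R)) ^ 2 * ∫ x in ball (0 : RSpace d) ρ, H x)) :
    ‖∫ x, f x * conj (v x)‖ ≤ (xStarNorm f).toReal * √(K * T) := by
  have hR0 : 0 < R := hδ.trans_le hR
  have hint0 : ∀ ρ, 0 ≤ ∫ x in ball (0 : RSpace d) ρ, H x :=
    fun ρ => integral_nonneg fun x => hH0 x
  have hT0 : 0 ≤ T := by
    have := (hint0 δ).trans (hT δ le_rfl)
    exact nonneg_of_mul_nonneg_left this hδ
  refine norm_integral_le_xStarNorm hd hf hfin hv (by positivity) fun j => ?_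
  set ρ : ℝ := 2 ^ (j + 1) with hρ
  have hρ0 : 0 < ρ := by positivity
  calc ∫⁻ x in dyadicShell d j, ‖v x‖ₑ ^ 2 ≤ ∫⁻ x in ball (0 : RSpace d) ρ, ‖v x‖ₑ ^ 2 :=
        lintegral_mono' (Measure.restrict_mono_ae (dyadicShell_ae_subset_ball hd j)) le_rfl
    _ ≤ _ := hvH ρ hρ0
    _ ≤ _ := by
      apply ENNReal.ofReal_le_ofReal
      rcases le_total δ ρ with h | h
      · calc K * (min 1 (ρ / R)) ^ 2 * ∫ x in ball (0 : RSpace d) ρ, H x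
            ≤ K * 1 ^ 2 * (T * ρ) := by
              gcongr
              · exact hint0 ρ
              · exact min_le_left _ _
              · exact hT ρ h
          _ = _ := by ring
      -- Below `δ` no growth is known, and the factor `(ρ/R)²` replaces it: `(ρ/R)² δ ≤ ρ` because
      -- `ρ ≤ δ ≤ R`.
      · have h1 : ∫ x in ball (0 : RSpace d) ρ, H x ≤ T * δ :=
          (setIntegral_mono_set hHi.integrableOn (Eventually.of_forall hH0)
            (ball_subset_ball h).eventuallyLE).trans (hT δ le_rfl)
        have h2 : (ρ / R) ^ 2 * δ ≤ ρ := by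
          rw [div_pow, div_mul_eq_mul_div, div_le_iff₀ (by positivity)]
          calc ρ ^ 2 * δ = ρ * (ρ * δ) := by ring
            _ ≤ ρ * (R * R) := by gcongr; exact h.trans hR
            _ = ρ * R ^ 2 := by ring
        calc K * (min 1 (ρ / R)) ^ 2 * ∫ x in ball (0 : RSpace d) ρ, H x
            ≤ K * (ρ / R) ^ 2 * (T * δ) := by
              gcongr
              · exact hint0 ρ
              · exact min_le_right _ _
          _ = K * T * ((ρ / R) ^ 2 * δ) := by ring
          _ ≤ K * T * ρ := by gcongr
          _ = _ := by ring

end Duality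

/-! ### Cutoffs, and passage to test functions without compact support. -/

section GlobalSolution

open Filter Topology

variable {d : ℕ}

theorem IsH1.smooth_mul {u : RSpace d → ℂ} {G : RSpace d → CSpace d} (h : IsH1 u G)
    {ψ : RSpace d → ℝ} (hψ : ContDiff ℝ ∞ ψ) {C : ℝ} (hC : ∀ x, |ψ x| ≤ C)
    (hC' : ∀ x, ‖cgrad ψ x‖ ≤ C) :
    IsH1 (fun x => (ψ x : ℂ) * u x) (fun x => (ψ x : ℂ) • G x + u x • cgrad ψ x) := by
  have hψm : Measurable fun x => (ψ x : ℂ) :=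
    (Complex.continuous_ofReal.comp hψ.continuous).measurable
  have hgm := (continuous_cgrad hψ).measurable
  have hm1 := hψm.mul h.measurable
  have hm2 := hψm.smul h.measurable_grad
  have hm3 := h.measurable.smul hgm
  refine ⟨hm1, hm2.add hm3, ?_, ?_, h.hasWeakGradient.smooth_mul hψ⟩
  · refine h.memLp.of_le_mul (c := C) hm1.aestronglyMeasurable (Eventually.of_forall fun x => ?_)
    rw [norm_mul, Complex.norm_real]
    exact mul_le_mul_of_nonneg_right (hC x) (norm_nonneg _)
  · refine MemLp.add ?_ ?_
    · refine h.memLp_grad.of_le_mul (c := C) hm2.aestronglyMeasurable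
        (Eventually.of_forall fun x => ?_)
      rw [norm_smul, Complex.norm_real]
      exact mul_le_mul_of_nonneg_right (hC x) (norm_nonneg _)
    · refine h.memLp.of_le_mul (c := C) hm3.aestronglyMeasurable (Eventually.of_forall fun x => ?_)
      rw [norm_smul, mul_comm]
      exact mul_le_mul_of_nonneg_right (hC' x) (norm_nonneg _)

theorem HasCompactSupport.cgrad {ψ : RSpace d → ℝ} (hc : HasCompactSupport ψ) :
    HasCompactSupport (cgrad ψ) := by
  refine (hc.fderiv (𝕜 := ℝ)).mono fun x hx hx' => hx ?_
  ext i
  simp [_root_.cgrad, hx']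

theorem cgrad_comp_smul {ψ : RSpace d → ℝ} (hψ : ContDiff ℝ ∞ ψ) (c : ℝ) (x : RSpace d) :
    cgrad (fun x => ψ (c • x)) x = (c : ℂ) • cgrad ψ (c • x) := by
  have hd : DifferentiableAt ℝ ψ (c • x) := hψ.differentiable (by simp) _
  have h2 : HasFDerivAt (fun x : RSpace d => c • x) (c • ContinuousLinearMap.id ℝ (RSpace d)) x :=
    (hasFDerivAt_id x).const_smul c
  have h1 := hd.hasFDerivAt.comp x h2
  ext i
  have e : fderiv ℝ (fun x => ψ (c • x)) x = _ := h1.fderiv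
  simp [cgrad, e]

/-- Rescaling one fixed bump makes `C` independent of `R`; the decay `C / R` gives the right
homogeneity in the local mass estimate. -/
theorem exists_cutoff (d : ℕ) : ∃ C : ℝ, 0 ≤ C ∧ ∀ R : ℝ, 0 < R → ∃ χ : RSpace d → ℝ,
    ContDiff ℝ ∞ χ ∧ HasCompactSupport χ ∧ (∀ x, 0 ≤ χ x ∧ χ x ≤ 1) ∧
    (∀ x ∈ ball (0 : RSpace d) R, χ x = 1) ∧ (∀ x, 2 * R ≤ ‖x‖ → χ x = 0) ∧
    ∀ x, ‖cgrad χ x‖ ≤ C / R := by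
  let b : ContDiffBump (0 : RSpace d) := ⟨1, 2, by norm_num, by norm_num⟩
  have hb : ContDiff ℝ ∞ b := b.contDiff
  obtain ⟨C, hC⟩ := (continuous_cgrad hb).bounded_above_of_compact_support
    (HasCompactSupport.cgrad b.hasCompactSupport)
  refine ⟨C, (norm_nonneg _).trans (hC 0), fun R hR => ?_⟩
  refine ⟨fun x => b (R⁻¹ • x), hb.comp (contDiff_const_smul _),
    b.hasCompactSupport.comp_homeomorph (Homeomorph.smulOfNeZero R⁻¹ (inv_ne_zero hR.ne')),
    fun x => ⟨b.nonneg, b.le_one⟩, fun x hx => ?_, fun x hx => ?_, fun x => ?_⟩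
  · apply b.one_of_mem_closedBall
    rw [mem_closedBall_zero_iff, norm_smul, Real.norm_of_nonneg (by positivity)]
    change _ ≤ (1 : ℝ)
    rw [inv_mul_le_iff₀ hR, mul_one]
    exact (mem_ball_zero_iff.1 hx).le
  · apply b.zero_of_le_dist
    rw [dist_zero_right, norm_smul, Real.norm_of_nonneg (by positivity)]
    change (2 : ℝ) ≤ _
    rw [le_inv_mul_iff₀ hR]
    linarith
  · rw [cgrad_comp_smul hb, norm_smul, Complex.norm_real, Real.norm_of_nonneg (by positivity),
      div_eq_inv_mul]
    exact mul_le_mul_of_nonneg_left (hC _) (by positivity)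

theorem cgrad_eq_zero_of_eventuallyEq_const {ψ : RSpace d → ℝ} {c : ℝ} {x : RSpace d}
    (h : ψ =ᶠ[𝓝 x] fun _ => c) : cgrad ψ x = 0 := by
  ext i
  simp [cgrad, h.fderiv_eq]

theorem inner_smooth_mul (u : ℂ) (g F : CSpace d) (w : CSpace d) (s : ℝ) :
    inner ℂ ((s : ℂ) • F + u • w) g = (s : ℂ) * inner ℂ F g + conj u * inner ℂ w g := by
  rw [inner_add_left, inner_smul_left, inner_smul_left, Complex.conj_ofReal]

/-- Cutting off a function of finite energy gives a test function. -/
theorem isH1_cutoff {u : RSpace d → ℂ} {G : RSpace d → CSpace d} (hu : Measurable u)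
    (hG : Measurable G) (hL : MemLp u 2 volume) (hw : HasWeakGradient u G)
    (hG2 : LocallyIntegrable (fun x => ‖G x‖ ^ 2) volume) {ψ : RSpace d → ℝ}
    (hψ : ContDiff ℝ ∞ ψ) (hc : HasCompactSupport ψ) :
    IsH1 (fun x => (ψ x : ℂ) * u x) (fun x => (ψ x : ℂ) • G x + u x • cgrad ψ x) := by
  have hψm : Measurable fun x => (ψ x : ℂ) :=
    (Complex.continuous_ofReal.comp hψ.continuous).measurable
  have hgm := (continuous_cgrad hψ).measurable
  have hm1 := hψm.mul hu
  have hm2 := hψm.smul hG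
  have hm3 := hu.smul hgm
  obtain ⟨C, hC⟩ := hψ.continuous.bounded_above_of_compact_support hc
  obtain ⟨C', hC'⟩ := (continuous_cgrad hψ).bounded_above_of_compact_support
    (HasCompactSupport.cgrad hc)
  refine ⟨hm1, hm2.add hm3, ?_, ?_, hw.smooth_mul hψ⟩
  · refine hL.of_le_mul (c := C) hm1.aestronglyMeasurable (Eventually.of_forall fun x => ?_)
    rw [norm_mul, Complex.norm_real]
    exact mul_le_mul_of_nonneg_right (hC x) (norm_nonneg _)
  · refine MemLp.add ?_ ?_
    · refine (memLp_two_iff_integrable_sq_norm (f := fun x => (ψ x : ℂ) • G x)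
        hm2.aestronglyMeasurable).2 ?_
      have hc2 : HasCompactSupport fun x => ψ x ^ 2 :=
        hc.comp_left (g := fun t : ℝ => t ^ 2) (by simp)
      have := hG2.integrable_smul_left_of_hasCompactSupport (hψ.continuous.pow 2) hc2
      refine this.congr (Eventually.of_forall fun x => ?_)
      simp [norm_smul, mul_pow]
    · refine hL.of_le_mul (c := C') hm3.aestronglyMeasurable (Eventually.of_forall fun x => ?_)
      rw [norm_smul, mul_comm]
      exact mul_le_mul_of_nonneg_right (hC' x) (norm_nonneg _)

/-- The solution after the removal of all localisation: everything is globally integrable and the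
equation may be tested with every `v ∈ H¹` of finite potential energy. -/
structure IsGlobalSolution (V : RSpace d → ℝ) (ε τ : ℝ) (f u : RSpace d → ℂ)
    (G : RSpace d → CSpace d) : Prop where
  isH1 : IsH1 u G
  energy : Integrable (fun x => V x * ‖u x‖ ^ 2) volume
  equation : ∀ (v : RSpace d → ℂ) (F : RSpace d → CSpace d), IsH1 v F →
    Integrable (fun x => V x * ‖v x‖ ^ 2) volume →
    (∫ x, inner ℂ (F x) (G x)) + (∫ x, (V x : ℂ) * (u x * conj (v x)))
      + (Complex.I * (ε : ℂ) - (τ : ℂ)) * (∫ x, u x * conj (v x)) = ∫ x, f x * conj (v x)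

theorem IsHelmholtzSolution.equation_inner {V : RSpace d → ℝ} {ε τ : ℝ} {f u : RSpace d → ℂ}
    {G : RSpace d → CSpace d} (h : IsHelmholtzSolution V ε τ f u G) {v : RSpace d → ℂ}
    {F : RSpace d → CSpace d} (hv : IsH1 v F) (hc : HasCompactSupport v)
    (hVv : Integrable (fun x => V x * ‖v x‖ ^ 2) volume) :
    (∫ x, inner ℂ (F x) (G x)) + (∫ x, (V x : ℂ) * (u x * conj (v x)))
      + (Complex.I * (ε : ℂ) - (τ : ℂ)) * (∫ x, u x * conj (v x)) = ∫ x, f x * conj (v x) := by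
  rw [← h.equation v F ⟨hc, hv.memLp, hv.memLp_grad, hv.hasWeakGradient, hVv⟩]
  simp only [PiLp.inner_apply, RCLike.inner_apply, mul_assoc]
  ring

theorem IsH1.integrable_inner {u v : RSpace d → ℂ} {G F : RSpace d → CSpace d} (h : IsH1 u G)
    (h' : IsH1 v F) : Integrable (fun x => (inner ℂ (F x) (G x) : ℂ)) volume := by
  have hm := h.measurable_grad
  have hm' := h'.measurable_grad
  refine (h.integrable_grad_sq.add h'.integrable_grad_sq).mono'
    (hm'.inner hm).aestronglyMeasurable (Eventually.of_forall fun x => ?_)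
  refine (norm_inner_le_norm _ _).trans ?_
  simp only [Pi.add_apply]
  nlinarith [sq_nonneg (‖F x‖ - ‖G x‖), sq_nonneg (‖F x‖ + ‖G x‖)]

theorem IsH1.integrable_mul_conj {u v : RSpace d → ℂ} {G F : RSpace d → CSpace d} (h : IsH1 u G)
    (h' : IsH1 v F) : Integrable (fun x => u x * conj (v x)) volume := by
  have hm := h.measurable
  have hm' := h'.measurable
  refine (h.integrable_sq.add h'.integrable_sq).mono'
    (hm.mul (Complex.continuous_conj.measurable.comp hm')).aestronglyMeasurable
    (Eventually.of_forall fun x => ?_)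
  rw [norm_mul, RCLike.norm_conj]
  simp only [Pi.add_apply]
  nlinarith [sq_nonneg (‖u x‖ - ‖v x‖), sq_nonneg (‖u x‖ + ‖v x‖)]

theorem integrable_potential_mul_conj {V : RSpace d → ℝ} (hVm : AEMeasurable V volume)
    (hV0 : ∀ᵐ x, 0 ≤ V x) {u v : RSpace d → ℂ} (hu : Measurable u) (hv : Measurable v)
    (h : Integrable (fun x => V x * ‖u x‖ ^ 2) volume)
    (h' : Integrable (fun x => V x * ‖v x‖ ^ 2) volume) :
    Integrable (fun x => (V x : ℂ) * (u x * conj (v x))) volume := by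
  refine (h.add h').mono' ((Complex.measurable_ofReal.comp_aemeasurable hVm).mul
    (hu.mul (Complex.continuous_conj.measurable.comp hv)).aemeasurable).aestronglyMeasurable ?_
  filter_upwards [hV0] with x hx
  rw [norm_mul, norm_mul, RCLike.norm_conj, Complex.norm_real, Real.norm_of_nonneg hx]
  simp only [Pi.add_apply]
  have : 0 ≤ V x * (‖u x‖ ^ 2 + ‖v x‖ ^ 2 - ‖u x‖ * ‖v x‖) := by
    apply mul_nonneg hx
    nlinarith [sq_nonneg (‖u x‖ - ‖v x‖), sq_nonneg (‖u x‖ + ‖v x‖)]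
  linarith

theorem integrable_data_mul_conj (hd : 3 ≤ d) {f : RSpace d → ℂ}
    (hf : AEStronglyMeasurable f volume) (hfin : xStarNorm f < ⊤) {v : RSpace d → ℂ}
    {F : RSpace d → CSpace d} (hv : IsH1 v F) :
    Integrable (fun x => f x * conj (v x)) volume := by
  have hm := hv.measurable
  refine ⟨hf.mul (Complex.continuous_conj.measurable.comp hm).aestronglyMeasurable, ?_⟩
  refine lt_of_le_of_lt (le_of_eq ?_) (lintegral_mul_lt_top_of_xStarNorm (by omega) hf hfin
    hm.aestronglyMeasurable fun j => lintegral_dyadicShell_le j (hv.integrable_sq_div_norm hd))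
  refine lintegral_congr fun x => ?_
  rw [enorm_mul]
  simp [← ofReal_norm]

/-- The equation is tested with `χₙ v`. At each point `χₙ = 1` and `∇χₙ = 0` eventually, and all
terms are dominated; for the data term the dominating function is integrable because `f ∈ X*` pairs
with every `v ∈ H¹`. -/
theorem IsHelmholtzSolution.isGlobalSolution {V : RSpace d → ℝ} {ε τ : ℝ} {f u : RSpace d → ℂ}
    {G : RSpace d → CSpace d} (h : IsHelmholtzSolution V ε τ f u G) (hd : 3 ≤ d)
    (hVm : AEMeasurable V volume) (hV0 : ∀ᵐ x, 0 ≤ V x)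
    (hf : AEStronglyMeasurable f volume) (hfin : xStarNorm f < ⊤) (hH : IsH1 u G)
    (hE : Integrable (fun x => V x * ‖u x‖ ^ 2) volume) : IsGlobalSolution V ε τ f u G := by
  refine ⟨hH, hE, fun v F hv hVv => ?_⟩
  obtain ⟨C, hC0, hC⟩ := exists_cutoff d
  choose χ hχ hχc hχ01 hχ1 hχ0 hχg using fun n : ℕ => hC (n + 1) (by positivity)
  have hgC : ∀ n x, ‖cgrad (χ n) x‖ ≤ C := fun n x =>
    (hχg n x).trans (div_le_self hC0 (by linarith [(n.cast_nonneg : (0 : ℝ) ≤ n)]))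
  have hge : ∀ x : RSpace d, ∀ᶠ n : ℕ in atTop, χ n x = 1 ∧ cgrad (χ n) x = 0 := by
    intro x
    obtain ⟨N, hN⟩ := exists_nat_gt ‖x‖
    filter_upwards [eventually_ge_atTop N] with n hn
    have hx : x ∈ ball (0 : RSpace d) (n + 1) := by
      rw [mem_ball_zero_iff]
      have : (N : ℝ) ≤ n := by exact_mod_cast hn
      linarith
    refine ⟨hχ1 n x hx, cgrad_eq_zero_of_eventuallyEq_const (c := 1) ?_⟩
    filter_upwards [isOpen_ball.mem_nhds hx] with y hy using hχ1 n y hy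
  have hvn := fun n => hv.smooth_mul (hχ n) (C := max 1 C)
    (fun x => (abs_of_nonneg (hχ01 n x).1).le.trans ((hχ01 n x).2.trans (le_max_left _ _)))
    (fun x => (hgC n x).trans (le_max_right _ _))
  have hVn : ∀ n, Integrable (fun x => V x * ‖(χ n x : ℂ) * v x‖ ^ 2) volume := by
    intro n
    have hmn := (hvn n).measurable
    refine hVv.mono' (hVm.mul (hmn.norm.pow_const 2).aemeasurable).aestronglyMeasurable ?_
    filter_upwards [hV0] with x hx
    rw [Real.norm_of_nonneg (by positivity), norm_mul, Complex.norm_real,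
      Real.norm_of_nonneg (hχ01 n x).1]
    have : χ n x * ‖v x‖ ≤ ‖v x‖ := mul_le_of_le_one_left (norm_nonneg _) (hχ01 n x).2
    have h0 := (hχ01 n x).1
    gcongr
  have key := fun n => h.equation_inner (hvn n)
    ((hχc n).comp_left (g := fun t : ℝ => (t : ℂ)) (by simp)).mul_right (hVn n)
  have hum := hH.measurable
  have hvm := hv.measurable
  have hχm : ∀ n, Measurable fun x => (χ n x : ℂ) := fun n =>
    (Complex.continuous_ofReal.comp (hχ n).continuous).measurable
  have hχn : ∀ n x, ‖(χ n x : ℂ)‖ ≤ 1 := fun n x => by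
    rw [Complex.norm_real, Real.norm_of_nonneg (hχ01 n x).1]; exact (hχ01 n x).2
  have hmc : Measurable fun x => conj (v x) := Complex.continuous_conj.measurable.comp hvm
  have l1 : Tendsto (fun n => ∫ x, inner ℂ ((χ n x : ℂ) • F x + v x • cgrad (χ n) x) (G x)) atTop
      (𝓝 (∫ x, inner ℂ (F x) (G x))) := by
    refine tendsto_integral_of_dominated_convergence
      (fun x => (‖F x‖ ^ 2 + C ^ 2 * ‖v x‖ ^ 2) + ‖G x‖ ^ 2)
      (fun n => (Measurable.inner (𝕜 := ℂ) (hvn n).measurable_grad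
        hH.measurable_grad).aestronglyMeasurable)
      ((hv.integrable_grad_sq.add (hv.integrable_sq.const_mul _)).add hH.integrable_grad_sq)
      (fun n => Eventually.of_forall fun x => ?_) (Eventually.of_forall fun x => ?_)
    · have e1 : ‖(χ n x : ℂ) • F x + v x • cgrad (χ n) x‖ ≤ ‖F x‖ + C * ‖v x‖ := by
        refine (norm_add_le _ _).trans (add_le_add ?_ ?_)
        · rw [norm_smul]; exact mul_le_of_le_one_left (norm_nonneg _) (hχn n x)
        · rw [norm_smul, mul_comm]
          exact mul_le_mul_of_nonneg_right (hgC n x) (norm_nonneg _)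
      refine (norm_inner_le_norm _ _).trans ((mul_le_mul_of_nonneg_right e1
        (norm_nonneg _)).trans ?_)
      nlinarith [sq_nonneg (‖F x‖ - C * ‖v x‖), sq_nonneg (‖F x‖ + C * ‖v x‖ - 2 * ‖G x‖)]
    · refine tendsto_const_nhds.congr' ?_
      filter_upwards [hge x] with n hn
      simp [hn.1, hn.2]
  have lim : ∀ (w : RSpace d → ℂ), Integrable (fun x => w x * conj (v x)) volume →
      Tendsto (fun n => ∫ x, w x * conj ((χ n x : ℂ) * v x)) atTop
        (𝓝 (∫ x, w x * conj (v x))) := by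
    intro w hw
    have e : ∀ n x, w x * conj ((χ n x : ℂ) * v x) = (χ n x : ℂ) * (w x * conj (v x)) := by
      intro n x
      rw [map_mul, Complex.conj_ofReal]; ring
    refine tendsto_integral_of_dominated_convergence (fun x => ‖w x * conj (v x)‖)
      (fun n => ?_) hw.norm
      (fun n => Eventually.of_forall fun x => ?_) (Eventually.of_forall fun x => ?_)
    · simp only [e]
      exact (hχm n).aestronglyMeasurable.mul hw.aestronglyMeasurable
    · rw [e, norm_mul]
      exact mul_le_of_le_one_left (norm_nonneg _) (hχn n x)
    · refine tendsto_const_nhds.congr' ?_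
      filter_upwards [hge x] with n hn
      simp [hn.1]
  have l2 := lim (fun x => (V x : ℂ) * u x) (by
    simpa only [mul_assoc] using integrable_potential_mul_conj hVm hV0 hum hvm hE hVv)
  have l3 := lim u (hH.integrable_mul_conj hv)
  have l4 := lim f (integrable_data_mul_conj hd hf hfin hv)
  simp only [mul_assoc] at l2
  refine tendsto_nhds_unique ((l1.add l2).add (l3.const_mul _)) ?_
  refine l4.congr fun n => ?_
  rw [← key n]

end GlobalSolution

/-! ### Global finiteness of the energy. -/

section GlobalBounds

open Filter Topology

variable {d : ℕ}

/-- With `a = ∇(χu)` and `b = u∇χ` this is the pointwise identity `Re ∇(χ²u)·∇u = |∇(χu)|² -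
|u∇χ|²`. -/
theorem re_inner_add_sub (a b : CSpace d) :
    (inner ℂ (a + b) (a - b) : ℂ).re = ‖a‖ ^ 2 - ‖b‖ ^ 2 := by
  have h1 : (inner ℂ a a : ℂ).re = ‖a‖ ^ 2 := by
    simpa using (inner_self_eq_norm_sq (𝕜 := ℂ) a)
  have h2 : (inner ℂ b b : ℂ).re = ‖b‖ ^ 2 := by
    simpa using (inner_self_eq_norm_sq (𝕜 := ℂ) b)
  have h3 : (inner ℂ b a : ℂ).re = (inner ℂ a b : ℂ).re := by
    rw [← inner_conj_symm b a, Complex.conj_re]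
  rw [inner_add_left, inner_sub_right, inner_sub_right]
  simp only [Complex.add_re, Complex.sub_re, h1, h2, h3]
  ring

theorem IsH1.integral_sq_div_norm_le {u : RSpace d → ℂ} {G : RSpace d → CSpace d} (h : IsH1 u G)
    (hd : 3 ≤ d) :
    ∫ x, ‖u x‖ ^ 2 / ‖x‖ ≤ (∫ x, ‖u x‖ ^ 2) + 2 * 2 ^ d * ∫ x, ‖G x‖ ^ 2 := by
  refine le_trans ?_ (add_le_add_right (h.hardy hd) _)
  rw [← integral_add h.integrable_sq (h.integrable_sq_div hd)]
  refine integral_mono (h.integrable_sq_div_norm hd)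
    (h.integrable_sq.add (h.integrable_sq_div hd)) fun x => ?_
  rcases eq_or_ne x 0 with rfl | hx
  · simp
  have hx0 : 0 < ‖x‖ := norm_pos_iff.2 hx
  have e : ‖u x‖ ^ 2 + ‖u x‖ ^ 2 / ‖x‖ ^ 2 - ‖u x‖ ^ 2 / ‖x‖
      = ‖u x‖ ^ 2 * ((1 - (‖x‖)⁻¹ / 2) ^ 2 + 3 / 4 * (‖x‖⁻¹) ^ 2) := by field_simp; ring
  have : 0 ≤ ‖u x‖ ^ 2 * ((1 - (‖x‖)⁻¹ / 2) ^ 2 + 3 / 4 * (‖x‖⁻¹) ^ 2) := by positivity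
  simp only
  linarith

/-- The energy identity localised by a cutoff, with the resulting bound. -/
theorem IsHelmholtzSolution.cutoff_energy_le {V : RSpace d → ℝ} {ε τ : ℝ} {f u : RSpace d → ℂ}
    {G : RSpace d → CSpace d} (h : IsHelmholtzSolution V ε τ f u G) (hd : 3 ≤ d)
    (hVm : AEMeasurable V volume) (hV0 : ∀ᵐ x, 0 ≤ V x) (hu : Measurable u) (hG : Measurable G)
    (hf : AEStronglyMeasurable f volume) (hfin : xStarNorm f < ⊤) {χ : RSpace d → ℝ}
    (hχ : ContDiff ℝ ∞ χ) (hc : HasCompactSupport χ) (h01 : ∀ x, 0 ≤ χ x ∧ χ x ≤ 1) {C : ℝ}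
    (hC : ∀ x, ‖cgrad χ x‖ ≤ C) :
    Integrable (fun x => V x * ‖(χ x : ℂ) * u x‖ ^ 2) volume ∧
    (∫ x, ‖(χ x : ℂ) • G x + u x • cgrad χ x‖ ^ 2) / 2 + (∫ x, V x * ‖(χ x : ℂ) * u x‖ ^ 2)
      ≤ (C ^ 2 + |τ| + 1) * (∫ x, ‖u x‖ ^ 2) + 2 * 2 ^ d * (xStarNorm f).toReal ^ 2 := by
  have hw := isH1_cutoff hu hG h.memLp h.hasWeakGradient h.locallyIntegrable_grad_sq hχ hc
  set w : RSpace d → ℂ := fun x => (χ x : ℂ) * u x with hwdef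
  set Gw : RSpace d → CSpace d := fun x => (χ x : ℂ) • G x + u x • cgrad χ x with hGw
  have hv := hw.smooth_mul hχ (C := max 1 C)
    (fun x => (abs_of_nonneg (h01 x).1).le.trans ((h01 x).2.trans (le_max_left _ _)))
    (fun x => (hC x).trans (le_max_right _ _))
  set v : RSpace d → ℂ := fun x => (χ x : ℂ) * w x with hvdef
  have hχn : ∀ x, ‖(χ x : ℂ)‖ ≤ 1 := fun x => by
    rw [Complex.norm_real, Real.norm_of_nonneg (h01 x).1]; exact (h01 x).2
  have hwu : ∀ x, ‖w x‖ ≤ ‖u x‖ := fun x => by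
    rw [hwdef]; simp only; rw [norm_mul]; exact mul_le_of_le_one_left (norm_nonneg _) (hχn x)
  have hvw : ∀ x, ‖v x‖ ≤ ‖w x‖ := fun x => by
    rw [hvdef]; simp only; rw [norm_mul]; exact mul_le_of_le_one_left (norm_nonneg _) (hχn x)
  have hu2 : Integrable (fun x => ‖u x‖ ^ 2) volume :=
    (memLp_two_iff_integrable_sq_norm h.memLp.aestronglyMeasurable).1 h.memLp
  have hVw : Integrable (fun x => V x * ‖w x‖ ^ 2) volume := by
    have hc2 : HasCompactSupport fun x => χ x ^ 2 :=
      hc.comp_left (g := fun t : ℝ => t ^ 2) (by simp)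
    have := h.locallyIntegrable_energy.integrable_smul_left_of_hasCompactSupport
      (hχ.continuous.pow 2) hc2
    refine this.congr (Eventually.of_forall fun x => ?_)
    simp only [hwdef, norm_mul, Complex.norm_real, mul_pow, Real.norm_eq_abs, sq_abs, smul_eq_mul,
      Pi.pow_apply]
    ring
  refine ⟨hVw, ?_⟩
  have hwm := hw.measurable
  have hvm := hv.measurable
  have hVv : Integrable (fun x => V x * ‖v x‖ ^ 2) volume := by
    refine hVw.mono' (hVm.mul (hvm.norm.pow_const 2).aemeasurable).aestronglyMeasurable ?_
    filter_upwards [hV0] with x hx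
    have := hvw x
    rw [Real.norm_of_nonneg (by positivity)]
    gcongr
  have hcv : HasCompactSupport v :=
    (hc.comp_left (g := fun t : ℝ => (t : ℂ)) (by simp)).mul_right
  have key := h.equation_inner hv hcv hVv
  -- The test function is `χ²u`. One factor `χ` is moved to `∇u`, where `χ∇u = ∇(χu) - u∇χ`.
  have e1 : ∀ x, (inner ℂ ((χ x : ℂ) • Gw x + w x • cgrad χ x) (G x) : ℂ)
      = inner ℂ (Gw x + u x • cgrad χ x) (Gw x - u x • cgrad χ x) := by
    intro x
    have e : Gw x - u x • cgrad χ x = (χ x : ℂ) • G x := by simp [hGw]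
    have e' : (χ x : ℂ) • Gw x + w x • cgrad χ x = (χ x : ℂ) • (Gw x + u x • cgrad χ x) := by
      rw [smul_add (χ x : ℂ) (Gw x), smul_smul]
    rw [e, e', inner_smul_left, inner_smul_right, Complex.conj_ofReal]
  have hcm := (continuous_cgrad hχ).measurable
  have hb2 : ∀ x, ‖u x • cgrad χ x‖ ^ 2 ≤ C ^ 2 * ‖u x‖ ^ 2 := fun x => by
    rw [norm_smul, mul_pow, mul_comm]
    have := hC x
    gcongr
  have hb2i : Integrable (fun x => ‖u x • cgrad χ x‖ ^ 2) volume := by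
    refine (hu2.const_mul (C ^ 2)).mono' ((hu.smul hcm).norm.pow_const 2).aestronglyMeasurable
      (Eventually.of_forall fun x => ?_)
    rw [Real.norm_of_nonneg (by positivity)]
    exact hb2 x
  have hi1 : Integrable (fun x => (inner ℂ ((χ x : ℂ) • Gw x + w x • cgrad χ x) (G x) : ℂ))
      volume := by
    refine ((hw.integrable_grad_sq.const_mul 2).add (hb2i.const_mul 2)).mono'
      (Measurable.inner (𝕜 := ℂ) hv.measurable_grad hG).aestronglyMeasurable
      (Eventually.of_forall fun x => ?_)
    rw [e1]
    refine (norm_inner_le_norm _ _).trans ?_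
    have n1 := norm_add_le (Gw x) (u x • cgrad χ x)
    have n2 := norm_sub_le (Gw x) (u x • cgrad χ x)
    simp only [Pi.add_apply]
    calc _ ≤ (‖Gw x‖ + ‖u x • cgrad χ x‖) * (‖Gw x‖ + ‖u x • cgrad χ x‖) := by gcongr
      _ ≤ _ := by nlinarith [sq_nonneg (‖Gw x‖ - ‖u x • cgrad χ x‖)]
  have r1 : (∫ x, (inner ℂ ((χ x : ℂ) • Gw x + w x • cgrad χ x) (G x) : ℂ)).re
      = (∫ x, ‖Gw x‖ ^ 2) - ∫ x, ‖u x • cgrad χ x‖ ^ 2 := by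
    rw [← integral_sub hw.integrable_grad_sq hb2i, ← RCLike.re_eq_complex_re, ← integral_re hi1]
    refine integral_congr_ae (Eventually.of_forall fun x => ?_)
    simp only [e1, RCLike.re_eq_complex_re, re_inner_add_sub]
  have e2 : ∀ x, u x * conj (v x) = ((‖w x‖ ^ 2 : ℝ) : ℂ) := by
    intro x
    simp only [hvdef, hwdef, map_mul, Complex.conj_ofReal]
    rw [norm_mul, Complex.norm_real, mul_pow, Real.norm_eq_abs, sq_abs]
    push_cast
    rw [← Complex.mul_conj']
    ring
  simp only [e2, ← Complex.ofReal_mul] at key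
  rw [integral_complex_ofReal, integral_complex_ofReal] at key
  have kre := congrArg Complex.re key
  have e3 : ((Complex.I * (ε : ℂ) - (τ : ℂ)) * ((∫ x, ‖w x‖ ^ 2 : ℝ) : ℂ)).re
      = -τ * ∫ x, ‖w x‖ ^ 2 := by simp
  rw [Complex.add_re, Complex.add_re, e3, Complex.ofReal_re, r1] at kre
  have hwle : ∫ x, ‖w x‖ ^ 2 ≤ ∫ x, ‖u x‖ ^ 2 :=
    integral_mono hw.integrable_sq hu2 fun x => pow_le_pow_left₀ (norm_nonneg _) (hwu x) 2
  have hw0 : 0 ≤ ∫ x, ‖w x‖ ^ 2 := integral_nonneg fun x => by positivity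
  have hcle : ∫ x, ‖u x • cgrad χ x‖ ^ 2 ≤ C ^ 2 * ∫ x, ‖u x‖ ^ 2 := by
    rw [← integral_const_mul]; exact integral_mono hb2i (hu2.const_mul _) hb2
  have hS0 : 0 ≤ ∫ x, ‖w x‖ ^ 2 / ‖x‖ := integral_nonneg fun x => by positivity
  have hP := norm_integral_le_xStarNorm (by omega) hf hfin hvm.aestronglyMeasurable hS0
    (fun j => le_trans (lintegral_mono fun x => pow_le_pow_left₀ zero_le
      (enorm_le_iff_norm_le.2 (hvw x)) 2)
      (lintegral_dyadicShell_le j (hw.integrable_sq_div_norm hd)))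
  have hS := hw.integral_sq_div_norm_le hd
  set S := ∫ x, ‖w x‖ ^ 2 / ‖x‖
  set A := ∫ x, ‖Gw x‖ ^ 2
  set Φ := (xStarNorm f).toReal
  -- `H` is the constant of Hardy's inequality. Young's inequality with this weight makes the data
  -- term cost at most half of the gradient term `A`, which is then absorbed.
  set H : ℝ := 2 * 2 ^ d with hH
  have hH1 : 1 ≤ H := by
    have : (1 : ℝ) ≤ 2 ^ d := one_le_pow₀ (by norm_num)
    rw [hH]; linarith
  have hf1 : (∫ x, f x * conj (v x)).re ≤ Φ * √S := (Complex.re_le_norm _).trans hP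
  have hf2 : Φ * √S ≤ S / (2 * H) + H * Φ ^ 2 := by
    have hs := Real.sq_sqrt hS0
    have : S / (2 * H) + H * Φ ^ 2 - Φ * √S
        = (√S - H * Φ) ^ 2 / (2 * H) + H * Φ ^ 2 / 2 := by
      rw [div_add_div _ _ (by positivity) (by norm_num), eq_div_iff (by positivity)]
      nth_rewrite 1 [← hs]
      field_simp
      ring
    have : 0 ≤ (√S - H * Φ) ^ 2 / (2 * H) + H * Φ ^ 2 / 2 := by positivity
    linarith
  have hS2 : S / (2 * H) ≤ (∫ x, ‖u x‖ ^ 2) / 2 + A / 2 := by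
    rw [div_le_iff₀ (by positivity)]
    have : (∫ x, ‖u x‖ ^ 2) * 1 ≤ (∫ x, ‖u x‖ ^ 2) * H :=
      mul_le_mul_of_nonneg_left hH1 (hw0.trans hwle)
    linarith
  have hτ : τ * ∫ x, ‖w x‖ ^ 2 ≤ |τ| * ∫ x, ‖u x‖ ^ 2 := by
    calc _ ≤ |τ| * ∫ x, ‖w x‖ ^ 2 := mul_le_mul_of_nonneg_right (le_abs_self _) hw0
      _ ≤ _ := by gcongr
  have hu0 := hw0.trans hwle
  linarith

theorem integrable_of_forall_ball_le {F : RSpace d → ℝ} (hF : LocallyIntegrable F volume)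
    (hF0 : ∀ᵐ x, 0 ≤ F x) {K : ℝ}
    (hK : ∀ n : ℕ, ∫ x in ball (0 : RSpace d) (n + 1), F x ≤ K) : Integrable F volume := by
  have hcov : AECover (volume : Measure (RSpace d)) atTop
      fun n : ℕ => ball (0 : RSpace d) ((n : ℝ) + 1) :=
    aecover_ball (tendsto_atTop_add_const_right _ _ tendsto_natCast_atTop_atTop)
  refine hcov.integrable_of_integral_norm_bounded K
    (fun n => (hF.integrableOn_isCompact (isCompact_closedBall 0 _)).mono_set ball_subset_closedBall)
    (Eventually.of_forall fun n => ?_)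
  refine le_trans (le_of_eq (setIntegral_congr_ae measurableSet_ball ?_)) (hK n)
  filter_upwards [hF0] with x hx _ using Real.norm_of_nonneg hx

/-- Weak solutions have globally finite energy. -/
theorem IsHelmholtzSolution.globalEnergy {V : RSpace d → ℝ} {ε τ : ℝ} {f u : RSpace d → ℂ}
    {G : RSpace d → CSpace d} (h : IsHelmholtzSolution V ε τ f u G) (hd : 3 ≤ d)
    (hVm : AEMeasurable V volume) (hV0 : ∀ᵐ x, 0 ≤ V x) (hu : Measurable u) (hG : Measurable G)
    (hf : AEStronglyMeasurable f volume) (hfin : xStarNorm f < ⊤) :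
    IsGlobalSolution V ε τ f u G := by
  obtain ⟨C, hC0, hC⟩ := exists_cutoff d
  choose χ hχ hχc hχ01 hχ1 hχ0 hχg using fun n : ℕ => hC (n + 1) (by positivity)
  have hgC : ∀ n x, ‖cgrad (χ n) x‖ ≤ C := fun n x =>
    (hχg n x).trans (div_le_self hC0 (by linarith [(n.cast_nonneg : (0 : ℝ) ≤ n)]))
  have key := fun n => h.cutoff_energy_le hd hVm hV0 hu hG hf hfin (hχ n) (hχc n) (hχ01 n)
    (hgC n)
  have hw := fun n => isH1_cutoff hu hG h.memLp h.hasWeakGradient h.locallyIntegrable_grad_sq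
    (hχ n) (hχc n)
  set K := (C ^ 2 + |τ| + 1) * (∫ x, ‖u x‖ ^ 2) + 2 * 2 ^ d * (xStarNorm f).toReal ^ 2
  have hA0 : ∀ n, 0 ≤ ∫ x, ‖(χ n x : ℂ) • G x + u x • cgrad (χ n) x‖ ^ 2 :=
    fun n => integral_nonneg fun x => by positivity
  have hB0 : ∀ n, 0 ≤ ∫ x, V x * ‖(χ n x : ℂ) * u x‖ ^ 2 := fun n =>
    integral_nonneg_of_ae (by filter_upwards [hV0] with x hx; positivity)
  have hG2 : Integrable (fun x => ‖G x‖ ^ 2) volume := by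
    refine integrable_of_forall_ball_le h.locallyIntegrable_grad_sq
      (Eventually.of_forall fun x => by positivity) (K := 2 * K) fun n => ?_
    have e : ∫ x in ball (0 : RSpace d) (n + 1), ‖G x‖ ^ 2
        = ∫ x in ball (0 : RSpace d) (n + 1), ‖(χ n x : ℂ) • G x + u x • cgrad (χ n) x‖ ^ 2 := by
      refine setIntegral_congr_fun measurableSet_ball fun x hx => ?_
      have : cgrad (χ n) x = 0 := by
        refine cgrad_eq_zero_of_eventuallyEq_const (c := 1) ?_
        filter_upwards [isOpen_ball.mem_nhds hx] with y hy using hχ1 n y hy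
      simp [hχ1 n x hx, this]
    rw [e]
    refine (setIntegral_le_integral (hw n).integrable_grad_sq
      (Eventually.of_forall fun x => by positivity)).trans ?_
    linarith [(key n).2, hB0 n]
  have hVu : Integrable (fun x => V x * ‖u x‖ ^ 2) volume := by
    refine integrable_of_forall_ball_le h.locallyIntegrable_energy
      (by filter_upwards [hV0] with x hx; positivity) (K := K) fun n => ?_
    have e : ∫ x in ball (0 : RSpace d) (n + 1), V x * ‖u x‖ ^ 2
        = ∫ x in ball (0 : RSpace d) (n + 1), V x * ‖(χ n x : ℂ) * u x‖ ^ 2 := by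
      refine setIntegral_congr_fun measurableSet_ball fun x hx => ?_
      simp [hχ1 n x hx]
    rw [e]
    refine (setIntegral_le_integral (key n).1
      (by filter_upwards [hV0] with x hx; simp only [Pi.zero_apply]; positivity)).trans ?_
    linarith [(key n).2, hA0 n]
  exact h.isGlobalSolution hd hVm hV0 hf hfin ⟨hu, hG, h.memLp,
    (memLp_two_iff_integrable_sq_norm hG.aestronglyMeasurable).2 hG2, h.hasWeakGradient⟩ hVu

/-- Changing the representatives of a solution and of its gradient. -/
theorem IsHelmholtzSolution.congr_ae {V : RSpace d → ℝ} {ε τ : ℝ} {f u u' : RSpace d → ℂ}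
    {G G' : RSpace d → CSpace d} (h : IsHelmholtzSolution V ε τ f u G) (hu : u =ᵐ[volume] u')
    (hG : G =ᵐ[volume] G') : IsHelmholtzSolution V ε τ f u' G' where
  memLp := h.memLp.ae_eq hu
  hasWeakGradient :=
    { locallyIntegrable := h.hasWeakGradient.locallyIntegrable.congr hu
      locallyIntegrable_grad := h.hasWeakGradient.locallyIntegrable_grad.congr hG
      integral_eq := by
        intro φ hφ hc i
        have e1 := h.hasWeakGradient.integral_eq φ hφ hc i
        have e2 : ∫ x, ((fderiv ℝ φ x (EuclideanSpace.single i 1) : ℝ) : ℂ) * u x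
            = ∫ x, ((fderiv ℝ φ x (EuclideanSpace.single i 1) : ℝ) : ℂ) * u' x :=
          integral_congr_ae (hu.mono fun x hx => by simp only [hx])
        have e3 : ∫ x, ((φ x : ℝ) : ℂ) * G x i = ∫ x, ((φ x : ℝ) : ℂ) * G' x i :=
          integral_congr_ae (hG.mono fun x hx => by simp only [hx])
        rw [← e2, e1, e3] }
  locallyIntegrable_grad_sq := h.locallyIntegrable_grad_sq.congr
    (hG.mono fun x hx => by simp only [hx])
  locallyIntegrable_energy := h.locallyIntegrable_energy.congr
    (hu.mono fun x hx => by simp only [hx])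
  equation := by
    intro v Gv hv
    have e1 : ∫ x, ∑ i, G x i * conj (Gv x i) = ∫ x, ∑ i, G' x i * conj (Gv x i) :=
      integral_congr_ae (hG.mono fun x hx => by simp only [hx])
    have e2 : ∫ x, (V x : ℂ) * u x * conj (v x) = ∫ x, (V x : ℂ) * u' x * conj (v x) :=
      integral_congr_ae (hu.mono fun x hx => by simp only [hx])
    have e3 : ∫ x, u x * conj (v x) = ∫ x, u' x * conj (v x) :=
      integral_congr_ae (hu.mono fun x hx => by simp only [hx])
    rw [← h.equation v Gv hv, e1, e2, e3]

end GlobalBounds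

/-! ### Construction of the concave radial multipliers. -/

section Profile

open Filter Topology

/-- The radial multiplier of scale `R`: `q r = g r / r` and `p = g'`, where `g` is concave, equal to
`r / R` for `r ≤ R` and constant for `r ≥ (11/10) R`. -/
structure IsMultiplier (q p : ℝ → ℝ) (R : ℝ) : Prop where
  pos : 0 < R
  contDiff_q : ContDiff ℝ ∞ q
  contDiff_p : ContDiff ℝ ∞ p
  q_eq : ∀ r ≤ R, q r = R⁻¹
  p_eq : ∀ r ≤ R, p r = R⁻¹
  p_eq_zero : ∀ r, 11 / 10 * R ≤ r → p r = 0
  rel : ∀ r, p r = q r + deriv q r * r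
  p_nonneg : ∀ r, 0 ≤ p r
  p_le : ∀ r, p r ≤ R⁻¹
  abs_deriv_p_le : ∀ r, |deriv p r| ≤ 100 / 9 / R ^ 2
  q_nonneg : ∀ r, 0 ≤ q r
  q_le : ∀ r, q r ≤ R⁻¹
  mul_q_le : ∀ r, 0 ≤ r → r * q r ≤ 11 / 10
  deriv_q_nonpos : ∀ r, deriv q r ≤ 0

/-- A normalised bump on `[1, 11/10]`. Its plateau has length `9/100`, so its height is at most
`100/9`, slightly more than the least possible `10`; this sharpness is needed for the numerical
absorption later. -/
theorem exists_cutoff_density : ∃ k : ℝ → ℝ, ContDiff ℝ ∞ k ∧ (∀ t, 0 ≤ k t) ∧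
    (∀ t, k t ≤ 100 / 9) ∧ (∀ t ≤ 1, k t = 0) ∧ (∀ t, 11 / 10 ≤ t → k t = 0) ∧
    ∫ t, k t = 1 := by
  let b : ContDiffBump (21 / 20 : ℝ) := ⟨9 / 200, 1 / 20, by norm_num, by norm_num⟩
  have hz : ∀ t, 1 / 20 ≤ |t - 21 / 20| → b.normed volume t = 0 := by
    intro t ht
    rw [ContDiffBump.normed, b.zero_of_le_dist (by rwa [Real.dist_eq]), zero_div]
  refine ⟨b.normed volume, b.contDiff_normed, fun t => b.nonneg_normed t, fun t => ?_,
    fun t ht => ?_, fun t ht => ?_, b.integral_normed⟩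
  · refine (b.normed_le_div_measure_closedBall_rIn volume t).trans ?_
    rw [Measure.real, Real.volume_closedBall, ENNReal.toReal_ofReal (by norm_num)]
    norm_num
  · apply hz
    rw [abs_of_nonpos (by linarith)]
    linarith
  · apply hz
    rw [abs_of_nonneg (by linarith)]
    linarith

theorem contDiff_integral_of_contDiff {k : ℝ → ℝ} (hk : ContDiff ℝ ∞ k) :
    ContDiff ℝ ∞ fun r => ∫ t in (0 : ℝ)..r, k t := by
  have hd : ∀ r, HasDerivAt (fun r => ∫ t in (0 : ℝ)..r, k t) (k r) r := fun r =>
    intervalIntegral.integral_hasDerivAt_right (hk.continuous.intervalIntegrable _ _)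
      (hk.continuous.stronglyMeasurableAtFilter _ _) hk.continuous.continuousAt
  rw [contDiff_infty_iff_deriv]
  refine ⟨fun r => (hd r).differentiableAt, ?_⟩
  rw [show deriv (fun r => ∫ t in (0 : ℝ)..r, k t) = k from funext fun r => (hd r).deriv]
  exact hk

/-- Two integrations of the density: `m = ∫ k` rises from `0` to `1`, `s = ∫ m`, and `g = r - s` is
concave. Then `p = g' = 1 - m` and `q = g/r = 1 - s/r`, which is harmless at `r = 0` because `s`
vanishes up to `1`. -/
theorem exists_unit_multiplier : ∃ q p : ℝ → ℝ, IsMultiplier q p 1 := by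
  obtain ⟨k, hk, hk0, hkle, hk1, hk2, hkint⟩ := exists_cutoff_density
  have hki : ∀ a b, IntervalIntegrable k volume a b := fun a b => hk.continuous.intervalIntegrable _ _
  set m : ℝ → ℝ := fun r => ∫ t in (0 : ℝ)..r, k t with hm
  have hmC : ContDiff ℝ ∞ m := contDiff_integral_of_contDiff hk
  have hmd : ∀ r, HasDerivAt m (k r) r := fun r =>
    intervalIntegral.integral_hasDerivAt_right (hki _ _)
      (hk.continuous.stronglyMeasurableAtFilter _ _) hk.continuous.continuousAt
  have hmono : Monotone m := monotone_of_hasDerivAt_nonneg hmd hk0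
  have hm0 : ∀ r ≤ 1, m r = 0 := by
    intro r hr
    rw [hm]
    simp only
    rw [intervalIntegral.integral_congr (g := fun _ => 0)]
    · simp
    · intro t ht
      exact hk1 t (ht.2.trans (max_le zero_le_one hr))
  have hm1 : ∀ r, 11 / 10 ≤ r → m r = 1 := by
    intro r hr
    rw [← hkint, hm]
    simp only
    rw [intervalIntegral.integral_of_le (by linarith)]
    refine setIntegral_eq_integral_of_forall_compl_eq_zero fun t ht => ?_
    rw [mem_Ioc, not_and_or, not_lt, not_le] at ht
    rcases ht with ht | ht
    · exact hk1 t (by linarith)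
    · exact hk2 t (by linarith)
  have hmn : ∀ r, 0 ≤ m r := fun r => (hm0 (min r 1) (min_le_right _ _)).symm.le.trans
    (hmono (min_le_left _ _))
  have hmle : ∀ r, m r ≤ 1 := fun r => (hmono (le_max_left r (11 / 10))).trans
    (hm1 _ (le_max_right _ _)).le
  have hmi : ∀ a b, IntervalIntegrable m volume a b := fun a b =>
    hmC.continuous.intervalIntegrable _ _
  set s : ℝ → ℝ := fun r => ∫ t in (0 : ℝ)..r, m t with hs
  have hsC : ContDiff ℝ ∞ s := contDiff_integral_of_contDiff hmC
  have hsd : ∀ r, HasDerivAt s (m r) r := fun r =>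
    intervalIntegral.integral_hasDerivAt_right (hmi _ _)
      (hmC.continuous.stronglyMeasurableAtFilter _ _) hmC.continuous.continuousAt
  have hs0 : ∀ r ≤ 1, s r = 0 := by
    intro r hr
    rw [hs]
    simp only
    rw [intervalIntegral.integral_congr (g := fun _ => 0)]
    · simp
    · intro t ht
      exact hm0 t (ht.2.trans (max_le zero_le_one hr))
  have hsmono : Monotone s := monotone_of_hasDerivAt_nonneg hsd hmn
  have hsn : ∀ r, 0 ≤ s r := fun r => (hs0 (min r 1) (min_le_right _ _)).symm.le.trans
    (hsmono (min_le_left _ _))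
  have hsle : ∀ r, 0 ≤ r → s r ≤ r * m r := by
    intro r hr
    calc s r ≤ ∫ t in (0 : ℝ)..r, m r :=
          intervalIntegral.integral_mono_on hr (hmi _ _) (by simp) fun t ht => hmono ht.2
      _ = r * m r := by simp
  -- This is the bound `g ≤ 11/10`, hence `r q(r) ≤ 11/10`.
  have hsge : ∀ r, r - 11 / 10 ≤ s r := by
    intro r
    rcases le_total r (11 / 10) with h | h
    · linarith [hsn r]
    · have h1 : s r = s (11 / 10) + ∫ t in (11 / 10 : ℝ)..r, m t :=
        (intervalIntegral.integral_add_adjacent_intervals (hmi _ _) (hmi _ _)).symm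
      have h2 : ∫ t in (11 / 10 : ℝ)..r, m t = ∫ t in (11 / 10 : ℝ)..r, (1 : ℝ) := by
        refine intervalIntegral.integral_congr fun t ht => ?_
        rw [uIcc_of_le h] at ht
        exact hm1 t ht.1
      rw [h1, h2]
      simp only [intervalIntegral.integral_const, smul_eq_mul, mul_one]
      linarith [hsn (11 / 10)]
  have hq1 : ∀ r ≤ 1, 1 - s r / r = 1 := fun r hr => by rw [hs0 r hr]; simp
  have hqd : ∀ r, HasDerivAt (fun r => 1 - s r / r) ((s r - r * m r) / r ^ 2) r := by
    intro r
    rcases lt_or_ge r 1 with h | h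
    · have e : (s r - r * m r) / r ^ 2 = 0 := by rw [hs0 r h.le, hm0 r h.le]; simp
      rw [e]
      refine (hasDerivAt_const r (1 : ℝ)).congr_of_eventuallyEq ?_
      filter_upwards [Iio_mem_nhds h] with t ht using hq1 t (le_of_lt ht)
    · have hr : r ≠ 0 := by linarith
      have h2 := ((hsd r).div (hasDerivAt_id r) hr).const_sub 1
      refine h2.congr_deriv ?_
      simp
      ring
  refine ⟨fun r => 1 - s r / r, fun r => 1 - m r, one_pos, ?_, contDiff_const.sub hmC, ?_, ?_, ?_,
    ?_, ?_, ?_, ?_, ?_, ?_, ?_, ?_⟩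
  · rw [contDiff_iff_contDiffAt]
    intro r
    rcases lt_or_ge r 1 with h | h
    · refine (contDiffAt_const (c := (1 : ℝ))).congr_of_eventuallyEq ?_
      filter_upwards [Iio_mem_nhds h] with t ht using hq1 t (le_of_lt ht)
    · exact contDiffAt_const.sub (hsC.contDiffAt.div contDiffAt_id (by linarith : r ≠ 0))
  · intro r hr
    simp [hq1 r hr]
  · intro r hr
    simp [hm0 r hr]
  · intro r hr
    simp [hm1 r (by linarith)]
  · intro r
    rw [(hqd r).deriv]
    rcases eq_or_ne r 0 with rfl | hr
    · simp [hm0 0 zero_le_one]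
    · field_simp
      ring
  · intro r; linarith [hmle r]
  · intro r; simp [hmn r]
  · intro r
    rw [((hmd r).const_sub 1).deriv, abs_neg, abs_of_nonneg (hk0 r)]
    simpa using hkle r
  · intro r
    rcases le_total r 1 with h | h
    · rw [hq1 r h]; exact zero_le_one
    · have : s r / r ≤ 1 := by
        rw [div_le_one (by linarith)]
        calc s r ≤ r * m r := hsle r (by linarith)
          _ ≤ r * 1 := by
            have := hmle r
            gcongr
          _ = r := mul_one r
      linarith
  · intro r
    rcases le_total r 1 with h | h
    · rw [hq1 r h]; simp
    · have : 0 ≤ s r / r := div_nonneg (hsn r) (by linarith)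
      simp [this]
  · intro r hr
    rcases hr.eq_or_lt with rfl | h
    · norm_num
    · have : r * (1 - s r / r) = r - s r := by field_simp
      rw [this]
      linarith [hsge r]
  · intro r
    rw [(hqd r).deriv]
    rcases le_total r 0 with h | h
    · rw [hs0 r (by linarith), hm0 r (by linarith)]; simp
    · exact div_nonpos_of_nonpos_of_nonneg (by linarith [hsle r h]) (by positivity)

theorem IsMultiplier.scale {q p : ℝ → ℝ} (h : IsMultiplier q p 1) {R : ℝ} (hR : 0 < R) :
    IsMultiplier (fun r => R⁻¹ * q (R⁻¹ * r)) (fun r => R⁻¹ * p (R⁻¹ * r)) R := by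
  have hle : ∀ r, r ≤ R → R⁻¹ * r ≤ 1 := fun r hr => by rwa [inv_mul_le_iff₀ hR, mul_one]
  have hdq : ∀ r, deriv (fun r => R⁻¹ * q (R⁻¹ * r)) r = R⁻¹ * (R⁻¹ * deriv q (R⁻¹ * r)) := by
    intro r
    rw [deriv_const_mul_field, deriv_comp_mul_left, smul_eq_mul]
  have hdp : ∀ r, deriv (fun r => R⁻¹ * p (R⁻¹ * r)) r = R⁻¹ * (R⁻¹ * deriv p (R⁻¹ * r)) := by
    intro r
    rw [deriv_const_mul_field, deriv_comp_mul_left, smul_eq_mul]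
  have hRi : 0 < R⁻¹ := inv_pos.2 hR
  refine ⟨hR, contDiff_const.mul (h.contDiff_q.comp (contDiff_const.mul contDiff_id)),
    contDiff_const.mul (h.contDiff_p.comp (contDiff_const.mul contDiff_id)), fun r hr => ?_,
    fun r hr => ?_, fun r hr => ?_, fun r => ?_, fun r => mul_nonneg hRi.le (h.p_nonneg _),
    fun r => ?_, fun r => ?_, fun r => mul_nonneg hRi.le (h.q_nonneg _), fun r => ?_,
    fun r hr => ?_, fun r => ?_⟩
  · rw [h.q_eq _ (hle r hr)]; simp
  · rw [h.p_eq _ (hle r hr)]; simp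
  · rw [h.p_eq_zero, mul_zero]
    rw [le_inv_mul_iff₀ hR]; linarith
  · rw [hdq, h.rel]; ring
  · have := h.p_le (R⁻¹ * r)
    simp only [inv_one] at this
    exact mul_le_of_le_one_right hRi.le this
  · have := h.abs_deriv_p_le (R⁻¹ * r)
    rw [hdp, abs_mul, abs_mul, abs_of_pos hRi]
    simp only [one_pow, div_one] at this
    calc R⁻¹ * (R⁻¹ * |deriv p (R⁻¹ * r)|) ≤ R⁻¹ * (R⁻¹ * (100 / 9)) := by gcongr
      _ = _ := by field_simp
  · have := h.q_le (R⁻¹ * r)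
    simp only [inv_one] at this
    exact mul_le_of_le_one_right hRi.le this
  · have := h.mul_q_le (R⁻¹ * r) (by positivity)
    linarith
  · rw [hdq]
    have := h.deriv_q_nonpos (R⁻¹ * r)
    exact mul_nonpos_of_nonneg_of_nonpos hRi.le (mul_nonpos_of_nonneg_of_nonpos hRi.le this)

theorem exists_multiplier {R : ℝ} (hR : 0 < R) : ∃ q p : ℝ → ℝ, IsMultiplier q p R := by
  obtain ⟨q, p, h⟩ := exists_unit_multiplier
  exact ⟨_, _, h.scale hR⟩

end Profile

/-! ### Dilations in `L²`, and the asymptotic size of weighted increments. -/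

section Dilations

open Filter Topology

variable {d : ℕ}

theorem integral_mul_le_sqrt {α : Type*} [MeasurableSpace α] {μ : Measure α} {f g : α → ℝ}
    (hf : AEStronglyMeasurable f μ) (hg : AEStronglyMeasurable g μ) (hf0 : ∀ x, 0 ≤ f x)
    (hg0 : ∀ x, 0 ≤ g x) (hfi : Integrable (fun x => f x ^ 2) μ)
    (hgi : Integrable (fun x => g x ^ 2) μ) :
    ∫ x, f x * g x ∂μ ≤ √(∫ x, f x ^ 2 ∂μ) * √(∫ x, g x ^ 2 ∂μ) := by
  have e : ENNReal.ofReal 2 = 2 := by simp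
  have h := integral_mul_le_Lp_mul_Lq_of_nonneg (μ := μ) Real.HolderConjugate.two_two
    (Eventually.of_forall hf0) (Eventually.of_forall hg0)
    (by rw [e]; exact (memLp_two_iff_integrable_sq hf).2 hfi)
    (by rw [e]; exact (memLp_two_iff_integrable_sq hg).2 hgi)
  simpa only [Real.rpow_two, Real.sqrt_eq_rpow] using h

theorem eventually_near_one : ∀ᶠ l : ℝ in 𝓝[<] 1, l ∈ Ioo (1 / 2 : ℝ) 1 :=
  Ioo_mem_nhdsLT (by norm_num)

theorem inv_pow_le_two_pow {l : ℝ} (hl : 1 / 2 ≤ l) (n : ℕ) : (l ^ n)⁻¹ ≤ 2 ^ n := by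
  have hl0 : 0 < l := by linarith
  rw [← inv_pow]
  have : l⁻¹ ≤ 2 := by rw [inv_le_comm₀ hl0 (by norm_num)]; linarith
  gcongr

/-- Continuity of dilations in `L²`. -/
theorem IsH1.tendsto_integral_sub_dilation_sq {u : RSpace d → ℂ} {G : RSpace d → CSpace d}
    (h : IsH1 u G) : Tendsto (fun l : ℝ => ∫ x, ‖u x - u (l • x)‖ ^ 2) (𝓝[<] 1) (𝓝 0) := by
  have hu := h.measurable
  have hN0 : 0 ≤ ∫ x, ‖G x‖ ^ 2 := integral_nonneg fun x => by positivity
  -- the mass far away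
  have htail : Tendsto (fun n : ℕ => ∫ x, indicator {y : RSpace d | (n : ℝ) ≤ ‖y‖}
      (fun y => ‖u y‖ ^ 2) x) atTop (𝓝 0) := by
    have := tendsto_integral_of_dominated_convergence (μ := (volume : Measure (RSpace d)))
      (F := fun (n : ℕ) x => indicator {y : RSpace d | (n : ℝ) ≤ ‖y‖} (fun y => ‖u y‖ ^ 2) x)
      (f := fun _ => 0) (fun x => ‖u x‖ ^ 2) (fun n => ?_) h.integrable_sq (fun n => ?_) ?_
    · simpa using this
    · exact ((hu.norm.pow_const 2).indicator
        (measurableSet_le measurable_const measurable_norm)).aestronglyMeasurable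
    · refine Eventually.of_forall fun x => ?_
      refine (norm_indicator_le_norm_self _ _).trans ?_
      simp
    · refine Eventually.of_forall fun x => ?_
      obtain ⟨N, hN⟩ := exists_nat_gt ‖x‖
      refine tendsto_const_nhds.congr' ?_
      filter_upwards [eventually_ge_atTop N] with n hn
      have : (N : ℝ) ≤ n := by exact_mod_cast hn
      rw [indicator_of_notMem]
      simp only [Set.mem_ofPred_eq, not_le]
      linarith
  -- For `|x| ≤ 2n` the estimate weighted by `|x|⁻²` suffices. For `|x| ≥ 2n` both `x` and `l x` lie
  -- outside `B_n`, as `l > 1/2`, and the tail of `|u|²` controls the increment.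
  have hbound : ∀ n : ℕ, ∀ l ∈ Ioo (1 / 2 : ℝ) 1, ∫ x, ‖u x - u (l • x)‖ ^ 2
      ≤ (2 * n) ^ 2 * ((1 - l) ^ 2 * 2 ^ d * ∫ x, ‖G x‖ ^ 2)
        + (2 + 2 * 2 ^ d) * ∫ x, indicator {y : RSpace d | (n : ℝ) ≤ ‖y‖}
          (fun y => ‖u y‖ ^ 2) x := by
    intro n l hl
    have hl0 : 0 < l := by linarith [hl.1]
    obtain ⟨hi1, hi1v⟩ := h.integral_sub_dilation_div_le hl0 hl.2.le
    set m : RSpace d → ℝ := indicator {y : RSpace d | (n : ℝ) ≤ ‖y‖} (fun y => ‖u y‖ ^ 2) with hm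
    have hmi : Integrable m volume := h.integrable_sq.indicator
      (measurableSet_le measurable_const measurable_norm)
    have hm0 : ∀ x, 0 ≤ m x := fun x => indicator_nonneg (fun y _ => by positivity) x
    have hmint : 0 ≤ ∫ x, m x := integral_nonneg hm0
    have hmli : Integrable (fun x => m (l • x)) volume := hmi.comp_smul hl0.ne'
    have hmv : ∫ x, m (l • x) ≤ 2 ^ d * ∫ x, m x := by
      rw [integral_comp_smul_of_pos m hl0, smul_eq_mul]
      exact mul_le_mul_of_nonneg_right (inv_pow_le_two_pow hl.1.le d) hmint
    have hpt : ∀ᵐ x : RSpace d, ‖u x - u (l • x)‖ ^ 2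
        ≤ (2 * n) ^ 2 * (‖u x - u (l • x)‖ ^ 2 / ‖x‖ ^ 2) + (2 * m x + 2 * m (l • x)) := by
      refine Eventually.of_forall fun x => ?_
      rcases eq_or_ne x 0 with rfl | hx
      · have := hm0 0
        simp
        linarith
      have hx0 : 0 < ‖x‖ := norm_pos_iff.2 hx
      have h1 := hm0 x
      have h2 := hm0 (l • x)
      rcases le_total ‖x‖ (2 * n) with hle | hle
      · have : ‖u x - u (l • x)‖ ^ 2 ≤ (2 * n) ^ 2 * (‖u x - u (l • x)‖ ^ 2 / ‖x‖ ^ 2) := by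
          rw [mul_div_assoc', le_div_iff₀ (by positivity), mul_comm]
          gcongr
        linarith
      · have hx1 : (n : ℝ) ≤ ‖x‖ := by linarith [(n.cast_nonneg : (0 : ℝ) ≤ n)]
        have hx2 : (n : ℝ) ≤ ‖l • x‖ := by
          rw [norm_smul, Real.norm_of_nonneg hl0.le]
          nlinarith [hl.1]
        have e1 : m x = ‖u x‖ ^ 2 := indicator_of_mem (by exact hx1) _
        have e2 : m (l • x) = ‖u (l • x)‖ ^ 2 := indicator_of_mem (by exact hx2) _
        have h3 := norm_sub_le (u x) (u (l • x))
        have h4 : ‖u x - u (l • x)‖ ^ 2 ≤ 2 * m x + 2 * m (l • x) := by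
          rw [e1, e2]
          calc _ ≤ (‖u x‖ + ‖u (l • x)‖) ^ 2 := by gcongr
            _ ≤ _ := by nlinarith [sq_nonneg (‖u x‖ - ‖u (l • x)‖)]
        have : 0 ≤ (2 * n) ^ 2 * (‖u x - u (l • x)‖ ^ 2 / ‖x‖ ^ 2) := by positivity
        linarith
    have hi3 : Integrable (fun x => 2 * m x + 2 * m (l • x)) volume :=
      (hmi.const_mul 2).add (hmli.const_mul 2)
    have hi2 : Integrable (fun x => (2 * (n : ℝ)) ^ 2 * (‖u x - u (l • x)‖ ^ 2 / ‖x‖ ^ 2)) volume :=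
      hi1.const_mul _
    have hI := integral_mono_ae (h.sub (h.comp_smul hl0)).integrable_sq (hi2.add hi3) hpt
    have eI : ∫ x, ((2 * (n : ℝ)) ^ 2 * (‖u x - u (l • x)‖ ^ 2 / ‖x‖ ^ 2)
        + (2 * m x + 2 * m (l • x)))
        = (2 * n) ^ 2 * (∫ x, ‖u x - u (l • x)‖ ^ 2 / ‖x‖ ^ 2)
          + (2 * (∫ x, m x) + 2 * ∫ x, m (l • x)) := by
      rw [integral_add hi2 hi3, integral_const_mul, integral_add (hmi.const_mul 2)
        (hmli.const_mul 2), integral_const_mul, integral_const_mul]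
    have hI := hI.trans_eq eI
    have h5 : ∫ x, ‖u x - u (l • x)‖ ^ 2 / ‖x‖ ^ 2 ≤ (1 - l) ^ 2 * 2 ^ d * ∫ x, ‖G x‖ ^ 2 := by
      refine hi1v.trans ?_
      have := inv_pow_le_two_pow hl.1.le d
      gcongr
    have h6 : (2 * (n : ℝ)) ^ 2 * (∫ x, ‖u x - u (l • x)‖ ^ 2 / ‖x‖ ^ 2)
        ≤ (2 * n) ^ 2 * ((1 - l) ^ 2 * 2 ^ d * ∫ x, ‖G x‖ ^ 2) := by gcongr
    linarith
  rw [Metric.tendsto_nhds]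
  intro e he
  have h1 : ∀ᶠ n : ℕ in atTop, (2 + 2 * 2 ^ d) * (∫ x, indicator {y : RSpace d | (n : ℝ) ≤ ‖y‖}
      (fun y => ‖u y‖ ^ 2) x) < e / 2 := by
    have := htail.const_mul (2 + 2 * 2 ^ d : ℝ)
    rw [mul_zero] at this
    exact this.eventually_lt_const (by positivity)
  obtain ⟨n, hn⟩ := h1.exists
  have h2 : Tendsto (fun l : ℝ => (2 * n) ^ 2 * ((1 - l) ^ 2 * 2 ^ d * ∫ x, ‖G x‖ ^ 2)) (𝓝[<] 1)
      (𝓝 0) := by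
    have : ContinuousAt (fun l : ℝ => (2 * n) ^ 2 * ((1 - l) ^ 2 * 2 ^ d * ∫ x, ‖G x‖ ^ 2)) 1 := by
      fun_prop
    have := this.tendsto
    simp only [sub_self, ne_eq, OfNat.ofNat_ne_zero, not_false_eq_true, zero_pow, zero_mul,
      mul_zero] at this
    exact this.mono_left nhdsWithin_le_nhds
  filter_upwards [eventually_near_one, h2.eventually_lt_const (half_pos he)] with l hl hl2
  have h0 : 0 ≤ ∫ x, ‖u x - u (l • x)‖ ^ 2 := integral_nonneg fun x => by positivity
  rw [Real.dist_eq, sub_zero, abs_of_nonneg h0]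
  linarith [hbound n l hl]

/-- The weighted difference quotient is asymptotically bounded by the weighted Euler derivative. -/
theorem IsH1.eventually_sub_dilation_le {u : RSpace d → ℂ} {G : RSpace d → CSpace d} (h : IsH1 u G)
    {ψ : RSpace d → ℝ} (hψ : Continuous ψ) (hψ0 : ∀ x, 0 ≤ ψ x) {C : ℝ} (hC : ∀ x, ψ x ≤ C)
    {e : ℝ} (he : 0 < e) :
    ∀ᶠ l : ℝ in 𝓝[<] 1, ∫ x, ψ x / ‖x‖ ^ 2 * ‖u x - u (l • x)‖ ^ 2
      ≤ (1 - l) ^ 2 * ((∫ x, ψ x / ‖x‖ ^ 2 * ‖euler G x‖ ^ 2) + e) := by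
  have hu := h.measurable
  have hEm := measurable_euler h.measurable_grad
  have hC0 : 0 ≤ C := (hψ0 0).trans (hC 0)
  have hψm := hψ.measurable
  -- The weighted square norm of the dilated Euler derivative, written after a change of variables
  -- so that `s` acts only on the continuous weight and `T` converges as `s → 1`.
  set T : ℝ → ℝ := fun s => ∫ x, (s ^ d)⁻¹ * (ψ (s⁻¹ • x) / ‖x‖ ^ 2 * ‖euler G x‖ ^ 2) with hTdef
  have hpt : ∀ (w : ℝ), 0 ≤ w → w ≤ C → ∀ x : RSpace d,
      w / ‖x‖ ^ 2 * ‖euler G x‖ ^ 2 ≤ C * ‖G x‖ ^ 2 := by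
    intro w hw hwC x
    have := norm_euler_sq_div_le G x
    calc w / ‖x‖ ^ 2 * ‖euler G x‖ ^ 2 = w * (‖euler G x‖ ^ 2 / ‖x‖ ^ 2) := by ring
      _ ≤ C * ‖G x‖ ^ 2 := by gcongr
  have hTi : ∀ s : ℝ, 0 < s → Integrable (fun x => ψ (s⁻¹ • x) / ‖x‖ ^ 2 * ‖euler G x‖ ^ 2) volume := by
    intro s hs
    have hm : Measurable fun x => ψ (s⁻¹ • x) / ‖x‖ ^ 2 * ‖euler G x‖ ^ 2 := by fun_prop
    refine (h.integrable_grad_sq.const_mul C).mono' hm.aestronglyMeasurable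
      (Eventually.of_forall fun x => ?_)
    have := hψ0 (s⁻¹ • x)
    rw [Real.norm_of_nonneg (by positivity)]
    exact hpt _ this (hC _) x
  have hT : Tendsto T (𝓝[<] 1) (𝓝 (∫ x, ψ x / ‖x‖ ^ 2 * ‖euler G x‖ ^ 2)) := by
    refine tendsto_integral_filter_of_dominated_convergence
      (fun x => 2 ^ d * (C * ‖G x‖ ^ 2)) ?_ ?_ ((h.integrable_grad_sq.const_mul C).const_mul _) ?_
    · filter_upwards [eventually_near_one] with s hs
      exact ((hTi s (by linarith [hs.1])).const_mul _).aestronglyMeasurable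
    · filter_upwards [eventually_near_one] with s hs
      filter_upwards with x
      have hs0 : 0 < s := by linarith [hs.1]
      have h0 := hψ0 (s⁻¹ • x)
      rw [Real.norm_of_nonneg (by positivity)]
      exact mul_le_mul (inv_pow_le_two_pow hs.1.le d) (hpt _ h0 (hC _) x) (by positivity)
        (by positivity)
    · filter_upwards with x
      have h1 : ContinuousAt (fun s : ℝ => (s ^ d)⁻¹ * (ψ (s⁻¹ • x) / ‖x‖ ^ 2 *
          ‖euler G x‖ ^ 2)) 1 := by
        have h2 : ContinuousAt (fun s : ℝ => ψ (s⁻¹ • x)) 1 :=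
          hψ.continuousAt.comp ((continuousAt_inv₀ one_ne_zero).smul continuousAt_const)
        have h3 : ContinuousAt (fun s : ℝ => (s ^ d)⁻¹) 1 :=
          (continuousAt_pow 1 d).inv₀ (by simp)
        exact h3.mul ((h2.div_const _).mul continuousAt_const)
      have := h1.tendsto
      simp only [one_pow, inv_one, one_smul, one_mul] at this
      exact this.mono_left nhdsWithin_le_nhds
  have hev := hT.eventually_le_const (lt_add_of_pos_right _ he)
  rw [eventually_nhdsWithin_iff, Metric.eventually_nhds_iff] at hev
  obtain ⟨δ, hδ, hδT⟩ := hev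
  have hnear2 : ∀ᶠ l : ℝ in 𝓝[<] 1, l ∈ Ioo (1 - δ) 1 := Ioo_mem_nhdsLT (by linarith)
  filter_upwards [eventually_near_one, hnear2] with l hl hl2
  have hl0 : 0 < l := by linarith [hl.1]
  have hp : 0 < 1 - l := by linarith [hl.2]
  set B := (∫ x, ψ x / ‖x‖ ^ 2 * ‖euler G x‖ ^ 2) + e with hB
  have hB0 : 0 ≤ B := add_nonneg (integral_nonneg fun x => by
    have := hψ0 x
    positivity) he.le
  -- The limit controls only `s < 1`; the endpoint `s = 1` belongs to the interval of integration
  -- and is checked directly.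
  have hTB : ∀ s ∈ Ioc l 1, ∫ x, (s ^ d)⁻¹ * (ψ (s⁻¹ • x) / ‖x‖ ^ 2 * ‖euler G x‖ ^ 2) ≤ B := by
    intro s hs
    rcases hs.2.eq_or_lt with rfl | h1
    · simp only [one_pow, inv_one, one_smul, one_mul]
      rw [hB]; linarith
    · refine hδT ?_ h1
      rw [Real.dist_eq, abs_of_neg (by linarith)]
      linarith [hs.1, hl2.1]
  have hA := h.lintegral_sub_dilation_le hl0 hl.2.le
    (w := fun x => ENNReal.ofReal (ψ x / ‖x‖ ^ 2)) (by fun_prop)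
  have hA2 : ∀ s ∈ Ioc l 1, ∫⁻ x, ENNReal.ofReal (ψ x / ‖x‖ ^ 2) *
      ‖(s : ℂ)⁻¹ * euler G (s • x)‖ₑ ^ 2 ≤ ENNReal.ofReal B := by
    intro s hs
    have hs0 : 0 < s := hl0.trans hs.1
    refine le_trans (le_of_eq ?_) (ENNReal.ofReal_le_ofReal (hTB s hs))
    rw [integral_const_mul, ENNReal.ofReal_mul (by positivity),
      ofReal_integral_eq_lintegral_ofReal (hTi s hs0) (Eventually.of_forall fun x => by
        have := hψ0 (s⁻¹ • x)
        simp only [Pi.zero_apply]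
        positivity), ← lintegral_comp_smul_of_pos _ hs0]
    refine lintegral_congr fun x => ?_
    have h0 := hψ0 x
    rw [smul_smul, inv_mul_cancel₀ hs0.ne', one_smul, ← ofReal_norm,
      ← ENNReal.ofReal_pow (norm_nonneg _), ← ENNReal.ofReal_mul (by positivity)]
    congr 1
    rw [norm_mul, norm_inv, Complex.norm_real, norm_smul, Real.norm_of_nonneg hs0.le]
    field_simp
  have hA3 : ∫⁻ s in Ioc l 1, ∫⁻ x, ENNReal.ofReal (ψ x / ‖x‖ ^ 2) *
      ‖(s : ℂ)⁻¹ * euler G (s • x)‖ₑ ^ 2 ≤ ENNReal.ofReal (1 - l) * ENNReal.ofReal B := by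
    refine (setLIntegral_mono' measurableSet_Ioc hA2).trans (le_of_eq ?_)
    rw [setLIntegral_const, Real.volume_Ioc, mul_comm]
  have hA4 := hA.trans (mul_le_mul' le_rfl hA3)
  rw [← ENNReal.ofReal_mul hp.le, ← ENNReal.ofReal_mul hp.le] at hA4
  have hul := (h.comp_smul hl0).measurable
  rw [integral_eq_lintegral_of_nonneg_ae (Eventually.of_forall fun x => by
      have := hψ0 x
      simp only [Pi.zero_apply]
      positivity) (Measurable.aestronglyMeasurable (by fun_prop))]
  refine ENNReal.toReal_le_of_le_ofReal (by positivity) ?_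
  rw [show (1 - l) ^ 2 * B = (1 - l) * ((1 - l) * B) by ring]
  refine le_trans (le_of_eq (lintegral_congr fun x => ?_)) hA4
  have h0 := hψ0 x
  rw [ENNReal.ofReal_mul (by positivity), ENNReal.ofReal_pow (norm_nonneg _), ofReal_norm]

/-- Substitution `x = y / l` against a dilated function. -/
theorem integral_mul_comp_smul {Q F : RSpace d → ℝ} {l : ℝ} (hl : 0 < l) :
    ∫ x, Q x * F (l • x) = (l ^ d)⁻¹ * ∫ y, Q (l⁻¹ • y) * F y := by
  have h1 := integral_comp_smul_of_pos (fun y : RSpace d => Q (l⁻¹ • y) * F y) hl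
  simp only [smul_smul, inv_mul_cancel₀ hl.ne', one_smul, smul_eq_mul] at h1
  exact h1

end Dilations

/-! ### Pointwise properties of the multipliers and of their gradients. -/

section Multipliers

open Filter Topology

variable {d : ℕ}

theorem cgrad_radial {q : ℝ → ℝ} (hq : Differentiable ℝ q) {a : ℝ} (ha : 0 < a)
    (hc : ∀ r < a, q r = q 0) (x : RSpace d) :
    cgrad (fun x : RSpace d => q ‖x‖) x
      = ((deriv q ‖x‖ / ‖x‖ : ℝ) : ℂ) • WithLp.toLp 2 fun i => (x i : ℂ) := by
  ext i
  simp only [cgrad, fderiv_radial hq ha hc, PiLp.smul_apply, smul_eq_mul]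
  rw [EuclideanSpace.inner_single_right]
  push_cast
  simp
  ring

theorem inner_cgrad_radial {q : ℝ → ℝ} (hq : Differentiable ℝ q) {a : ℝ} (ha : 0 < a)
    (hc : ∀ r < a, q r = q 0) (G : RSpace d → CSpace d) (x : RSpace d) :
    inner ℂ (cgrad (fun x : RSpace d => q ‖x‖) x) (G x)
      = ((deriv q ‖x‖ / ‖x‖ : ℝ) : ℂ) * euler G x := by
  rw [cgrad_radial hq ha hc, inner_smul_left, Complex.conj_ofReal]
  congr 1
  simp [PiLp.inner_apply, euler, mul_comm]

theorem norm_cgrad_radial_le {q : ℝ → ℝ} (hq : Differentiable ℝ q) {a : ℝ} (ha : 0 < a)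
    (hc : ∀ r < a, q r = q 0) (x : RSpace d) :
    ‖cgrad (fun x : RSpace d => q ‖x‖) x‖ ≤ |deriv q ‖x‖| := by
  have e2 : ‖(WithLp.toLp 2 fun i => (x i : ℂ) : CSpace d)‖ = ‖x‖ := by
    simp [EuclideanSpace.norm_eq]
  rw [cgrad_radial hq ha hc, norm_smul, e2, Complex.norm_real, Real.norm_eq_abs, abs_div, abs_norm]
  rcases eq_or_ne ‖x‖ 0 with h0 | h0
  · simp [h0]
  · rw [div_mul_cancel₀ _ h0]

namespace IsMultiplier

variable {q p : ℝ → ℝ} {R : ℝ}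

theorem q_const (h : IsMultiplier q p R) : ∀ r < R, q r = q 0 := fun r hr => by
  rw [h.q_eq r hr.le, h.q_eq 0 h.pos.le]

theorem p_const (h : IsMultiplier q p R) : ∀ r < R, p r = p 0 := fun r hr => by
  rw [h.p_eq r hr.le, h.p_eq 0 h.pos.le]

theorem differentiable_q (h : IsMultiplier q p R) : Differentiable ℝ q := h.contDiff_q.differentiable (by simp)

theorem differentiable_p (h : IsMultiplier q p R) : Differentiable ℝ p := h.contDiff_p.differentiable (by simp)

theorem deriv_q_eq_zero (h : IsMultiplier q p R) {r : ℝ} (hr : r < R) : deriv q r = 0 := by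
  have : q =ᶠ[𝓝 r] fun _ => R⁻¹ := by
    filter_upwards [Iio_mem_nhds hr] with t ht using h.q_eq t (le_of_lt ht)
  rw [this.deriv_eq, deriv_const]

theorem deriv_p_eq_zero (h : IsMultiplier q p R) {r : ℝ} (hr : r < R) : deriv p r = 0 := by
  have : p =ᶠ[𝓝 r] fun _ => R⁻¹ := by
    filter_upwards [Iio_mem_nhds hr] with t ht using h.p_eq t (le_of_lt ht)
  rw [this.deriv_eq, deriv_const]

/-- Such a point is a minimum of the nonnegative function `p`; this argument includes the endpoint.
-/
theorem deriv_p_eq_zero_of_ge (h : IsMultiplier q p R) {r : ℝ} (hr : 11 / 10 * R ≤ r) :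
    deriv p r = 0 := by
  refine IsLocalMin.deriv_eq_zero (Eventually.of_forall fun s => ?_)
  rw [h.p_eq_zero r hr]
  exact h.p_nonneg s

theorem deriv_q_mul_nonpos (h : IsMultiplier q p R) {r : ℝ} (hr : 0 ≤ r) : deriv q r * r ≤ 0 :=
  mul_nonpos_of_nonpos_of_nonneg (h.deriv_q_nonpos r) hr

theorem neg_deriv_q_mul_le (h : IsMultiplier q p R) (r : ℝ) : -(deriv q r * r) ≤ q r := by
  linarith [h.rel r, h.p_nonneg r]

theorem abs_deriv_q_mul_le (h : IsMultiplier q p R) (r : ℝ) : |deriv q r * r| ≤ R⁻¹ := by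
  rcases lt_or_ge r R with hr | hr
  · rw [h.deriv_q_eq_zero hr, zero_mul, abs_zero]
    exact (inv_pos.2 h.pos).le
  · rw [abs_of_nonpos (h.deriv_q_mul_nonpos (h.pos.le.trans hr))]
    exact (h.neg_deriv_q_mul_le r).trans (h.q_le r)

theorem abs_deriv_q_le (h : IsMultiplier q p R) (r : ℝ) : |deriv q r| ≤ R⁻¹ / R := by
  have hR := h.pos
  rcases lt_or_ge r R with hr | hr
  · rw [h.deriv_q_eq_zero hr, abs_zero]
    positivity
  · rw [le_div_iff₀ hR]
    calc |deriv q r| * R ≤ |deriv q r| * |r| := by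
          gcongr
          exact hr.trans (le_abs_self r)
      _ = |deriv q r * r| := (abs_mul _ _).symm
      _ ≤ _ := h.abs_deriv_q_mul_le r

theorem p_le_q (h : IsMultiplier q p R) {r : ℝ} (hr : 0 ≤ r) : p r ≤ q r := by
  rw [h.rel r]
  linarith [h.deriv_q_mul_nonpos hr]

theorem antitone_q (h : IsMultiplier q p R) : Antitone q :=
  antitone_of_deriv_nonpos h.differentiable_q h.deriv_q_nonpos

theorem abs_q_le (h : IsMultiplier q p R) (r : ℝ) : |q r| ≤ R⁻¹ := by
  rw [abs_of_nonneg (h.q_nonneg r)]; exact h.q_le r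

theorem contDiff_radial_q (h : IsMultiplier q p R) : ContDiff ℝ ∞ fun x : RSpace d => q ‖x‖ :=
  contDiff_radial h.contDiff_q h.pos h.q_const

theorem contDiff_radial_p (h : IsMultiplier q p R) : ContDiff ℝ ∞ fun x : RSpace d => p ‖x‖ :=
  contDiff_radial h.contDiff_p h.pos h.p_const

theorem fderiv_radial_q (h : IsMultiplier q p R) (x : RSpace d) :
    fderiv ℝ (fun x : RSpace d => q ‖x‖) x x = deriv q ‖x‖ * ‖x‖ :=
  fderiv_radial_self h.differentiable_q h.pos h.q_const x

theorem abs_fderiv_radial_q_le (h : IsMultiplier q p R) (x : RSpace d) :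
    |fderiv ℝ (fun x : RSpace d => q ‖x‖) x x| ≤ R⁻¹ := by
  rw [h.fderiv_radial_q]; exact h.abs_deriv_q_mul_le _

theorem norm_cgrad_radial_q_le (h : IsMultiplier q p R) (x : RSpace d) :
    ‖cgrad (fun x : RSpace d => q ‖x‖) x‖ ≤ R⁻¹ / R :=
  (norm_cgrad_radial_le h.differentiable_q h.pos h.q_const x).trans (h.abs_deriv_q_le _)

/-- `r q(r) ≤ (11/10) min(1, ρ/R)` for `r ≤ ρ`. -/
theorem mul_q_le_min (h : IsMultiplier q p R) {r ρ : ℝ} (hr : 0 ≤ r) (hρ : r ≤ ρ) :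
    r * q r ≤ 11 / 10 * min 1 (ρ / R) := by
  have hR := h.pos
  rcases le_total 1 (ρ / R) with h1 | h1
  · rw [min_eq_left h1, mul_one]; exact h.mul_q_le r hr
  · rw [min_eq_right h1]
    have : r * q r ≤ ρ * R⁻¹ := mul_le_mul hρ (h.q_le r) (h.q_nonneg r) (hr.trans hρ)
    rw [← div_eq_mul_inv] at this
    have h2 : 0 ≤ ρ / R := div_nonneg (hr.trans hρ) hR.le
    linarith

end IsMultiplier

end Multipliers

/-! ### Potential energy of the dilated solution. -/

section Potential

open Filter Topology

variable {d : ℕ}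

/-- The dilated potential energy, controlled by the potential energy and a loss term. -/
theorem potential_dilation_le {V : RSpace d → ℝ} (hd : 0 < d) (hVm : AEMeasurable V volume)
    (hV0 : ∀ x, x ≠ 0 → 0 ≤ V x) {u : RSpace d → ℂ} (hu : Measurable u)
    (hVu : Integrable (fun x => V x * ‖u x‖ ^ 2) volume) {q p : ℝ → ℝ} {R : ℝ}
    (hq : IsMultiplier q p R) {γ L : ℝ} (hL0 : 0 ≤ L) {w : ℝ → ℝ≥0∞} (hw : Measurable w)
    (hFTC : ∀ σ : ℝ, 1 ≤ σ → ∀ y : RSpace d, y ≠ 0 → ENNReal.ofReal (σ ^ γ * V (σ • y))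
      ≤ ENNReal.ofReal (V y) + ∫⁻ t in Ioc 1 σ, w (t * ‖y‖))
    (hL : ∀ t : ℝ, 1 ≤ t → ∫⁻ x, w (t * ‖x‖) * ENNReal.ofReal (q ‖x‖ * ‖u x‖ ^ 2)
      ≤ ENNReal.ofReal L) {l : ℝ} (hl : 0 < l) (hl1 : l < 1) :
    Integrable (fun x => q ‖x‖ * V x * ‖u (l • x)‖ ^ 2) volume ∧
    ∫ x, q ‖x‖ * V x * ‖u (l • x)‖ ^ 2
      ≤ l ^ (-(d - γ)) * (∫ y, V y * ‖u y‖ ^ 2 * q ‖l⁻¹ • y‖)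
        + l ^ (-(d - γ)) * ((l⁻¹ - 1) * L) := by
  have : Nonempty (Fin d) := ⟨⟨0, hd⟩⟩
  set σ := l⁻¹ with hσ
  have hσ0 : 0 < σ := inv_pos.2 hl
  have hσ1 : 1 ≤ σ := (one_le_inv₀ hl).2 hl1.le
  have hae : ∀ᵐ x : RSpace d, x ≠ 0 := by
    rw [ae_iff]; simp
  have hqm : Measurable q := hq.contDiff_q.continuous.measurable
  have hqn := hq.q_nonneg
  have hls : Measurable fun x : RSpace d => l • x := by fun_prop
  have hul : Measurable fun x => u (l • x) := hu.comp hls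
  have hm1 : AEMeasurable (fun x => q ‖x‖ * V x * ‖u (l • x)‖ ^ 2) volume :=
    ((hqm.comp measurable_norm).aemeasurable.mul hVm).mul (hul.norm.pow_const 2).aemeasurable
  have h0 : ∀ᵐ x : RSpace d, 0 ≤ q ‖x‖ * V x * ‖u (l • x)‖ ^ 2 := by
    filter_upwards [hae] with x hx
    exact mul_nonneg (mul_nonneg (hqn _) (hV0 x hx)) (by positivity)
  set A := ∫ y, V y * ‖u y‖ ^ 2 * q ‖σ • y‖ with hA
  have hAi : Integrable (fun y => V y * ‖u y‖ ^ 2 * q ‖σ • y‖) volume := by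
    refine hVu.mul_bdd (c := R⁻¹) ?_ (Eventually.of_forall fun y => hq.abs_q_le _)
    exact (hqm.comp (measurable_norm.comp (measurable_const_smul σ))).aestronglyMeasurable
  have hA0 : 0 ≤ A := integral_nonneg_of_ae (by
    filter_upwards [hae] with x hx
    exact mul_nonneg (mul_nonneg (hV0 x hx) (by positivity)) (hqn _))
  have hc : (l ^ d)⁻¹ * σ ^ (-γ) = l ^ (-(d - γ)) := by
    rw [hσ, Real.inv_rpow hl.le, ← Real.rpow_neg hl.le, ← Real.rpow_natCast,
      ← Real.rpow_neg hl.le, ← Real.rpow_add hl]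
    congr 1; ring
  have hσγ : 0 < σ ^ (-γ) := Real.rpow_pos_of_pos hσ0 _
  have key : ∫⁻ x, ENNReal.ofReal (q ‖x‖ * V x * ‖u (l • x)‖ ^ 2)
      ≤ ENNReal.ofReal (l ^ (-(d - γ)) * A + l ^ (-(d - γ)) * ((σ - 1) * L)) := by
    have e1 : ∀ x, ENNReal.ofReal (q ‖x‖ * V x * ‖u (l • x)‖ ^ 2)
        = (fun y => ENNReal.ofReal (q ‖σ • y‖ * V (σ • y) * ‖u y‖ ^ 2)) (l • x) := by
      intro x
      simp only [smul_smul, hσ, inv_mul_cancel₀ hl.ne', one_smul]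
    rw [(lintegral_congr e1).trans (lintegral_comp_smul_of_pos
      (fun y => ENNReal.ofReal (q ‖σ • y‖ * V (σ • y) * ‖u y‖ ^ 2)) hl)]
    -- Extracting `σ^(-γ)` leaves `σ^γ V(σy)`, which the ray inequality bounds. In the loss term
    -- `q(σ|y|)` may be replaced by `q(|y|)` since `q` decreases.
    have hpt : ∀ᵐ y : RSpace d, ENNReal.ofReal (q ‖σ • y‖ * V (σ • y) * ‖u y‖ ^ 2)
        ≤ ENNReal.ofReal (σ ^ (-γ)) * (ENNReal.ofReal (V y * ‖u y‖ ^ 2 * q ‖σ • y‖)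
          + ∫⁻ t in Ioc 1 σ, w (t * ‖y‖) * ENNReal.ofReal (q ‖y‖ * ‖u y‖ ^ 2)) := by
      filter_upwards [hae] with y hy
      have e2 : q ‖σ • y‖ * V (σ • y) * ‖u y‖ ^ 2
          = σ ^ (-γ) * ((q ‖σ • y‖ * ‖u y‖ ^ 2) * (σ ^ γ * V (σ • y))) := by
        have : σ ^ (-γ) * σ ^ γ = 1 := by rw [← Real.rpow_add hσ0]; simp
        calc _ = (σ ^ (-γ) * σ ^ γ) * (q ‖σ • y‖ * V (σ • y) * ‖u y‖ ^ 2) := by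
              rw [this, one_mul]
          _ = _ := by ring
      have hB0 : 0 ≤ q ‖σ • y‖ * ‖u y‖ ^ 2 := mul_nonneg (hqn _) (by positivity)
      rw [e2, ENNReal.ofReal_mul hσγ.le, ENNReal.ofReal_mul hB0]
      refine mul_le_mul' le_rfl ?_
      refine (mul_le_mul' le_rfl (hFTC σ hσ1 y hy)).trans ?_
      rw [mul_add]
      refine add_le_add (le_of_eq ?_) ?_
      · rw [← ENNReal.ofReal_mul hB0]; congr 1; ring
      · rw [lintegral_mul_const _ (by fun_prop), mul_comm]
        refine mul_le_mul' le_rfl (ENNReal.ofReal_le_ofReal ?_)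
        have : q ‖σ • y‖ ≤ q ‖y‖ := hq.antitone_q (by
          rw [norm_smul, Real.norm_of_nonneg hσ0.le]
          exact le_mul_of_one_le_left (norm_nonneg _) hσ1)
        gcongr
    have hAe : ∫⁻ y, ENNReal.ofReal (V y * ‖u y‖ ^ 2 * q ‖σ • y‖) = ENNReal.ofReal A := by
      rw [hA, ofReal_integral_eq_lintegral_ofReal hAi]
      filter_upwards [hae] with x hx
      exact mul_nonneg (mul_nonneg (hV0 x hx) (by positivity)) (hqn _)
    have hmw : Measurable fun z : RSpace d × ℝ =>
        w (z.2 * ‖z.1‖) * ENNReal.ofReal (q ‖z.1‖ * ‖u z.1‖ ^ 2) := by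
      refine (hw.comp (by fun_prop)).mul (ENNReal.measurable_ofReal.comp ?_)
      exact (hqm.comp (by fun_prop)).mul ((hu.comp measurable_fst).norm.pow_const 2)
    have hB : ∫⁻ y, ∫⁻ t in Ioc 1 σ, w (t * ‖y‖) * ENNReal.ofReal (q ‖y‖ * ‖u y‖ ^ 2)
        ≤ ENNReal.ofReal ((σ - 1) * L) := by
      rw [lintegral_lintegral_swap hmw.aemeasurable]
      refine (setLIntegral_mono' measurableSet_Ioc fun t ht => hL t ht.1.le).trans (le_of_eq ?_)
      rw [setLIntegral_const, Real.volume_Ioc, mul_comm, ENNReal.ofReal_mul (by linarith)]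
    refine (mul_le_mul' le_rfl (lintegral_mono_ae hpt)).trans ?_
    rw [lintegral_const_mul' _ _ ENNReal.ofReal_ne_top, lintegral_add_right' _
      (Measurable.lintegral_prod_right' hmw).aemeasurable, ← mul_add,
      hAe, ← mul_assoc, ← ENNReal.ofReal_mul (by positivity), hc,
      ENNReal.ofReal_mul (Real.rpow_nonneg hl.le _), ENNReal.ofReal_add hA0 (by
        have : 0 ≤ σ - 1 := by linarith
        positivity)]
    exact mul_le_mul' le_rfl (add_le_add le_rfl hB)
  have hi : Integrable (fun x => q ‖x‖ * V x * ‖u (l • x)‖ ^ 2) volume := by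
    refine ⟨hm1.aestronglyMeasurable, ?_⟩
    rw [hasFiniteIntegral_iff_ofReal h0]
    exact key.trans_lt ENNReal.ofReal_lt_top
  refine ⟨hi, ?_⟩
  rw [← ofReal_integral_eq_lintegral_ofReal hi h0] at key
  refine (ENNReal.ofReal_le_ofReal_iff ?_).1 key
  have h3 : 0 ≤ σ - 1 := by linarith
  have h4 := Real.rpow_nonneg hl.le (-(d - γ))
  positivity

end Potential

/-! ### The equation tested with the increment `q (u - u(l·))`. -/

section DifferenceTest

open Filter Topology

variable {d : ℕ}

theorem re_mul_conj_sub (a b : ℂ) :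
    (a * conj (a - b)).re = (‖a‖ ^ 2 - ‖b‖ ^ 2 + ‖a - b‖ ^ 2) / 2 := by
  rw [← Complex.normSq_eq_norm_sq, ← Complex.normSq_eq_norm_sq, ← Complex.normSq_eq_norm_sq]
  simp only [Complex.normSq_apply, Complex.sub_re, Complex.sub_im, Complex.mul_re,
    Complex.conj_re, Complex.conj_im]
  ring

/-- Polarisation with `|a - b|²/2` discarded. For gradients that term is not known to be small,
since `G` has no regularity, but it has the favourable sign; this is why the argument yields an
inequality. -/
theorem re_inner_sub_ge (a b : CSpace d) :
    (‖a‖ ^ 2 - ‖b‖ ^ 2) / 2 ≤ (inner ℂ (a - b) a : ℂ).re := by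
  have h1 : (inner ℂ a a : ℂ).re = ‖a‖ ^ 2 := by
    simpa using (inner_self_eq_norm_sq (𝕜 := ℂ) a)
  have h2 : (inner ℂ b a : ℂ).re ≤ ‖b‖ * ‖a‖ := (Complex.re_le_norm _).trans (norm_inner_le_norm _ _)
  rw [inner_sub_left, Complex.sub_re, h1]
  nlinarith [sq_nonneg (‖a‖ - ‖b‖)]

theorem IsMultiplier.integrable_mul {q p : ℝ → ℝ} {R : ℝ} (hq : IsMultiplier q p R)
    {F : RSpace d → ℝ} (hF : Integrable F volume) : Integrable (fun x => q ‖x‖ * F x) volume :=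
  hF.bdd_mul (c := R⁻¹)
    (hq.contDiff_q.continuous.comp continuous_norm).aestronglyMeasurable
    (Eventually.of_forall fun _ => hq.abs_q_le _)

/-- The equation tested with `q (u - u_l)`. -/
theorem IsGlobalSolution.difference_test {V : RSpace d → ℝ} {ε τ : ℝ} {f u : RSpace d → ℂ}
    {G : RSpace d → CSpace d} (h : IsGlobalSolution V ε τ f u G) (hd : 3 ≤ d)
    (hVm : AEMeasurable V volume) (hV0 : ∀ᵐ x, 0 ≤ V x) {q p : ℝ → ℝ} {R : ℝ}
    (hq : IsMultiplier q p R) {l : ℝ} (hl : 0 < l) (hl1 : l < 1)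
    (hVl : Integrable (fun x => q ‖x‖ * V x * ‖u (l • x)‖ ^ 2) volume) :
    ((∫ x, q ‖x‖ * ‖G x‖ ^ 2) - l ^ 2 * ∫ x, q ‖x‖ * ‖G (l • x)‖ ^ 2) / 2
      - (1 - l) / 2 * (∫ x, -(deriv q ‖x‖ * ‖x‖) / ‖x‖ ^ 2 * ‖euler G x‖ ^ 2)
      - (2 * (1 - l))⁻¹ * (∫ x, -(deriv q ‖x‖ * ‖x‖) / ‖x‖ ^ 2 * ‖u x - u (l • x)‖ ^ 2)
      + ((∫ x, q ‖x‖ * (V x * ‖u x‖ ^ 2)) - ∫ x, q ‖x‖ * V x * ‖u (l • x)‖ ^ 2) / 2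
      - τ * (((∫ x, q ‖x‖ * ‖u x‖ ^ 2) - (∫ x, q ‖x‖ * ‖u (l • x)‖ ^ 2)
        + ∫ x, q ‖x‖ * ‖u x - u (l • x)‖ ^ 2) / 2)
    ≤ |ε| * (∫ x, ‖u x‖ * (q ‖x‖ * ‖u x - u (l • x)‖))
      + ‖∫ x, f x * conj ((q ‖x‖ : ℂ) * (u x - u (l • x)))‖ := by
  have hH := h.isH1
  have hR := hq.pos
  have hqn := hq.q_nonneg
  have hp : 0 < 1 - l := by linarith
  have hqc : Continuous q := hq.contDiff_q.continuous
  have hqdc : Continuous (deriv q) := hq.contDiff_q.continuous_deriv (by simp)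
  have hHl := hH.comp_smul hl
  have hD := hH.sub hHl
  have hv := hD.smooth_mul (hq.contDiff_radial_q (d := d)) (C := max R⁻¹ (R⁻¹ / R))
    (fun x => (hq.abs_q_le _).trans (le_max_left _ _))
    (fun x => (hq.norm_cgrad_radial_q_le x).trans (le_max_right _ _))
  set D : RSpace d → ℂ := fun x => u x - u (l • x) with hDdef
  set v : RSpace d → ℂ := fun x => (q ‖x‖ : ℂ) * D x with hvdef
  have hum := hH.measurable
  have hulm := hHl.measurable
  have hDm := hD.measurable
  have hvm := hv.measurable
  have hEm := measurable_euler hH.measurable_grad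
  have hVu := h.energy
  have hqVu := hq.integrable_mul hVu
  -- Admissibility of the test function: the part with `u(l·)` is the hypothesis `hVl`, which comes
  -- from `potential_dilation_le`.
  have hVv : Integrable (fun x => V x * ‖v x‖ ^ 2) volume := by
    refine ((hqVu.add hVl).const_mul (2 * R⁻¹)).mono'
      (hVm.mul (hvm.norm.pow_const 2).aemeasurable).aestronglyMeasurable ?_
    filter_upwards [hV0] with x hx
    rw [Real.norm_of_nonneg (by positivity), hvdef]
    simp only [Pi.add_apply]
    rw [norm_mul, Complex.norm_real, Real.norm_of_nonneg (hqn _)]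
    have h1 : ‖D x‖ ^ 2 ≤ 2 * (‖u x‖ ^ 2 + ‖u (l • x)‖ ^ 2) := by
      have := norm_sub_le (u x) (u (l • x))
      calc ‖D x‖ ^ 2 ≤ (‖u x‖ + ‖u (l • x)‖) ^ 2 := by rw [hDdef]; gcongr
        _ ≤ _ := by nlinarith [sq_nonneg (‖u x‖ - ‖u (l • x)‖)]
    have h2 := hq.q_le ‖x‖
    have h3 := hqn ‖x‖
    calc V x * (q ‖x‖ * ‖D x‖) ^ 2 = q ‖x‖ * (q ‖x‖ * V x * ‖D x‖ ^ 2) := by ring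
      _ ≤ R⁻¹ * (q ‖x‖ * V x * (2 * (‖u x‖ ^ 2 + ‖u (l • x)‖ ^ 2))) := by gcongr
      _ = _ := by ring
  have key := congrArg Complex.re (h.equation v _ hv hVv)
  -- the kinetic term
  set ψ : RSpace d → ℝ := fun x => -(deriv q ‖x‖ * ‖x‖) with hψ
  have hψ0 : ∀ x, 0 ≤ ψ x := fun x => by
    rw [hψ]; have := hq.deriv_q_mul_nonpos (norm_nonneg x); simp only; linarith
  have hψle : ∀ x, ψ x ≤ R⁻¹ := fun x => (neg_le_abs _).trans (hq.abs_deriv_q_mul_le _)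
  have hψm : Measurable ψ := by
    have : Continuous ψ := by
      rw [hψ]; exact ((hqdc.comp continuous_norm).mul continuous_norm).neg
    exact this.measurable
  have hkin : ∀ x, q ‖x‖ * ((‖G x‖ ^ 2 - l ^ 2 * ‖G (l • x)‖ ^ 2) / 2)
      - ((1 - l) / 2 * (ψ x / ‖x‖ ^ 2 * ‖euler G x‖ ^ 2)
        + (2 * (1 - l))⁻¹ * (ψ x / ‖x‖ ^ 2 * ‖D x‖ ^ 2))
      ≤ (inner ℂ ((q ‖x‖ : ℂ) • (G x - (l : ℂ) • G (l • x))
        + D x • cgrad (fun x : RSpace d => q ‖x‖) x) (G x) : ℂ).re := by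
    intro x
    rw [inner_smooth_mul, inner_cgrad_radial hq.differentiable_q hR hq.q_const, Complex.add_re,
      Complex.re_ofReal_mul]
    have h1 := re_inner_sub_ge (G x) ((l : ℂ) • G (l • x))
    rw [norm_smul, Complex.norm_real, mul_pow, Real.norm_eq_abs, sq_abs] at h1
    have h2 := mul_le_mul_of_nonneg_left h1 (hqn ‖x‖)
    have h3 : conj (D x) * (((deriv q ‖x‖ / ‖x‖ : ℝ) : ℂ) * euler G x)
        = ((deriv q ‖x‖ / ‖x‖ : ℝ) : ℂ) * (conj (D x) * euler G x) := by ring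
    rw [h3, Complex.re_ofReal_mul]
    have h4 : deriv q ‖x‖ / ‖x‖ = -(ψ x / ‖x‖ ^ 2) := by
      rcases eq_or_ne ‖x‖ 0 with h0 | h0
      · simp [h0]
      · rw [hψ]; field_simp
    rw [h4]
    have h5 : (conj (D x) * euler G x).re ≤ ‖D x‖ * ‖euler G x‖ := by
      refine (Complex.re_le_norm _).trans ?_
      rw [norm_mul, RCLike.norm_conj]
    -- The weight `1 - l` is optimal, because `D` behaves like `(1 - l)` times the Euler derivative;
    -- each half contributes the same limit.
    have h6 : ‖D x‖ * ‖euler G x‖ ≤ (1 - l) / 2 * ‖euler G x‖ ^ 2 + (2 * (1 - l))⁻¹ * ‖D x‖ ^ 2 := by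
      have : (1 - l) / 2 * ‖euler G x‖ ^ 2 + (2 * (1 - l))⁻¹ * ‖D x‖ ^ 2 - ‖D x‖ * ‖euler G x‖
          = (2 * (1 - l))⁻¹ * ((1 - l) * ‖euler G x‖ - ‖D x‖) ^ 2 := by field_simp; ring
      have h7 : 0 ≤ (2 * (1 - l))⁻¹ * ((1 - l) * ‖euler G x‖ - ‖D x‖) ^ 2 := by positivity
      linarith
    have h8 : 0 ≤ ψ x / ‖x‖ ^ 2 := div_nonneg (hψ0 x) (by positivity)
    have h9 := mul_le_mul_of_nonneg_left (h5.trans h6) h8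
    linarith
  have hGl : Integrable (fun x => ‖G (l • x)‖ ^ 2) volume := hH.integrable_grad_sq.comp_smul hl.ne'
  have hi1 := hq.integrable_mul hH.integrable_grad_sq
  have hi2 := hq.integrable_mul hGl
  have hi3 : Integrable (fun x => ψ x / ‖x‖ ^ 2 * ‖euler G x‖ ^ 2) volume := by
    refine (hH.integrable_grad_sq.const_mul R⁻¹).mono'
      (Measurable.aestronglyMeasurable (by fun_prop)) (Eventually.of_forall fun x => ?_)
    have := hψ0 x
    rw [Real.norm_of_nonneg (by positivity)]
    calc ψ x / ‖x‖ ^ 2 * ‖euler G x‖ ^ 2 = ψ x * (‖euler G x‖ ^ 2 / ‖x‖ ^ 2) := by ring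
      _ ≤ R⁻¹ * ‖G x‖ ^ 2 := mul_le_mul (hψle x) (norm_euler_sq_div_le G x) (by positivity)
        (by positivity)
  have hi4 : Integrable (fun x => ψ x / ‖x‖ ^ 2 * ‖D x‖ ^ 2) volume :=
    hD.integrable_mul_sq_div hd hψm (C := R⁻¹)
      (fun x => by rw [abs_of_nonneg (hψ0 x)]; exact hψle x)
  have hinn := hH.integrable_inner hv
  have r1 : ((∫ x, q ‖x‖ * ‖G x‖ ^ 2) - l ^ 2 * ∫ x, q ‖x‖ * ‖G (l • x)‖ ^ 2) / 2
      - (1 - l) / 2 * (∫ x, ψ x / ‖x‖ ^ 2 * ‖euler G x‖ ^ 2)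
      - (2 * (1 - l))⁻¹ * (∫ x, ψ x / ‖x‖ ^ 2 * ‖D x‖ ^ 2)
      ≤ (∫ x, (inner ℂ ((q ‖x‖ : ℂ) • (G x - (l : ℂ) • G (l • x))
        + D x • cgrad (fun x : RSpace d => q ‖x‖) x) (G x) : ℂ)).re := by
    have hi5 : Integrable (fun x => q ‖x‖ * ‖G x‖ ^ 2 - l ^ 2 * (q ‖x‖ * ‖G (l • x)‖ ^ 2)) volume :=
      hi1.sub (hi2.const_mul _)
    have hi6 : Integrable (fun x => (1 - l) / 2 * (ψ x / ‖x‖ ^ 2 * ‖euler G x‖ ^ 2)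
        + (2 * (1 - l))⁻¹ * (ψ x / ‖x‖ ^ 2 * ‖D x‖ ^ 2)) volume :=
      (hi3.const_mul _).add (hi4.const_mul _)
    have e : ((∫ x, q ‖x‖ * ‖G x‖ ^ 2) - l ^ 2 * ∫ x, q ‖x‖ * ‖G (l • x)‖ ^ 2) / 2
      - (1 - l) / 2 * (∫ x, ψ x / ‖x‖ ^ 2 * ‖euler G x‖ ^ 2)
      - (2 * (1 - l))⁻¹ * (∫ x, ψ x / ‖x‖ ^ 2 * ‖D x‖ ^ 2)
      = ∫ x, ((q ‖x‖ * ‖G x‖ ^ 2 - l ^ 2 * (q ‖x‖ * ‖G (l • x)‖ ^ 2)) / 2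
        - ((1 - l) / 2 * (ψ x / ‖x‖ ^ 2 * ‖euler G x‖ ^ 2)
        + (2 * (1 - l))⁻¹ * (ψ x / ‖x‖ ^ 2 * ‖D x‖ ^ 2))) := by
      rw [integral_sub (hi5.div_const 2) hi6, integral_div, integral_sub hi1 (hi2.const_mul _),
        integral_add (hi3.const_mul _) (hi4.const_mul _), integral_const_mul, integral_const_mul,
        integral_const_mul]
      ring
    rw [e, ← RCLike.re_eq_complex_re, ← integral_re hinn]
    refine integral_mono ((hi5.div_const 2).sub hi6) hinn.re fun x => ?_
    refine le_trans (le_of_eq ?_) (hkin x)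
    simp only
    ring
  -- the potential term
  have hVuv := integrable_potential_mul_conj hVm hV0 hum hvm hVu hVv
  have r2 : ((∫ x, q ‖x‖ * (V x * ‖u x‖ ^ 2)) - ∫ x, q ‖x‖ * V x * ‖u (l • x)‖ ^ 2) / 2
      ≤ (∫ x, (V x : ℂ) * (u x * conj (v x))).re := by
    rw [← integral_sub hqVu hVl, ← integral_div, ← RCLike.re_eq_complex_re, ← integral_re hVuv]
    refine integral_mono_ae ((hqVu.sub hVl).div_const 2) hVuv.re ?_
    filter_upwards [hV0] with x hx
    have e : (V x : ℂ) * (u x * conj (v x)) = ((V x * q ‖x‖ : ℝ) : ℂ) * (u x * conj (D x)) := by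
      rw [hvdef]; simp only [map_mul, Complex.conj_ofReal]; push_cast; ring
    rw [e, RCLike.re_eq_complex_re, Complex.re_ofReal_mul, hDdef]
    simp only
    rw [re_mul_conj_sub]
    have h1 : 0 ≤ V x * q ‖x‖ * ‖u x - u (l • x)‖ ^ 2 := by
      have := hqn ‖x‖
      positivity
    linarith
  -- the zero order terms
  have huv := hH.integrable_mul_conj hv
  have hil := hHl.integrable_sq
  have hj1 := hq.integrable_mul hH.integrable_sq
  have hj2 := hq.integrable_mul hil
  have hj3 := hq.integrable_mul hD.integrable_sq
  have e3 : ∀ x, u x * conj (v x) = ((q ‖x‖ : ℝ) : ℂ) * (u x * conj (D x)) := by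
    intro x
    rw [hvdef]; simp only [map_mul, Complex.conj_ofReal]; ring
  have r3 : (∫ x, u x * conj (v x)).re = ((∫ x, q ‖x‖ * ‖u x‖ ^ 2)
      - (∫ x, q ‖x‖ * ‖u (l • x)‖ ^ 2) + ∫ x, q ‖x‖ * ‖u x - u (l • x)‖ ^ 2) / 2 := by
    have hj12 : Integrable (fun x => q ‖x‖ * ‖u x‖ ^ 2 - q ‖x‖ * ‖u (l • x)‖ ^ 2) volume :=
      hj1.sub hj2
    rw [← integral_sub hj1 hj2, ← integral_add hj12 hj3, ← integral_div,
      ← RCLike.re_eq_complex_re, ← integral_re huv]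
    refine integral_congr_ae (Eventually.of_forall fun x => ?_)
    simp only
    rw [e3, RCLike.re_eq_complex_re, Complex.re_ofReal_mul, hDdef]
    simp only
    rw [re_mul_conj_sub]
    ring
  have r4 : |(∫ x, u x * conj (v x)).im| ≤ ∫ x, ‖u x‖ * (q ‖x‖ * ‖D x‖) := by
    refine (Complex.abs_im_le_norm _).trans ((norm_integral_le_integral_norm _).trans (le_of_eq ?_))
    refine integral_congr_ae (Eventually.of_forall fun x => ?_)
    simp only [hvdef]
    rw [norm_mul, RCLike.norm_conj, norm_mul, Complex.norm_real, Real.norm_of_nonneg (hqn _)]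
  have e5 : ((Complex.I * (ε : ℂ) - (τ : ℂ)) * ∫ x, u x * conj (v x)).re
      = -ε * (∫ x, u x * conj (v x)).im - τ * (∫ x, u x * conj (v x)).re := by
    simp [Complex.mul_re]
    ring
  rw [Complex.add_re, Complex.add_re, e5, r3] at key
  have r6 : (∫ x, f x * conj (v x)).re ≤ ‖∫ x, f x * conj (v x)‖ := Complex.re_le_norm _
  have r7 : ε * (∫ x, u x * conj (v x)).im ≤ |ε| * ∫ x, ‖u x‖ * (q ‖x‖ * ‖D x‖) :=
    calc _ ≤ |ε * (∫ x, u x * conj (v x)).im| := le_abs_self _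
      _ = |ε| * |(∫ x, u x * conj (v x)).im| := abs_mul _ _
      _ ≤ _ := mul_le_mul_of_nonneg_left r4 (abs_nonneg _)
  linarith

end DifferenceTest

/-! ### The limit `l → 1` of the increment test. -/

section MorawetzLimit

open Filter Topology

variable {d : ℕ}

theorem IsMultiplier.integrable_deriv_mul {q p : ℝ → ℝ} {R : ℝ} (hq : IsMultiplier q p R)
    {F : RSpace d → ℝ} (hF : Integrable F volume) :
    Integrable (fun x => deriv q ‖x‖ * ‖x‖ * F x) volume := by
  have hc : Continuous (deriv q) := hq.contDiff_q.continuous_deriv (by simp)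
  exact hF.bdd_mul (c := R⁻¹)
    ((hc.comp continuous_norm).mul continuous_norm).aestronglyMeasurable
    (Eventually.of_forall fun _ => hq.abs_deriv_q_mul_le _)

theorem IsMultiplier.tendsto_dilation {q p : ℝ → ℝ} {R : ℝ} (hq : IsMultiplier q p R)
    {F : RSpace d → ℝ} (hF : Integrable F volume) (a : ℝ) :
    Tendsto (fun l : ℝ => (1 - l)⁻¹ * ((∫ x, q ‖x‖ * F x) - l ^ (-a) * ∫ y, q ‖l⁻¹ • y‖ * F y))
      (𝓝[<] 1) (𝓝 (-(a * (∫ x, q ‖x‖ * F x) + ∫ x, deriv q ‖x‖ * ‖x‖ * F x))) := by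
  have h1 := tendsto_integral_dilation hF ((hq.contDiff_radial_q (d := d)).of_le (by simp))
    (fun x => hq.abs_q_le _) (fun x => hq.abs_fderiv_radial_q_le x) a
  have e1 : ∫ y, F y * (a * q ‖y‖ + fderiv ℝ (fun x : RSpace d => q ‖x‖) y y)
      = a * (∫ x, q ‖x‖ * F x) + ∫ x, deriv q ‖x‖ * ‖x‖ * F x := by
    rw [← integral_const_mul, ← integral_add ((hq.integrable_mul hF).const_mul a)
      (hq.integrable_deriv_mul hF)]
    refine integral_congr_ae (Eventually.of_forall fun x => ?_)
    simp only [hq.fderiv_radial_q]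
    ring
  rw [e1] at h1
  refine h1.congr fun l => ?_
  have hl : Integrable (fun y => q ‖l⁻¹ • y‖ * F y) volume :=
    hF.bdd_mul (c := R⁻¹)
      (hq.contDiff_q.continuous.comp
        (continuous_norm.comp (continuous_const_smul l⁻¹))).aestronglyMeasurable
      (Eventually.of_forall fun _ => hq.abs_q_le _)
  rw [← integral_const_mul (l ^ (-a)), ← integral_sub (hq.integrable_mul hF) (hl.const_mul _)]
  congr 2
  ext y
  ring

/-- Growth of the test function `q (u - u_l)` on balls. -/
theorem IsH1.lintegral_multiplier_sub_dilation_le {u : RSpace d → ℂ} {G : RSpace d → CSpace d}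
    (h : IsH1 u G) {q p : ℝ → ℝ} {R : ℝ} (hq : IsMultiplier q p R) {l : ℝ} (hl : 0 < l)
    (hl1 : l ≤ 1) {ρ : ℝ} :
    ∫⁻ x in ball (0 : RSpace d) ρ, ‖(q ‖x‖ : ℂ) * (u x - u (l • x))‖ₑ ^ 2
      ≤ ENNReal.ofReal ((11 / 10 * min 1 (ρ / R)) ^ 2 * ((1 - l) ^ 2 * (l ^ d)⁻¹)
        * ∫ x in ball (0 : RSpace d) ρ, ‖G x‖ ^ 2) := by
  have hstar : ∀ x ∈ ball (0 : RSpace d) ρ, ∀ s : ℝ, 0 < s → s ≤ 1 → s • x ∈ ball (0 : RSpace d) ρ := by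
    intro x hx s hs hs1
    rw [mem_ball_zero_iff] at hx ⊢
    rw [norm_smul, Real.norm_of_nonneg hs.le]
    exact (mul_le_of_le_one_left (norm_nonneg x) hs1).trans_lt hx
  have h1 := h.lintegral_sub_dilation_div_le hl hl1 measurableSet_ball hstar
  have h2 : ∫⁻ x in ball (0 : RSpace d) ρ, ‖G x‖ₑ ^ 2
      = ENNReal.ofReal (∫ x in ball (0 : RSpace d) ρ, ‖G x‖ ^ 2) := by
    rw [ofReal_integral_eq_lintegral_ofReal h.integrable_grad_sq.integrableOn
      (Eventually.of_forall fun x => by positivity)]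
    congr 1; ext x; rw [← ofReal_norm, ENNReal.ofReal_pow (norm_nonneg _)]
  rw [h2, ← ENNReal.ofReal_mul (by positivity)] at h1
  rw [mul_assoc, ENNReal.ofReal_mul (by positivity)]
  refine le_trans ?_ (mul_le_mul' le_rfl h1)
  rw [← lintegral_const_mul' _ _ ENNReal.ofReal_ne_top]
  have hae : ∀ᵐ x ∂(volume.restrict (ball (0 : RSpace d) ρ)), x ∈ ball (0 : RSpace d) ρ :=
    ae_restrict_mem measurableSet_ball
  refine lintegral_mono_ae (hae.mono fun x hx => ?_)
  rw [mem_ball_zero_iff] at hx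
  rw [← ofReal_norm, ← ofReal_norm, ← ENNReal.ofReal_pow (norm_nonneg _),
    ← ENNReal.ofReal_pow (norm_nonneg _), ← ENNReal.ofReal_mul (by positivity),
    ← ENNReal.ofReal_mul (by positivity)]
  apply ENNReal.ofReal_le_ofReal
  rw [norm_mul, Complex.norm_real, Real.norm_of_nonneg (hq.q_nonneg _)]
  rcases eq_or_ne x 0 with rfl | hx0
  · simp
  have hx0 : 0 < ‖x‖ := norm_pos_iff.2 hx0
  have h3 := hq.mul_q_le_min (norm_nonneg x) hx.le
  have h4 := hq.q_nonneg ‖x‖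
  calc (q ‖x‖ * ‖u x - u (l • x)‖) ^ 2
      = (‖x‖ * q ‖x‖) ^ 2 * ((‖x‖ ^ 2)⁻¹ * ‖u x - u (l • x)‖ ^ 2) := by field_simp
    _ ≤ _ := by gcongr

theorem setIntegral_le_add_left {A B : RSpace d → ℝ} {S : Set (RSpace d)}
    (hA : Integrable A volume) (hB : Integrable B volume) (hB0 : ∀ x, 0 ≤ B x) :
    ∫ x in S, A x ≤ ∫ x in S, (A x + B x) :=
  integral_mono hA.integrableOn (hA.add hB).integrableOn fun x => by
    have := hB0 x
    simp only
    linarith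

theorem ae_ne_zero (hd : 0 < d) : ∀ᵐ x : RSpace d, x ≠ 0 := by
  have : Nonempty (Fin d) := ⟨⟨0, hd⟩⟩
  rw [ae_iff]; simp

/-- Since `τ` has no sign, the quadratic remainder of the mass term cannot be dropped. As `r q ≤
11/10`, it is bounded by the product of `‖(u - u_l)/|x|‖ = O(1 - l)` and `‖u - u_l‖ → 0`, both in
`L²`. -/
theorem IsH1.tendsto_multiplier_sub_dilation {u : RSpace d → ℂ} {G : RSpace d → CSpace d}
    (hH : IsH1 u G) {q p : ℝ → ℝ} {R : ℝ} (hq : IsMultiplier q p R) (hd : 0 < d) :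
    Tendsto (fun l : ℝ => (1 - l)⁻¹ * ∫ x, q ‖x‖ * ‖u x - u (l • x)‖ ^ 2) (𝓝[<] 1) (𝓝 0) := by
  have hae := ae_ne_zero hd
  have hqn := hq.q_nonneg
  set N := ∫ x, ‖G x‖ ^ 2 with hN
  have hN0 : 0 ≤ N := integral_nonneg fun x => by positivity
  have hb : Tendsto (fun l : ℝ => 11 / 10 * (√(2 ^ d * N) *
      √(∫ x, ‖u x - u (l • x)‖ ^ 2))) (𝓝[<] 1) (𝓝 0) := by
    have := (Real.continuous_sqrt.tendsto 0).comp hH.tendsto_integral_sub_dilation_sq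
    have := (this.const_mul (√(2 ^ d * N))).const_mul (11 / 10)
    simpa using this
  refine tendsto_of_tendsto_of_tendsto_of_le_of_le' tendsto_const_nhds hb ?_ ?_
  · filter_upwards [eventually_near_one] with l hl
    have : 0 < 1 - l := by linarith [hl.2]
    exact mul_nonneg (by positivity) (integral_nonneg fun x => mul_nonneg (hqn _) (by positivity))
  · filter_upwards [eventually_near_one] with l hl
    have hp : 0 < 1 - l := by linarith [hl.2]
    have hl0 : 0 < l := by linarith [hl.1]
    have hD := hH.sub (hH.comp_smul hl0)
    have hDm := hD.measurable
    obtain ⟨hi, hiv⟩ := hH.integral_sub_dilation_div_le hl0 hl.2.le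
    have hDi := hD.integrable_sq
    have hi' : Integrable (fun x => (‖u x - u (l • x)‖ / ‖x‖) ^ 2) volume := by
      simpa only [div_pow] using hi
    have cs := integral_mul_le_sqrt (μ := (volume : Measure (RSpace d)))
      (f := fun x => ‖u x - u (l • x)‖ / ‖x‖) (g := fun x => ‖u x - u (l • x)‖)
      (Measurable.aestronglyMeasurable (by fun_prop))
      (Measurable.aestronglyMeasurable (by fun_prop)) (fun x => by positivity)
      (fun x => by positivity) hi' hDi
    simp only [div_pow] at cs
    have hmi : Integrable (fun x => ‖u x - u (l • x)‖ / ‖x‖ * ‖u x - u (l • x)‖) volume := by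
      refine (hi.add hDi).mono' (Measurable.aestronglyMeasurable (by fun_prop))
        (Eventually.of_forall fun x => ?_)
      rw [Real.norm_of_nonneg (by positivity)]
      simp only [Pi.add_apply]
      rw [← div_pow]
      nlinarith [sq_nonneg (‖u x - u (l • x)‖ / ‖x‖ - ‖u x - u (l • x)‖),
        sq_nonneg (‖u x - u (l • x)‖ / ‖x‖ + ‖u x - u (l • x)‖)]
    have h1 : ∫ x, q ‖x‖ * ‖u x - u (l • x)‖ ^ 2
        ≤ 11 / 10 * ∫ x, ‖u x - u (l • x)‖ / ‖x‖ * ‖u x - u (l • x)‖ := by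
      rw [← integral_const_mul]
      refine integral_mono_ae (hq.integrable_mul hDi) (hmi.const_mul _) ?_
      filter_upwards [hae] with x hx
      have hx0 : 0 < ‖x‖ := norm_pos_iff.2 hx
      have h2 := hq.mul_q_le ‖x‖ (norm_nonneg x)
      calc q ‖x‖ * ‖u x - u (l • x)‖ ^ 2
          = (‖x‖ * q ‖x‖) * (‖u x - u (l • x)‖ / ‖x‖ * ‖u x - u (l • x)‖) := by field_simp
        _ ≤ _ := by gcongr
    have h3 : √(∫ x, ‖u x - u (l • x)‖ ^ 2 / ‖x‖ ^ 2) ≤ (1 - l) * √(2 ^ d * N) := by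
      have e1 : (1 - l) * √(2 ^ d * N) = √((1 - l) ^ 2 * (2 ^ d * N)) := by
        rw [Real.sqrt_mul (sq_nonneg (1 - l)), Real.sqrt_sq hp.le]
      rw [e1]
      refine Real.sqrt_le_sqrt (hiv.trans ?_)
      rw [mul_assoc]
      have := inv_pow_le_two_pow hl.1.le d
      gcongr
    rw [inv_mul_le_iff₀ hp]
    calc _ ≤ 11 / 10 * (√(∫ x, ‖u x - u (l • x)‖ ^ 2 / ‖x‖ ^ 2)
          * √(∫ x, ‖u x - u (l • x)‖ ^ 2)) := h1.trans (by gcongr)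
      _ ≤ 11 / 10 * ((1 - l) * √(2 ^ d * N) * √(∫ x, ‖u x - u (l • x)‖ ^ 2)) := by gcongr
      _ = _ := by ring

/-- This controls the `ε` term, which is not handled by polarisation. The factor `2` swallows
`(11/10)² · 2 ≤ 4`, where `l^(-d) ≤ 2` holds for `l` near `1`. -/
theorem IsH1.integral_mul_multiplier_sub_dilation_le {u : RSpace d → ℂ} {G : RSpace d → CSpace d}
    (hH : IsH1 u G) {q p : ℝ → ℝ} {R : ℝ} (hq : IsMultiplier q p R) (hd : 0 < d) {l : ℝ}
    (hl0 : 0 < l) (hl1 : l < 1) (hl2 : (l ^ d)⁻¹ ≤ 2) :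
    ∫ x, ‖u x‖ * (q ‖x‖ * ‖u x - u (l • x)‖)
      ≤ (1 - l) * (2 * (√(∫ x, ‖u x‖ ^ 2) * √(∫ x, ‖G x‖ ^ 2))) := by
  have hae := ae_ne_zero hd
  have hqn := hq.q_nonneg
  have hu := hH.measurable
  have hp : 0 < 1 - l := by linarith
  have hD := hH.sub (hH.comp_smul hl0)
  have hDm := hD.measurable
  obtain ⟨hi, hiv⟩ := hH.integral_sub_dilation_div_le hl0 hl1.le
  have hN0 : 0 ≤ ∫ x, ‖G x‖ ^ 2 := integral_nonneg fun x => by positivity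
  generalize (∫ x, ‖G x‖ ^ 2) = N at *
  have hqDm : Measurable fun x => q ‖x‖ * ‖u x - u (l • x)‖ :=
    (hq.contDiff_q.continuous.measurable.comp measurable_norm).mul hDm.norm
  have hpt : ∀ x, x ≠ 0 → (q ‖x‖ * ‖u x - u (l • x)‖) ^ 2
      ≤ (11 / 10) ^ 2 * (‖u x - u (l • x)‖ ^ 2 / ‖x‖ ^ 2) := by
    intro x hx
    have hx0 : 0 < ‖x‖ := norm_pos_iff.2 hx
    have h2 := hq.mul_q_le ‖x‖ (norm_nonneg x)
    have h3 := hqn ‖x‖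
    calc (q ‖x‖ * ‖u x - u (l • x)‖) ^ 2
        = (‖x‖ * q ‖x‖) ^ 2 * (‖u x - u (l • x)‖ ^ 2 / ‖x‖ ^ 2) := by field_simp
      _ ≤ _ := by gcongr
  have hqDi : Integrable (fun x => (q ‖x‖ * ‖u x - u (l • x)‖) ^ 2) volume := by
    refine (hi.const_mul ((11 / 10) ^ 2)).mono' (hqDm.pow_const 2).aestronglyMeasurable ?_
    filter_upwards [hae] with x hx
    rw [Real.norm_of_nonneg (by positivity)]
    exact hpt x hx
  have cs := integral_mul_le_sqrt (μ := (volume : Measure (RSpace d)))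
    (f := fun x => ‖u x‖) (g := fun x => q ‖x‖ * ‖u x - u (l • x)‖)
    hu.norm.aestronglyMeasurable hqDm.aestronglyMeasurable (fun x => norm_nonneg _)
    (fun x => mul_nonneg (hqn _) (norm_nonneg _)) hH.integrable_sq hqDi
  have h4 : ∫ x, (q ‖x‖ * ‖u x - u (l • x)‖) ^ 2 ≤ (2 * (1 - l)) ^ 2 * N := by
    calc _ ≤ (11 / 10) ^ 2 * ∫ x, ‖u x - u (l • x)‖ ^ 2 / ‖x‖ ^ 2 := by
          rw [← integral_const_mul]
          exact integral_mono_ae hqDi (hi.const_mul _) (hae.mono hpt)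
      _ ≤ (11 / 10) ^ 2 * ((1 - l) ^ 2 * 2 * N) := by
          have : (1 - l) ^ 2 * (l ^ d)⁻¹ * N ≤ (1 - l) ^ 2 * 2 * N := by gcongr
          gcongr
          exact hiv.trans this
      _ ≤ _ := by nlinarith [mul_nonneg (sq_nonneg (1 - l)) hN0]
  have h5 : √(∫ x, (q ‖x‖ * ‖u x - u (l • x)‖) ^ 2) ≤ 2 * (1 - l) * √N := by
    have e1 : 2 * (1 - l) * √N = √((2 * (1 - l)) ^ 2 * N) := by
      rw [Real.sqrt_mul (sq_nonneg _), Real.sqrt_sq (by positivity)]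
    rw [e1]
    exact Real.sqrt_le_sqrt h4
  calc _ ≤ √(∫ x, ‖u x‖ ^ 2) * √(∫ x, (q ‖x‖ * ‖u x - u (l • x)‖) ^ 2) := cs
    _ ≤ √(∫ x, ‖u x‖ ^ 2) * (2 * (1 - l) * √N) := by gcongr
    _ = _ := by ring

/-- On `B_ρ` the squared test function integrates to at most `(1 - l)² min(1, ρ/R)²` times the
gradient energy of `B_ρ`, up to a constant. This is exactly what the growth form of the duality
accepts. -/
theorem IsH1.norm_integral_multiplier_sub_dilation_le {f u : RSpace d → ℂ} {G : RSpace d → CSpace d}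
    (hH : IsH1 u G) {q p : ℝ → ℝ} {R : ℝ} (hq : IsMultiplier q p R) (hd : 3 ≤ d)
    (hf : AEStronglyMeasurable f volume) (hfin : xStarNorm f < ⊤)
    {δ T : ℝ} (hδ : 0 < δ) (hδR : δ ≤ R)
    (hT : ∀ ρ, δ ≤ ρ → ∫ x in ball (0 : RSpace d) ρ, (‖G x‖ ^ 2 + ‖u x‖ ^ 2 / ‖x‖ ^ 2) ≤ T * ρ)
    {l : ℝ} (hl0 : 0 < l) (hl1 : l < 1) (hl2 : (l ^ d)⁻¹ ≤ 2) :
    ‖∫ x, f x * conj ((q ‖x‖ : ℂ) * (u x - u (l • x)))‖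
      ≤ (1 - l) * (2 * ((xStarNorm f).toReal * √T)) := by
  have hD := hH.sub (hH.comp_smul hl0)
  have hDm := hD.measurable
  have hp : 0 < 1 - l := by linarith
  have hvm : Measurable fun x => (q ‖x‖ : ℂ) * (u x - u (l • x)) :=
    (Complex.measurable_ofReal.comp
      (hq.contDiff_q.continuous.measurable.comp measurable_norm)).mul hDm
  have hHi : Integrable (fun x => ‖G x‖ ^ 2 + ‖u x‖ ^ 2 / ‖x‖ ^ 2) volume :=
    hH.integrable_grad_sq.add (hH.integrable_sq_div hd)
  have h1 := norm_integral_le_of_growth (by omega) hf hfin hvm.aestronglyMeasurable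
    (fun x => by positivity) hHi hδ hδR (K := (2 * (1 - l)) ^ 2) (by positivity) hT
    (fun ρ hρ => (hH.lintegral_multiplier_sub_dilation_le hq hl0 hl1.le).trans
      (ENNReal.ofReal_le_ofReal ?_))
  · rw [Real.sqrt_mul (sq_nonneg _), Real.sqrt_sq (by positivity)] at h1
    exact h1.trans (le_of_eq (by ring))
  · have h2 : ∫ x in ball (0 : RSpace d) ρ, ‖G x‖ ^ 2
        ≤ ∫ x in ball (0 : RSpace d) ρ, (‖G x‖ ^ 2 + ‖u x‖ ^ 2 / ‖x‖ ^ 2) :=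
      setIntegral_le_add_left hH.integrable_grad_sq (hH.integrable_sq_div hd)
        fun x => by positivity
    have h3 : (11 / 10 * min 1 (ρ / R)) ^ 2 * ((1 - l) ^ 2 * (l ^ d)⁻¹)
        ≤ (2 * (1 - l)) ^ 2 * min 1 (ρ / R) ^ 2 := by
      calc _ ≤ (11 / 10 * min 1 (ρ / R)) ^ 2 * ((1 - l) ^ 2 * 2) := by gcongr
        _ ≤ _ := by nlinarith [mul_nonneg (sq_nonneg (1 - l)) (sq_nonneg (min 1 (ρ / R)))]
    have h4 : 0 ≤ ∫ x in ball (0 : RSpace d) ρ, ‖G x‖ ^ 2 :=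
      integral_nonneg fun x => by positivity
    exact mul_le_mul h3 h2 h4 (by positivity)

/-- The limit of the difference test. -/
theorem IsGlobalSolution.difference_limit {V : RSpace d → ℝ} {ε τ : ℝ} {f u : RSpace d → ℂ}
    {G : RSpace d → CSpace d} (h : IsGlobalSolution V ε τ f u G) (hd : 3 ≤ d)
    (hVm : AEMeasurable V volume) (hV0 : ∀ x, x ≠ 0 → 0 ≤ V x)
    (hf : AEStronglyMeasurable f volume) (hfin : xStarNorm f < ⊤) {q p : ℝ → ℝ} {R : ℝ}
    (hq : IsMultiplier q p R) {γ L : ℝ} (hL0 : 0 ≤ L) {w : ℝ → ℝ≥0∞} (hw : Measurable w)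
    (hFTC : ∀ σ : ℝ, 1 ≤ σ → ∀ y : RSpace d, y ≠ 0 → ENNReal.ofReal (σ ^ γ * V (σ • y))
      ≤ ENNReal.ofReal (V y) + ∫⁻ t in Ioc 1 σ, w (t * ‖y‖))
    (hL : ∀ t : ℝ, 1 ≤ t → ∫⁻ x, w (t * ‖x‖) * ENNReal.ofReal (q ‖x‖ * ‖u x‖ ^ 2)
      ≤ ENNReal.ofReal L) {δ T : ℝ} (hδ : 0 < δ) (hδR : δ ≤ R)
    (hT : ∀ ρ, δ ≤ ρ → ∫ x in ball (0 : RSpace d) ρ, (‖G x‖ ^ 2 + ‖u x‖ ^ 2 / ‖x‖ ^ 2) ≤ T * ρ) :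
    -(1 / 2) * ((d - 2) * (∫ x, q ‖x‖ * ‖G x‖ ^ 2) + ∫ x, deriv q ‖x‖ * ‖x‖ * ‖G x‖ ^ 2)
      - (∫ x, -(deriv q ‖x‖ * ‖x‖) / ‖x‖ ^ 2 * ‖euler G x‖ ^ 2)
      - 1 / 2 * ((d - γ) * (∫ x, q ‖x‖ * (V x * ‖u x‖ ^ 2))
        + ∫ x, deriv q ‖x‖ * ‖x‖ * (V x * ‖u x‖ ^ 2))
      + τ / 2 * (d * (∫ x, q ‖x‖ * ‖u x‖ ^ 2) + ∫ x, deriv q ‖x‖ * ‖x‖ * ‖u x‖ ^ 2)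
    ≤ 1 / 2 * L + 2 * (|ε| * (√(∫ x, ‖u x‖ ^ 2) * √(∫ x, ‖G x‖ ^ 2)))
      + 2 * ((xStarNorm f).toReal * √T) := by
  have hae : ∀ᵐ x : RSpace d, x ≠ 0 := ae_ne_zero (by omega)
  have hV0' : ∀ᵐ x : RSpace d, 0 ≤ V x := hae.mono hV0
  have hH := h.isH1
  have hu := hH.measurable
  have hR := hq.pos
  have hqn := hq.q_nonneg
  have hqdc : Continuous (deriv q) := hq.contDiff_q.continuous_deriv (by simp)
  set U := ∫ x, ‖u x‖ ^ 2 with hU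
  set N := ∫ x, ‖G x‖ ^ 2 with hN
  have hU0 : 0 ≤ U := integral_nonneg fun x => by positivity
  have hN0 : 0 ≤ N := integral_nonneg fun x => by positivity
  set P := ∫ x, -(deriv q ‖x‖ * ‖x‖) / ‖x‖ ^ 2 * ‖euler G x‖ ^ 2 with hP
  set Φ := (xStarNorm f).toReal with hΦ
  have hΦ0 : 0 ≤ Φ := ENNReal.toReal_nonneg
  -- limits of the pieces
  have l1 := hq.tendsto_dilation hH.integrable_grad_sq ((d : ℝ) - 2)
  have l2 := hq.tendsto_dilation h.energy ((d : ℝ) - γ)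
  have l3 := hq.tendsto_dilation hH.integrable_sq (d : ℝ)
  have l4 := hH.tendsto_multiplier_sub_dilation hq (by omega)
  have l5 : Tendsto (fun l : ℝ => l ^ (-((d : ℝ) - γ)) * l⁻¹ * L) (𝓝[<] 1) (𝓝 L) := by
    have c1 : ContinuousAt (fun l : ℝ => l ^ (-((d : ℝ) - γ)) * l⁻¹ * L) 1 :=
      ((Real.continuousAt_rpow_const 1 _ (Or.inl one_ne_zero)).mul
        (continuousAt_inv₀ one_ne_zero)).mul continuousAt_const
    have := c1.tendsto
    simp only [Real.one_rpow, inv_one, one_mul] at this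
    exact this.mono_left nhdsWithin_le_nhds
  have hlim := (((l1.const_mul (1 / 2)).sub_const (P / 2)).add
    ((l2.sub l5).const_mul (1 / 2))).sub ((l3.add l4).const_mul (τ / 2))
  -- the inequality for each `l`
  have hψ0 : ∀ x : RSpace d, 0 ≤ -(deriv q ‖x‖ * ‖x‖) := fun x => by
    linarith [hq.deriv_q_mul_nonpos (norm_nonneg x)]
  have hψle : ∀ x : RSpace d, -(deriv q ‖x‖ * ‖x‖) ≤ R⁻¹ := fun x =>
    (neg_le_abs _).trans (hq.abs_deriv_q_mul_le _)
  have hψc : Continuous fun x : RSpace d => -(deriv q ‖x‖ * ‖x‖) :=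
    ((hqdc.comp continuous_norm).mul continuous_norm).neg
  have hld : ∀ᶠ l : ℝ in 𝓝[<] 1, (l ^ d)⁻¹ < 2 := by
    have c1 : ContinuousAt (fun l : ℝ => (l ^ d)⁻¹) 1 := (continuousAt_pow 1 d).inv₀ (by simp)
    have := c1.tendsto
    simp only [one_pow, inv_one] at this
    exact (this.mono_left nhdsWithin_le_nhds).eventually_lt_const (by norm_num)
  -- The weighted increment is bounded by its limit only up to an arbitrary `e`.
  refine le_of_forall_pos_le_add fun e he => ?_
  have key := le_of_tendsto hlim (b := P / 2 + e + 2 * (|ε| * (√U * √N)) + 2 * (Φ * √T)) ?_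
  · linarith
  filter_upwards [eventually_near_one, hld, hH.eventually_sub_dilation_le hψc hψ0 hψle he]
    with l hl hl2 hQ
  have hl0 : 0 < l := by linarith [hl.1]
  have hp : 0 < 1 - l := by linarith [hl.2]
  obtain ⟨hVl, hVle⟩ := potential_dilation_le (by omega) hVm hV0 hu h.energy hq hL0 hw hFTC hL hl0
    hl.2
  have dt := h.difference_test hd hVm hV0' hq hl0 hl.2 hVl
  have hD := hH.sub (hH.comp_smul hl0)
  have hDm := hD.measurable
  obtain ⟨hi, hiv⟩ := hH.integral_sub_dilation_div_le hl0 hl.2.le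
  have eK : l ^ 2 * ∫ x, q ‖x‖ * ‖G (l • x)‖ ^ 2
      = l ^ (-((d : ℝ) - 2)) * ∫ y, q ‖l⁻¹ • y‖ * ‖G y‖ ^ 2 := by
    rw [integral_mul_comp_smul (Q := fun x => q ‖x‖) (F := fun x => ‖G x‖ ^ 2) hl0, ← mul_assoc]
    congr 1
    rw [neg_sub, Real.rpow_sub hl0, Real.rpow_natCast, Real.rpow_two, div_eq_mul_inv]
  have eU : ∫ x, q ‖x‖ * ‖u (l • x)‖ ^ 2 = l ^ (-(d : ℝ)) * ∫ y, q ‖l⁻¹ • y‖ * ‖u y‖ ^ 2 := by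
    rw [integral_mul_comp_smul (Q := fun x => q ‖x‖) (F := fun x => ‖u x‖ ^ 2) hl0,
      Real.rpow_neg hl0.le, Real.rpow_natCast]
  have eV : ∫ y, V y * ‖u y‖ ^ 2 * q ‖l⁻¹ • y‖ = ∫ y, q ‖l⁻¹ • y‖ * (V y * ‖u y‖ ^ 2) :=
    integral_congr_ae (Eventually.of_forall fun x => mul_comm _ _)
  have eL : (l⁻¹ - 1) * L = (1 - l) * l⁻¹ * L := by
    rw [sub_mul 1 l, mul_inv_cancel₀ hl0.ne', one_mul]
  rw [eV, eL] at hVle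
  rw [eK, eU] at dt
  -- The second half of Young's inequality costs another `P / 2`, so that `P` appears with
  -- coefficient `1`, as for the exact multiplier.
  have hQ' : (2 * (1 - l))⁻¹ * (∫ x, -(deriv q ‖x‖ * ‖x‖) / ‖x‖ ^ 2 * ‖u x - u (l • x)‖ ^ 2)
      ≤ (1 - l) * ((P + e) / 2) := by
    have hQ2 : ∫ x, -(deriv q ‖x‖ * ‖x‖) / ‖x‖ ^ 2 * ‖u x - u (l • x)‖ ^ 2
        ≤ (1 - l) ^ 2 * (P + e) := hQ
    refine (mul_le_mul_of_nonneg_left hQ2 (by positivity)).trans (le_of_eq ?_)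
    clear_value P
    field_simp
  have hI := hH.integral_mul_multiplier_sub_dilation_le hq (by omega) hl0 hl.2 hl2.le
  have hI' : |ε| * (∫ x, ‖u x‖ * (q ‖x‖ * ‖u x - u (l • x)‖))
      ≤ (1 - l) * (2 * (|ε| * (√U * √N))) :=
    (mul_le_mul_of_nonneg_left hI (abs_nonneg ε)).trans (le_of_eq (by ring))
  have hF := hH.norm_integral_multiplier_sub_dilation_le hq hd hf hfin hδ hδR hT hl0 hl.2 hl2.le
  have e1 : (1 - l) * (1 - l)⁻¹ = 1 := mul_inv_cancel₀ hp.ne'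
  refine le_of_mul_le_mul_left ?_ hp
  set a1 := ∫ y, q ‖l⁻¹ • y‖ * ‖G y‖ ^ 2
  set a2 := ∫ y, q ‖l⁻¹ • y‖ * (V y * ‖u y‖ ^ 2)
  set a3 := ∫ y, q ‖l⁻¹ • y‖ * ‖u y‖ ^ 2
  set b1 := ∫ x, q ‖x‖ * ‖G x‖ ^ 2
  set b2 := ∫ x, q ‖x‖ * (V x * ‖u x‖ ^ 2)
  set b3 := ∫ x, q ‖x‖ * ‖u x‖ ^ 2
  set b4 := ∫ x, q ‖x‖ * ‖u x - u (l • x)‖ ^ 2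
  have e2 : (1 - l) * (1 / 2 * ((1 - l)⁻¹ * (b1 - l ^ (-((d : ℝ) - 2)) * a1)) - P / 2
      + 1 / 2 * ((1 - l)⁻¹ * (b2 - l ^ (-((d : ℝ) - γ)) * a2) - l ^ (-((d : ℝ) - γ)) * l⁻¹ * L)
      - τ / 2 * ((1 - l)⁻¹ * (b3 - l ^ (-(d : ℝ)) * a3) + (1 - l)⁻¹ * b4))
      = ((1 - l) * (1 - l)⁻¹) * (1 / 2 * (b1 - l ^ (-((d : ℝ) - 2)) * a1)
        + 1 / 2 * (b2 - l ^ (-((d : ℝ) - γ)) * a2)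
        - τ / 2 * (b3 - l ^ (-(d : ℝ)) * a3 + b4)) - (1 - l) * (P / 2)
        - (1 - l) * (1 / 2 * (l ^ (-((d : ℝ) - γ)) * l⁻¹ * L)) := by ring
  rw [e2, e1, one_mul]
  have he' : 0 ≤ (1 - l) * e := by positivity
  linarith

end MorawetzLimit

/-! ### The test with `u` weighted by half the divergence of `q x`, and the Morawetz inequality. -/

section Morawetz

open Filter Topology

variable {d : ℕ}

theorem IsMultiplier.integrable_p_mul {q p : ℝ → ℝ} {R : ℝ} (hq : IsMultiplier q p R)
    {F : RSpace d → ℝ} (hF : Integrable F volume) : Integrable (fun x => p ‖x‖ * F x) volume :=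
  hF.bdd_mul (c := R⁻¹)
    (hq.contDiff_p.continuous.comp continuous_norm).aestronglyMeasurable
    (Eventually.of_forall fun _ => by
      rw [Real.norm_of_nonneg (hq.p_nonneg _)]; exact hq.p_le _)

theorem IsMultiplier.integral_p_mul {q p : ℝ → ℝ} {R : ℝ} (hq : IsMultiplier q p R)
    {F : RSpace d → ℝ} (hF : Integrable F volume) :
    ∫ x, p ‖x‖ * F x = (∫ x, q ‖x‖ * F x) + ∫ x, deriv q ‖x‖ * ‖x‖ * F x := by
  rw [← integral_add (hq.integrable_mul hF) (hq.integrable_deriv_mul hF)]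
  refine integral_congr_ae (Eventually.of_forall fun x => ?_)
  simp only
  rw [hq.rel]; ring

theorem IsMultiplier.abs_deriv_p_mul_le {q p : ℝ → ℝ} {R : ℝ} (hq : IsMultiplier q p R) (r : ℝ) :
    |deriv p r * r| ≤ 13 * R⁻¹ := by
  have hR := hq.pos
  rcases lt_or_ge r R with h | h
  · rw [hq.deriv_p_eq_zero h, zero_mul, abs_zero]; positivity
  rcases lt_or_ge (11 / 10 * R) r with h2 | h2
  · rw [hq.deriv_p_eq_zero_of_ge h2.le, zero_mul, abs_zero]; positivity
  · rw [abs_mul, abs_of_nonneg (hR.le.trans h)]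
    calc |deriv p r| * r ≤ 100 / 9 / R ^ 2 * (11 / 10 * R) := by
          have := hq.abs_deriv_p_le r
          have : 0 ≤ r := hR.le.trans h
          gcongr
      _ = 110 / 9 * R⁻¹ := by field_simp; norm_num
      _ ≤ _ := by
          have : 0 < R⁻¹ := inv_pos.2 hR
          linarith

/-- The equation tested with `φ u`, where `φ = (p + (d - 1) q) / 2`. -/
theorem IsGlobalSolution.multiplier_test {V : RSpace d → ℝ} {ε τ : ℝ} {f u : RSpace d → ℂ}
    {G : RSpace d → CSpace d} (h : IsGlobalSolution V ε τ f u G) (hd : 3 ≤ d)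
    (hf : AEStronglyMeasurable f volume) (hfin : xStarNorm f < ⊤) {q p : ℝ → ℝ} {R : ℝ}
    (hq : IsMultiplier q p R) {δ T : ℝ} (hδ : 0 < δ) (hδR : δ ≤ R)
    (hT : ∀ ρ, δ ≤ ρ → ∫ x in ball (0 : RSpace d) ρ, (‖G x‖ ^ 2 + ‖u x‖ ^ 2 / ‖x‖ ^ 2) ≤ T * ρ) :
    1 / 2 * (d * (∫ x, q ‖x‖ * ‖G x‖ ^ 2) + ∫ x, deriv q ‖x‖ * ‖x‖ * ‖G x‖ ^ 2)
      + (∫ x, (deriv p ‖x‖ * ‖x‖ + (d - 1) * (deriv q ‖x‖ * ‖x‖)) / 2 / ‖x‖ ^ 2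
          * (conj (u x) * euler G x).re)
      + 1 / 2 * (d * (∫ x, q ‖x‖ * (V x * ‖u x‖ ^ 2))
        + ∫ x, deriv q ‖x‖ * ‖x‖ * (V x * ‖u x‖ ^ 2))
      - τ / 2 * (d * (∫ x, q ‖x‖ * ‖u x‖ ^ 2) + ∫ x, deriv q ‖x‖ * ‖x‖ * ‖u x‖ ^ 2)
    ≤ d * ((xStarNorm f).toReal * √T) := by
  have hH := h.isH1
  have hu := hH.measurable
  have hR := hq.pos
  have hd1 : (1 : ℝ) ≤ d := by exact_mod_cast (by omega : 1 ≤ d)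
  have hae : ∀ᵐ x : RSpace d, x ≠ 0 := ae_ne_zero (by omega)
  -- the radial profile
  set m : ℝ → ℝ := fun r => (p r + (d - 1) * q r) / 2 with hm
  have hmC : ContDiff ℝ ∞ m := (hq.contDiff_p.add (contDiff_const.mul hq.contDiff_q)).div_const 2
  have hmc : ∀ r < R, m r = m 0 := fun r hr => by
    simp only [hm, hq.p_const r hr, hq.q_const r hr]
  have hmd : ∀ r, deriv m r = (deriv p r + (d - 1) * deriv q r) / 2 := fun r => by
    have h1 := ((hq.differentiable_p r).hasDerivAt.add
      ((hq.differentiable_q r).hasDerivAt.const_mul ((d : ℝ) - 1))).div_const 2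
    exact h1.deriv
  have hm0 : ∀ r, 0 ≤ m r := fun r => by
    have h1 := hq.p_nonneg r
    have h2 := mul_nonneg (by linarith : (0 : ℝ) ≤ d - 1) (hq.q_nonneg r)
    simp only [hm]; linarith
  have hmq : ∀ r, 0 ≤ r → m r ≤ d / 2 * q r := fun r hr => by
    have := hq.p_le_q hr
    simp only [hm]; linarith
  have hmb : ∀ x : RSpace d, |m ‖x‖| ≤ d / 2 * R⁻¹ := fun x => by
    rw [abs_of_nonneg (hm0 _)]
    have h2 := hq.q_le ‖x‖
    exact (hmq _ (norm_nonneg x)).trans (by gcongr)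
  have hmg : ∀ x : RSpace d, ‖cgrad (fun x : RSpace d => m ‖x‖) x‖
      ≤ (100 / 9 / R ^ 2 + (d - 1) * (R⁻¹ / R)) / 2 := fun x => by
    refine (norm_cgrad_radial_le (hmC.differentiable (by simp)) hR hmc x).trans ?_
    rw [hmd, abs_div, abs_two]
    have h1 := abs_add_le (deriv p ‖x‖) ((d - 1) * deriv q ‖x‖)
    rw [abs_mul, abs_of_nonneg (by linarith : (0 : ℝ) ≤ d - 1)] at h1
    have h2 := hq.abs_deriv_p_le ‖x‖
    have h3 := mul_le_mul_of_nonneg_left (hq.abs_deriv_q_le ‖x‖) (by linarith : (0 : ℝ) ≤ d - 1)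
    linarith
  have hmr : ContDiff ℝ ∞ fun x : RSpace d => m ‖x‖ := contDiff_radial hmC hR hmc
  have hv := hH.smooth_mul hmr
    (C := max (d / 2 * R⁻¹) ((100 / 9 / R ^ 2 + (d - 1) * (R⁻¹ / R)) / 2))
    (fun x => (hmb x).trans (le_max_left _ _)) (fun x => (hmg x).trans (le_max_right _ _))
  set v : RSpace d → ℂ := fun x => (m ‖x‖ : ℂ) * u x with hvdef
  have hvm := hv.measurable
  have hmm : Measurable fun x : RSpace d => m ‖x‖ := hmr.continuous.measurable
  have hmi : ∀ {F : RSpace d → ℝ}, Integrable F volume → Integrable (fun x => m ‖x‖ * F x) volume :=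
    fun hF => hF.bdd_mul (c := d / 2 * R⁻¹) hmm.aestronglyMeasurable
      (Eventually.of_forall fun x => hmb x)
  have hmint : ∀ {F : RSpace d → ℝ}, Integrable F volume → ∫ x, m ‖x‖ * F x
      = 1 / 2 * (d * (∫ x, q ‖x‖ * F x) + ∫ x, deriv q ‖x‖ * ‖x‖ * F x) := by
    intro F hF
    have e1 : ∫ x, m ‖x‖ * F x = ∫ x, (p ‖x‖ * F x + (d - 1) * (q ‖x‖ * F x)) / 2 :=
      integral_congr_ae (Eventually.of_forall fun x => by simp only [hm]; ring)
    rw [e1, integral_div, integral_add (hq.integrable_p_mul hF)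
      ((hq.integrable_mul hF).const_mul _), integral_const_mul, hq.integral_p_mul hF]
    ring
  have hVv : Integrable (fun x => V x * ‖v x‖ ^ 2) volume := by
    refine (hmi (hmi h.energy)).congr (Eventually.of_forall fun x => ?_)
    simp only [hvdef, norm_mul, Complex.norm_real, mul_pow, Real.norm_eq_abs, sq_abs]
    ring
  have key := congrArg Complex.re (h.equation v _ hv hVv)
  have hinn := hH.integrable_inner hv
  have hmdc : Continuous (deriv m) := hmC.continuous_deriv (by simp)
  have hgm : Measurable fun x : RSpace d => deriv m ‖x‖ * ‖x‖ :=
    ((hmdc.comp continuous_norm).mul continuous_norm).measurable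
  have hg2 := hH.integrable_mul_re_euler hd hgm (C := (13 * R⁻¹ + (d - 1) * R⁻¹) / 2) (fun x => by
    have e : deriv m ‖x‖ * ‖x‖
        = (deriv p ‖x‖ * ‖x‖ + (d - 1) * (deriv q ‖x‖ * ‖x‖)) / 2 := by rw [hmd]; ring
    rw [e, abs_div, abs_two]
    have h1 := abs_add_le (deriv p ‖x‖ * ‖x‖) ((d - 1) * (deriv q ‖x‖ * ‖x‖))
    rw [abs_mul (d - 1 : ℝ), abs_of_nonneg (by linarith : (0 : ℝ) ≤ d - 1)] at h1
    have h2 := hq.abs_deriv_p_mul_le ‖x‖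
    have h3 := mul_le_mul_of_nonneg_left (hq.abs_deriv_q_mul_le ‖x‖)
      (by linarith : (0 : ℝ) ≤ d - 1)
    linarith)
  have r1 : (∫ x, (inner ℂ ((m ‖x‖ : ℂ) • G x + u x • cgrad (fun x : RSpace d => m ‖x‖) x) (G x)
      : ℂ)).re = (∫ x, m ‖x‖ * ‖G x‖ ^ 2)
        + ∫ x, (deriv p ‖x‖ * ‖x‖ + (d - 1) * (deriv q ‖x‖ * ‖x‖)) / 2 / ‖x‖ ^ 2
          * (conj (u x) * euler G x).re := by
    have e1 : ∫ x, (deriv p ‖x‖ * ‖x‖ + (d - 1) * (deriv q ‖x‖ * ‖x‖)) / 2 / ‖x‖ ^ 2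
          * (conj (u x) * euler G x).re
        = ∫ x, deriv m ‖x‖ * ‖x‖ / ‖x‖ ^ 2 * (conj (u x) * euler G x).re := by
      refine integral_congr_ae (Eventually.of_forall fun x => ?_)
      simp only [hmd]; ring
    rw [e1, ← integral_add (hmi hH.integrable_grad_sq) hg2, ← RCLike.re_eq_complex_re,
      ← integral_re hinn]
    refine integral_congr_ae (Eventually.of_forall fun x => ?_)
    simp only
    rw [inner_smooth_mul, inner_cgrad_radial (hmC.differentiable (by simp)) hR hmc,
      RCLike.re_eq_complex_re, Complex.add_re, Complex.re_ofReal_mul]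
    have h1 : (inner ℂ (G x) (G x) : ℂ).re = ‖G x‖ ^ 2 := by
      simpa using (inner_self_eq_norm_sq (𝕜 := ℂ) (G x))
    have h3 : conj (u x) * (((deriv m ‖x‖ / ‖x‖ : ℝ) : ℂ) * euler G x)
        = ((deriv m ‖x‖ / ‖x‖ : ℝ) : ℂ) * (conj (u x) * euler G x) := by ring
    have h4 : deriv m ‖x‖ / ‖x‖ = deriv m ‖x‖ * ‖x‖ / ‖x‖ ^ 2 := by
      rcases eq_or_ne ‖x‖ 0 with h0 | h0
      · simp [h0]
      · field_simp
    rw [h1, h3, Complex.re_ofReal_mul, h4]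
  have e2 : ∀ x, u x * conj (v x) = ((m ‖x‖ * ‖u x‖ ^ 2 : ℝ) : ℂ) := by
    intro x
    simp only [hvdef, map_mul, Complex.conj_ofReal]
    push_cast
    rw [← Complex.mul_conj']
    ring
  have e4 : ∀ x, V x * (m ‖x‖ * ‖u x‖ ^ 2) = m ‖x‖ * (V x * ‖u x‖ ^ 2) := fun x => by ring
  simp only [e2, ← Complex.ofReal_mul, e4] at key
  rw [integral_complex_ofReal, integral_complex_ofReal, Complex.add_re, Complex.add_re,
    Complex.ofReal_re, r1] at key
  have e3 : ((Complex.I * (ε : ℂ) - (τ : ℂ)) * ((∫ x, m ‖x‖ * ‖u x‖ ^ 2 : ℝ) : ℂ)).re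
      = -τ * ∫ x, m ‖x‖ * ‖u x‖ ^ 2 := by simp
  rw [e3, hmint hH.integrable_grad_sq, hmint h.energy, hmint hH.integrable_sq] at key
  -- the data term
  have hHi : Integrable (fun x => ‖G x‖ ^ 2 + ‖u x‖ ^ 2 / ‖x‖ ^ 2) volume :=
    hH.integrable_grad_sq.add (hH.integrable_sq_div hd)
  have hF := norm_integral_le_of_growth (by omega) hf hfin hvm.aestronglyMeasurable
    (fun x => by positivity) hHi hδ hδR (K := (d : ℝ) ^ 2) (by positivity) hT (fun ρ hρ => by
      have h2 : ∫ x in ball (0 : RSpace d) ρ, ‖u x‖ ^ 2 / ‖x‖ ^ 2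
          ≤ ∫ x in ball (0 : RSpace d) ρ, (‖G x‖ ^ 2 + ‖u x‖ ^ 2 / ‖x‖ ^ 2) :=
        integral_mono (hH.integrable_sq_div hd).integrableOn hHi.integrableOn fun x => by
          have : 0 ≤ ‖G x‖ ^ 2 := by positivity
          simp only
          linarith
      have hDi := (hH.integrable_sq_div hd).integrableOn (s := ball (0 : RSpace d) ρ)
      calc ∫⁻ x in ball (0 : RSpace d) ρ, ‖v x‖ₑ ^ 2
          ≤ ∫⁻ x in ball (0 : RSpace d) ρ, ENNReal.ofReal
              ((d : ℝ) ^ 2 * min 1 (ρ / R) ^ 2 * (‖u x‖ ^ 2 / ‖x‖ ^ 2)) := by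
            have hmem : ∀ᵐ x ∂(volume.restrict (ball (0 : RSpace d) ρ)),
              x ∈ ball (0 : RSpace d) ρ := ae_restrict_mem measurableSet_ball
            refine lintegral_mono_ae ?_
            filter_upwards [hmem, ae_restrict_of_ae hae] with x hx hx0
            have hx1 : 0 < ‖x‖ := norm_pos_iff.2 hx0
            rw [mem_ball_zero_iff] at hx
            rw [← ofReal_norm, ← ENNReal.ofReal_pow (norm_nonneg _)]
            apply ENNReal.ofReal_le_ofReal
            simp only [hvdef]
            rw [norm_mul, Complex.norm_real, Real.norm_of_nonneg (hm0 _)]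
            have h3 := hq.mul_q_le_min (norm_nonneg x) hx.le
            have h4 : ‖x‖ * m ‖x‖ ≤ d * min 1 (ρ / R) := by
              have h5 : 0 ≤ min 1 (ρ / R) := le_min zero_le_one (by positivity)
              -- Here `m ≤ (d/2) q` because `p ≤ q`, so `|x| m` inherits the bound by `min(1, ρ/R)`.
              calc ‖x‖ * m ‖x‖ ≤ ‖x‖ * (d / 2 * q ‖x‖) := by
                    gcongr; exact hmq _ (norm_nonneg x)
                _ = d / 2 * (‖x‖ * q ‖x‖) := by ring
                _ ≤ d / 2 * (11 / 10 * min 1 (ρ / R)) := by gcongr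
                _ ≤ _ := by nlinarith [mul_nonneg (by linarith : (0 : ℝ) ≤ d) h5]
            have h6 : 0 ≤ ‖x‖ * m ‖x‖ := mul_nonneg hx1.le (hm0 _)
            calc (m ‖x‖ * ‖u x‖) ^ 2 = (‖x‖ * m ‖x‖) ^ 2 * (‖u x‖ ^ 2 / ‖x‖ ^ 2) := by field_simp
              _ ≤ (d * min 1 (ρ / R)) ^ 2 * (‖u x‖ ^ 2 / ‖x‖ ^ 2) := by gcongr
              _ = _ := by ring
        _ = ENNReal.ofReal ((d : ℝ) ^ 2 * min 1 (ρ / R) ^ 2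
              * ∫ x in ball (0 : RSpace d) ρ, ‖u x‖ ^ 2 / ‖x‖ ^ 2) := by
            rw [← integral_const_mul, ofReal_integral_eq_lintegral_ofReal (hDi.const_mul _)
              (Eventually.of_forall fun x => by positivity)]
        _ ≤ _ := by gcongr)
  rw [Real.sqrt_mul (by positivity), Real.sqrt_sq (by linarith)] at hF
  have hF2 := (Complex.re_le_norm (∫ x, f x * conj (v x))).trans hF
  linarith

/-- The Morawetz inequality before the completion of squares. -/
theorem IsGlobalSolution.morawetz {V : RSpace d → ℝ} {ε τ : ℝ} {f u : RSpace d → ℂ}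
    {G : RSpace d → CSpace d} (h : IsGlobalSolution V ε τ f u G) (hd : 3 ≤ d)
    (hVm : AEMeasurable V volume) (hV0 : ∀ x, x ≠ 0 → 0 ≤ V x)
    (hf : AEStronglyMeasurable f volume) (hfin : xStarNorm f < ⊤) {q p : ℝ → ℝ} {R : ℝ}
    (hq : IsMultiplier q p R) {γ L : ℝ} (hL0 : 0 ≤ L) {w : ℝ → ℝ≥0∞} (hw : Measurable w)
    (hFTC : ∀ σ : ℝ, 1 ≤ σ → ∀ y : RSpace d, y ≠ 0 → ENNReal.ofReal (σ ^ γ * V (σ • y))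
      ≤ ENNReal.ofReal (V y) + ∫⁻ t in Ioc 1 σ, w (t * ‖y‖))
    (hL : ∀ t : ℝ, 1 ≤ t → ∫⁻ x, w (t * ‖x‖) * ENNReal.ofReal (q ‖x‖ * ‖u x‖ ^ 2)
      ≤ ENNReal.ofReal L) {δ T : ℝ} (hδ : 0 < δ) (hδR : δ ≤ R)
    (hT : ∀ ρ, δ ≤ ρ → ∫ x in ball (0 : RSpace d) ρ, (‖G x‖ ^ 2 + ‖u x‖ ^ 2 / ‖x‖ ^ 2) ≤ T * ρ) :
    (∫ x, q ‖x‖ * ‖G x‖ ^ 2)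
      - (∫ x, -(deriv q ‖x‖ * ‖x‖) / ‖x‖ ^ 2 * ‖euler G x‖ ^ 2)
      + (∫ x, (deriv p ‖x‖ * ‖x‖ + (d - 1) * (deriv q ‖x‖ * ‖x‖)) / 2 / ‖x‖ ^ 2
          * (conj (u x) * euler G x).re)
      + γ / 2 * (∫ x, q ‖x‖ * (V x * ‖u x‖ ^ 2))
    ≤ 1 / 2 * L + 2 * (|ε| * (√(∫ x, ‖u x‖ ^ 2) * √(∫ x, ‖G x‖ ^ 2)))
      + (d + 2) * ((xStarNorm f).toReal * √T) := by
  -- On adding the two tests the `τ` terms cancel, as do the terms with `q'` times `|∇u|²` and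
  -- `V|u|²`; coefficient `1` is left in front of `∫ q|∇u|²` and `γ/2` in front of the potential
  -- energy.
  have h1 := h.difference_limit hd hVm hV0 hf hfin hq hL0 hw hFTC hL hδ hδR hT
  have h2 := h.multiplier_test hd hf hfin hq hδ hδR hT
  linarith

end Morawetz

/-! ### Completion of squares in the kinetic terms. -/

section CompletedSquares

open Filter Topology

variable {d : ℕ}

/-- The cross term `Re (ū (∂ᵣu + c u / |x|)) / |x|`. -/
noncomputable def radialCross (c : ℝ) (u : RSpace d → ℂ) (G : RSpace d → CSpace d)
    (x : RSpace d) : ℝ :=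
  (conj (u x) * (euler G x + (c : ℂ) * u x)).re / ‖x‖ ^ 2

theorem radialCross_eq (c : ℝ) (u : RSpace d → ℂ) (G : RSpace d → CSpace d) (x : RSpace d) :
    radialCross c u G x
      = (conj (u x) * euler G x).re / ‖x‖ ^ 2 + c * (‖u x‖ ^ 2 / ‖x‖ ^ 2) := by
  have e : conj (u x) * ((c : ℂ) * u x) = ((c * ‖u x‖ ^ 2 : ℝ) : ℂ) := by
    push_cast
    rw [← Complex.conj_mul']
    ring
  rw [radialCross, mul_add, e, Complex.add_re, Complex.ofReal_re]
  ring

/-- The tangential part of the gradient, squared. -/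
noncomputable def tangentialEnergy (G : RSpace d → CSpace d) (x : RSpace d) : ℝ :=
  ‖G x‖ ^ 2 - ‖euler G x‖ ^ 2 / ‖x‖ ^ 2

theorem tangentialEnergy_nonneg (G : RSpace d → CSpace d) (x : RSpace d) :
    0 ≤ tangentialEnergy G x := sub_nonneg.2 (norm_euler_sq_div_le G x)

theorem IsH1.integrable_euler_sq_div {u : RSpace d → ℂ} {G : RSpace d → CSpace d} (h : IsH1 u G) :
    Integrable (fun x => ‖euler G x‖ ^ 2 / ‖x‖ ^ 2) volume := by
  have hE := measurable_euler h.measurable_grad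
  refine h.integrable_grad_sq.mono' (Measurable.aestronglyMeasurable (by fun_prop))
    (Eventually.of_forall fun x => ?_)
  rw [Real.norm_of_nonneg (by positivity)]
  exact norm_euler_sq_div_le G x

theorem IsH1.integrable_tangentialEnergy {u : RSpace d → ℂ} {G : RSpace d → CSpace d}
    (h : IsH1 u G) : Integrable (tangentialEnergy G) volume :=
  h.integrable_grad_sq.sub h.integrable_euler_sq_div

theorem IsH1.integrable_re_euler_div {u : RSpace d → ℂ} {G : RSpace d → CSpace d} (h : IsH1 u G)
    (hd : 3 ≤ d) : Integrable (fun x => (conj (u x) * euler G x).re / ‖x‖ ^ 2) volume := by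
  have h1 := h.integrable_mul_re_euler hd (ψ := fun _ => 1) measurable_const (C := 1) (by simp)
  refine h1.congr (Eventually.of_forall fun x => ?_)
  simp only
  ring

theorem IsH1.integrable_radialCross {u : RSpace d → ℂ} {G : RSpace d → CSpace d} (h : IsH1 u G)
    (hd : 3 ≤ d) (c : ℝ) : Integrable (radialCross c u G) volume := by
  refine ((h.integrable_re_euler_div hd).add ((h.integrable_sq_div hd).const_mul c)).congr
    (Eventually.of_forall fun x => ?_)
  rw [radialCross_eq]; rfl

theorem IsMultiplier.integrable_deriv_p_mul {q p : ℝ → ℝ} {R : ℝ} (hq : IsMultiplier q p R)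
    {F : RSpace d → ℝ} (hF : Integrable F volume) :
    Integrable (fun x => deriv p ‖x‖ * ‖x‖ * F x) volume := by
  have hc : Continuous (deriv p) := hq.contDiff_p.continuous_deriv (by simp)
  exact hF.bdd_mul (c := 13 * R⁻¹)
    ((hc.comp continuous_norm).mul continuous_norm).aestronglyMeasurable
    (Eventually.of_forall fun _ => hq.abs_deriv_p_mul_le _)

/-- Completion of squares in the Morawetz identity. -/
theorem IsH1.multiplier_identity {u : RSpace d → ℂ} {G : RSpace d → CSpace d} (h : IsH1 u G)
    (hd : 3 ≤ d) {q p : ℝ → ℝ} {R : ℝ} (hq : IsMultiplier q p R) :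
    (∫ x, q ‖x‖ * ‖G x‖ ^ 2)
      - (∫ x, -(deriv q ‖x‖ * ‖x‖) / ‖x‖ ^ 2 * ‖euler G x‖ ^ 2)
      + (∫ x, (deriv p ‖x‖ * ‖x‖ + (d - 1) * (deriv q ‖x‖ * ‖x‖)) / 2 / ‖x‖ ^ 2
          * (conj (u x) * euler G x).re)
    = (∫ x, p ‖x‖ * radialEnergy ((d - 1) / 2) u G x)
      + 1 / 2 * (∫ x, deriv p ‖x‖ * ‖x‖ * radialCross ((d - 1) / 2) u G x)
      + (∫ x, q ‖x‖ * tangentialEnergy G x)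
      + ((d : ℝ) - 1) * (d - 3) / 4 * (∫ x, q ‖x‖ * (‖u x‖ ^ 2 / ‖x‖ ^ 2)) := by
  have hR := hq.pos
  have hRi : 0 < R⁻¹ := inv_pos.2 hR
  have iE := h.integrable_euler_sq_div
  have iC := h.integrable_re_euler_div hd
  have iU := h.integrable_sq_div hd
  have hpq : ContDiff ℝ 1 fun x : RSpace d => p ‖x‖ + q ‖x‖ :=
    ((hq.contDiff_radial_p (d := d)).of_le (by simp)).add
      ((hq.contDiff_radial_q (d := d)).of_le (by simp))
  have hfd : ∀ x : RSpace d, fderiv ℝ (fun x : RSpace d => p ‖x‖ + q ‖x‖) x x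
      = deriv p ‖x‖ * ‖x‖ + deriv q ‖x‖ * ‖x‖ := by
    intro x
    have e := fderiv_fun_add (𝕜 := ℝ) (x := x)
      ((hq.contDiff_radial_p (d := d)).differentiable (by simp) x)
      ((hq.contDiff_radial_q (d := d)).differentiable (by simp) x)
    rw [e, add_apply, hq.fderiv_radial_q,
      fderiv_radial_self hq.differentiable_p hR hq.p_const]
  have IR := h.integral_radial hd hpq (C := 14 * R⁻¹) (fun x => by
      have h1 := hq.p_nonneg ‖x‖
      have h2 := hq.q_nonneg ‖x‖
      rw [abs_of_nonneg (by linarith)]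
      linarith [hq.p_le ‖x‖, hq.q_le ‖x‖]) (fun x => by
      rw [hfd]
      refine (abs_add_le _ _).trans ?_
      linarith [hq.abs_deriv_p_mul_le ‖x‖, hq.abs_deriv_q_mul_le ‖x‖])
  simp only [hfd] at IR
  -- the remainder integrates to zero
  have j1 : Integrable (fun x => (p ‖x‖ + q ‖x‖) / ‖x‖ ^ 2 * (conj (u x) * euler G x).re)
      volume := by
    refine ((hq.integrable_p_mul iC).add (hq.integrable_mul iC)).congr
      (Eventually.of_forall fun x => ?_)
    simp only [Pi.add_apply]; ring
  have j2 : Integrable (fun x => ‖u x‖ ^ 2 / ‖x‖ ^ 2 * ((d - 2) * (p ‖x‖ + q ‖x‖)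
      + (deriv p ‖x‖ * ‖x‖ + deriv q ‖x‖ * ‖x‖))) volume := by
    have := (((hq.integrable_p_mul iU).add (hq.integrable_mul iU)).const_mul ((d : ℝ) - 2)).add
      ((hq.integrable_deriv_p_mul iU).add (hq.integrable_deriv_mul iU))
    refine this.congr (Eventually.of_forall fun x => ?_)
    simp only [Pi.add_apply]; ring
  set c : ℝ := ((d : ℝ) - 1) / 2 with hc
  -- The two sides differ pointwise by this exact divergence: `-c/2` times that of `(p + q)|u|²
  -- x/|x|²`.
  have hZ : ∫ x, (-(c / 2) * (‖u x‖ ^ 2 / ‖x‖ ^ 2 * ((d - 2) * (p ‖x‖ + q ‖x‖)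
      + (deriv p ‖x‖ * ‖x‖ + deriv q ‖x‖ * ‖x‖)))
      - c * ((p ‖x‖ + q ‖x‖) / ‖x‖ ^ 2 * (conj (u x) * euler G x).re)) = 0 := by
    rw [integral_sub (j2.const_mul _) (j1.const_mul _), integral_const_mul, integral_const_mul, IR]
    ring
  have k1 := hq.integrable_mul h.integrable_grad_sq
  have k2 : Integrable (fun x => -(deriv q ‖x‖ * ‖x‖) / ‖x‖ ^ 2 * ‖euler G x‖ ^ 2) volume := by
    refine (hq.integrable_deriv_mul iE).neg.congr (Eventually.of_forall fun x => ?_)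
    simp only [Pi.neg_apply]; ring
  have k3 : Integrable (fun x => (deriv p ‖x‖ * ‖x‖ + (d - 1) * (deriv q ‖x‖ * ‖x‖)) / 2 / ‖x‖ ^ 2
      * (conj (u x) * euler G x).re) volume := by
    refine (((hq.integrable_deriv_p_mul iC).add
      ((hq.integrable_deriv_mul iC).const_mul ((d : ℝ) - 1))).div_const 2).congr
      (Eventually.of_forall fun x => ?_)
    simp only [Pi.add_apply]; ring
  have m1 := hq.integrable_p_mul (h.integrable_radialEnergy hd c)
  have m2 := (hq.integrable_deriv_p_mul (h.integrable_radialCross hd c)).const_mul (1 / 2)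
  have m3 := hq.integrable_mul h.integrable_tangentialEnergy
  have m4 := (hq.integrable_mul iU).const_mul (((d : ℝ) - 1) * (d - 3) / 4)
  have k12 : Integrable (fun x => q ‖x‖ * ‖G x‖ ^ 2
      - -(deriv q ‖x‖ * ‖x‖) / ‖x‖ ^ 2 * ‖euler G x‖ ^ 2) volume := k1.sub k2
  have m12 : Integrable (fun x => p ‖x‖ * radialEnergy c u G x
      + 1 / 2 * (deriv p ‖x‖ * ‖x‖ * radialCross c u G x)) volume := m1.add m2
  have m123 : Integrable (fun x => p ‖x‖ * radialEnergy c u G x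
      + 1 / 2 * (deriv p ‖x‖ * ‖x‖ * radialCross c u G x) + q ‖x‖ * tangentialEnergy G x)
      volume := m12.add m3
  have m1234 : Integrable (fun x => p ‖x‖ * radialEnergy c u G x
      + 1 / 2 * (deriv p ‖x‖ * ‖x‖ * radialCross c u G x) + q ‖x‖ * tangentialEnergy G x
      + ((d : ℝ) - 1) * (d - 3) / 4 * (q ‖x‖ * (‖u x‖ ^ 2 / ‖x‖ ^ 2))) volume := m123.add m4
  have hZi : Integrable (fun x => -(c / 2) * (‖u x‖ ^ 2 / ‖x‖ ^ 2 * ((d - 2) * (p ‖x‖ + q ‖x‖)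
      + (deriv p ‖x‖ * ‖x‖ + deriv q ‖x‖ * ‖x‖)))
      - c * ((p ‖x‖ + q ‖x‖) / ‖x‖ ^ 2 * (conj (u x) * euler G x).re)) volume :=
    (j2.const_mul (-(c / 2))).sub (j1.const_mul c)
  rw [← integral_sub k1 k2, ← integral_add k12 k3, ← integral_const_mul, ← integral_const_mul,
    ← integral_add m1 m2, ← integral_add m12 m3, ← integral_add m123 m4]
  rw [← add_zero (∫ x, (p ‖x‖ * radialEnergy c u G x
      + 1 / 2 * (deriv p ‖x‖ * ‖x‖ * radialCross c u G x) + q ‖x‖ * tangentialEnergy G x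
      + ((d : ℝ) - 1) * (d - 3) / 4 * (q ‖x‖ * (‖u x‖ ^ 2 / ‖x‖ ^ 2)))), ← hZ,
    ← integral_add m1234 hZi]
  refine integral_congr_ae (Eventually.of_forall fun x => ?_)
  simp only [radialEnergy_eq, radialCross_eq, tangentialEnergy]
  rw [hq.rel ‖x‖, hc]
  ring

end CompletedSquares

/-! ### Near-maximal scales, and absorption of the error containing `p'`. -/

section Absorption

open Filter Topology

variable {d : ℕ}

/-- The averages `ρ⁻¹ ∫_{B_ρ} F` are bounded for `ρ ≥ δ` by integrability alone, whereas boundedness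
as `ρ → 0` is part of what is to be proved. The supremum need not be attained, hence `θ < 1`. -/
theorem exists_growth_constant {F : RSpace d → ℝ} (hF : Integrable F volume) (hF0 : ∀ x, 0 ≤ F x)
    {δ : ℝ} (hδ : 0 < δ) {θ : ℝ} (hθ1 : θ < 1) :
    ∃ M : ℝ, 0 ≤ M ∧ (∀ ρ, δ ≤ ρ → ∫ x in ball (0 : RSpace d) ρ, F x ≤ M * ρ) ∧
      ∃ R, δ ≤ R ∧ θ * M * R ≤ ∫ x in ball (0 : RSpace d) R, F x := by
  set S : Set ℝ := (fun ρ => (∫ x in ball (0 : RSpace d) ρ, F x) / ρ) '' Ici δ with hS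
  have hne : S.Nonempty := ⟨_, δ, mem_Ici.2 le_rfl, rfl⟩
  have hI : ∀ ρ, 0 ≤ ∫ x in ball (0 : RSpace d) ρ, F x := fun ρ => integral_nonneg hF0
  have hbdd : BddAbove S := by
    refine ⟨(∫ x, F x) / δ, ?_⟩
    rintro _ ⟨ρ, hρ, rfl⟩
    rw [mem_Ici] at hρ
    have h1 : ∫ x in ball (0 : RSpace d) ρ, F x ≤ ∫ x, F x :=
      setIntegral_le_integral hF (Eventually.of_forall hF0)
    have h2 : 0 ≤ ∫ x, F x := integral_nonneg hF0
    exact div_le_div₀ h2 h1 hδ hρ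
  have h0 : 0 ≤ sSup S := le_csSup_of_le hbdd ⟨δ, mem_Ici.2 le_rfl, rfl⟩ (div_nonneg (hI δ) hδ.le)
  refine ⟨sSup S, h0, fun ρ hρ => ?_, ?_⟩
  · rw [← div_le_iff₀ (hδ.trans_le hρ)]
    exact le_csSup hbdd ⟨ρ, hρ, rfl⟩
  · rcases h0.eq_or_lt with h | h
    · refine ⟨δ, le_rfl, ?_⟩
      rw [← h]
      simpa using hI δ
    · obtain ⟨_, ⟨R, hR, rfl⟩, hlt⟩ := exists_lt_of_lt_csSup hne
        (show θ * sSup S < sSup S by nlinarith)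
      refine ⟨R, hR, ?_⟩
      rw [← le_div_iff₀ (hδ.trans_le hR)]
      exact hlt.le

/-- The function `r q(r)` has derivative `p ≥ 0` and equals `1` at `R`. This lets `q` dominate
`1/|x|` outside `B_R`. -/
theorem IsMultiplier.one_le_mul_q {q p : ℝ → ℝ} {R : ℝ} (h : IsMultiplier q p R) {r : ℝ}
    (hr : R ≤ r) : 1 ≤ r * q r := by
  have hm : Monotone fun r => r * q r := by
    refine monotone_of_deriv_nonneg (differentiable_id.mul h.differentiable_q) fun x => ?_
    have e : HasDerivAt (fun r => r * q r) (1 * q x + x * deriv q x) x :=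
      (hasDerivAt_id x).mul (h.differentiable_q x).hasDerivAt
    rw [e.deriv]
    have := h.p_nonneg x
    rw [h.rel x] at this
    linarith
  have h1 := hm hr
  simp only at h1
  rwa [h.q_eq R le_rfl, mul_inv_cancel₀ h.pos.ne'] at h1

theorem abs_radialCross_le (c : ℝ) (u : RSpace d → ℂ) (G : RSpace d → CSpace d) {x : RSpace d}
    {R : ℝ} (hR : 0 < R) :
    ‖x‖ * |radialCross c u G x| ≤ 1 / 2 * (‖u x‖ ^ 2 / R + R * radialEnergy c u G x) := by
  rcases eq_or_ne x 0 with rfl | hx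
  · rw [norm_zero, zero_mul]
    have := radialEnergy_nonneg c u G 0
    positivity
  have hr := norm_pos_iff.2 hx
  unfold radialCross radialEnergy
  set z := euler G x + (c : ℂ) * u x
  have h1 : |(conj (u x) * z).re| ≤ ‖u x‖ * ‖z‖ := by
    refine (Complex.abs_re_le_norm _).trans ?_
    rw [norm_mul, RCLike.norm_conj]
  have h2 : ‖x‖ * |(conj (u x) * z).re / ‖x‖ ^ 2| ≤ ‖u x‖ * (‖z‖ / ‖x‖) := by
    rw [abs_div, abs_of_nonneg (sq_nonneg ‖x‖)]
    calc ‖x‖ * (|(conj (u x) * z).re| / ‖x‖ ^ 2) = |(conj (u x) * z).re| / ‖x‖ := by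
          field_simp
      _ ≤ (‖u x‖ * ‖z‖) / ‖x‖ := by gcongr
      _ = _ := by ring
  refine h2.trans ?_
  rw [← div_pow]
  set a := ‖u x‖
  set b := ‖z‖ / ‖x‖
  have h3 : 0 ≤ (a - R * b) ^ 2 / R := by positivity
  have h4 : (a - R * b) ^ 2 / R = a ^ 2 / R - 2 * (a * b) + R * b ^ 2 := by
    field_simp; ring
  linarith

/-- The spherical shell `R ≤ |x| < 11R/10`. -/
def thinShell (d : ℕ) (R : ℝ) : Set (RSpace d) := ball 0 (11 / 10 * R) \ ball 0 R

theorem measurableSet_thinShell (R : ℝ) : MeasurableSet (thinShell d R) :=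
  measurableSet_ball.diff measurableSet_ball

/-- The trace bound integrated over radii from `R` to `11R/10`: density at most `M (11R/10)²`,
length `R/10`. -/
theorem IsH1.setIntegral_thinShell_sq_le {u : RSpace d → ℂ} {G : RSpace d → CSpace d}
    (h : IsH1 u G) (hd : 3 ≤ d) {M δ R : ℝ} (hδ : 0 < δ) (hδR : δ ≤ R) (hM0 : 0 ≤ M)
    (hM : ∀ ρ, δ ≤ ρ → ∫ x in ball (0 : RSpace d) ρ, radialEnergy ((d - 1) / 2) u G x ≤ M * ρ) :
    ∫ x in thinShell d R, ‖u x‖ ^ 2 ≤ 121 / 1000 * R ^ 3 * M := by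
  have hR := hδ.trans_le hδR
  have h1 := h.lintegral_radial_le hd (fun ρ h1 _ => hM ρ h1)
    (w := (Ico R (11 / 10 * R)).indicator 1) ((measurable_one.indicator measurableSet_Ico).aemeasurable)
  have e1 : ∀ x : RSpace d, (Ico R (11 / 10 * R)).indicator (1 : ℝ → ℝ≥0∞) ‖x‖
      * ENNReal.ofReal (‖u x‖ ^ 2)
      = (thinShell d R).indicator (fun x => ENNReal.ofReal (‖u x‖ ^ 2)) x := by
    intro x
    have : ‖x‖ ∈ Ico R (11 / 10 * R) ↔ x ∈ thinShell d R := by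
      simp only [thinShell, mem_Ico, Set.mem_sdiff, mem_ball_zero_iff, not_lt]
      tauto
    by_cases hx : x ∈ thinShell d R
    · rw [indicator_of_mem hx, indicator_of_mem (this.2 hx), Pi.one_apply, one_mul]
    · rw [indicator_of_notMem hx, indicator_of_notMem (fun h => hx (this.1 h)), zero_mul]
  simp only [e1] at h1
  rw [lintegral_indicator (measurableSet_thinShell R)] at h1
  rw [integral_eq_lintegral_of_nonneg_ae (Eventually.of_forall fun x => by positivity)
    h.integrable_sq.aestronglyMeasurable.restrict]
  refine ENNReal.toReal_le_of_le_ofReal (by positivity) (h1.trans ?_)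
  have h2 : ∀ t ∈ Ioi (0 : ℝ), (Ico R (11 / 10 * R)).indicator (1 : ℝ → ℝ≥0∞) t
      * ENNReal.ofReal (M * t * max t δ)
      ≤ (Ico R (11 / 10 * R)).indicator
        (fun _ => ENNReal.ofReal (M * (11 / 10 * R) * (11 / 10 * R))) t := by
    intro t _
    by_cases ht : t ∈ Ico R (11 / 10 * R)
    · rw [indicator_of_mem ht, indicator_of_mem ht, Pi.one_apply, one_mul]
      have h3 : max t δ ≤ 11 / 10 * R := max_le ht.2.le (hδR.trans (ht.1.trans ht.2.le))
      have h4 : 0 ≤ t := hR.le.trans ht.1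
      refine ENNReal.ofReal_le_ofReal ?_
      have h5 := ht.2.le
      gcongr
    · rw [indicator_of_notMem ht, indicator_of_notMem ht, zero_mul]
  calc _ ≤ ∫⁻ t in Ioi (0 : ℝ), (Ico R (11 / 10 * R)).indicator
        (fun _ => ENNReal.ofReal (M * (11 / 10 * R) * (11 / 10 * R))) t :=
        setLIntegral_mono' measurableSet_Ioi h2
    _ ≤ ∫⁻ t, (Ico R (11 / 10 * R)).indicator
        (fun _ => ENNReal.ofReal (M * (11 / 10 * R) * (11 / 10 * R))) t := setLIntegral_le_lintegral _ _
    _ = ENNReal.ofReal (M * (11 / 10 * R) * (11 / 10 * R)) * ENNReal.ofReal (11 / 10 * R - R) := by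
        rw [lintegral_indicator measurableSet_Ico, setLIntegral_const, Real.volume_Ico]
    _ = ENNReal.ofReal (121 / 1000 * R ^ 3 * M) := by
        rw [← ENNReal.ofReal_mul (by positivity)]
        congr 1
        ring

/-- `p'` is supported in the shell and at most `100/(9R²)` there. The shell carries at most `(11/10
- θ) M R` of `D` by near-maximality at `R`, and the trace bound adds `121/1000`; their sum is
`1221/1000 - θ`. -/
theorem IsH1.abs_integral_cross_le {u : RSpace d → ℂ} {G : RSpace d → CSpace d}
    (h : IsH1 u G) (hd : 3 ≤ d) {q p : ℝ → ℝ} {M δ R θ : ℝ} (hq : IsMultiplier q p R) (hδ : 0 < δ)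
    (hδR : δ ≤ R) (hM0 : 0 ≤ M)
    (hM : ∀ ρ, δ ≤ ρ → ∫ x in ball (0 : RSpace d) ρ, radialEnergy ((d - 1) / 2) u G x ≤ M * ρ)
    (hθ : θ * M * R ≤ ∫ x in ball (0 : RSpace d) R, radialEnergy ((d - 1) / 2) u G x) :
    |∫ x, deriv p ‖x‖ * ‖x‖ * radialCross ((d - 1) / 2) u G x| ≤ 50 / 9 * (1221 / 1000 - θ) * M := by
  have hR := hq.pos
  set c : ℝ := ((d : ℝ) - 1) / 2
  have iD := h.integrable_radialEnergy hd c
  have iU := h.integrable_sq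
  have hsub : ball (0 : RSpace d) R ⊆ ball 0 (11 / 10 * R) := ball_subset_ball (by linarith)
  have hD : ∫ x in thinShell d R, radialEnergy c u G x ≤ (11 / 10 - θ) * M * R := by
    rw [thinShell, setIntegral_sdiff measurableSet_ball iD.integrableOn hsub]
    linarith [hM (11 / 10 * R) (by linarith)]
  have hU := h.setIntegral_thinShell_sq_le hd hδ hδR hM0 hM
  have hpt : ∀ x, ‖deriv p ‖x‖ * ‖x‖ * radialCross c u G x‖ ≤ (thinShell d R).indicator
      (fun x => 50 / 9 / R ^ 2 * (R⁻¹ * ‖u x‖ ^ 2 + R * radialEnergy c u G x)) x := by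
    intro x
    by_cases hx : x ∈ thinShell d R
    · rw [indicator_of_mem hx, Real.norm_eq_abs, abs_mul, abs_mul, abs_norm, mul_assoc]
      have h1 := abs_radialCross_le c u G (x := x) hR
      have h2 := hq.abs_deriv_p_le ‖x‖
      have h3 : (0 : ℝ) ≤ ‖x‖ * |radialCross c u G x| := by positivity
      calc _ ≤ 100 / 9 / R ^ 2 * (1 / 2 * (‖u x‖ ^ 2 / R + R * radialEnergy c u G x)) := by gcongr
        _ = _ := by ring
    · rw [indicator_of_notMem hx]
      have : deriv p ‖x‖ = 0 := by
        by_cases h1 : ‖x‖ < R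
        · exact hq.deriv_p_eq_zero h1
        · refine hq.deriv_p_eq_zero_of_ge (not_lt.1 fun h2 => hx ?_)
          exact ⟨mem_ball_zero_iff.2 h2, fun h3 => h1 (mem_ball_zero_iff.1 h3)⟩
      rw [this]; simp
  have i1 : Integrable (fun x => R⁻¹ * ‖u x‖ ^ 2) volume := iU.const_mul _
  have i2 : Integrable (fun x => R * radialEnergy c u G x) volume := iD.const_mul _
  have i3 : Integrable (fun x => 50 / 9 / R ^ 2 * (R⁻¹ * ‖u x‖ ^ 2 + R * radialEnergy c u G x))
      volume := (i1.add i2).const_mul _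
  calc _ ≤ ∫ x, ‖deriv p ‖x‖ * ‖x‖ * radialCross c u G x‖ := by
        rw [← Real.norm_eq_abs]; exact norm_integral_le_integral_norm _
    _ ≤ ∫ x, (thinShell d R).indicator
        (fun x => 50 / 9 / R ^ 2 * (R⁻¹ * ‖u x‖ ^ 2 + R * radialEnergy c u G x)) x :=
        integral_mono (hq.integrable_deriv_p_mul (h.integrable_radialCross hd c)).norm
          (i3.indicator (measurableSet_thinShell R)) hpt
    _ = 50 / 9 / R ^ 2 * (R⁻¹ * (∫ x in thinShell d R, ‖u x‖ ^ 2)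
          + R * ∫ x in thinShell d R, radialEnergy c u G x) := by
        rw [integral_indicator (measurableSet_thinShell R), integral_const_mul,
          integral_add i1.integrableOn i2.integrableOn, integral_const_mul, integral_const_mul]
    _ ≤ 50 / 9 / R ^ 2 * (R⁻¹ * (121 / 1000 * R ^ 3 * M) + R * ((11 / 10 - θ) * M * R)) := by
        gcongr
    _ = _ := by field_simp; ring

end Absorption

/-! ### Closing the Morawetz estimate up to the data and the `ε` error. -/

section Closing

open Filter Topology

variable {d : ℕ}

/-- Quantitative repulsivity: along rays, the growth of `V` is controlled by a radial weight `w`,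
and the weight is absorbed by the terms of the Morawetz identity. -/
structure IsAbsorbable (V : RSpace d → ℝ) (γ η : ℝ) (w : ℝ → ℝ≥0∞) : Prop where
  aemeasurable : AEMeasurable V volume
  nonneg : ∀ x, x ≠ 0 → 0 ≤ V x
  gamma_pos : 0 < γ
  eta_pos : 0 < η
  eta_le : η ≤ 1
  measurable : Measurable w
  dilation_le : ∀ σ : ℝ, 1 ≤ σ → ∀ y : RSpace d, y ≠ 0 → ENNReal.ofReal (σ ^ γ * V (σ • y))
      ≤ ENNReal.ofReal (V y) + ∫⁻ t in Ioc 1 σ, w (t * ‖y‖)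
  loss_le : ∀ (u : RSpace d → ℂ) (G : RSpace d → CSpace d) (q p : ℝ → ℝ) (R δ M : ℝ), IsH1 u G →
    IsMultiplier q p R → 0 < δ → δ ≤ R → 0 ≤ M →
    (∀ ρ, δ ≤ ρ → ∫ x in ball (0 : RSpace d) ρ, radialEnergy ((d - 1) / 2) u G x ≤ M * ρ) →
    ∀ t : ℝ, 1 ≤ t → ∫⁻ x, w (t * ‖x‖) * ENNReal.ofReal (q ‖x‖ * ‖u x‖ ^ 2)
      ≤ ENNReal.ofReal (2 * ((1 - η) * (((d : ℝ) - 1) * (d - 3) / 4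
          * ∫ x, q ‖x‖ * (‖u x‖ ^ 2 / ‖x‖ ^ 2))) + 11 / 20 * M)

theorem IsMultiplier.integral_nonneg {q p : ℝ → ℝ} {R : ℝ} (hq : IsMultiplier q p R)
    {F : RSpace d → ℝ} (hF : ∀ᵐ x, 0 ≤ F x) : 0 ≤ ∫ x, q ‖x‖ * F x :=
  integral_nonneg_of_ae (hF.mono fun _ hx => mul_nonneg (hq.q_nonneg _) hx)

theorem IsMultiplier.setIntegral_ball_le {q p : ℝ → ℝ} {R : ℝ} (hq : IsMultiplier q p R)
    {F : RSpace d → ℝ} (hF : Integrable F volume) (hF0 : ∀ᵐ x, 0 ≤ F x) :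
    ∫ x in ball (0 : RSpace d) R, F x ≤ R * ∫ x, q ‖x‖ * F x := by
  have hR := hq.pos
  have h1 : ∫ x in ball (0 : RSpace d) R, R * (q ‖x‖ * F x) ≤ ∫ x, R * (q ‖x‖ * F x) :=
    setIntegral_le_integral ((hq.integrable_mul hF).const_mul R)
      (hF0.mono fun x hx => mul_nonneg hR.le (mul_nonneg (hq.q_nonneg _) hx))
  rw [integral_const_mul (μ := volume)] at h1
  refine le_of_eq_of_le (setIntegral_congr_fun measurableSet_ball fun x hx => ?_) h1
  rw [mem_ball_zero_iff] at hx
  rw [hq.q_eq _ hx.le, mul_inv_cancel_left₀ hR.ne']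

theorem IsMultiplier.setIntegral_ball_le_p {q p : ℝ → ℝ} {R : ℝ} (hq : IsMultiplier q p R)
    {F : RSpace d → ℝ} (hF : Integrable F volume) (hF0 : ∀ x, 0 ≤ F x) :
    ∫ x in ball (0 : RSpace d) R, F x ≤ R * ∫ x, p ‖x‖ * F x := by
  have hR := hq.pos
  have h1 : ∫ x in ball (0 : RSpace d) R, R * (p ‖x‖ * F x) ≤ ∫ x, R * (p ‖x‖ * F x) :=
    setIntegral_le_integral ((hq.integrable_p_mul hF).const_mul R)
      (Eventually.of_forall fun x => mul_nonneg hR.le (mul_nonneg (hq.p_nonneg _) (hF0 x)))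
  rw [integral_const_mul (μ := volume)] at h1
  refine le_of_eq_of_le (setIntegral_congr_fun measurableSet_ball fun x hx => ?_) h1
  rw [mem_ball_zero_iff] at hx
  rw [hq.p_eq _ hx.le, mul_inv_cancel_left₀ hR.ne']

theorem hardyConst_nonneg (hd : 3 ≤ d) : 0 ≤ ((d : ℝ) - 1) * (d - 3) / 4 := by
  have : (3 : ℝ) ≤ d := by exact_mod_cast hd
  have h1 : (0 : ℝ) ≤ d - 3 := by linarith
  have h2 : (0 : ℝ) ≤ d - 1 := by linarith
  positivity

/-- The source terms of the Morawetz estimate. -/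
noncomputable def morawetzSource (ε : ℝ) (f u : RSpace d → ℂ) (G : RSpace d → CSpace d) (T : ℝ) :
    ℝ :=
  2 * (|ε| * (√(∫ x, ‖u x‖ ^ 2) * √(∫ x, ‖G x‖ ^ 2))) + (d + 2) * ((xStarNorm f).toReal * √T)

/-- Half of the loss `L` is `(1 - η)` times the Hardy term, which leaves the fraction `η`, plus
`11/40 M`. The coefficient of `M` collects the gain `θ`, half of the cross term and `11/40`. -/
theorem IsGlobalSolution.absorbed_morawetz {V : RSpace d → ℝ} {ε τ : ℝ} {f u : RSpace d → ℂ}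
    {G : RSpace d → CSpace d} (h : IsGlobalSolution V ε τ f u G) (hd : 3 ≤ d) {γ η : ℝ}
    {w : ℝ → ℝ≥0∞} (hV : IsAbsorbable V γ η w)
    (hf : AEStronglyMeasurable f volume) (hfin : xStarNorm f < ⊤) {q p : ℝ → ℝ} {R : ℝ}
    (hq : IsMultiplier q p R) {δ T M θ : ℝ} (hδ : 0 < δ) (hδR : δ ≤ R)
    (hT : ∀ ρ, δ ≤ ρ → ∫ x in ball (0 : RSpace d) ρ, (‖G x‖ ^ 2 + ‖u x‖ ^ 2 / ‖x‖ ^ 2) ≤ T * ρ)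
    (hM0 : 0 ≤ M)
    (hM : ∀ ρ, δ ≤ ρ → ∫ x in ball (0 : RSpace d) ρ, radialEnergy ((d - 1) / 2) u G x ≤ M * ρ)
    (hθ : θ * M * R ≤ ∫ x in ball (0 : RSpace d) R, radialEnergy ((d - 1) / 2) u G x) :
    (θ - 25 / 9 * (1221 / 1000 - θ) - 11 / 40) * M + (∫ x, q ‖x‖ * tangentialEnergy G x)
      + η * (((d : ℝ) - 1) * (d - 3) / 4 * ∫ x, q ‖x‖ * (‖u x‖ ^ 2 / ‖x‖ ^ 2))
      + γ / 2 * (∫ x, q ‖x‖ * (V x * ‖u x‖ ^ 2)) ≤ morawetzSource ε f u G T := by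
  have hR := hq.pos
  have hκ := hardyConst_nonneg hd
  have hK : 0 ≤ ∫ x, q ‖x‖ * (‖u x‖ ^ 2 / ‖x‖ ^ 2) :=
    hq.integral_nonneg (Eventually.of_forall fun x => by positivity)
  have hη := sub_nonneg.2 hV.eta_le
  have h1 := h.morawetz hd hV.aemeasurable hV.nonneg hf hfin hq (by positivity) hV.measurable
    hV.dilation_le (hV.loss_le u G q p R δ M h.isH1 hq hδ hδR hM0 hM) hδ hδR hT
  rw [h.isH1.multiplier_identity hd hq] at h1
  have h2 := h.isH1.abs_integral_cross_le hd hq hδ hδR hM0 hM hθ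
  have h3 := (abs_le.1 h2).1
  have h4 : θ * M ≤ ∫ x, p ‖x‖ * radialEnergy ((d - 1) / 2) u G x := by
    have h5 := hθ.trans (hq.setIntegral_ball_le_p (h.isH1.integrable_radialEnergy hd _)
      (radialEnergy_nonneg _ u G))
    rw [mul_comm] at h5
    exact le_of_mul_le_mul_left h5 hR
  rw [morawetzSource]
  linarith

theorem radialEnergy_control (u : RSpace d → ℂ) (G : RSpace d → CSpace d) (c : ℝ) (x : RSpace d) :
    ‖G x‖ ^ 2 + ‖u x‖ ^ 2 / ‖x‖ ^ 2 ≤ tangentialEnergy G x + 2 * radialEnergy c u G x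
      + (2 * c ^ 2 + 1) * (‖u x‖ ^ 2 / ‖x‖ ^ 2) := by
  have h1 : ‖euler G x‖ ^ 2 ≤ 2 * ‖euler G x + (c : ℂ) * u x‖ ^ 2 + 2 * (c ^ 2 * ‖u x‖ ^ 2) := by
    have e : euler G x = (euler G x + (c : ℂ) * u x) - (c : ℂ) * u x := by ring
    have h2 := norm_sub_le (euler G x + (c : ℂ) * u x) ((c : ℂ) * u x)
    rw [← e, norm_mul, Complex.norm_real, Real.norm_eq_abs] at h2
    calc ‖euler G x‖ ^ 2 ≤ (‖euler G x + (c : ℂ) * u x‖ + |c| * ‖u x‖) ^ 2 := by gcongr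
      _ ≤ 2 * ‖euler G x + (c : ℂ) * u x‖ ^ 2 + 2 * (|c| * ‖u x‖) ^ 2 := by
        nlinarith [sq_nonneg (‖euler G x + (c : ℂ) * u x‖ - |c| * ‖u x‖)]
      _ = _ := by rw [mul_pow, sq_abs]
  have h3 : ‖euler G x‖ ^ 2 / ‖x‖ ^ 2 ≤ 2 * radialEnergy c u G x
      + 2 * c ^ 2 * (‖u x‖ ^ 2 / ‖x‖ ^ 2) := by
    calc _ ≤ (2 * ‖euler G x + (c : ℂ) * u x‖ ^ 2 + 2 * (c ^ 2 * ‖u x‖ ^ 2)) / ‖x‖ ^ 2 := by gcongr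
      _ = _ := by rw [radialEnergy]; ring
  rw [tangentialEnergy]
  linarith

/-- The constant relating the energy growth to the source terms. -/
noncomputable def energyConst (d : ℕ) : ℝ := 81 + 112 * (2 * (((d : ℝ) - 1) / 2) ^ 2 + 1)

theorem energyConst_pos (d : ℕ) : 0 < energyConst d := by unfold energyConst; positivity

/-- All the quantities controlled by the Morawetz estimate at scales `ρ ≥ δ`. -/
theorem IsGlobalSolution.growth_le_source {V : RSpace d → ℝ} {ε τ : ℝ} {f u : RSpace d → ℂ}
    {G : RSpace d → CSpace d} (h : IsGlobalSolution V ε τ f u G) (hd : 3 ≤ d) {γ η : ℝ}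
    {w : ℝ → ℝ≥0∞} (hV : IsAbsorbable V γ η w)
    (hf : AEStronglyMeasurable f volume) (hfin : xStarNorm f < ⊤) {δ T : ℝ} (hδ : 0 < δ)
    (hT : ∀ ρ, δ ≤ ρ → ∫ x in ball (0 : RSpace d) ρ, (‖G x‖ ^ 2 + ‖u x‖ ^ 2 / ‖x‖ ^ 2) ≤ T * ρ)
    {R : ℝ} (hR : δ ≤ R) {q p : ℝ → ℝ} (hq : IsMultiplier q p R) :
    (∫ x in ball (0 : RSpace d) R, radialEnergy ((d - 1) / 2) u G x
      ≤ 14 * morawetzSource ε f u G T * R) ∧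
    (∫ x in ball (0 : RSpace d) R, (‖G x‖ ^ 2 + ‖u x‖ ^ 2 / ‖x‖ ^ 2)
      ≤ energyConst d * morawetzSource ε f u G T * R) ∧
    η * (((d : ℝ) - 1) * (d - 3) / 4 * ∫ x, q ‖x‖ * (‖u x‖ ^ 2 / ‖x‖ ^ 2))
      + γ / 2 * (∫ x, q ‖x‖ * (V x * ‖u x‖ ^ 2)) ≤ 53 * morawetzSource ε f u G T := by
  have hVae : ∀ᵐ x, 0 ≤ V x * ‖u x‖ ^ 2 := (ae_ne_zero (by omega : 0 < d)).mono fun x hx =>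
    mul_nonneg (hV.nonneg x hx) (sq_nonneg _)
  have hκ := hardyConst_nonneg hd
  have hR0 := hδ.trans_le hR
  obtain ⟨M, hM0, hM, R₁, hR₁, hM1⟩ := exists_growth_constant
    (h.isH1.integrable_radialEnergy hd ((d - 1) / 2)) (radialEnergy_nonneg _ u G) hδ
    (θ := 99 / 100) (by norm_num)
  set B := morawetzSource ε f u G T
  have pos : ∀ {q p : ℝ → ℝ} {R : ℝ}, IsMultiplier q p R →
      0 ≤ (∫ x, q ‖x‖ * tangentialEnergy G x)
      ∧ 0 ≤ η * (((d : ℝ) - 1) * (d - 3) / 4 * ∫ x, q ‖x‖ * (‖u x‖ ^ 2 / ‖x‖ ^ 2))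
      ∧ 0 ≤ γ / 2 * (∫ x, q ‖x‖ * (V x * ‖u x‖ ^ 2)) := by
    intro q p R hq
    refine ⟨hq.integral_nonneg (Eventually.of_forall (tangentialEnergy_nonneg G)),
      mul_nonneg hV.eta_pos.le (mul_nonneg hκ
        (hq.integral_nonneg (Eventually.of_forall fun x => by positivity))),
      mul_nonneg (by linarith [hV.gamma_pos]) (hq.integral_nonneg hVae)⟩
  -- At the near-maximal scale, with `θ = 99/100`, the coefficient of `M` is about `0.0733`, just
  -- above `1/14`; both the width `1/10` of the shell and the bound `1/2` on `∫ t W` are needed to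
  -- keep it positive.
  have hMB : M ≤ 14 * B := by
    obtain ⟨q₁, p₁, hq₁⟩ := exists_multiplier (hδ.trans_le hR₁)
    have h1 := h.absorbed_morawetz hd hV hf hfin hq₁ hδ hR₁ hT hM0 hM hM1
    obtain ⟨e1, e2, e3⟩ := pos hq₁
    norm_num at h1
    linarith
  -- At an arbitrary scale nothing is gained from `M`, so `θ = 0`. The negative coefficient, about
  -- `-3.67`, costs less than `52 B` because `M ≤ 14 B`, whence `53`.
  have h2 := h.absorbed_morawetz hd hV hf hfin hq hδ hR hT hM0 hM (θ := 0) (by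
    rw [zero_mul, zero_mul]
    exact MeasureTheory.integral_nonneg (radialEnergy_nonneg _ u G))
  obtain ⟨e1, e2, e3⟩ := pos hq
  norm_num at h2
  refine ⟨(hM R hR).trans (by gcongr), ?_, by linarith⟩
  have iD := h.isH1.integrable_radialEnergy hd (((d : ℝ) - 1) / 2)
  have iU := h.isH1.integrable_sq_div hd
  have iT := h.isH1.integrable_tangentialEnergy
  have iG := h.isH1.integrable_grad_sq
  set c : ℝ := ((d : ℝ) - 1) / 2 with hc
  have t1 : ∫ x in ball (0 : RSpace d) R, tangentialEnergy G x ≤ R * (53 * B) := by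
    refine (hq.setIntegral_ball_le iT (Eventually.of_forall (tangentialEnergy_nonneg G))).trans ?_
    gcongr
    linarith
  have t2 : ∫ x in ball (0 : RSpace d) R, radialEnergy c u G x ≤ 14 * B * R :=
    (hM R hR).trans (by gcongr)
  have t3 : ∫ x in ball (0 : RSpace d) R, ‖u x‖ ^ 2 / ‖x‖ ^ 2 ≤ 112 * B * R := by
    have := hM (2 * R) (by linarith)
    have h3 := h.isH1.setIntegral_sq_div_le hd hR0
    have h4 : M * R ≤ 14 * B * R := by gcongr
    linarith
  have iD2 : Integrable (fun x => 2 * radialEnergy c u G x) volume := iD.const_mul 2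
  have iU2 : Integrable (fun x => (2 * c ^ 2 + 1) * (‖u x‖ ^ 2 / ‖x‖ ^ 2)) volume :=
    iU.const_mul _
  have iTD : Integrable (fun x => tangentialEnergy G x + 2 * radialEnergy c u G x) volume :=
    iT.add iD2
  have iS : Integrable (fun x => tangentialEnergy G x + 2 * radialEnergy c u G x
      + (2 * c ^ 2 + 1) * (‖u x‖ ^ 2 / ‖x‖ ^ 2)) volume := iTD.add iU2
  calc _ ≤ ∫ x in ball (0 : RSpace d) R, (tangentialEnergy G x + 2 * radialEnergy c u G x
        + (2 * c ^ 2 + 1) * (‖u x‖ ^ 2 / ‖x‖ ^ 2)) :=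
        integral_mono (iG.add iU).integrableOn iS.integrableOn
          (radialEnergy_control u G c)
    _ = (∫ x in ball (0 : RSpace d) R, tangentialEnergy G x)
        + 2 * (∫ x in ball (0 : RSpace d) R, radialEnergy c u G x)
        + (2 * c ^ 2 + 1) * ∫ x in ball (0 : RSpace d) R, ‖u x‖ ^ 2 / ‖x‖ ^ 2 := by
        rw [integral_add iTD.integrableOn iU2.integrableOn,
          integral_add iT.integrableOn iD2.integrableOn, integral_const_mul, integral_const_mul]
    _ ≤ R * (53 * B) + 2 * (14 * B * R) + (2 * c ^ 2 + 1) * (112 * B * R) := by gcongr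
    -- Here `81 = 53 + 2·14`, while `112 = 4·2·14` comes from `IsH1.setIntegral_sq_div_le` at radius
    -- `2R`.
    _ = _ := by rw [energyConst, hc]; ring

/-- The quadratic size of the data and of the absorption error. -/
noncomputable def dataSize (ε : ℝ) (f u : RSpace d → ℂ) (G : RSpace d → CSpace d) : ℝ :=
  |ε| * (√(∫ x, ‖u x‖ ^ 2) * √(∫ x, ‖G x‖ ^ 2)) + (xStarNorm f).toReal ^ 2

theorem dataSize_nonneg (ε : ℝ) (f u : RSpace d → ℂ) (G : RSpace d → CSpace d) :
    0 ≤ dataSize ε f u G := by unfold dataSize; positivity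

/-- A bound for the source terms in terms of the data. -/
noncomputable def sourceConst (d : ℕ) : ℝ := 8 + 8 * energyConst d * ((d : ℝ) + 2) ^ 2

theorem sourceConst_pos (d : ℕ) : 0 < sourceConst d := by
  have := energyConst_pos d
  unfold sourceConst; positivity

/-- The source contains `√T`, and near-maximality of `T` at some scale, combined with the growth
bound there, gives `T` at most a constant times the source. The dependence being only through `√T`,
Young's inequality eliminates `T`, with constants independent of `δ`. -/
theorem IsGlobalSolution.exists_source_le {V : RSpace d → ℝ} {ε τ : ℝ} {f u : RSpace d → ℂ}
    {G : RSpace d → CSpace d} (h : IsGlobalSolution V ε τ f u G) (hd : 3 ≤ d) {γ η : ℝ}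
    {w : ℝ → ℝ≥0∞} (hV : IsAbsorbable V γ η w)
    (hf : AEStronglyMeasurable f volume) (hfin : xStarNorm f < ⊤) {δ : ℝ} (hδ : 0 < δ) :
    ∃ T : ℝ, (∀ ρ, δ ≤ ρ →
      ∫ x in ball (0 : RSpace d) ρ, (‖G x‖ ^ 2 + ‖u x‖ ^ 2 / ‖x‖ ^ 2) ≤ T * ρ) ∧
      morawetzSource ε f u G T ≤ sourceConst d * dataSize ε f u G := by
  obtain ⟨T, hT0, hT, R, hR, hT1⟩ := exists_growth_constant
    (F := fun x => ‖G x‖ ^ 2 + ‖u x‖ ^ 2 / ‖x‖ ^ 2)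
    (h.isH1.integrable_grad_sq.add (h.isH1.integrable_sq_div hd)) (fun _ => by positivity) hδ
    (θ := 1 / 2) (by norm_num)
  refine ⟨T, hT, ?_⟩
  have hR0 := hδ.trans_le hR
  obtain ⟨q, p, hq⟩ := exists_multiplier hR0
  have h1 := (h.growth_le_source hd hV hf hfin hδ hT hR hq).2.1
  have h2 : T ≤ 2 * energyConst d * morawetzSource ε f u G T := by
    have h3 := hT1.trans h1
    have h4 := le_of_mul_le_mul_right h3 hR0
    linarith
  have hK := energyConst_pos d
  unfold morawetzSource at h2 ⊢
  unfold dataSize sourceConst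
  set K := energyConst d
  set N := |ε| * (√(∫ x, ‖u x‖ ^ 2) * √(∫ x, ‖G x‖ ^ 2)) with hN
  have hN0 : 0 ≤ N := by positivity
  set F := (xStarNorm f).toReal with hF
  have hF0 : 0 ≤ F := ENNReal.toReal_nonneg
  set s := √T with hs
  have hs0 : 0 ≤ s := Real.sqrt_nonneg _
  have hsT : s ^ 2 = T := Real.sq_sqrt hT0
  set D : ℝ := (d : ℝ) + 2 with hD
  have hD2 : 1 ≤ D := by
    have : (0 : ℝ) ≤ d := Nat.cast_nonneg d
    linarith
  have h5 : D * (F * s) ≤ 2 * N + 4 * K * D ^ 2 * F ^ 2 := by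
    have h6 : s ^ 2 ≤ 4 * K * N + 2 * K * (D * F) * s := by rw [hsT]; linarith
    have h7 : 2 * K * (D * F) * s ≤ s ^ 2 / 2 + 2 * (K * (D * F)) ^ 2 := by
      nlinarith [sq_nonneg (s - 2 * (K * (D * F)))]
    have h8 : s ^ 2 ≤ 8 * K * N + 4 * (K * (D * F)) ^ 2 := by linarith
    have h9 : D * (F * s) * (2 * K) ≤ s ^ 2 / 2 + 2 * (K * (D * F)) ^ 2 := by linarith
    have h10 : D * (F * s) * (2 * K) ≤ (2 * N + 4 * K * D ^ 2 * F ^ 2) * (2 * K) := by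
      have : 0 ≤ (K * (D * F)) ^ 2 := sq_nonneg _
      have e : (2 * N + 4 * K * D ^ 2 * F ^ 2) * (2 * K) = 4 * K * N + 8 * (K * (D * F)) ^ 2 := by
        ring
      rw [e]
      linarith
    exact le_of_mul_le_mul_right h10 (by positivity)
  have h11 : 0 ≤ K * D ^ 2 * N := by positivity
  have h12 : 0 ≤ K * D ^ 2 * F ^ 2 := by positivity
  have h13 : 0 ≤ F ^ 2 := sq_nonneg F
  have e2 : (8 + 8 * K * D ^ 2) * (N + F ^ 2)
      = 8 * N + 8 * F ^ 2 + 8 * (K * D ^ 2 * N) + 8 * (K * D ^ 2 * F ^ 2) := by ring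
  rw [e2]
  linarith

/-- The Morawetz estimate, up to the absorption error in `dataSize`. -/
theorem IsGlobalSolution.morawetz_bounds {V : RSpace d → ℝ} {ε τ : ℝ} {f u : RSpace d → ℂ}
    {G : RSpace d → CSpace d} (h : IsGlobalSolution V ε τ f u G) (hd : 3 ≤ d) {γ η : ℝ}
    {w : ℝ → ℝ≥0∞} (hV : IsAbsorbable V γ η w)
    (hf : AEStronglyMeasurable f volume) (hfin : xStarNorm f < ⊤) {R : ℝ} {q p : ℝ → ℝ}
    (hq : IsMultiplier q p R) :
    (∫ x in ball (0 : RSpace d) R, radialEnergy ((d - 1) / 2) u G x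
      ≤ 14 * sourceConst d * dataSize ε f u G * R) ∧
    (∫ x in ball (0 : RSpace d) R, (‖G x‖ ^ 2 + ‖u x‖ ^ 2 / ‖x‖ ^ 2)
      ≤ energyConst d * sourceConst d * dataSize ε f u G * R) ∧
    η * (((d : ℝ) - 1) * (d - 3) / 4 * ∫ x, q ‖x‖ * (‖u x‖ ^ 2 / ‖x‖ ^ 2))
      + γ / 2 * (∫ x, q ‖x‖ * (V x * ‖u x‖ ^ 2)) ≤ 53 * sourceConst d * dataSize ε f u G := by
  have hR := hq.pos
  obtain ⟨T, hT, hB⟩ := h.exists_source_le hd hV hf hfin hR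
  obtain ⟨h1, h2, h3⟩ := h.growth_le_source hd hV hf hfin hR hT le_rfl hq
  have hK := energyConst_pos d
  simp only [mul_assoc] at *
  refine ⟨h1.trans ?_, h2.trans ?_, h3.trans (by linarith)⟩
  · rw [← mul_assoc (sourceConst d)]
    gcongr
  · rw [← mul_assoc (sourceConst d)]
    gcongr

end Closing

/-! ### From the differential to the integrated form of repulsivity. -/

section Potential

open Filter Topology

variable {d : ℕ}

theorem quasiMeasurePreserving_mul_right {a : ℝ} (ha : a ≠ 0) :
    Measure.QuasiMeasurePreserving (fun t : ℝ => t * a) volume volume := by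
  refine ⟨measurable_mul_const a, ?_⟩
  rw [Real.map_volume_mul_right ha]
  exact Measure.smul_absolutelyContinuous

theorem setLIntegral_Ioi_comp_mul {w : ℝ → ℝ≥0∞} (hw : Measurable w) {a : ℝ} (ha : 0 < a) :
    ∫⁻ t in Ioi (0 : ℝ), w (a * t) = ENNReal.ofReal a⁻¹ * ∫⁻ t in Ioi (0 : ℝ), w t := by
  have e : ∀ t, (Ioi (0 : ℝ)).indicator (fun t => w (a * t)) t = (Ioi (0 : ℝ)).indicator w (a * t) := by
    intro t
    by_cases ht : 0 < t
    · rw [indicator_of_mem (mem_Ioi.2 ht), indicator_of_mem (mem_Ioi.2 (mul_pos ha ht))]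
    · rw [indicator_of_notMem (by simpa using ht), indicator_of_notMem]
      rw [mem_Ioi, not_lt]
      exact mul_nonpos_of_nonneg_of_nonpos ha.le (not_lt.1 ht)
  rw [← lintegral_indicator measurableSet_Ioi, ← lintegral_indicator measurableSet_Ioi]
  simp only [e]
  rw [← lintegral_map (hw.indicator measurableSet_Ioi) (measurable_const_mul a),
    Real.map_volume_mul_left ha.ne', lintegral_smul_measure, abs_of_pos (inv_pos.2 ha), smul_eq_mul]

theorem hasDerivAt_along_ray {V : RSpace d → ℝ}
    (hVd : ∀ x, x ≠ 0 → LineDifferentiableAt ℝ V x (‖x‖⁻¹ • x)) {y : RSpace d} (hy : y ≠ 0) {t : ℝ}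
    (ht : 0 < t) : HasDerivAt (fun s : ℝ => V (s • y)) (radialDeriv V (t • y) * ‖y‖) t := by
  have hy' := norm_pos_iff.2 hy
  have h1 : HasDerivAt (fun s : ℝ => V (t • y + s • (‖t • y‖⁻¹ • (t • y)))) (radialDeriv V (t • y)) 0 :=
    (hVd _ (smul_ne_zero ht.ne' hy)).hasLineDerivAt
  have h2 : HasDerivAt (fun s : ℝ => (s - t) * ‖y‖) (1 * ‖y‖) t :=
    ((hasDerivAt_id t).sub_const t).mul_const ‖y‖
  have h3 := HasDerivAt.comp_of_eq t h1 h2 (by simp)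
  rw [one_mul] at h3
  refine h3.congr_of_eventuallyEq (Eventually.of_forall fun s => ?_)
  simp only [Function.comp]
  congr 1
  rw [norm_smul, Real.norm_of_nonneg ht.le, smul_smul, smul_smul, ← add_smul]
  congr 1
  field_simp
  ring

/-- The derivative of `s^γ V(sy)` is `s^(γ-1) (γV + r∂ᵣV)(sy)`. It need not be integrable; an upper
bound of the increment needs only an integrable majorant of the derivative. -/
theorem dilation_le_of_radialDeriv_le {V : RSpace d → ℝ}
    (hVd : ∀ x, x ≠ 0 → LineDifferentiableAt ℝ V x (‖x‖⁻¹ • x)) (hV0 : ∀ x, x ≠ 0 → 0 ≤ V x)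
    {b : ℝ → ℝ} {γ : ℝ} (hγ1 : γ ≤ 1) (hb0 : ∀ t, 0 < t → 0 ≤ b t)
    (hbV : ∀ x, x ≠ 0 → γ * V x + ‖x‖ * radialDeriv V x ≤ b ‖x‖) {w : ℝ → ℝ≥0∞}
    (hwm : Measurable w) (hw : ∀ᵐ t : ℝ, 0 < t → w t = ENNReal.ofReal (b t)) {σ : ℝ} (hσ : 1 ≤ σ)
    {y : RSpace d} (hy : y ≠ 0) : ENNReal.ofReal (σ ^ γ * V (σ • y))
      ≤ ENNReal.ofReal (V y) + ∫⁻ t in Ioc 1 σ, w (t * ‖y‖) := by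
  have hy' := norm_pos_iff.2 hy
  -- If the weight is not integrable along this segment there is nothing to prove; otherwise `b` is
  -- the required majorant.
  by_cases hfin : ∫⁻ t in Ioc 1 σ, w (t * ‖y‖) = ⊤
  · rw [hfin, add_top]; exact le_top
  have hae : ∀ᵐ t ∂volume.restrict (Ioc 1 σ), ENNReal.ofReal (b (t * ‖y‖)) = w (t * ‖y‖) := by
    rw [ae_restrict_iff' measurableSet_Ioc]
    filter_upwards [(quasiMeasurePreserving_mul_right hy'.ne').ae hw] with t ht ht1
    exact (ht (mul_pos (zero_lt_one.trans ht1.1) hy')).symm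
  have hb : ∀ t ∈ Ioc 1 σ, 0 ≤ b (t * ‖y‖) := fun t ht =>
    hb0 _ (mul_pos (zero_lt_one.trans ht.1) hy')
  have hbae : ∀ᵐ t ∂volume.restrict (Ioc 1 σ), 0 ≤ b (t * ‖y‖) :=
    (ae_restrict_iff' measurableSet_Ioc).2 (Eventually.of_forall hb)
  have hbm : AEStronglyMeasurable (fun t => b (t * ‖y‖)) (volume.restrict (Ioc 1 σ)) := by
    have h1 : Measurable fun t => (w (t * ‖y‖)).toReal :=
      (hwm.comp (measurable_mul_const ‖y‖)).ennreal_toReal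
    refine h1.aestronglyMeasurable.congr ?_
    filter_upwards [hae, hbae] with t ht ht0
    rw [← ht, ENNReal.toReal_ofReal ht0]
  have hbi : IntegrableOn (fun t => b (t * ‖y‖)) (Ioc 1 σ) volume := by
    refine ⟨hbm, ?_⟩
    rw [hasFiniteIntegral_iff_ofReal hbae, lintegral_congr_ae hae]
    exact lt_top_iff_ne_top.2 hfin
  have hder : ∀ t : ℝ, 0 < t → HasDerivAt (fun s : ℝ => s ^ γ * V (s • y))
      (γ * t ^ (γ - 1) * V (t • y) + t ^ γ * (radialDeriv V (t • y) * ‖y‖)) t := by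
    intro t ht
    exact (Real.hasDerivAt_rpow_const (Or.inl ht.ne')).mul (hasDerivAt_along_ray hVd hy ht)
  have hle := intervalIntegral.sub_le_integral_of_hasDeriv_right_of_le hσ
    (g := fun s : ℝ => s ^ γ * V (s • y)) (φ := fun t => b (t * ‖y‖))
    (g' := fun t => γ * t ^ (γ - 1) * V (t • y) + t ^ γ * (radialDeriv V (t • y) * ‖y‖))
    (fun t ht => (hder t (zero_lt_one.trans_le ht.1)).continuousAt.continuousWithinAt)
    (fun t ht => (hder t (zero_lt_one.trans ht.1)).hasDerivWithinAt)
    ((integrableOn_Icc_iff_integrableOn_Ioc (by simp)).2 hbi) (fun t ht => by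
      have ht0 : 0 < t := zero_lt_one.trans ht.1
      have h1 := hbV (t • y) (smul_ne_zero ht0.ne' hy)
      have h2 := hb t ⟨ht.1, ht.2.le⟩
      rw [norm_smul, Real.norm_of_nonneg ht0.le] at h1
      have h3 : t ^ γ = t ^ (γ - 1) * t := by
        rw [← Real.rpow_add_one ht0.ne', sub_add_cancel]
      have h4 : 0 ≤ t ^ (γ - 1) := Real.rpow_nonneg ht0.le _
      -- This is the reason for normalising to `γ ≤ 1`.
      have h5 : t ^ (γ - 1) ≤ 1 := Real.rpow_le_one_of_one_le_of_nonpos ht.1.le (by linarith)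
      calc _ = t ^ (γ - 1) * (γ * V (t • y) + t * ‖y‖ * radialDeriv V (t • y)) := by rw [h3]; ring
        _ ≤ t ^ (γ - 1) * b (t * ‖y‖) := by gcongr
        _ ≤ 1 * b (t * ‖y‖) := by gcongr
        _ = _ := one_mul _)
  simp only [Real.one_rpow, one_smul, one_mul] at hle
  rw [intervalIntegral.integral_of_le hσ] at hle
  have hI : ENNReal.ofReal (∫ t in Ioc 1 σ, b (t * ‖y‖)) = ∫⁻ t in Ioc 1 σ, w (t * ‖y‖) := by
    rw [ofReal_integral_eq_lintegral_ofReal hbi hbae]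
    exact lintegral_congr_ae hae
  rw [← hI, ← ENNReal.ofReal_add (hV0 y hy) (integral_nonneg_of_ae hbae)]
  exact ENNReal.ofReal_le_ofReal (by linarith)

theorem loss_le_of_inverse_square (hd : 3 ≤ d) {K : ℝ} (hK : 0 ≤ K) {u : RSpace d → ℂ}
    {G : RSpace d → CSpace d} (h : IsH1 u G) {q p : ℝ → ℝ} {R : ℝ} (hq : IsMultiplier q p R) {t : ℝ}
    (ht : 1 ≤ t) : ∫⁻ x, ENNReal.ofReal (K / (t * ‖x‖) ^ 2) * ENNReal.ofReal (q ‖x‖ * ‖u x‖ ^ 2)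
      ≤ ENNReal.ofReal (K * ∫ x, q ‖x‖ * (‖u x‖ ^ 2 / ‖x‖ ^ 2)) := by
  rw [← integral_const_mul, ofReal_integral_eq_lintegral_ofReal
    ((hq.integrable_mul (h.integrable_sq_div hd)).const_mul K)
    (Eventually.of_forall fun x => mul_nonneg hK (mul_nonneg (hq.q_nonneg _) (by positivity)))]
  refine lintegral_mono fun x => ?_
  rw [← ENNReal.ofReal_mul (by positivity)]
  refine ENNReal.ofReal_le_ofReal ?_
  have h1 := hq.q_nonneg ‖x‖
  have h2 : K / (t * ‖x‖) ^ 2 ≤ K / ‖x‖ ^ 2 := by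
    rcases eq_or_ne x 0 with rfl | hx
    · simp
    · have := norm_pos_iff.2 hx
      refine div_le_div_of_nonneg_left hK (by positivity) ?_
      exact pow_le_pow_left₀ this.le (le_mul_of_one_le_left this.le ht) 2
  calc _ ≤ K / ‖x‖ ^ 2 * (q ‖x‖ * ‖u x‖ ^ 2) := by gcongr
    _ = _ := by ring

/-- The trace inequality turns the loss into a radial integral. There `q(s) max(s, δ) ≤ 11/10`,
because `s q ≤ 11/10` and `q δ ≤ δ/R ≤ 1`. The constant is `11/10` times the bound `1/2` on `∫ t W`;
rescaling by `t ≥ 1` only helps. -/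
theorem loss_le_of_integrable (hd : 3 ≤ d) {w : ℝ → ℝ≥0∞} (hw : Measurable w)
    (hJ : ∫⁻ t in Ioi (0 : ℝ), w t * ENNReal.ofReal t ≤ 1 / 2) {u : RSpace d → ℂ}
    {G : RSpace d → CSpace d} (h : IsH1 u G) {q p : ℝ → ℝ} {R δ M : ℝ} (hq : IsMultiplier q p R)
    (hδ : 0 < δ) (hδR : δ ≤ R) (hM0 : 0 ≤ M)
    (hM : ∀ ρ, δ ≤ ρ → ∫ x in ball (0 : RSpace d) ρ, radialEnergy ((d - 1) / 2) u G x ≤ M * ρ)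
    {t : ℝ} (ht : 1 ≤ t) :
    ∫⁻ x, w (t * ‖x‖) * ENNReal.ofReal (q ‖x‖ * ‖u x‖ ^ 2) ≤ ENNReal.ofReal (11 / 20 * M) := by
  have ht0 : 0 < t := zero_lt_one.trans_le ht
  have hqm : Measurable q := hq.contDiff_q.continuous.measurable
  have hwt : Measurable fun s => w (t * s) := hw.comp (measurable_const_mul t)
  have h1 := h.lintegral_radial_le hd (fun ρ h1 _ => hM ρ h1)
    (w := fun s => w (t * s) * ENNReal.ofReal (q s)) (hwt.mul hqm.ennreal_ofReal).aemeasurable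
  have hle : ∀ s ∈ Ioi (0 : ℝ), w (t * s) * ENNReal.ofReal (q s) * ENNReal.ofReal (M * s * max s δ)
      ≤ ENNReal.ofReal (11 / 10 * M * t⁻¹) * (w (t * s) * ENNReal.ofReal (t * s)) := by
    intro s hs
    have hs0 : 0 < s := hs
    have h2 : q s * max s δ ≤ 11 / 10 := by
      rcases max_cases s δ with ⟨e, _⟩ | ⟨e, _⟩
      · rw [e, mul_comm]; exact hq.mul_q_le s hs0.le
      · rw [e]
        calc q s * δ ≤ R⁻¹ * R := mul_le_mul (hq.q_le s) hδR hδ.le (inv_nonneg.2 hq.pos.le)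
          _ = 1 := inv_mul_cancel₀ hq.pos.ne'
          _ ≤ _ := by norm_num
    have h3 : 0 ≤ M * s := by positivity
    calc _ = w (t * s) * ENNReal.ofReal (q s * (M * s * max s δ)) := by
          rw [mul_assoc, ← ENNReal.ofReal_mul (hq.q_nonneg s)]
      _ ≤ w (t * s) * ENNReal.ofReal (11 / 10 * M * t⁻¹ * (t * s)) := by
          gcongr w (t * s) * ENNReal.ofReal ?_
          calc q s * (M * s * max s δ) = M * s * (q s * max s δ) := by ring
            _ ≤ M * s * (11 / 10) := by gcongr
            _ = _ := by field_simp
      _ = _ := by rw [ENNReal.ofReal_mul (by positivity)]; ring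
  have hI : ∫⁻ s in Ioi (0 : ℝ), w (t * s) * ENNReal.ofReal (t * s) ≤ 1 / 2 := by
    rw [setLIntegral_Ioi_comp_mul (w := fun s => w s * ENNReal.ofReal s)
      (hw.mul ENNReal.measurable_ofReal) ht0]
    calc _ ≤ 1 * (1 / 2 : ℝ≥0∞) := by
          gcongr
          exact ENNReal.ofReal_le_one.2 (inv_le_one_of_one_le₀ ht)
      _ = _ := one_mul _
  calc _ = ∫⁻ x : RSpace d, w (t * ‖x‖) * ENNReal.ofReal (q ‖x‖) * ENNReal.ofReal (‖u x‖ ^ 2) := by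
        refine lintegral_congr fun x => ?_
        rw [ENNReal.ofReal_mul (hq.q_nonneg _), mul_assoc]
    _ ≤ _ := h1
    _ ≤ ∫⁻ s in Ioi (0 : ℝ), ENNReal.ofReal (11 / 10 * M * t⁻¹)
          * (w (t * s) * ENNReal.ofReal (t * s)) := setLIntegral_mono' measurableSet_Ioi hle
    _ = ENNReal.ofReal (11 / 10 * M * t⁻¹)
          * ∫⁻ s in Ioi (0 : ℝ), w (t * s) * ENNReal.ofReal (t * s) :=
        lintegral_const_mul' _ _ ENNReal.ofReal_ne_top
    _ ≤ ENNReal.ofReal (11 / 10 * M) * ENNReal.ofReal (1 / 2) := by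
        refine mul_le_mul' (ENNReal.ofReal_le_ofReal ?_) ?_
        · exact mul_le_of_le_one_right (by positivity) (inv_le_one_of_one_le₀ ht)
        · refine hI.trans (le_of_eq ?_)
          rw [ENNReal.ofReal_div_of_pos two_pos]; simp
    _ = _ := by
        rw [← ENNReal.ofReal_mul (by positivity)]
        congr 1; ring

/-- Since `V ≥ 0` and the Hardy bound is nonnegative, `γ` and `η` may be lowered to at most `1`. For
`d = 3` the Hardy coefficient is zero, so `η = 1` is allowed and the loss is charged entirely to
`M`; for `d > 3` it is charged entirely to the Hardy term. -/
theorem IsRepulsive.exists_isAbsorbable {V : RSpace d → ℝ} {W : ℝ → ℝ} (hd : 3 ≤ d)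
    (hV : IsRepulsive V W) : ∃ γ η w, IsAbsorbable V γ η w := by
  obtain ⟨γ, hγ, hlarge, hthree⟩ := hV.repulsive
  have hmono : ∀ x, x ≠ 0 → min γ 1 * V x + ‖x‖ * radialDeriv V x
      ≤ γ * V x + ‖x‖ * radialDeriv V x := fun x hx => by
    have := hV.nonneg x hx
    gcongr
    exact min_le_left _ _
  have hγ' : 0 < min γ 1 := lt_min hγ one_pos
  rcases hd.eq_or_lt with h3 | h3
  · obtain ⟨hWm, hW0, hWV, hJ⟩ := hthree h3.symm
    -- The ray inequality is needed for every `y`, and the weight must be Borel. Changing `W` on a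
    -- null set is harmless, because dilations of the half-line preserve null sets.
    set W' := hWm.mk W with hW'
    have hae : ∀ᵐ t : ℝ, 0 < t → ENNReal.ofReal (W' t) = ENNReal.ofReal (W t) := by
      have h1 := (ae_restrict_iff' measurableSet_Ioi).1 hWm.ae_eq_mk
      filter_upwards [h1] with t ht ht0
      rw [ht ht0]
    have hm : Measurable fun t => ENNReal.ofReal (W' t) := hWm.measurable_mk.ennreal_ofReal
    refine ⟨min γ 1, 1, fun t => ENNReal.ofReal (W' t), hV.aemeasurable, hV.nonneg, hγ', one_pos,
      le_rfl, hm, fun σ hσ y hy => dilation_le_of_radialDeriv_le hV.radial_differentiable hV.nonneg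
        (min_le_right _ _) hW0 (fun x hx => (hmono x hx).trans
          (hWV ‖x‖ (norm_pos_iff.2 hx) x rfl)) hm hae hσ hy, ?_⟩
    intro u G q p R δ M hu hq hδ hδR hM0 hM t ht
    have hJ' : ∫⁻ t in Ioi (0 : ℝ), ENNReal.ofReal (W' t) * ENNReal.ofReal t ≤ 1 / 2 := by
      refine le_trans (le_of_eq ?_) hJ.le
      refine lintegral_congr_ae ?_
      rw [Filter.EventuallyEq, ae_restrict_iff' measurableSet_Ioi]
      filter_upwards [hae] with s hs hs0
      rw [hs hs0, mul_comm s, ENNReal.ofReal_mul (hW0 s hs0)]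
    refine (loss_le_of_integrable hd hm hJ' hu hq hδ hδR hM0 hM ht).trans (le_of_eq ?_)
    congr 1
    ring
  · obtain ⟨η, hη, hηV⟩ := hlarge h3
    have hdr : (3 : ℝ) < d := by exact_mod_cast h3
    have hκ : 0 ≤ ((d : ℝ) - 1) * (d - 3) := mul_nonneg (by linarith) (by linarith)
    have hη1 : 0 ≤ 1 - min η 1 := sub_nonneg.2 (min_le_right _ _)
    set K : ℝ := (1 - min η 1) * (((d : ℝ) - 1) * (d - 3) / 2) with hK
    have hK0 : 0 ≤ K := by positivity
    have hm : Measurable fun t : ℝ => ENNReal.ofReal (K / t ^ 2) :=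
      Measurable.ennreal_ofReal (by fun_prop)
    refine ⟨min γ 1, min η 1, fun t => ENNReal.ofReal (K / t ^ 2), hV.aemeasurable, hV.nonneg, hγ',
      lt_min hη one_pos, min_le_right _ _, hm, fun σ hσ y hy =>
        dilation_le_of_radialDeriv_le (b := fun t => K / t ^ 2) hV.radial_differentiable hV.nonneg
        (min_le_right _ _) (fun t ht => by positivity) (fun x hx => ?_) hm
        (Eventually.of_forall fun t _ => rfl) hσ hy, ?_⟩
    · refine ((hmono x hx).trans (hηV x hx)).trans ?_
      have h1 : 0 ≤ ((d : ℝ) - 1) * (d - 3) / (2 * ‖x‖ ^ 2) := by positivity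
      calc _ ≤ (1 - min η 1) * (((d : ℝ) - 1) * (d - 3) / (2 * ‖x‖ ^ 2)) := by
            gcongr
            exact min_le_left _ _
        _ = _ := by rw [hK]; field_simp
    · intro u G q p R δ M hu hq hδ hδR hM0 hM t ht
      refine (loss_le_of_inverse_square hd hK0 hu hq ht).trans (ENNReal.ofReal_le_ofReal ?_)
      have e : K * (∫ x, q ‖x‖ * (‖u x‖ ^ 2 / ‖x‖ ^ 2)) = 2 * ((1 - min η 1)
          * (((d : ℝ) - 1) * (d - 3) / 4 * ∫ x, q ‖x‖ * (‖u x‖ ^ 2 / ‖x‖ ^ 2))) := by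
        rw [hK]; ring
      linarith

end Potential

/-! ### Local mass estimates, and control of the `ε` error. -/

section Absorption

open Filter Topology

variable {d : ℕ}

/-- The equation tested with `ψ u`, for a weight `ψ ≥ 0`. -/
theorem IsGlobalSolution.weighted_test {V : RSpace d → ℝ} {ε τ : ℝ} {f u : RSpace d → ℂ}
    {G : RSpace d → CSpace d} (h : IsGlobalSolution V ε τ f u G) {ψ : RSpace d → ℝ}
    (hψ : ContDiff ℝ ∞ ψ) (hψ0 : ∀ x, 0 ≤ ψ x) {C : ℝ} (hC : ∀ x, |ψ x| ≤ C)
    (hC' : ∀ x, ‖cgrad ψ x‖ ≤ C) (hV0 : ∀ᵐ x, 0 ≤ V x) :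
    |ε| * (∫ x, ψ x * ‖u x‖ ^ 2) ≤ (∫ x, ‖u x‖ * (‖cgrad ψ x‖ * ‖G x‖))
        + ‖∫ x, f x * conj ((ψ x : ℂ) * u x)‖ ∧
    τ * (∫ x, ψ x * ‖u x‖ ^ 2) ≤ (∫ x, ψ x * ‖G x‖ ^ 2) + (∫ x, ψ x * (V x * ‖u x‖ ^ 2))
      + (∫ x, ‖u x‖ * (‖cgrad ψ x‖ * ‖G x‖)) + ‖∫ x, f x * conj ((ψ x : ℂ) * u x)‖ ∧
    (∫ x, ψ x * ‖G x‖ ^ 2) ≤ τ * (∫ x, ψ x * ‖u x‖ ^ 2)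
      + (∫ x, ‖u x‖ * (‖cgrad ψ x‖ * ‖G x‖)) + ‖∫ x, f x * conj ((ψ x : ℂ) * u x)‖ := by
  have hH := h.isH1
  have hv := hH.smooth_mul hψ hC hC'
  have hi : ∀ {F : RSpace d → ℝ}, Integrable F volume → Integrable (fun x => ψ x * F x) volume :=
    fun hF => hF.bdd_mul (c := C) hψ.continuous.aestronglyMeasurable (Eventually.of_forall hC)
  have hVv : Integrable (fun x => V x * ‖(ψ x : ℂ) * u x‖ ^ 2) volume := by
    refine (hi (hi h.energy)).congr (Eventually.of_forall fun x => ?_)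
    simp only [norm_mul, Complex.norm_real, mul_pow, Real.norm_eq_abs, sq_abs]
    ring
  have key := h.equation _ _ hv hVv
  have iu : MemLp (fun x => ‖u x‖) 2 volume := hH.memLp.norm
  have iG : MemLp (fun x => ‖G x‖) 2 volume := hH.memLp_grad.norm
  have iX : Integrable (fun x => ‖u x‖ * (‖cgrad ψ x‖ * ‖G x‖)) volume := by
    have i1 : Integrable (fun x => ‖u x‖ * ‖G x‖) volume := iu.integrable_mul iG
    refine (i1.bdd_mul (c := C) (continuous_cgrad hψ).norm.aestronglyMeasurable
      (Eventually.of_forall fun x => by simpa using hC' x)).congr (Eventually.of_forall fun x => ?_)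
    simp only
    ring
  have iZ : Integrable (fun x => conj (u x) * inner ℂ (cgrad ψ x) (G x)) volume := by
    refine iX.mono' ?_ (Eventually.of_forall fun x => ?_)
    · have h1 := hH.measurable
      have h2 := hH.measurable_grad
      have h3 := (continuous_cgrad hψ).measurable
      exact ((Complex.continuous_conj.measurable.comp h1).mul
        (Measurable.inner (𝕜 := ℂ) h3 h2)).aestronglyMeasurable
    · rw [norm_mul, RCLike.norm_conj]
      gcongr
      exact norm_inner_le_norm _ _
  have hZ : ‖∫ x, conj (u x) * inner ℂ (cgrad ψ x) (G x)‖ ≤ ∫ x, ‖u x‖ * (‖cgrad ψ x‖ * ‖G x‖) := by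
    refine norm_integral_le_of_norm_le iX (Eventually.of_forall fun x => ?_)
    rw [norm_mul, RCLike.norm_conj]
    gcongr
    exact norm_inner_le_norm _ _
  have e1 : ∀ x, (inner ℂ ((ψ x : ℂ) • G x + u x • cgrad ψ x) (G x) : ℂ)
      = ((ψ x * ‖G x‖ ^ 2 : ℝ) : ℂ) + conj (u x) * inner ℂ (cgrad ψ x) (G x) := by
    intro x
    rw [inner_smooth_mul, inner_self_eq_norm_sq_to_K]
    push_cast
    rfl
  have e2 : ∀ x, u x * conj ((ψ x : ℂ) * u x) = ((ψ x * ‖u x‖ ^ 2 : ℝ) : ℂ) := by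
    intro x
    simp only [map_mul, Complex.conj_ofReal]
    push_cast
    rw [← Complex.mul_conj']
    ring
  have e4 : ∀ x, V x * (ψ x * ‖u x‖ ^ 2) = ψ x * (V x * ‖u x‖ ^ 2) := fun x => by ring
  simp only [e1, e2, ← Complex.ofReal_mul, e4] at key
  have iN : Integrable (fun x => ((ψ x * ‖G x‖ ^ 2 : ℝ) : ℂ)) volume :=
    (hi hH.integrable_grad_sq).ofReal
  rw [integral_add iN iZ, integral_complex_ofReal,
    integral_complex_ofReal, integral_complex_ofReal] at key
  set Z := ∫ x, conj (u x) * inner ℂ (cgrad ψ x) (G x)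
  set Y := ∫ x, f x * conj ((ψ x : ℂ) * u x)
  set X := ∫ x, ‖u x‖ * (‖cgrad ψ x‖ * ‖G x‖)
  have hU0 : 0 ≤ ∫ x, ψ x * ‖u x‖ ^ 2 :=
    integral_nonneg fun x => mul_nonneg (hψ0 x) (sq_nonneg _)
  have hE0 : 0 ≤ ∫ x, ψ x * (V x * ‖u x‖ ^ 2) :=
    integral_nonneg_of_ae (hV0.mono fun x hx => mul_nonneg (hψ0 x) (mul_nonneg hx (sq_nonneg _)))
  set U := ∫ x, ψ x * ‖u x‖ ^ 2
  set E := ∫ x, ψ x * (V x * ‖u x‖ ^ 2)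
  set N := ∫ x, ψ x * ‖G x‖ ^ 2
  -- The imaginary part isolates `ε`, the real part isolates `τ`. For the gradient bound the
  -- nonnegative potential energy is dropped.
  have hre := congrArg Complex.re key
  have him := congrArg Complex.im key
  simp only [Complex.add_re, Complex.add_im, Complex.mul_re, Complex.mul_im, Complex.sub_re,
    Complex.sub_im, Complex.ofReal_re, Complex.ofReal_im, Complex.I_re, Complex.I_im] at hre him
  have z1 := abs_le.1 ((Complex.abs_re_le_norm Z).trans hZ)
  have z2 := abs_le.1 ((Complex.abs_im_le_norm Z).trans hZ)
  have y1 := abs_le.1 (Complex.abs_re_le_norm Y)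
  have y2 := abs_le.1 (Complex.abs_im_le_norm Y)
  refine ⟨?_, by linarith [z1.1, z1.2, y1.1, y1.2], by linarith [z1.1, z1.2, y1.1, y1.2]⟩
  rw [← abs_of_nonneg hU0, ← abs_mul, abs_le]
  constructor <;> linarith [z2.1, z2.2, y2.1, y2.2]

/-- On the support of `χ` one has `|u|² ≤ (2R)² |u|²/|x|²`, and the linear growth of the right-hand
density is the dyadic bound needed for duality. -/
theorem IsH1.norm_integral_cutoff_le {f u : RSpace d → ℂ} {G : RSpace d → CSpace d} (hH : IsH1 u G)
    (hd : 3 ≤ d) (hf : AEStronglyMeasurable f volume) (hfin : xStarNorm f < ⊤) {A : ℝ} (hA : 0 ≤ A)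
    (hG : ∀ ρ, 0 < ρ → ∫ x in ball (0 : RSpace d) ρ, (‖G x‖ ^ 2 + ‖u x‖ ^ 2 / ‖x‖ ^ 2) ≤ A * ρ)
    {χ : RSpace d → ℝ} (hχm : Measurable χ) (h01 : ∀ x, 0 ≤ χ x ∧ χ x ≤ 1) {R : ℝ} (hR : 0 < R)
    (hχ : ∀ x, 2 * R ≤ ‖x‖ → χ x = 0) :
    ‖∫ x, f x * conj ((χ x : ℂ) * u x)‖ ≤ 2 * R * ((xStarNorm f).toReal * √A) := by
  have hu := hH.measurable
  have hae : ∀ᵐ x : RSpace d, x ≠ 0 := ae_ne_zero (by omega)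
  have hi := hH.integrable_sq_div hd
  have h1 := norm_integral_le_xStarNorm (by omega) hf hfin (v := fun x => (χ x : ℂ) * u x)
    (Measurable.aestronglyMeasurable (by fun_prop)) (S := (2 * R) ^ 2 * A) (by positivity) (fun j => by
      have hρ : (0 : ℝ) < 2 ^ (j + 1) := by positivity
      calc ∫⁻ x in dyadicShell d j, ‖(χ x : ℂ) * u x‖ₑ ^ 2
          ≤ ∫⁻ x in ball (0 : RSpace d) (2 ^ (j + 1)), ‖(χ x : ℂ) * u x‖ₑ ^ 2 :=
            lintegral_mono_set' (dyadicShell_ae_subset_ball (by omega) j)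
        _ ≤ ∫⁻ x in ball (0 : RSpace d) (2 ^ (j + 1)),
              ENNReal.ofReal ((2 * R) ^ 2 * (‖u x‖ ^ 2 / ‖x‖ ^ 2)) := by
            refine lintegral_mono_ae ?_
            filter_upwards [ae_restrict_of_ae hae] with x hx0
            rw [← ofReal_norm, ← ENNReal.ofReal_pow (norm_nonneg _)]
            refine ENNReal.ofReal_le_ofReal ?_
            have hx := norm_pos_iff.2 hx0
            rw [norm_mul, Complex.norm_real, Real.norm_of_nonneg (h01 x).1]
            by_cases hxR : 2 * R ≤ ‖x‖
            · rw [hχ x hxR, zero_mul, zero_pow two_ne_zero]; positivity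
            · have h2 : χ x * ‖u x‖ ≤ ‖u x‖ := mul_le_of_le_one_left (norm_nonneg _) (h01 x).2
              have h3 : 0 ≤ χ x * ‖u x‖ := mul_nonneg (h01 x).1 (norm_nonneg _)
              calc _ ≤ ‖u x‖ ^ 2 := by gcongr
                _ = ‖x‖ ^ 2 * (‖u x‖ ^ 2 / ‖x‖ ^ 2) := by field_simp
                _ ≤ _ := by gcongr; exact (not_le.1 hxR).le
        _ = ENNReal.ofReal ((2 * R) ^ 2
              * ∫ x in ball (0 : RSpace d) (2 ^ (j + 1)), ‖u x‖ ^ 2 / ‖x‖ ^ 2) := by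
            rw [← integral_const_mul, ofReal_integral_eq_lintegral_ofReal
              (hi.integrableOn.const_mul _) (Eventually.of_forall fun x => by positivity)]
        _ ≤ _ := by
            refine ENNReal.ofReal_le_ofReal ?_
            have h2 := hG (2 ^ (j + 1)) hρ
            have h3 : ∫ x in ball (0 : RSpace d) (2 ^ (j + 1)), ‖u x‖ ^ 2 / ‖x‖ ^ 2
                ≤ ∫ x in ball (0 : RSpace d) (2 ^ (j + 1)), (‖G x‖ ^ 2 + ‖u x‖ ^ 2 / ‖x‖ ^ 2) :=
              integral_mono hi.integrableOn (hH.integrable_grad_sq.add hi).integrableOn fun x => by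
                have : 0 ≤ ‖G x‖ ^ 2 := by positivity
                simp only
                linarith
            calc _ ≤ (2 * R) ^ 2 * (A * 2 ^ (j + 1)) := by gcongr; exact h3.trans h2
              _ = _ := by ring)
  rw [Real.sqrt_mul (sq_nonneg _), Real.sqrt_sq (by positivity)] at h1
  exact h1.trans (le_of_eq (by ring))

theorem integral_mul_le_setIntegral {ψ F : RSpace d → ℝ} (hψ : Continuous ψ)
    (h01 : ∀ x, 0 ≤ ψ x ∧ ψ x ≤ 1) {ρ : ℝ} (hψρ : ∀ x, ρ ≤ ‖x‖ → ψ x = 0) (hF : Integrable F volume)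
    (hF0 : ∀ᵐ x, 0 ≤ F x) : ∫ x, ψ x * F x ≤ ∫ x in ball (0 : RSpace d) ρ, F x := by
  have hb : ∀ x, ‖ψ x‖ ≤ 1 := fun x => by rw [Real.norm_of_nonneg (h01 x).1]; exact (h01 x).2
  rw [← integral_indicator measurableSet_ball]
  refine integral_mono_ae (hF.bdd_mul (c := 1) hψ.aestronglyMeasurable (Eventually.of_forall hb))
    (hF.indicator measurableSet_ball) ?_
  filter_upwards [hF0] with x hx
  by_cases hxρ : ρ ≤ ‖x‖
  · simp only [hψρ x hxρ, zero_mul]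
    exact indicator_apply_nonneg fun _ => hx
  · rw [indicator_of_mem (mem_ball_zero_iff.2 (not_le.1 hxρ))]
    exact mul_le_of_le_one_left hx (h01 x).2

theorem setIntegral_le_integral_mul {ψ F : RSpace d → ℝ} (hψ : Continuous ψ)
    (h01 : ∀ x, 0 ≤ ψ x ∧ ψ x ≤ 1) {ρ : ℝ} (hψρ : ∀ x ∈ ball (0 : RSpace d) ρ, ψ x = 1)
    (hF : Integrable F volume) (hF0 : ∀ x, 0 ≤ F x) :
    ∫ x in ball (0 : RSpace d) ρ, F x ≤ ∫ x, ψ x * F x := by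
  have hb : ∀ x, ‖ψ x‖ ≤ 1 := fun x => by rw [Real.norm_of_nonneg (h01 x).1]; exact (h01 x).2
  rw [← integral_indicator measurableSet_ball]
  refine integral_mono (hF.indicator measurableSet_ball)
    (hF.bdd_mul (c := 1) hψ.aestronglyMeasurable (Eventually.of_forall hb)) fun x => ?_
  by_cases hx : x ∈ ball (0 : RSpace d) ρ
  · rw [indicator_of_mem hx, hψρ x hx, one_mul]
  · rw [indicator_of_notMem hx]
    exact mul_nonneg (h01 x).1 (hF0 x)

/-- Testing with `χu`, the factor `C/R` from `∇χ` is compensated by `|u| ≤ 2R |u|/|x|`, so every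
term is linear in `R`. The imaginary part bounds the `|ε|` mass, and the real part the `τ` mass when
`τ > 0`; the two are added. -/
theorem exists_local_mass_const (d : ℕ) (hd : 3 ≤ d) : ∃ C : ℝ, 0 ≤ C ∧
    ∀ {V : RSpace d → ℝ} {ε τ : ℝ} {f u : RSpace d → ℂ} {G : RSpace d → CSpace d},
    IsGlobalSolution V ε τ f u G → (∀ᵐ x, 0 ≤ V x) → AEStronglyMeasurable f volume →
    xStarNorm f < ⊤ → ∀ {A : ℝ}, 0 ≤ A →
    (∀ ρ, 0 < ρ → ∫ x in ball (0 : RSpace d) ρ, (‖G x‖ ^ 2 + ‖u x‖ ^ 2 / ‖x‖ ^ 2) ≤ A * ρ) →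
    (∀ ρ, 0 < ρ → ∫ x in ball (0 : RSpace d) ρ, V x * ‖u x‖ ^ 2 ≤ A * ρ) →
    ∀ R, 0 < R → (max 0 τ + |ε|) * (∫ x in ball (0 : RSpace d) R, ‖u x‖ ^ 2)
      ≤ (C * A + 2 * (xStarNorm f).toReal ^ 2) * R := by
  obtain ⟨C, hC0, hcut⟩ := exists_cutoff d
  refine ⟨6 + 4 * C, by positivity, ?_⟩
  intro V ε τ f u G h hV0 hf hfin A hA hG hV R hR
  obtain ⟨χ, hχ, -, h01, hχ1, hχ0, hχg⟩ := hcut R hR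
  have hH := h.isH1
  have iG := hH.integrable_grad_sq
  have iU := hH.integrable_sq_div hd
  have iGU : Integrable (fun x => ‖G x‖ ^ 2 + ‖u x‖ ^ 2 / ‖x‖ ^ 2) volume := iG.add iU
  have hae : ∀ᵐ x : RSpace d, x ≠ 0 := ae_ne_zero (by omega)
  obtain ⟨t1, t2, -⟩ := h.weighted_test hχ (fun x => (h01 x).1) (C := max 1 (C / R))
    (fun x => by rw [abs_of_nonneg (h01 x).1]; exact (h01 x).2.trans (le_max_left _ _))
    (fun x => (hχg x).trans (le_max_right _ _)) hV0
  have hY := hH.norm_integral_cutoff_le hd hf hfin hA hG hχ.continuous.measurable h01 hR hχ0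
  set Y := ‖∫ x, f x * conj ((χ x : ℂ) * u x)‖
  set F := (xStarNorm f).toReal
  have hY2 : Y ≤ (F ^ 2 + A) * R := by
    have h1 : 2 * (F * √A) ≤ F ^ 2 + A := by
      nlinarith [sq_nonneg (F - √A), Real.sq_sqrt hA]
    calc Y ≤ 2 * (F * √A) * R := by linarith
      _ ≤ _ := by gcongr
  have hX : ∫ x, ‖u x‖ * (‖cgrad χ x‖ * ‖G x‖) ≤ 2 * C * A * R := by
    have hpt : ∀ᵐ x, ‖u x‖ * (‖cgrad χ x‖ * ‖G x‖) ≤ (ball (0 : RSpace d) (2 * R)).indicator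
        (fun x => C * (‖G x‖ ^ 2 + ‖u x‖ ^ 2 / ‖x‖ ^ 2)) x := by
      have hsph : ∀ᵐ x : RSpace d, ‖x‖ ≠ 2 * R := by
        have h1 : volume (sphere (0 : RSpace d) (2 * R)) = 0 :=
          Measure.addHaar_sphere_of_ne_zero _ _ (by positivity)
        filter_upwards [measure_eq_zero_iff_ae_notMem.1 h1] with x hx hx'
        exact hx (mem_sphere_zero_iff_norm.2 hx')
      filter_upwards [hae, hsph] with x hx0 hxs
      have hx := norm_pos_iff.2 hx0
      by_cases hxR : ‖x‖ < 2 * R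
      · rw [indicator_of_mem (mem_ball_zero_iff.2 hxR)]
        have h1 : ‖u x‖ * ‖G x‖ ≤ R * (‖G x‖ ^ 2 + ‖u x‖ ^ 2 / ‖x‖ ^ 2) := by
          have h2 : ‖u x‖ = ‖x‖ * (‖u x‖ / ‖x‖) := by field_simp
          have h3 : ‖x‖ * (‖u x‖ / ‖x‖) * ‖G x‖ ≤ 2 * R * (‖u x‖ / ‖x‖) * ‖G x‖ := by
            gcongr
          rw [← h2] at h3
          refine h3.trans ?_
          rw [← div_pow]
          nlinarith [mul_nonneg hR.le (sq_nonneg (‖G x‖ - ‖u x‖ / ‖x‖))]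
        calc _ = ‖cgrad χ x‖ * (‖u x‖ * ‖G x‖) := by ring
          _ ≤ C / R * (R * (‖G x‖ ^ 2 + ‖u x‖ ^ 2 / ‖x‖ ^ 2)) := by
              gcongr
              exact hχg x
          _ = _ := by field_simp
      · have hlt : 2 * R < ‖x‖ := lt_of_le_of_ne (not_lt.1 hxR) (Ne.symm hxs)
        have h1 : cgrad χ x = 0 := by
          refine cgrad_eq_zero_of_eventuallyEq_const (c := 0) ?_
          filter_upwards [(isOpen_lt continuous_const continuous_norm).mem_nhds hlt] with y hy
          exact hχ0 y (le_of_lt hy)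
        rw [h1, norm_zero, zero_mul, mul_zero]
        exact indicator_nonneg (fun y _ => by positivity) x
    have h2 : ∫ x, ‖u x‖ * (‖cgrad χ x‖ * ‖G x‖) ≤ ∫ x, (ball (0 : RSpace d) (2 * R)).indicator
        (fun x => C * (‖G x‖ ^ 2 + ‖u x‖ ^ 2 / ‖x‖ ^ 2)) x :=
      integral_mono_of_nonneg (Eventually.of_forall fun x => by positivity)
        ((iGU.const_mul C).indicator measurableSet_ball) hpt
    rw [integral_indicator measurableSet_ball, integral_const_mul] at h2
    calc _ ≤ C * (A * (2 * R)) := h2.trans (by gcongr; exact hG _ (by positivity))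
      _ = _ := by ring
  have hN : ∫ x, χ x * ‖G x‖ ^ 2 ≤ 2 * A * R := by
    have h1 := integral_mul_le_setIntegral hχ.continuous h01 hχ0 iG
      (Eventually.of_forall fun x => by positivity)
    have h2 : ∫ x in ball (0 : RSpace d) (2 * R), ‖G x‖ ^ 2
        ≤ ∫ x in ball (0 : RSpace d) (2 * R), (‖G x‖ ^ 2 + ‖u x‖ ^ 2 / ‖x‖ ^ 2) :=
      setIntegral_le_add_left iG iU fun x => by positivity
    linarith [hG (2 * R) (by positivity)]
  have hE : ∫ x, χ x * (V x * ‖u x‖ ^ 2) ≤ 2 * A * R := by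
    have h1 := integral_mul_le_setIntegral hχ.continuous h01 hχ0 h.energy
      (hV0.mono fun x hx => by positivity)
    linarith [hV (2 * R) (by positivity)]
  have hU := setIntegral_le_integral_mul hχ.continuous h01 hχ1 hH.integrable_sq
    (fun x => by positivity)
  have hU0 : 0 ≤ ∫ x, χ x * ‖u x‖ ^ 2 :=
    integral_nonneg fun x => mul_nonneg (h01 x).1 (sq_nonneg _)
  have hτ : max 0 τ * (∫ x, χ x * ‖u x‖ ^ 2) ≤ (5 * A + 2 * C * A + F ^ 2) * R := by
    rcases le_total τ 0 with h0 | h0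
    · rw [max_eq_left h0, zero_mul]; positivity
    · rw [max_eq_right h0]; linarith
  have ha : 0 ≤ max 0 τ + |ε| := by positivity
  calc _ ≤ (max 0 τ + |ε|) * ∫ x, χ x * ‖u x‖ ^ 2 := by gcongr
    _ ≤ _ := by linarith

/-- The absorption error is controlled by the data. -/
theorem IsGlobalSolution.error_le {V : RSpace d → ℝ} {ε τ : ℝ} {f u : RSpace d → ℂ}
    {G : RSpace d → CSpace d} (h : IsGlobalSolution V ε τ f u G) (hd : 3 ≤ d) (hε : ε ≠ 0)
    (hV0 : ∀ᵐ x, 0 ≤ V x) (hf : AEStronglyMeasurable f volume) (hfin : xStarNorm f < ⊤) {S : ℝ}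
    (hS0 : 0 ≤ S)
    (hS : ∀ R, 0 < R → (max 0 τ + |ε|) * (∫ x in ball (0 : RSpace d) R, ‖u x‖ ^ 2) ≤ S * R) :
    |ε| * (√(∫ x, ‖u x‖ ^ 2) * √(∫ x, ‖G x‖ ^ 2)) ≤ (xStarNorm f).toReal * √S := by
  have hH := h.isH1
  have hε' : 0 < |ε| := abs_pos.2 hε
  have ha : 0 < max 0 τ + |ε| := add_pos_of_nonneg_of_pos (le_max_left _ _) hε'
  set a := max 0 τ + |ε| with hadef
  have hcg : ∀ x : RSpace d, cgrad (fun _ : RSpace d => (1 : ℝ)) x = 0 := fun x =>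
    cgrad_eq_zero_of_eventuallyEq_const (Eventually.of_forall fun _ => rfl)
  -- With the constant weight the gradient errors vanish: `|ε| ‖u‖² ≤ P` and `‖∇u‖² ≤ τ ‖u‖² + P`,
  -- where `P` is the modulus of the pairing with `f`.
  obtain ⟨t1, -, t3⟩ := h.weighted_test (ψ := fun _ => 1) contDiff_const (fun _ => zero_le_one)
    (C := 1) (by simp) (fun x => by rw [hcg, norm_zero]; exact zero_le_one) hV0
  simp only [hcg, norm_zero, zero_mul, mul_zero, integral_zero, zero_add, add_zero, one_mul,
    Complex.ofReal_one] at t1 t3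
  have hP := norm_integral_le_xStarNorm (by omega) hf hfin hH.measurable.aestronglyMeasurable
    (S := S / a) (by positivity) (fun j => by
      have hρ : (0 : ℝ) < 2 ^ (j + 1) := by positivity
      calc ∫⁻ x in dyadicShell d j, ‖u x‖ₑ ^ 2
          ≤ ∫⁻ x in ball (0 : RSpace d) (2 ^ (j + 1)), ‖u x‖ₑ ^ 2 :=
            lintegral_mono_set' (dyadicShell_ae_subset_ball (by omega) j)
        _ = ENNReal.ofReal (∫ x in ball (0 : RSpace d) (2 ^ (j + 1)), ‖u x‖ ^ 2) := by
            rw [ofReal_integral_eq_lintegral_ofReal hH.integrable_sq.integrableOn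
              (Eventually.of_forall fun x => by positivity)]
            refine lintegral_congr fun x => ?_
            rw [← ofReal_norm, ← ENNReal.ofReal_pow (norm_nonneg _)]
        _ ≤ _ := by
            refine ENNReal.ofReal_le_ofReal ?_
            rw [mul_div_assoc', le_div_iff₀ ha]
            linarith [hS _ hρ])
  set P := ‖∫ x, f x * conj (u x)‖
  set F := (xStarNorm f).toReal
  have hF0 : 0 ≤ F := ENNReal.toReal_nonneg
  have hU0 : 0 ≤ ∫ x, ‖u x‖ ^ 2 := integral_nonneg fun x => by positivity
  have hN0 : 0 ≤ ∫ x, ‖G x‖ ^ 2 := integral_nonneg fun x => by positivity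
  set U := ∫ x, ‖u x‖ ^ 2
  set N := ∫ x, ‖G x‖ ^ 2
  have hP0 : 0 ≤ P := norm_nonneg _
  have hN : N ≤ max 0 τ * U + P := t3.trans (by gcongr; exact le_max_right _ _)
  -- Multiplying the two bounds produces exactly the combination `a = max(0, τ) + |ε|`, and the mass
  -- estimate provides the compensating `a^(-1/2)` in `P`; hence uniformity in `τ` and `ε`.
  have h1 : (|ε| * (√U * √N)) ^ 2 ≤ (√a * P) ^ 2 := by
    rw [mul_pow, mul_pow, mul_pow, Real.sq_sqrt hU0, Real.sq_sqrt hN0, Real.sq_sqrt ha.le]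
    have hτ0 : 0 ≤ max 0 τ := le_max_left _ _
    calc |ε| ^ 2 * (U * N) = |ε| * N * (|ε| * U) := by ring
      _ ≤ |ε| * N * P := by gcongr
      _ ≤ |ε| * (max 0 τ * U + P) * P := by gcongr
      _ = (max 0 τ * (|ε| * U) + |ε| * P) * P := by ring
      _ ≤ (max 0 τ * P + |ε| * P) * P := by gcongr
      _ = a * P ^ 2 := by rw [hadef]; ring
  have h2 := le_of_abs_le (abs_le_of_sq_le_sq h1 (by positivity))
  calc _ ≤ √a * P := h2
    _ ≤ √a * (F * √(S / a)) := by gcongr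
    _ = F * √S := by
      rw [Real.sqrt_div' _ ha.le]
      have := Real.sqrt_pos.2 ha
      field_simp

/-- Under the square root `E` grows more slowly than `E` itself, so it can be absorbed without any
smallness of `K`. -/
theorem le_of_le_mul_sqrt {E F K : ℝ} (hE : 0 ≤ E) (hK : 0 ≤ K)
    (h : E ≤ F * √(K * (E + F ^ 2))) : E ≤ (K + 1) * F ^ 2 := by
  by_contra! hlt
  have h1 : E ^ 2 ≤ F ^ 2 * (K * (E + F ^ 2)) := by
    calc E ^ 2 ≤ (F * √(K * (E + F ^ 2))) ^ 2 := by gcongr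
      _ = _ := by rw [mul_pow, Real.sq_sqrt (by positivity)]
  have hE' : 0 < E := lt_of_le_of_lt (by positivity) hlt
  have h2 : (K + 1) * F ^ 2 * E < E * E := mul_lt_mul_of_pos_right hlt hE'
  have h3 : F ^ 2 * ((K + 1) * F ^ 2) ≤ F ^ 2 * E := by gcongr
  have h4 : 0 ≤ F ^ 2 * F ^ 2 := by positivity
  linarith

end Absorption

/-! ### Uniform bounds, and the individual norms of the theorem. -/

section Assembly

open Filter Topology

variable {d : ℕ}

/-- The uniform bounds satisfied by `u`, with gradient `G`, in terms of a size `B`. -/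
structure HasMorawetzBounds (V : RSpace d → ℝ) (τ : ℝ) (u : RSpace d → ℂ) (G : RSpace d → CSpace d)
    (B : ℝ) : Prop where
  isH1 : IsH1 u G
  energy : Integrable (fun x => V x * ‖u x‖ ^ 2) volume
  nonneg : 0 ≤ B
  radial_le : ∀ R, 0 < R → ∫ x in ball (0 : RSpace d) R, radialEnergy ((d - 1) / 2) u G x ≤ B * R
  grad_le : ∀ R, 0 < R → ∫ x in ball (0 : RSpace d) R, (‖G x‖ ^ 2 + ‖u x‖ ^ 2 / ‖x‖ ^ 2) ≤ B * R
  mass_le : ∀ R, 0 < R → max 0 τ * ∫ x in ball (0 : RSpace d) R, ‖u x‖ ^ 2 ≤ B * R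
  hardy_le : ∀ (q p : ℝ → ℝ) (R : ℝ), IsMultiplier q p R →
    ((d : ℝ) - 1) * (d - 3) / 4 * ∫ x, q ‖x‖ * (‖u x‖ ^ 2 / ‖x‖ ^ 2) ≤ B
  potential_le : ∀ (q p : ℝ → ℝ) (R : ℝ), IsMultiplier q p R →
    ∫ x, q ‖x‖ * (V x * ‖u x‖ ^ 2) ≤ B

/-- All Morawetz quantities are linear in `Q = E + F²`, where `E` is the `ε` error, and hence so is
the local mass. Inserting this in `error_le` gives `E ≤ F √(c' Q)`, so `Q` is at most a multiple of
`F²`. -/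
theorem IsAbsorbable.exists_bounds (hd : 3 ≤ d) {V : RSpace d → ℝ} {γ η : ℝ} {w : ℝ → ℝ≥0∞}
    (hV : IsAbsorbable V γ η w) : ∃ K : ℝ, 0 ≤ K ∧
    ∀ {ε τ : ℝ} {f u : RSpace d → ℂ} {G : RSpace d → CSpace d}, ε ≠ 0 →
      IsGlobalSolution V ε τ f u G → AEStronglyMeasurable f volume → xStarNorm f < ⊤ →
      HasMorawetzBounds V τ u G (K * (xStarNorm f).toReal ^ 2) := by
  obtain ⟨C, hC0, hmass⟩ := exists_local_mass_const d hd
  have hγ := hV.gamma_pos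
  have hη := hV.eta_pos
  have hs := sourceConst_pos d
  have he := energyConst_pos d
  have hκ := hardyConst_nonneg hd
  have hV0 : ∀ᵐ x, 0 ≤ V x := (ae_ne_zero (by omega : 0 < d)).mono hV.nonneg
  -- One constant dominating the radial, growth, Hardy and potential bounds; the last two are
  -- divided by `η` and `γ/2`.
  set c : ℝ := 14 * sourceConst d + energyConst d * sourceConst d + 53 * sourceConst d / η
    + 106 * sourceConst d / γ with hc
  have p1 : 0 ≤ 14 * sourceConst d := by positivity
  have p2 : 0 ≤ energyConst d * sourceConst d := by positivity
  have p3 : 0 ≤ 53 * sourceConst d / η := by positivity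
  have p4 : 0 ≤ 106 * sourceConst d / γ := by positivity
  have hc0 : 0 ≤ c := by positivity
  set c' : ℝ := C * c + 2 with hc'
  have hc'0 : 0 ≤ c' := by positivity
  refine ⟨(c + c') * (c' + 2), by positivity, ?_⟩
  intro ε τ f u G hε h hf hfin
  set F := (xStarNorm f).toReal with hF
  set Q := dataSize ε f u G with hQ
  have hQ0 : 0 ≤ Q := dataSize_nonneg ε f u G
  have hVU : ∀ᵐ x, 0 ≤ V x * ‖u x‖ ^ 2 := hV0.mono fun x hx => mul_nonneg hx (sq_nonneg _)
  have b1 : ∀ R, 0 < R → ∫ x in ball (0 : RSpace d) R, radialEnergy ((d - 1) / 2) u G x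
      ≤ c * Q * R := fun R hR => by
    obtain ⟨q, p, hq⟩ := exists_multiplier hR
    refine (h.morawetz_bounds hd hV hf hfin hq).1.trans ?_
    gcongr
    linarith
  have b2 : ∀ R, 0 < R → ∫ x in ball (0 : RSpace d) R, (‖G x‖ ^ 2 + ‖u x‖ ^ 2 / ‖x‖ ^ 2)
      ≤ c * Q * R := fun R hR => by
    obtain ⟨q, p, hq⟩ := exists_multiplier hR
    refine (h.morawetz_bounds hd hV hf hfin hq).2.1.trans ?_
    gcongr
    linarith
  have b34 : ∀ (q p : ℝ → ℝ) (R : ℝ), IsMultiplier q p R →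
      ((d : ℝ) - 1) * (d - 3) / 4 * (∫ x, q ‖x‖ * (‖u x‖ ^ 2 / ‖x‖ ^ 2)) ≤ c * Q ∧
      ∫ x, q ‖x‖ * (V x * ‖u x‖ ^ 2) ≤ c * Q := by
    intro q p R hq
    have h1 := (h.morawetz_bounds hd hV hf hfin hq).2.2
    have h2 : 0 ≤ ((d : ℝ) - 1) * (d - 3) / 4 * (∫ x, q ‖x‖ * (‖u x‖ ^ 2 / ‖x‖ ^ 2)) :=
      mul_nonneg hκ (hq.integral_nonneg (Eventually.of_forall fun x => by positivity))
    have h3 : 0 ≤ ∫ x, q ‖x‖ * (V x * ‖u x‖ ^ 2) := hq.integral_nonneg hVU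
    set X := ((d : ℝ) - 1) * (d - 3) / 4 * (∫ x, q ‖x‖ * (‖u x‖ ^ 2 / ‖x‖ ^ 2))
    set Y := ∫ x, q ‖x‖ * (V x * ‖u x‖ ^ 2)
    have h4 : 0 ≤ η * X := by positivity
    have h5 : 0 ≤ γ / 2 * Y := by positivity
    constructor
    · calc X ≤ 53 * sourceConst d / η * Q := by
            rw [div_mul_eq_mul_div, le_div_iff₀ hη]; linarith
        _ ≤ c * Q := by gcongr; linarith
    · calc Y ≤ 106 * sourceConst d / γ * Q := by
            rw [div_mul_eq_mul_div, le_div_iff₀ hγ]; linarith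
        _ ≤ c * Q := by gcongr; linarith
  have b5 : ∀ R, 0 < R → ∫ x in ball (0 : RSpace d) R, V x * ‖u x‖ ^ 2 ≤ c * Q * R :=
    fun R hR => by
      obtain ⟨q, p, hq⟩ := exists_multiplier hR
      have h1 := hq.setIntegral_ball_le h.energy hVU
      have h2 := mul_le_mul_of_nonneg_left (b34 q p R hq).2 hR.le
      linarith
  have b6 : ∀ R, 0 < R → (max 0 τ + |ε|) * (∫ x in ball (0 : RSpace d) R, ‖u x‖ ^ 2)
      ≤ c' * Q * R := fun R hR => by
    refine (hmass h hV0 hf hfin (A := c * Q) (by positivity) b2 b5 R hR).trans ?_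
    have hFQ : F ^ 2 ≤ Q := by
      rw [hQ, dataSize]
      exact le_add_of_nonneg_left (by positivity)
    gcongr
    rw [hc']
    linarith
  have hE := h.error_le hd hε hV0 hf hfin (by positivity) b6
  have hE2 := le_of_le_mul_sqrt (by positivity) hc'0 hE
  have hQF : Q ≤ (c' + 2) * F ^ 2 := by
    rw [hQ, dataSize]
    linarith
  have hcB : c * Q ≤ (c + c') * (c' + 2) * F ^ 2 := by
    calc c * Q ≤ (c + c') * ((c' + 2) * F ^ 2) := by gcongr; linarith
      _ = _ := by ring
  have hcB' : c' * Q ≤ (c + c') * (c' + 2) * F ^ 2 := by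
    calc c' * Q ≤ (c + c') * ((c' + 2) * F ^ 2) := by gcongr; linarith
      _ = _ := by ring
  exact
    { isH1 := h.isH1
      energy := h.energy
      nonneg := by positivity
      radial_le := fun R hR => (b1 R hR).trans (by gcongr)
      grad_le := fun R hR => (b2 R hR).trans (by gcongr)
      mass_le := fun R hR => by
        have h1 : 0 ≤ ∫ x in ball (0 : RSpace d) R, ‖u x‖ ^ 2 :=
          integral_nonneg fun x => by positivity
        calc _ ≤ (max 0 τ + |ε|) * ∫ x in ball (0 : RSpace d) R, ‖u x‖ ^ 2 := by
              gcongr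
              exact le_add_of_nonneg_right (abs_nonneg ε)
          _ ≤ c' * Q * R := b6 R hR
          _ ≤ _ := by gcongr
      hardy_le := fun q p R hq => (b34 q p R hq).1.trans hcB
      potential_le := fun q p R hq => (b34 q p R hq).2.trans hcB }

theorem enorm_sq_eq_ofReal {F : Type*} [NormedAddCommGroup F] (z : F) :
    ‖z‖ₑ ^ 2 = ENNReal.ofReal (‖z‖ ^ 2) := by
  rw [← ofReal_norm, ← ENNReal.ofReal_pow (norm_nonneg _)]

theorem ofReal_mul_setLIntegral_le {F : Type*} [NormedAddCommGroup F] {g : RSpace d → F}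
    (hi : Integrable (fun x => ‖g x‖ ^ 2) volume) {a R B : ℝ} (ha : 0 ≤ a)
    (h : a * ∫ x in ball (0 : RSpace d) R, ‖g x‖ ^ 2 ≤ B) :
    ENNReal.ofReal a * ∫⁻ x in ball (0 : RSpace d) R, ‖g x‖ₑ ^ 2 ≤ ENNReal.ofReal B := by
  simp only [enorm_sq_eq_ofReal]
  rw [← ofReal_integral_eq_lintegral_ofReal hi.integrableOn
    (Eventually.of_forall fun x => by positivity), ← ENNReal.ofReal_mul ha]
  exact ENNReal.ofReal_le_ofReal h

theorem lintegral_le_of_forall_compl_ball (hd : 0 < d) {F : RSpace d → ℝ≥0∞} {B : ℝ≥0∞}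
    (h : ∀ R, 0 < R → ∫⁻ x in (ball (0 : RSpace d) R)ᶜ, F x ≤ B) : ∫⁻ x, F x ≤ B := by
  have hU : ⋃ n : ℕ, (ball (0 : RSpace d) (1 / ((n : ℝ) + 1)))ᶜ =ᵐ[volume] univ := by
    refine eventuallyEq_univ.2 ?_
    filter_upwards [ae_ne_zero hd] with x hx
    obtain ⟨n, hn⟩ := exists_nat_one_div_lt (norm_pos_iff.2 hx)
    refine mem_iUnion.2 ⟨n, ?_⟩
    rw [mem_compl_iff, mem_ball_zero_iff, not_lt]
    exact hn.le
  have hm : Monotone fun n : ℕ => (ball (0 : RSpace d) (1 / ((n : ℝ) + 1)))ᶜ := by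
    intro m n hmn
    refine compl_subset_compl.2 (ball_subset_ball ?_)
    exact Nat.one_div_le_one_div hmn
  rw [← setLIntegral_univ, ← setLIntegral_congr hU, setLIntegral_iUnion_of_directed _ hm.directed_le]
  exact iSup_le fun n => h _ (by positivity)

/-- Passing from multipliers to the weight `1 / |x|`. -/
theorem lintegral_div_norm_le (hd : 0 < d) {F : RSpace d → ℝ} (hF : Integrable F volume)
    (hF0 : ∀ᵐ x, 0 ≤ F x) {B : ℝ}
    (h : ∀ (q p : ℝ → ℝ) (R : ℝ), IsMultiplier q p R → ∫ x, q ‖x‖ * F x ≤ B) :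
    ∫⁻ x, ENNReal.ofReal (F x / ‖x‖) ≤ ENNReal.ofReal B := by
  refine lintegral_le_of_forall_compl_ball hd fun R hR => ?_
  obtain ⟨q, p, hq⟩ := exists_multiplier hR
  calc _ ≤ ∫⁻ x in (ball (0 : RSpace d) R)ᶜ, ENNReal.ofReal (q ‖x‖ * F x) := by
        have hmem : ∀ᵐ x ∂(volume.restrict (ball (0 : RSpace d) R)ᶜ),
          x ∈ (ball (0 : RSpace d) R)ᶜ := ae_restrict_mem measurableSet_ball.compl
        refine lintegral_mono_ae ?_
        filter_upwards [hmem, ae_restrict_of_ae hF0] with x hx hx0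
        rw [mem_compl_iff, mem_ball_zero_iff, not_lt] at hx
        have hx1 : 0 < ‖x‖ := hR.trans_le hx
        refine ENNReal.ofReal_le_ofReal ?_
        rw [div_le_iff₀ hx1]
        -- Outside `B_R` one has `1/|x| ≤ q`. As `B` does not depend on the scale, the ball can be
        -- shrunk to the origin.
        have h1 := mul_le_mul_of_nonneg_right (hq.one_le_mul_q hx) hx0
        linarith
    _ ≤ ∫⁻ x, ENNReal.ofReal (q ‖x‖ * F x) := setLIntegral_le_lintegral _ _
    _ = ENNReal.ofReal (∫ x, q ‖x‖ * F x) := by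
        rw [ofReal_integral_eq_lintegral_ofReal (hq.integrable_mul hF)
          (hF0.mono fun x hx => mul_nonneg (hq.q_nonneg _) hx)]
    _ ≤ _ := ENNReal.ofReal_le_ofReal (h q p R hq)

namespace HasMorawetzBounds

variable {V : RSpace d → ℝ} {τ B : ℝ} {u : RSpace d → ℂ} {G : RSpace d → CSpace d}

theorem xNormSq_grad_le (h : HasMorawetzBounds V τ u G B) (hd : 3 ≤ d) :
    xNormSq G ≤ ENNReal.ofReal B := by
  refine iSup₂_le fun R hR => ofReal_mul_setLIntegral_le h.isH1.integrable_grad_sq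
    (by positivity) ?_
  rw [inv_mul_le_iff₀ hR, mul_comm R]
  refine le_trans ?_ (h.grad_le R hR)
  exact setIntegral_le_add_left h.isH1.integrable_grad_sq (h.isH1.integrable_sq_div hd)
    fun x => by positivity

theorem xNormSq_le (h : HasMorawetzBounds V τ u G B) :
    ENNReal.ofReal (max 0 τ) * xNormSq u ≤ ENNReal.ofReal B := by
  rw [xNormSq]
  simp only [ENNReal.mul_iSup]
  refine iSup₂_le fun R hR => ?_
  rw [← mul_assoc, ← ENNReal.ofReal_mul (le_max_left _ _)]
  refine ofReal_mul_setLIntegral_le h.isH1.integrable_sq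
    (mul_nonneg (le_max_left _ _) (by positivity)) ?_
  have h1 := h.mass_le R hR
  rw [mul_right_comm, ← div_eq_mul_inv, div_le_iff₀ hR]
  exact h1

theorem iSup_le (h : HasMorawetzBounds V τ u G B) (hd : 3 ≤ d) :
    (⨆ (R : ℝ) (_ : 0 < R),
      ENNReal.ofReal (R ^ 3)⁻¹ * ∫⁻ x in ball (0 : RSpace d) R, ‖u x‖ₑ ^ 2) ≤ ENNReal.ofReal B := by
  refine iSup₂_le fun R hR => ofReal_mul_setLIntegral_le h.isH1.integrable_sq (by positivity) ?_
  have iU := h.isH1.integrable_sq_div hd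
  have iG := h.isH1.integrable_grad_sq
  rw [inv_mul_le_iff₀ (by positivity)]
  have hmem : ∀ᵐ x ∂(volume.restrict (ball (0 : RSpace d) R)),
    x ∈ ball (0 : RSpace d) R := ae_restrict_mem measurableSet_ball
  have iS : Integrable (fun x => R ^ 2 * (‖G x‖ ^ 2 + ‖u x‖ ^ 2 / ‖x‖ ^ 2)) volume :=
    (iG.add iU).const_mul _
  have h1 : ∫ x in ball (0 : RSpace d) R, ‖u x‖ ^ 2
      ≤ ∫ x in ball (0 : RSpace d) R, R ^ 2 * (‖G x‖ ^ 2 + ‖u x‖ ^ 2 / ‖x‖ ^ 2) := by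
    refine integral_mono_ae h.isH1.integrable_sq.integrableOn iS.integrableOn ?_
    filter_upwards [hmem, ae_restrict_of_ae (ae_ne_zero (by omega))] with x hx hx0
    rw [mem_ball_zero_iff] at hx
    have hx1 := norm_pos_iff.2 hx0
    calc ‖u x‖ ^ 2 = ‖x‖ ^ 2 * (0 + ‖u x‖ ^ 2 / ‖x‖ ^ 2) := by field_simp; ring
      _ ≤ R ^ 2 * (‖G x‖ ^ 2 + ‖u x‖ ^ 2 / ‖x‖ ^ 2) := by
          gcongr
          positivity
  rw [integral_const_mul] at h1
  have h2 := mul_le_mul_of_nonneg_left (h.grad_le R hR) (sq_nonneg R)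
  calc _ ≤ R ^ 2 * (B * R) := h1.trans h2
    _ = _ := by ring

theorem lintegral_hardy_le (h : HasMorawetzBounds V τ u G B) (hd : 3 ≤ d) :
    ((d - 3 : ℕ) : ℝ≥0∞) * (∫⁻ x, ‖u x‖ₑ ^ 2 / ENNReal.ofReal (‖x‖ ^ 3))
      ≤ 2 * ENNReal.ofReal B := by
  rcases hd.eq_or_lt with h3 | h3
  · rw [show d - 3 = 0 by omega, Nat.cast_zero, zero_mul]
    exact zero_le
  have hdr : (3 : ℝ) < d := by exact_mod_cast h3
  have hκ : 0 < ((d : ℝ) - 1) * (d - 3) / 4 :=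
    div_pos (mul_pos (by linarith) (by linarith)) (by norm_num)
  have h1 := lintegral_div_norm_le (by omega) (h.isH1.integrable_sq_div hd)
    (Eventually.of_forall fun x => by positivity) (B := B / (((d : ℝ) - 1) * (d - 3) / 4))
    (fun q p R hq => by
      rw [le_div_iff₀ hκ, mul_comm]
      exact h.hardy_le q p R hq)
  have e : ∫⁻ x, ‖u x‖ₑ ^ 2 / ENNReal.ofReal (‖x‖ ^ 3)
      = ∫⁻ x, ENNReal.ofReal (‖u x‖ ^ 2 / ‖x‖ ^ 2 / ‖x‖) := by
    refine lintegral_congr_ae ?_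
    filter_upwards [ae_ne_zero (by omega)] with x hx
    have hx1 := norm_pos_iff.2 hx
    rw [enorm_sq_eq_ofReal, ← ENNReal.ofReal_div_of_pos (by positivity), div_div, ← pow_succ]
  have e2 : ((d - 3 : ℕ) : ℝ≥0∞) = ENNReal.ofReal ((d : ℝ) - 3) := by
    rw [← ENNReal.ofReal_natCast, Nat.cast_sub hd]
    norm_num
  rw [e, e2]
  calc _ ≤ ENNReal.ofReal ((d : ℝ) - 3) * ENNReal.ofReal (B / (((d : ℝ) - 1) * (d - 3) / 4)) := by
        gcongr
    _ = ENNReal.ofReal (((d : ℝ) - 3) * (B / (((d : ℝ) - 1) * (d - 3) / 4))) :=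
        (ENNReal.ofReal_mul (by linarith)).symm
    _ ≤ ENNReal.ofReal (2 * B) := by
        refine ENNReal.ofReal_le_ofReal ?_
        have hB := h.nonneg
        rw [mul_div_assoc', div_le_iff₀ hκ]
        -- After cancelling `d - 3` the constant is `4/(d-1)`, which is at most `2` for `d ≥ 3`.
        nlinarith [mul_nonneg (mul_nonneg hB (by linarith : (0 : ℝ) ≤ d - 3))
          (by linarith : (0 : ℝ) ≤ d - 3)]
    _ = _ := by rw [ENNReal.ofReal_mul two_pos.le]; simp

theorem lintegral_potential_le (h : HasMorawetzBounds V τ u G B) (hd : 3 ≤ d)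
    (hV : ∀ x, x ≠ 0 → 0 ≤ V x) :
    ∫⁻ x, ENNReal.ofReal (V x / ‖x‖) * ‖u x‖ₑ ^ 2 ≤ ENNReal.ofReal B := by
  have hae : ∀ᵐ x : RSpace d, x ≠ 0 := ae_ne_zero (by omega)
  refine le_of_eq_of_le (lintegral_congr_ae ?_) (lintegral_div_norm_le (by omega) h.energy
    (hae.mono fun x hx => mul_nonneg (hV x hx) (sq_nonneg _)) h.potential_le)
  filter_upwards [hae] with x hx
  rw [enorm_sq_eq_ofReal, ← ENNReal.ofReal_mul (div_nonneg (hV x hx) (norm_nonneg x))]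
  congr 1
  ring

/-- The radial bound now holds at all scales, so the trace inequality may be used with `δ = 0`:
spheres have density `B t²`, and `(W/t) · B t² = B t W`. -/
theorem lintegral_weight_le (h : HasMorawetzBounds V τ u G B) (hd : 3 ≤ d) {W : ℝ → ℝ}
    (hW : AEMeasurable W (volume.restrict (Ioi 0)))
    (hJ : ∫⁻ t in Ioi (0 : ℝ), ENNReal.ofReal (t * W t) ≤ 1) :
    ∫⁻ x : RSpace d, ENNReal.ofReal (W ‖x‖ / ‖x‖) * ‖u x‖ₑ ^ 2 ≤ ENNReal.ofReal B := by
  have h1 := h.isH1.lintegral_radial_le hd (δ := 0) (fun R _ hR => h.radial_le R hR)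
    (w := fun t => ENNReal.ofReal (W t / t)) (hW.div aemeasurable_id).ennreal_ofReal
  simp only [enorm_sq_eq_ofReal]
  refine h1.trans ?_
  calc _ = ∫⁻ t in Ioi (0 : ℝ), ENNReal.ofReal B * ENNReal.ofReal (t * W t) := by
        refine setLIntegral_congr_fun measurableSet_Ioi fun t ht => ?_
        have ht0 : 0 < t := ht
        rw [max_eq_left ht0.le, mul_comm, ← ENNReal.ofReal_mul (by have := h.nonneg; positivity),
          ← ENNReal.ofReal_mul h.nonneg]
        congr 1
        field_simp
    _ = ENNReal.ofReal B * ∫⁻ t in Ioi (0 : ℝ), ENNReal.ofReal (t * W t) :=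
        lintegral_const_mul' _ _ ENNReal.ofReal_ne_top
    _ ≤ ENNReal.ofReal B * 1 := by gcongr
    _ = _ := mul_one _

end HasMorawetzBounds

theorem xNormSq_congr_ae {F : Type*} [NormedAddCommGroup F] {g g' : RSpace d → F}
    (h : g =ᵐ[volume] g') : xNormSq g = xNormSq g' := by
  unfold xNormSq
  congr! 4 with R hR
  exact lintegral_congr_ae (ae_restrict_of_ae (h.mono fun x hx => by simp only [hx]))

end Assembly

theorem theorem2p1 (d : ℕ) (hd : 3 ≤ d) (V : RSpace d → ℝ) (W : ℝ → ℝ)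
    (hV : IsRepulsive V W) :
    ∃ C : ℝ≥0, ∀ ε τ : ℝ, ε ≠ 0 →
      ∀ (f u : RSpace d → ℂ) (G : RSpace d → CSpace d),
        AEStronglyMeasurable f volume → xStarNorm f < ⊤ →
        IsHelmholtzSolution V ε τ f u G →
        xNormSq G
          + ENNReal.ofReal (max 0 τ) * xNormSq u
          + ((d - 3 : ℕ) : ℝ≥0∞) * (∫⁻ x, ‖u x‖ₑ ^ 2 / ENNReal.ofReal (‖x‖ ^ 3))
          + (∫⁻ x, ENNReal.ofReal (V x / ‖x‖) * ‖u x‖ₑ ^ 2)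
          + (⨆ (R : ℝ) (_ : 0 < R),
              ENNReal.ofReal (R ^ 3)⁻¹ * ∫⁻ x in ball (0 : RSpace d) R, ‖u x‖ₑ ^ 2)
          + (if d = 3 then ∫⁻ x : RSpace d, ENNReal.ofReal (W ‖x‖ / ‖x‖) * ‖u x‖ₑ ^ 2 else 0)
        ≤ (C : ℝ≥0∞) * xStarNorm f ^ 2 := by
  obtain ⟨γ, η, w, hA⟩ := hV.exists_isAbsorbable hd
  obtain ⟨K, hK, hb⟩ := hA.exists_bounds hd
  -- Six terms, each bounded by `K F²` except the Hardy term, which costs `2 K F²`.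
  refine ⟨7 * K.toNNReal, fun ε τ hε f u G hf hfin h => ?_⟩
  have hV0 : ∀ᵐ x, 0 ≤ V x := (ae_ne_zero (by omega : 0 < d)).mono hV.nonneg
  -- measurable representatives
  have hum := h.memLp.aestronglyMeasurable
  have hGm := h.hasWeakGradient.locallyIntegrable_grad.aestronglyMeasurable
  have hu := hum.ae_eq_mk
  have hG := hGm.ae_eq_mk
  have h' := (h.congr_ae hu hG).globalEnergy hd hV.aemeasurable hV0
    hum.stronglyMeasurable_mk.measurable hGm.stronglyMeasurable_mk.measurable hf hfin
  have B := hb hε h' hf hfin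
  set u' := hum.mk u
  set G' := hGm.mk G
  have e1 : ∫⁻ x, ‖u x‖ₑ ^ 2 / ENNReal.ofReal (‖x‖ ^ 3)
      = ∫⁻ x, ‖u' x‖ₑ ^ 2 / ENNReal.ofReal (‖x‖ ^ 3) :=
    lintegral_congr_ae (hu.mono fun x hx => by simp only [hx])
  have e2 : ∫⁻ x, ENNReal.ofReal (V x / ‖x‖) * ‖u x‖ₑ ^ 2
      = ∫⁻ x, ENNReal.ofReal (V x / ‖x‖) * ‖u' x‖ₑ ^ 2 :=
    lintegral_congr_ae (hu.mono fun x hx => by simp only [hx])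
  have e3 : ∀ R : ℝ, ∫⁻ x in ball (0 : RSpace d) R, ‖u x‖ₑ ^ 2
      = ∫⁻ x in ball (0 : RSpace d) R, ‖u' x‖ₑ ^ 2 := fun R =>
    lintegral_congr_ae (ae_restrict_of_ae (hu.mono fun x hx => by simp only [hx]))
  have e4 : ∫⁻ x : RSpace d, ENNReal.ofReal (W ‖x‖ / ‖x‖) * ‖u x‖ₑ ^ 2
      = ∫⁻ x : RSpace d, ENNReal.ofReal (W ‖x‖ / ‖x‖) * ‖u' x‖ₑ ^ 2 :=
    lintegral_congr_ae (hu.mono fun x hx => by simp only [hx])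
  rw [xNormSq_congr_ae hu, xNormSq_congr_ae hG, e1, e2, e4]
  simp only [e3]
  have hW : (if d = 3 then ∫⁻ x : RSpace d, ENNReal.ofReal (W ‖x‖ / ‖x‖) * ‖u' x‖ₑ ^ 2 else 0)
      ≤ ENNReal.ofReal (K * (xStarNorm f).toReal ^ 2) := by
    split_ifs with h3
    · obtain ⟨_, _, _, hthree⟩ := hV.repulsive
      obtain ⟨hWm, -, -, hJ⟩ := hthree h3
      refine B.lintegral_weight_le hd hWm (hJ.le.trans ?_)
      simp
    · exact zero_le
  have hF : ENNReal.ofReal (K * (xStarNorm f).toReal ^ 2)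
      = (K.toNNReal : ℝ≥0∞) * xStarNorm f ^ 2 := by
    rw [ENNReal.ofReal_mul hK, ENNReal.ofReal_pow ENNReal.toReal_nonneg,
      ENNReal.ofReal_toReal hfin.ne]
    rfl
  calc _ ≤ ENNReal.ofReal (K * (xStarNorm f).toReal ^ 2)
        + ENNReal.ofReal (K * (xStarNorm f).toReal ^ 2)
        + 2 * ENNReal.ofReal (K * (xStarNorm f).toReal ^ 2)
        + ENNReal.ofReal (K * (xStarNorm f).toReal ^ 2)
        + ENNReal.ofReal (K * (xStarNorm f).toReal ^ 2)
        + ENNReal.ofReal (K * (xStarNorm f).toReal ^ 2) := by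
        exact add_le_add (add_le_add (add_le_add (add_le_add (add_le_add (B.xNormSq_grad_le hd)
          B.xNormSq_le) (B.lintegral_hardy_le hd)) (B.lintegral_potential_le hd hV.nonneg))
          (B.iSup_le hd)) hW
    _ = _ := by
        rw [hF]
        push_cast
        ring
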